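/- **Setting.** Let $G=(-1,1)^2$ and $\Omega=G\times(-1,1)$, with horizontal coordinates $x,y$ and vertical coordinate $z$. All Sobolev spaces are spaces of real-valued periodic functions: $H^s(G)$, $H^s(\Omega)$ are the periodic Bessel potential spaces, defined through Fourier series. $L^2_\sigma(G)$ is the $L^2$-closure of the smooth periodic divergence free vector fields $G\to\mathbb R^2$, and $L^2_\sigma(\Omega)$ is the $L^2$-closure of the smooth periodic divergence free fields $u=(v,w)\colon\Omega\to\mathbb R^2\times\mathbb R$ with $v$ even in $z$ and $w$ odd in $z$. For $D\in\{G,\Omega\}$ put $\mathbb E_1(T)=L^2(0,T;H^2(D))\cap H^1(0,T;L^2(D))$ with the norm $\|f\|_{L^2(0,T;H^2)}+\|f\|_{H^1(0,T;L^2)}$ (componentwise for vector fields). Write $\nabla_H=(\partial_x,\partial_y)$, $\Delta_H=\partial_x^2+\partial_y^2$, $\Delta_\delta=\Delta_H+\delta\partial_z^2$. A *strong solution on $(0,T)$ of the rescaled Navier–Stokes equations* with parameters $\varepsilon,\delta>0$ and initial value $u_0$ is a field $u=(v,w)\in\mathbb E_1(T)$ with values in $L^2_\sigma(\Omega)$ for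 which there is a pressure $p\in L^2(0,T;H^1(\Omega))$, even in $z$ and of mean zero, such that almost everywhere $$\partial_t v+u\cdot\nabla v-\Delta_\delta v+\nabla_H p=0,\qquad \partial_t w+u\cdot\nabla w-\Delta_\delta w+\tfrac1{\varepsilon^2}\partial_z p=0,\qquad \operatorname{div}u=0,\qquad u(0)=u_0 .$$ Its *existence time* relative to $T$ is the largest $\tau\in(0,T]$ such that a strong solution on $(0,\tau)$ exists. A *strong solution on $(0,T)$ of the 2D Navier–Stokes equations* with initial value $\bar v_0$ is a field $\bar v\in\mathbb E_1(T)$ on $G$ for which there is a pressure $\bar p\in L^2(0,T;H^1(G))$ of mean zero such that almost everywhere $$\partial_t\bar v+\bar v\cdot\nabla_H\bar v-\Delta_H\bar v+\nabla_H\bar p=0,\qquad \operatorname{div}_H\bar v=0,\qquad \bar v(0)=\bar v_0 .$$ For $u=(v,w)$ on $\Omega$ put $\bar v=\frac12\int_{-1}^1 v(\cdot,\cdot,\zeta)\,d\zeta$ and $\tilde u=(v-\bar v,\,w)$. **Theorem 4.7** (Convergence for $0<\varepsilon\le1$ and $\delta\to\infty$). Let $T\in(0,\infty)$, $\bar v_0\in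 H^1(G)^2\cap L^2_\sigma(G)$ and $\tilde u_0\in H^{3/2}(\Omega)^3\cap L^2_\sigma(\Omega)$ with $\int_{-1}^1\tilde u_0(\cdot,\cdot,\zeta)\,d\zeta=0$. Let $\bar v_{0,\infty}$ be the strong solution on $(0,T)$ of the 2D Navier–Stokes equations with initial value $\bar v_0$ (it exists and is unique), and let $u_{\varepsilon,\delta}$, with existence time $T_{\varepsilon,\delta}$ relative to $T$, be the strong solution of the rescaled Navier–Stokes equations with initial value $u_0=(\bar v_0,0)+\tilde u_0$. Then: (a) There is a constant $c>0$ such that $T_{\varepsilon,\delta}=T$ for all $\varepsilon,\delta>0$ with $\varepsilon<c$ and $\frac1\delta<c$. (b) There are constants $C,c>0$, independent of $\varepsilon$ and $\delta$, such that for all $\delta>0$ with $\frac1\delta<c$ and all $\varepsilon\in(0,1]$ the strong solution $u_{\varepsilon,\delta}$ exists on $(0,T)$ and is unique, and $$\sup_{\varepsilon\in(0,1]}\Big(\|\bar v_{0,\infty}-\bar v_{\varepsilon,\delta}\|_{\mathbb E_1(T)}+\|\tilde u_{\varepsilon,\delta}\|_{L^4(0,T;H^{3/2}(\Omega))}\Big)\le\frac{C}{\delta^{1/4}}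 .$$ -/

import Mathlib

open MeasureTheory Set
open scoped ENNReal

noncomputable section

namespace AnisoNS

/-! ### Function spaces on the periodic cells `G = (-1,1)^2` and `Ω = (-1,1)^3` -/

/-- The open cell `(-1,1)^d`; `G` is the case `d = 2` and `Ω` the case `d = 3`, where the
coordinates with indices `0, 1` are the horizontal ones and index `2` is the vertical one. -/
def cell (d : ℕ) : Set (Fin d → ℝ) := Set.pi univ fun _ => Ioo (-1 : ℝ) 1

/-- Lebesgue measure on the cell. -/
abbrev cellMeasure (d : ℕ) : Measure (Fin d → ℝ) := volume.restrict (cell d)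

/-- The real Hilbert space `L²((-1,1)^d)`. -/
abbrev L2 (d : ℕ) : Type := Lp ℝ 2 (cellMeasure d)

/-- Smooth functions on `ℝ^d` which are periodic with period `2` in every coordinate,
that is, the elements of `C^∞_per` of the closed cell. -/
def IsSmoothPeriodic {d : ℕ} (φ : (Fin d → ℝ) → ℝ) : Prop :=
  ContDiff ℝ (⊤ : ℕ∞) φ ∧ ∀ (i : Fin d) (x : Fin d → ℝ), φ (x + Pi.single i 2) = φ x

/-- The classical partial derivative `∂ᵢ φ`. -/
def classicalDeriv {d : ℕ} (i : Fin d) (φ : (Fin d → ℝ) → ℝ) (x : Fin d → ℝ) : ℝ :=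
  fderiv ℝ φ x (Pi.single i 1)

/-- `g ∈ L²` is the weak derivative `∂ᵢ f` of `f ∈ L²` on the torus: the test functions are the
smooth periodic functions, so periodicity of the traces of `f` is part of the notion. -/
def HasWeakDeriv {d : ℕ} (i : Fin d) (f g : L2 d) : Prop :=
  ∀ φ : (Fin d → ℝ) → ℝ, IsSmoothPeriodic φ →
    ∫ x in cell d, f x * classicalDeriv i φ x = - ∫ x in cell d, g x * φ x

open Classical in
/-- The weak derivative `∂ᵢ f` (`0` if `f` has no weak derivative in `L²`). It is only used for
functions in `H¹_per`, for which it exists. -/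
def pderiv {d : ℕ} (i : Fin d) (f : L2 d) : L2 d :=
  if h : ∃ g, HasWeakDeriv i f g then h.choose else 0

/-- Fourier coefficients `f̂(k) = 2^{-d} ∫ f(x) e^{-iπ k·x} dx` with respect to the cell. -/
def fourierCoef {d : ℕ} (f : L2 d) (k : Fin d → ℤ) : ℂ :=
  ((2 : ℂ) ^ d)⁻¹ * ∫ x in cell d,
    ((f x : ℝ) : ℂ) * Complex.exp (-(Real.pi * Complex.I * ∑ i, (k i : ℂ) * ((x i : ℝ) : ℂ)))

/-- The norm of the periodic Bessel potential space `H^s_per`, with value `∞` for functions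
outside the space: `‖f‖² = 2^d ∑ₖ (1 + |π k|²)^s |f̂(k)|²`, which for `s = 0` is the `L²` norm. -/
def hNorm {d : ℕ} (s : ℝ) (f : L2 d) : ℝ≥0∞ :=
  (∑' k : Fin d → ℤ,
    ENNReal.ofReal (2 ^ d * (1 + ∑ i, (Real.pi * (k i : ℝ)) ^ 2) ^ s * ‖fourierCoef f k‖ ^ 2))
      ^ (1 / 2 : ℝ)

/-- `f ∈ H^s_per`. -/
def MemH {d : ℕ} (s : ℝ) (f : L2 d) : Prop := hNorm s f < ∞

/-- Reflection `(x, y, z) ↦ (x, y, -z)`. -/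
def reflect (x : Fin 3 → ℝ) : Fin 3 → ℝ := ![x 0, x 1, -x 2]

/-- `f` is even in `z`. -/
def IsEvenZ (f : L2 3) : Prop := ∀ᵐ x ∂cellMeasure 3, f (reflect x) = f x

/-- `L²_σ(Ω)`: the `L²`-closure of the smooth periodic divergence free fields `u = (v, w)` with
`v` even in `z` and `w` odd in `z`. -/
def solenoidal3 : Set (Fin 3 → L2 3) :=
  closure {u | ∃ φ : Fin 3 → (Fin 3 → ℝ) → ℝ,
    (∀ i, IsSmoothPeriodic (φ i)) ∧
    (∀ x, ∑ j, classicalDeriv j (φ j) x = 0) ∧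
    (∀ x, φ 0 (reflect x) = φ 0 x ∧ φ 1 (reflect x) = φ 1 x ∧ φ 2 (reflect x) = -φ 2 x) ∧
    ∀ i, u i =ᵐ[cellMeasure 3] φ i}

/-- `L²_σ(G)`: the `L²`-closure of the smooth periodic divergence free fields on `G`. -/
def solenoidal2 : Set (Fin 2 → L2 2) :=
  closure {v | ∃ φ : Fin 2 → (Fin 2 → ℝ) → ℝ,
    (∀ i, IsSmoothPeriodic (φ i)) ∧
    (∀ x, ∑ j, classicalDeriv j (φ j) x = 0) ∧
    ∀ i, v i =ᵐ[cellMeasure 2] φ i}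

/-! ### Barotropic and baroclinic modes -/

/-- The splitting `(x, y, z) ↦ (z, (x, y))` of a point into vertical and horizontal part. -/
def splitZ : (Fin 3 → ℝ) ≃ᵐ ℝ × (Fin 2 → ℝ) := MeasurableEquiv.piFinSuccAbove (fun _ => ℝ) 2

theorem splitZ_apply (x : Fin 3 → ℝ) : splitZ x = (x 2, ![x 0, x 1]) := by
  refine Prod.ext rfl ?_
  funext j
  fin_cases j <;> rfl

theorem splitZ_symm_apply (z : ℝ) (y : Fin 2 → ℝ) : splitZ.symm (z, y) = ![y 0, y 1, z] := by
  rw [MeasurableEquiv.symm_apply_eq, splitZ_apply]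
  refine Prod.ext rfl ?_
  funext j
  fin_cases j <;> rfl

theorem splitZ_measurePreserving :
    MeasurePreserving splitZ (cellMeasure 3)
      ((volume.restrict (Ioo (-1 : ℝ) 1)).prod (cellMeasure 2)) := by
  have h := volume_preserving_piFinSuccAbove (fun _ : Fin 3 => ℝ) 2
  have h2 := h.restrict_preimage (s := Ioo (-1 : ℝ) 1 ×ˢ cell 2)
    (measurableSet_Ioo.prod (MeasurableSet.univ_pi fun _ => measurableSet_Ioo))
  have hs : (MeasurableEquiv.piFinSuccAbove (fun _ : Fin 3 => ℝ) 2) ⁻¹'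
      (Ioo (-1 : ℝ) 1 ×ˢ cell 2) = cell 3 := by
    ext x
    change splitZ x ∈ Ioo (-1 : ℝ) 1 ×ˢ cell 2 ↔ _
    rw [splitZ_apply]
    simp only [cell, mem_prod, mem_pi, mem_univ, forall_true_left, Fin.forall_fin_succ]
    simp
    tauto
  rw [hs, Measure.volume_eq_prod, ← Measure.prod_restrict] at h2
  exact h2

theorem memLp_lift (g : L2 2) : MemLp (fun x : Fin 3 → ℝ => g ![x 0, x 1]) 2 (cellMeasure 3) := by
  have h1 : MemLp (fun q : ℝ × (Fin 2 → ℝ) => g q.2) 2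
      ((volume.restrict (Ioo (-1 : ℝ) 1)).prod (cellMeasure 2)) := (Lp.memLp g).comp_snd _
  have h2 := h1.comp_measurePreserving splitZ_measurePreserving
  refine h2.ae_eq (Filter.Eventually.of_forall fun x => ?_)
  simp only [Function.comp_apply, splitZ_apply]

theorem memLp_verticalAverage (f : L2 3) :
    MemLp (fun y : Fin 2 → ℝ => (1 / 2 : ℝ) * ∫ z in Ioo (-1 : ℝ) 1, f ![y 0, y 1, z]) 2
      (cellMeasure 2) := by
  have hF : MemLp (fun q : ℝ × (Fin 2 → ℝ) => f ![q.2 0, q.2 1, q.1]) 2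
      ((volume.restrict (Ioo (-1 : ℝ) 1)).prod (cellMeasure 2)) := by
    have h := (Lp.memLp f).comp_measurePreserving
      (splitZ_measurePreserving.symm splitZ)
    refine h.ae_eq (Filter.Eventually.of_forall fun q => ?_)
    obtain ⟨z, y⟩ := q
    simp only [Function.comp_apply, splitZ_symm_apply]
  refine MemLp.const_mul ?_ _
  have hsw := hF.1.prod_swap
  refine ⟨hsw.integral_prod_right', ?_⟩
  -- Cauchy-Schwarz in the vertical variable
  have hle : ∀ᵐ y ∂cellMeasure 2,
      ‖∫ z in Ioo (-1 : ℝ) 1, f ![y 0, y 1, z]‖ₑ ^ (2 : ℝ) ≤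
        2 * ∫⁻ z in Ioo (-1 : ℝ) 1, ‖f ![y 0, y 1, z]‖ₑ ^ (2 : ℝ) := by
    filter_upwards [hsw.prodMk_left] with y hy
    have h1 := eLpNorm_le_eLpNorm_mul_rpow_measure_univ
      (p := 1) (q := 2) (by norm_num) hy
    have h0 := enorm_integral_le_lintegral_enorm
      (μ := volume.restrict (Ioo (-1 : ℝ) 1)) (fun z => f ![y 0, y 1, z])
    rw [← eLpNorm_one_eq_lintegral_enorm] at h0
    have h2 := ENNReal.rpow_le_rpow (h0.trans h1) (by norm_num : (0 : ℝ) ≤ 2)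
    refine h2.trans (le_of_eq ?_)
    rw [ENNReal.mul_rpow_of_nonneg _ _ (by norm_num), ← ENNReal.rpow_mul,
      eLpNorm_eq_lintegral_rpow_enorm_toReal (by norm_num) (by norm_num), ← ENNReal.rpow_mul]
    norm_num
    exact mul_comm _ _
  have hfin := hF.2
  rw [eLpNorm_lt_top_iff_lintegral_rpow_enorm_lt_top (by norm_num) (by norm_num)] at hfin ⊢
  rw [lintegral_prod_symm _ (hF.1.enorm.pow_const _)] at hfin
  refine (lintegral_mono_ae hle).trans_lt ?_
  rw [lintegral_const_mul' _ _ (by norm_num)]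
  exact ENNReal.mul_lt_top (by norm_num) hfin

/-- The function on `Ω`, constant in `z`, which is given by a function on `G`. -/
def lift (g : L2 2) : L2 3 := (memLp_lift g).toLp

/-- The vertical average `½ ∫_{-1}^{1} f(·,·,ζ) dζ`. -/
def verticalAverage (f : L2 3) : L2 2 := (memLp_verticalAverage f).toLp

/-- A horizontal field on `G` regarded as a `z`-independent field on `Ω` with vertical
component `0`. -/
def barotropic (v : Fin 2 → L2 2) : Fin 3 → L2 3 := ![lift (v 0), lift (v 1), 0]

/-- The barotropic mode `v̄ = ½ ∫ v dz` of `u = (v, w)`. -/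
def averagePart (u : Fin 3 → L2 3) : Fin 2 → L2 2 :=
  ![verticalAverage (u 0), verticalAverage (u 1)]

/-- The baroclinic mode `ũ = (v - v̄, w)` of `u = (v, w)`. -/
def baroclinicPart (u : Fin 3 → L2 3) : Fin 3 → L2 3 := u - barotropic (averagePart u)

/-! ### Spaces of time dependent functions -/

/-- The norm of `L^q(0,T; H^s_per)`, with value `∞` outside the space. -/
def lqhNorm {d : ℕ} (T q s : ℝ) (f : ℝ → L2 d) : ℝ≥0∞ :=
  (∫⁻ t in Ioo 0 T, hNorm s (f t) ^ q) ^ (1 / q)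

/-- `f ∈ L²(0,T; H^s_per)`. -/
def MemL2H {d : ℕ} (T s : ℝ) (f : ℝ → L2 d) : Prop :=
  AEStronglyMeasurable f (volume.restrict (Ioo 0 T)) ∧ lqhNorm T 2 s f < ∞

/-- `f ∈ H¹(0,T; L²)`, for the continuous representative on `[0,T]`: `f` is absolutely continuous
with derivative in `L²(0,T; L²)`. -/
def MemH1L2 {d : ℕ} (T : ℝ) (f : ℝ → L2 d) : Prop :=
  MemLp (deriv f) 2 (volume.restrict (Ioo 0 T)) ∧
    ∀ t ∈ Icc 0 T, f t = f 0 + ∫ s in (0 : ℝ)..t, deriv f s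

/-- The maximal regularity space `𝔼₁(T) = L²(0,T; H²_per) ∩ H¹(0,T; L²)`; its elements are
identified with their continuous representatives `[0,T] → L²`. -/
def MemE1 {d : ℕ} (T : ℝ) (f : ℝ → L2 d) : Prop := MemL2H T 2 f ∧ MemH1L2 T f

/-- The norm `‖f‖_{L²(0,T;H²)} + ‖f‖_{L²(0,T;L²)} + ‖∂ₜ f‖_{L²(0,T;L²)}` of `𝔼₁(T)`. -/
def e1Norm {d : ℕ} (T : ℝ) (f : ℝ → L2 d) : ℝ≥0∞ :=
  lqhNorm T 2 2 f + eLpNorm f 2 (volume.restrict (Ioo 0 T))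
    + eLpNorm (deriv f) 2 (volume.restrict (Ioo 0 T))

/-! ### The equations -/

/-- `Δ_δ f = ∂ₓ² f + ∂ᵧ² f + δ ∂_z² f`. -/
def lapAniso (δ : ℝ) (f : L2 3) : L2 3 :=
  pderiv 0 (pderiv 0 f) + pderiv 1 (pderiv 1 f) + δ • pderiv 2 (pderiv 2 f)

/-- `Δ_H f` for functions on `G`. -/
def lapH (f : L2 2) : L2 2 := pderiv 0 (pderiv 0 f) + pderiv 1 (pderiv 1 f)

/-- The left hand side `∂ₜ uᵢ + u·∇uᵢ - Δ_δ uᵢ` of the `i`-th momentum equation at time `t`,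
without the pressure. -/
def momentum3 (δ : ℝ) (u : ℝ → Fin 3 → L2 3) (i : Fin 3) (t : ℝ) (x : Fin 3 → ℝ) : ℝ :=
  deriv (fun s => u s i) t x + ∑ j, u t j x * pderiv j (u t i) x - lapAniso δ (u t i) x

/-- `u = (v, w)` is a strong solution on `(0,T)` to the rescaled anisotropic Navier-Stokes equations
`∂ₜv + u·∇v - Δ_δ v + ∇_H p = 0`, `∂ₜw + u·∇w - Δ_δ w + ε⁻² ∂_z p = 0`, `div u = 0`, `u(0) = u₀`
on `Ω`, with periodicity, `v, p` even in `z` and `w` odd in `z`; that is, `u ∈ 𝔼₁ᵘ(T)`, there is a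
pressure `p ∈ 𝔼₁ᵖ(T)`, and the equations hold almost everywhere. -/
structure IsStrongSolution3 (ε δ T : ℝ) (u₀ : Fin 3 → L2 3) (u : ℝ → Fin 3 → L2 3) : Prop where
  memE1 : ∀ i, MemE1 T (fun t => u t i)
  solenoidal : ∀ t ∈ Icc 0 T, u t ∈ solenoidal3
  initial : u 0 = u₀
  divFree : ∀ᵐ t ∂volume.restrict (Ioo 0 T), ∑ j, pderiv j (u t j) = 0
  momentum : ∃ p : ℝ → L2 3, MemL2H T 1 p ∧
    (∀ᵐ t ∂volume.restrict (Ioo 0 T), (∫ x in cell 3, p t x = 0) ∧ IsEvenZ (p t)) ∧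
    ∀ᵐ t ∂volume.restrict (Ioo 0 T), ∀ᵐ x ∂cellMeasure 3,
      momentum3 δ u 0 t x + pderiv 0 (p t) x = 0 ∧
      momentum3 δ u 1 t x + pderiv 1 (p t) x = 0 ∧
      momentum3 δ u 2 t x + (1 / ε ^ 2) * pderiv 2 (p t) x = 0

/-- `v` is a strong solution on `(0,T)` to the two-dimensional Navier-Stokes equations
`∂ₜv + v·∇v - Δ_H v + ∇_H p = 0`, `div v = 0`, `v(0) = v₀` on `G` with periodicity. -/
structure IsStrongSolution2 (T : ℝ) (v₀ : Fin 2 → L2 2) (v : ℝ → Fin 2 → L2 2) : Prop where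
  memE1 : ∀ i, MemE1 T (fun t => v t i)
  initial : v 0 = v₀
  divFree : ∀ᵐ t ∂volume.restrict (Ioo 0 T), ∑ j, pderiv j (v t j) = 0
  momentum : ∃ p : ℝ → L2 2, MemL2H T 1 p ∧
    (∀ᵐ t ∂volume.restrict (Ioo 0 T), ∫ x in cell 2, p t x = 0) ∧
    ∀ᵐ t ∂volume.restrict (Ioo 0 T), ∀ᵐ x ∂cellMeasure 2, ∀ i,
      deriv (fun s => v s i) t x + ∑ j, v t j x * pderiv j (v t i) x - lapH (v t i) x
        + pderiv i (p t) x = 0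

/-- `τ ∈ (0,T]` is the maximal existence time, within `(0,T]`, of the strong solution to the
rescaled Navier-Stokes equations with initial value `u₀`. -/
def IsMaximalExistenceTime (ε δ T : ℝ) (u₀ : Fin 3 → L2 3) (τ : ℝ) : Prop :=
  IsGreatest {τ | τ ∈ Ioc 0 T ∧ ∃ u, IsStrongSolution3 ε δ τ u₀ u} τ

end AnisoNS

end

open AnisoNS

/-! The whole argument runs on Fourier coefficients. A strong solution is equivalent, for the
purposes needed here, to a family of coefficients solving the Leray-projected equations in
integrated form (`CoefSol`). The passage in one direction is `coefSol_of_strong`; in the other it is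
`CoefSol.exists_strong`, where the pressure is rebuilt from the quadratic term.

Uniqueness (`CoefSol.unique`) comes from the smoothing of each mode. For `a' = -λ a + f` one has
`|a(t)|² ≤ (2λ)⁻¹ ∫ |f|²`, and the factor `λ⁻¹` absorbs the derivative in the transport term. With
`H² · L² ⊆ L²` this leaves `D(t) ≤ ∫ H D` for the squared `L²` distance `D` and an integrable `H`,
and Gronwall gives `D = 0`.

Existence and the rate rest on separating the barotropic modes (`k₂ = 0`) from the baroclinic ones
(`k₂ ≠ 0`). Vertical frequencies add under multiplication, so the barotropic equation is the 2D
Navier-Stokes equation forced only by baroclinic times baroclinic terms, while every term in the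
baroclinic equation has a baroclinic factor. Three facts make the estimates independent of `ε` and
strong enough in `δ`.

First, the 2D transport term drops out of the `H¹` energy balance, by conservation of energy and
enstrophy (`barotropic_cancellation`). The barotropic part is therefore bounded globally, whatever
its size.

Second, for `k₂ ≠ 0` the anisotropic projection costs at most `|k₂|⁻¹` times the divergence of the
transport term, uniformly in the pressure coefficient `1/ε² ≥ 1`. For solenoidal fields that
divergence is a product of first derivatives, and `∂_z⁻¹ (H^{1/2} · H^{1/2}) ⊆ L²`
(`sum_sq_vert_conv_le`). Hence the projected product is bounded in `L²` by the product of the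
`H^{3/2}` norms, with a constant free of `ε` (`sum_leray_sq_le`).

Third, the baroclinic viscosity symbol is at least `(|k| + √δ)²/4`, up to lower order terms in
`|k|`. Measuring the baroclinic energy with the weight `|k|³/(|k| + √δ)` makes the product of energy
and dissipation control the square of the squared `H^{3/2}` norm (`crit_bc_sq_le`), and makes the
initial energy at most `‖ũ₀‖²_{H^{3/2}}/√δ` (`bcE_le_div_sqrt`). This is the only source of
smallness.

For large `δ` a bootstrap argument (`GalSol.apriori`) bounds both energies on all of `[0,T]` for the
Galerkin approximations, with baroclinic energy of order `δ^{-1/2}`. Multiplying by the integrated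
dissipation gives `∫ ‖ũ‖⁴_{H^{3/2}} ≤ C/δ`, that is, the rate `δ^{-1/4}`. The difference of the
barotropic part and the 2D flow solves an equation forced by a term of squared `L²` norm at most `C
‖ũ‖⁴_{H^{3/2}}`; a Gronwall estimate (`galerkin_comparison`) gives it the better rate `δ^{-1/2}`.

These bounds do not depend on the truncation. Equicontinuity of each mode and the `H¹` bound give
limits solving the full equations (`galerkin_limit`), and Fatou's lemma carries the rates over
(`exists_coefSol`). The 2D solution is obtained from the same construction with vanishing baroclinic
data, and statement (a) is contained in (b). -/

noncomputable section

namespace AnisoNS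

open scoped ComplexConjugate

/-! ### Fourier series on the cell: Parseval, products, synthesis. -/

section Torus

attribute [local instance] instMeasureSpaceUnitAddCircle

/-- The character `x ↦ exp(iπ k·x)` of the torus. -/
def chr {d : ℕ} (k : Fin d → ℤ) (x : Fin d → ℝ) : ℂ :=
  Complex.exp (Real.pi * Complex.I * ∑ i, (k i : ℂ) * ((x i : ℝ) : ℂ))

theorem chr_neg {d : ℕ} (k : Fin d → ℤ) (x : Fin d → ℝ) :
    chr (-k) x = Complex.exp (-(Real.pi * Complex.I * ∑ i, (k i : ℂ) * ((x i : ℝ) : ℂ))) := by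
  simp [chr, Finset.sum_neg_distrib]

theorem chr_add {d : ℕ} (k l : Fin d → ℤ) (x : Fin d → ℝ) :
    chr (k + l) x = chr k x * chr l x := by
  simp only [chr, ← Complex.exp_add, ← mul_add, ← Finset.sum_add_distrib]
  simp [add_mul]

theorem conj_chr {d : ℕ} (k : Fin d → ℤ) (x : Fin d → ℝ) : conj (chr k x) = chr (-k) x := by
  rw [chr_neg, chr, ← Complex.exp_conj]
  simp

theorem norm_chr {d : ℕ} (k : Fin d → ℤ) (x : Fin d → ℝ) : ‖chr k x‖ = 1 := by
  have : (Real.pi * Complex.I * ∑ i, (k i : ℂ) * ((x i : ℝ) : ℂ))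
      = ((Real.pi * ∑ i, (k i : ℝ) * x i : ℝ) : ℂ) * Complex.I := by
    push_cast; ring
  rw [chr, this, Complex.norm_exp_ofReal_mul_I]

theorem contDiff_chr {d : ℕ} (k : Fin d → ℤ) : ContDiff ℝ (⊤ : ℕ∞) (chr k) := by
  have : ∀ i : Fin d, ContDiff ℝ (⊤ : ℕ∞) (fun x : Fin d → ℝ => ((x i : ℝ) : ℂ)) := fun i =>
    Complex.ofRealCLM.contDiff.comp (contDiff_apply ℝ ℝ i)
  unfold chr
  exact (contDiff_const.mul (ContDiff.sum fun i _ => contDiff_const.mul (this i))).cexp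

@[fun_prop]
theorem continuous_chr {d : ℕ} (k : Fin d → ℤ) : Continuous (chr k) := (contDiff_chr k).continuous

instance {d : ℕ} : IsFiniteMeasure (cellMeasure d) := by
  refine ⟨?_⟩
  rw [Measure.restrict_apply_univ, cell, Real.volume_pi_Ioo]
  exact ENNReal.prod_lt_top (by simp)

theorem fourierCoef_eq {d : ℕ} (f : L2 d) (k : Fin d → ℤ) :
    fourierCoef f k = ((2 : ℂ) ^ d)⁻¹ * ∫ x in cell d, (f x : ℂ) * chr (-k) x := by
  simp only [fourierCoef, chr_neg]

/-- The parametrisation of the cell by the standard torus. -/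
def torusToCell (d : ℕ) (y : UnitAddTorus (Fin d)) : Fin d → ℝ :=
  (2 : ℝ) • ((UnitAddTorus.measurableEquivPiIoc (fun _ : Fin d => (-1 / 2 : ℝ)) y).1)

/-- The quotient map from the cell to the standard torus. -/
def cellToTorus (d : ℕ) (x : Fin d → ℝ) : UnitAddTorus (Fin d) := fun i => ((x i / 2 : ℝ) : UnitAddCircle)

theorem cellToTorus_torusToCell (d : ℕ) (y : UnitAddTorus (Fin d)) :
    cellToTorus d (torusToCell d y) = y := by
  funext i
  simp only [cellToTorus, torusToCell, UnitAddTorus.coe_measurableEquivPiIoc_apply, Pi.smul_apply,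
    smul_eq_mul, mul_div_cancel_left₀ _ (two_ne_zero' ℝ)]
  exact (AddCircle.equivIoc 1 (-1 / 2 : ℝ)).left_inv (y i)

theorem measurable_cellToTorus (d : ℕ) : Measurable (cellToTorus d) := by
  refine measurable_pi_lambda _ fun i => ?_
  exact AddCircle.measurable_mk'.comp ((measurable_pi_apply i).div_const 2)

theorem mFourier_eq_chr {d : ℕ} (k : Fin d → ℤ) (y : UnitAddTorus (Fin d)) :
    UnitAddTorus.mFourier k y = chr k (torusToCell d y) := by
  conv_lhs => rw [← cellToTorus_torusToCell d y]
  generalize torusToCell d y = x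
  simp only [UnitAddTorus.mFourier, ContinuousMap.coe_mk, cellToTorus, fourier_coe_apply, chr,
    ← Complex.exp_sum, Finset.mul_sum]
  congr 1
  refine Finset.sum_congr rfl fun i _ => ?_
  push_cast
  ring

/-- The torus carries a probability measure and the cell has volume `2^d`, whence the factor. The
half-open cube produced by the parametrisation differs from the open cell by a null set. This is the
bridge along which Fourier theory on the unit torus is transferred to the cell. -/
theorem measurePreserving_torusToCell (d : ℕ) :
    MeasurePreserving (torusToCell d) volume (((2 : ℝ≥0∞) ^ d)⁻¹ • cellMeasure d) := by
  have h1 := UnitAddTorus.measurePreserving_equivPiIoc (fun _ : Fin d => (-1 / 2 : ℝ))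
  set S : Set (Fin d → ℝ) := {x | ∀ i, x i ∈ Ioc (-1 / 2 : ℝ) (-1 / 2 + 1)} with hS
  have hSm : MeasurableSet S := by
    have : S = Set.pi univ (fun _ => Ioc (-1 / 2 : ℝ) (-1 / 2 + 1)) := by ext; simp [hS]
    rw [this]; exact MeasurableSet.univ_pi fun _ => measurableSet_Ioc
  have h2 : MeasurePreserving (Subtype.val : S → (Fin d → ℝ)) (Measure.comap Subtype.val volume)
      (volume.restrict S) := ⟨measurable_subtype_coe, map_comap_subtype_coe hSm volume⟩
  have h3 : MeasurePreserving (fun x : Fin d → ℝ => (2 : ℝ) • x) volume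
      (((2 : ℝ≥0∞) ^ d)⁻¹ • volume) := by
    refine ⟨by fun_prop, ?_⟩
    rw [Measure.map_addHaar_smul _ two_ne_zero]
    congr 1
    simp [abs_of_pos, ENNReal.ofReal_inv_of_pos, ENNReal.ofReal_pow]
  set R : Set (Fin d → ℝ) := Set.pi univ (fun _ => Ioc (-1 : ℝ) 1) with hR
  have hRm : MeasurableSet R := MeasurableSet.univ_pi fun _ => measurableSet_Ioc
  have h4 := h3.restrict_preimage hRm
  have hpre : (fun x : Fin d → ℝ => (2 : ℝ) • x) ⁻¹' R = S := by
    ext x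
    simp only [hR, hS, mem_preimage, mem_pi, mem_univ, true_implies, Pi.smul_apply, smul_eq_mul,
      mem_ofPred_eq, mem_Ioc]
    refine forall_congr' fun i => ?_
    constructor <;> rintro ⟨a, b⟩ <;> constructor <;> linarith
  have hcell : (((2 : ℝ≥0∞) ^ d)⁻¹ • (volume : Measure (Fin d → ℝ))).restrict R
      = ((2 : ℝ≥0∞) ^ d)⁻¹ • cellMeasure d := by
    rw [Measure.restrict_smul]
    congr 1
    rw [cellMeasure, cell, volume_pi, Measure.restrict_pi_pi, Measure.restrict_pi_pi]
    congr 1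
    funext i
    exact (Measure.restrict_congr_set Ioo_ae_eq_Ioc).symm
  rw [hpre, hcell] at h4
  exact h4.comp (h2.comp h1)

/-- The function on the torus given by a function on the cell. -/
def toTorus {d : ℕ} (f : L2 d) : UnitAddTorus (Fin d) → ℂ := fun y => (f (torusToCell d y) : ℂ)

theorem memLp_smul_cell {d : ℕ} {E : Type*} [NormedAddCommGroup E] {f : (Fin d → ℝ) → E}
    (hf : MemLp f 2 (cellMeasure d)) : MemLp f 2 (((2 : ℝ≥0∞) ^ d)⁻¹ • cellMeasure d) :=
  hf.smul_measure (by simp)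

theorem memLp_toTorus {d : ℕ} (f : L2 d) : MemLp (toTorus f) 2 volume := by
  have h : MemLp (fun x => (f x : ℂ)) 2 (cellMeasure d) := (Lp.memLp f).ofReal
  exact (memLp_smul_cell h).comp_measurePreserving (measurePreserving_torusToCell d)

theorem integral_torus_eq {d : ℕ} {E : Type*} [NormedAddCommGroup E] [NormedSpace ℝ E]
    {F : (Fin d → ℝ) → E} (hF : AEStronglyMeasurable F (cellMeasure d)) :
    ∫ y, F (torusToCell d y) = ((2 : ℝ) ^ d)⁻¹ • ∫ x in cell d, F x := by
  have h := measurePreserving_torusToCell d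
  rw [← integral_map h.measurable.aemeasurable (by
    rw [h.map_eq]; exact hF.smul_measure _), h.map_eq, integral_smul_measure]
  simp

theorem aesm_mul_chr {d : ℕ} (f : L2 d) (k : Fin d → ℤ) :
    AEStronglyMeasurable (fun x => (f x : ℂ) * chr k x) (cellMeasure d) :=
  (Complex.continuous_ofReal.comp_aestronglyMeasurable (Lp.aestronglyMeasurable f)).mul
    (continuous_chr k).aestronglyMeasurable

theorem mFourierCoeff_toTorus {d : ℕ} (f : L2 d) (k : Fin d → ℤ) :
    UnitAddTorus.mFourierCoeff (toTorus f) k = fourierCoef f k := by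
  rw [UnitAddTorus.mFourierCoeff, fourierCoef_eq]
  simp only [mFourier_eq_chr, smul_eq_mul, toTorus]
  have := integral_torus_eq (aesm_mul_chr f (-k))
  simp only [mul_comm (chr _ _)]
  rw [this, Complex.real_smul]
  push_cast
  rfl

theorem mFourierCoeff_congr {d : ℕ} {f g : UnitAddTorus (Fin d) → ℂ} (h : f =ᵐ[volume] g)
    (k : Fin d → ℤ) : UnitAddTorus.mFourierCoeff f k = UnitAddTorus.mFourierCoeff g k := by
  refine integral_congr_ae ?_
  filter_upwards [h] with y hy
  rw [hy]

theorem fourierCoef_neg {d : ℕ} (f : L2 d) (k : Fin d → ℤ) :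
    fourierCoef f (-k) = conj (fourierCoef f k) := by
  have h2 : conj (((2 : ℂ) ^ d)⁻¹) = ((2 : ℂ) ^ d)⁻¹ := by
    simp only [map_inv₀, map_pow, map_ofNat]
  rw [fourierCoef_eq, fourierCoef_eq, map_mul, ← integral_conj, h2]
  simp [conj_chr]

/-- Parseval's identity. -/
theorem hasSum_sq_fourierCoef {d : ℕ} (f : L2 d) :
    HasSum (fun k => 2 ^ d * ‖fourierCoef f k‖ ^ 2) (‖f‖ ^ 2) := by
  have hF := memLp_toTorus f
  have h := UnitAddTorus.hasSum_sq_mFourierCoeff hF.toLp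
  simp only [mFourierCoeff_congr hF.coeFn_toLp, mFourierCoeff_toTorus] at h
  have h2 : ∫ y, ‖hF.toLp (toTorus f) y‖ ^ 2 = ((2 : ℝ) ^ d)⁻¹ * ‖f‖ ^ 2 := by
    have h3 : ∫ y, ‖hF.toLp (toTorus f) y‖ ^ 2 = ∫ y, (fun x => (f x) ^ 2) (torusToCell d y) := by
      refine integral_congr_ae ?_
      filter_upwards [hF.coeFn_toLp] with y hy
      rw [hy]; simp [toTorus]
    rw [h3, integral_torus_eq (F := fun x => (f x) ^ 2)
      ((Lp.aestronglyMeasurable f).pow 2), smul_eq_mul]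
    congr 1
    rw [← real_inner_self_eq_norm_sq, L2.inner_def]
    simp [sq]
  rw [h2] at h
  have := h.mul_left ((2 : ℝ) ^ d)
  rwa [mul_inv_cancel_left₀ (by positivity)] at this

theorem integral_mul_chr_eq_fourierCoef {d : ℕ} (f : L2 d) (k : Fin d → ℤ) :
    ∫ x in cell d, (f x : ℂ) * chr (-k) x = 2 ^ d * fourierCoef f k := by
  rw [fourierCoef_eq, mul_inv_cancel_left₀ (by simp)]

theorem memLp_mul_chr {d : ℕ} (f : L2 d) (k : Fin d → ℤ) :
    MemLp (fun x => (f x : ℂ) * chr k x) 2 (cellMeasure d) := by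
  refine MemLp.of_le (Lp.memLp f) (aesm_mul_chr f k) (Filter.Eventually.of_forall fun x => ?_)
  rw [norm_mul, norm_chr, mul_one, Complex.norm_real]

/-- The Fourier coefficients of a product are the convolution of the Fourier coefficients. -/
theorem hasSum_fourierCoef_mul {d : ℕ} (f g : L2 d) (k : Fin d → ℤ) :
    HasSum (fun l => fourierCoef f l * fourierCoef g (k - l))
      (((2 : ℂ) ^ d)⁻¹ * ∫ x in cell d, ((f x * g x : ℝ) : ℂ) * chr (-k) x) := by
  have hF := memLp_toTorus f
  -- Parseval is applied to `f` and `g` times a character. The character shifts the coefficients of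
  -- `g` by `k`, which turns the inner product of coefficients into a convolution at `k`.
  have hG : MemLp (fun y => toTorus g y * chr (-k) (torusToCell d y)) 2 volume :=
    (memLp_smul_cell (memLp_mul_chr g (-k))).comp_measurePreserving (measurePreserving_torusToCell d)
  have h := UnitAddTorus.hasSum_prod_mFourierCoeff hF.toLp hG.toLp
  have hcG : ∀ i, UnitAddTorus.mFourierCoeff
      (fun y => toTorus g y * chr (-k) (torusToCell d y)) i = fourierCoef g (k + i) := by
    intro i
    rw [← mFourierCoeff_toTorus]
    simp only [UnitAddTorus.mFourierCoeff, mFourier_eq_chr, smul_eq_mul, neg_add, chr_add]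
    refine integral_congr_ae (Filter.Eventually.of_forall fun y => ?_)
    simp only
    ring
  simp only [mFourierCoeff_congr hF.coeFn_toLp, mFourierCoeff_toTorus,
    mFourierCoeff_congr hG.coeFn_toLp, hcG, ← fourierCoef_neg] at h
  have h2 := (Equiv.neg (Fin d → ℤ)).hasSum_iff.mpr h
  simp only [Function.comp_def, Equiv.neg_apply, neg_neg, ← sub_eq_add_neg] at h2
  convert h2 using 1
  have h3 : ∫ y, conj (hF.toLp (toTorus f) y) * hG.toLp _ y
      = ∫ y, (fun x => ((f x * g x : ℝ) : ℂ) * chr (-k) x) (torusToCell d y) := by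
    refine integral_congr_ae ?_
    filter_upwards [hF.coeFn_toLp, hG.coeFn_toLp] with y hy hy2
    rw [hy, hy2]
    simp [toTorus]
    ring
  rw [h3, integral_torus_eq (F := fun x => ((f x * g x : ℝ) : ℂ) * chr (-k) x), Complex.real_smul]
  · push_cast; rfl
  · exact (Complex.continuous_ofReal.comp_aestronglyMeasurable
      ((Lp.aestronglyMeasurable f).mul (Lp.aestronglyMeasurable g))).mul
      (continuous_chr (-k)).aestronglyMeasurable

theorem integrable_mul_chr {d : ℕ} (f : L2 d) (k : Fin d → ℤ) :
    Integrable (fun x => (f x : ℂ) * chr k x) (cellMeasure d) :=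
  (memLp_mul_chr f k).integrable one_le_two

theorem fourierCoef_add {d : ℕ} (f g : L2 d) (k : Fin d → ℤ) :
    fourierCoef (f + g) k = fourierCoef f k + fourierCoef g k := by
  simp only [fourierCoef_eq]
  rw [← mul_add, ← integral_add (integrable_mul_chr f _) (integrable_mul_chr g _)]
  congr 1
  refine integral_congr_ae ?_
  filter_upwards [Lp.coeFn_add f g] with x hx
  rw [hx]; simp [add_mul]

theorem fourierCoef_smul {d : ℕ} (a : ℝ) (f : L2 d) (k : Fin d → ℤ) :
    fourierCoef (a • f) k = a * fourierCoef f k := by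
  simp only [fourierCoef_eq]
  rw [mul_left_comm]
  congr 1
  rw [← integral_const_mul (μ := cellMeasure d) (a : ℂ) fun x => (f x : ℂ) * chr (-k) x]
  refine integral_congr_ae ?_
  filter_upwards [Lp.coeFn_smul a f] with x hx
  rw [hx]; simp [mul_assoc]

theorem norm_fourierCoef_le {d : ℕ} (f : L2 d) (k : Fin d → ℤ) : ‖fourierCoef f k‖ ≤ ‖f‖ := by
  have h := le_hasSum (hasSum_sq_fourierCoef f) k (fun _ _ => by positivity)
  have h1 : (1 : ℝ) ≤ 2 ^ d := one_le_pow₀ one_le_two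
  refine (pow_le_pow_iff_left₀ (norm_nonneg _) (norm_nonneg _) two_ne_zero).mp ?_
  nlinarith [sq_nonneg ‖fourierCoef f k‖]

/-- The Fourier coefficient as a continuous linear functional. -/
def fourierCoefL {d : ℕ} (k : Fin d → ℤ) : L2 d →L[ℝ] ℂ :=
  LinearMap.mkContinuous
    { toFun := fun f => fourierCoef f k
      map_add' := fun f g => fourierCoef_add f g k
      map_smul' := fun a f => by simp [fourierCoef_smul] } 1
    (fun f => by simpa using norm_fourierCoef_le f k)

theorem fourierCoefL_apply {d : ℕ} (k : Fin d → ℤ) (f : L2 d) :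
    fourierCoefL k f = fourierCoef f k := rfl

theorem fourierCoef_sub {d : ℕ} (f g : L2 d) (k : Fin d → ℤ) :
    fourierCoef (f - g) k = fourierCoef f k - fourierCoef g k := map_sub (fourierCoefL k) f g

theorem fourierCoef_zero {d : ℕ} (k : Fin d → ℤ) : fourierCoef (0 : L2 d) k = 0 :=
  map_zero (fourierCoefL k)

theorem fourierCoef_sum {d : ℕ} {ι : Type*} (s : Finset ι) (f : ι → L2 d) (k : Fin d → ℤ) :
    fourierCoef (∑ i ∈ s, f i) k = ∑ i ∈ s, fourierCoef (f i) k := map_sum (fourierCoefL k) f s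

theorem ext_fourierCoef {d : ℕ} {f g : L2 d} (h : ∀ k, fourierCoef f k = fourierCoef g k) :
    f = g := by
  have h1 := hasSum_sq_fourierCoef (f - g)
  simp only [fourierCoef_sub, h, sub_self, norm_zero, ne_eq, OfNat.ofNat_ne_zero,
    not_false_eq_true, zero_pow, mul_zero] at h1
  have := h1.unique hasSum_zero
  exact sub_eq_zero.mp (norm_eq_zero.mp (pow_eq_zero_iff two_ne_zero |>.mp this))

/-- Square summable coefficients with `c(-k) = conj c(k)` are Fourier coefficients. -/
theorem exists_fourierCoef_eq {d : ℕ} (c : (Fin d → ℤ) → ℂ) (hc : Summable fun k => ‖c k‖ ^ 2)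
    (hr : ∀ k, c (-k) = conj (c k)) : ∃ f : L2 d, ∀ k, fourierCoef f k = c k := by
  have hmem : Memℓp c 2 := by
    rw [memℓp_gen_iff (by simp)]
    simpa using hc
  set F := UnitAddTorus.mFourierBasis.repr.symm ⟨c, hmem⟩ with hFdef
  have hFc : ∀ k, UnitAddTorus.mFourierCoeff F k = c k := by
    intro k
    rw [← UnitAddTorus.mFourierBasis_repr, hFdef, LinearIsometryEquiv.apply_symm_apply]
  have hφ := measurePreserving_torusToCell d
  set G : (Fin d → ℝ) → ℂ := fun x => F (cellToTorus d x) with hG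
  have hGs : StronglyMeasurable G :=
    (Lp.stronglyMeasurable F).comp_measurable (measurable_cellToTorus d)
  have hGφ : G ∘ torusToCell d = F := by
    funext y; simp [hG, cellToTorus_torusToCell]
  have hGm : MemLp G 2 (cellMeasure d) := by
    have h1 : MemLp G 2 (((2 : ℝ≥0∞) ^ d)⁻¹ • cellMeasure d) := by
      rw [← hφ.map_eq, memLp_map_measure_iff hGs.aestronglyMeasurable hφ.measurable.aemeasurable,
        hGφ]
      exact Lp.memLp F
    have h2 := h1.smul_measure (c := (2 : ℝ≥0∞) ^ d) (by simp)
    rwa [smul_smul, ENNReal.mul_inv_cancel (by simp) (by simp), one_smul] at h2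
  -- Elements of `L2 d` are real. The symmetry `hr` says that `G` and its conjugate have the same
  -- coefficients, so the real part has them too.
  have hre : MemLp (fun x => (G x).re) 2 (cellMeasure d) := hGm.re
  have hcoef : ∀ k, ((2 : ℂ) ^ d)⁻¹ * ∫ x in cell d, G x * chr (-k) x = c k := by
    intro k
    rw [← hFc k, UnitAddTorus.mFourierCoeff]
    have := integral_torus_eq (F := fun x => G x * chr (-k) x)
      (hGm.1.mul (continuous_chr (-k)).aestronglyMeasurable)
    have h2 : ∀ y, G (torusToCell d y) = F y := fun y => congrFun hGφ y
    simp only [h2, ← mFourier_eq_chr] at this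
    simp only [smul_eq_mul, mul_comm (UnitAddTorus.mFourier (-k) _)]
    rw [this, Complex.real_smul]; push_cast; rfl
  have hi : ∀ H : (Fin d → ℝ) → ℂ, MemLp H 2 (cellMeasure d) → ∀ k,
      Integrable (fun x => H x * chr k x) (cellMeasure d) := by
    intro H hH k
    have : MemLp (fun x => H x * chr k x) 2 (cellMeasure d) :=
      hH.of_le (hH.1.mul (continuous_chr k).aestronglyMeasurable)
        (Filter.Eventually.of_forall fun x => by rw [norm_mul, norm_chr, mul_one])
    exact this.integrable one_le_two
  refine ⟨hre.toLp, fun k => ?_⟩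
  rw [fourierCoef_eq]
  have h1 : ∫ x in cell d, ((hre.toLp _ x : ℝ) : ℂ) * chr (-k) x
      = ∫ x in cell d, ((1 / 2 : ℂ) * (G x * chr (-k) x) + (1 / 2 : ℂ) * (conj (G x) * chr (-k) x)) := by
    refine integral_congr_ae ?_
    filter_upwards [hre.coeFn_toLp] with x hx
    rw [hx]
    have := Complex.add_conj (G x)
    have h4 : (((G x).re : ℝ) : ℂ) = (1 / 2 : ℂ) * (G x + conj (G x)) := by rw [this]; push_cast; ring
    rw [h4]; ring
  have hconj : MemLp (fun x => conj (G x)) 2 (cellMeasure d) :=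
    hGm.of_le (Complex.continuous_conj.comp_aestronglyMeasurable hGm.1)
      (Filter.Eventually.of_forall fun x => by simp)
  rw [h1, integral_add ((hi _ hGm _).const_mul _) ((hi _ hconj _).const_mul _),
    integral_const_mul, integral_const_mul]
  have h2 : ∫ x in cell d, conj (G x) * chr (-k) x = conj (∫ x in cell d, G x * chr (- -k) x) := by
    rw [← integral_conj]
    simp [conj_chr]
  have h3 := hcoef k
  have h4 := congrArg conj (hcoef (-k))
  rw [map_mul, ← h2, hr, Complex.conj_conj] at h4
  simp only [map_inv₀, map_pow, map_ofNat] at h4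
  linear_combination (1 / 2 : ℂ) * h3 + (1 / 2 : ℂ) * h4

end Torus

/-! ### Trigonometric polynomials and the Fourier description of weak derivatives. -/

theorem fderiv_chr {d : ℕ} (k : Fin d → ℤ) (x : Fin d → ℝ) (i : Fin d) :
    fderiv ℝ (chr k) x (Pi.single i 1) = (Real.pi * Complex.I * k i) * chr k x := by
  have h1 : ∀ j : Fin d, HasFDerivAt (fun x : Fin d → ℝ => ((x j : ℝ) : ℂ))
      (Complex.ofRealCLM.comp (ContinuousLinearMap.proj (R := ℝ) (φ := fun _ : Fin d => ℝ) j)) x :=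
    fun j => (Complex.ofRealCLM.comp
      (ContinuousLinearMap.proj (R := ℝ) (φ := fun _ : Fin d => ℝ) j)).hasFDerivAt
  have h2 := ((HasFDerivAt.fun_sum (u := Finset.univ)
    fun j _ => (h1 j).const_mul (k j : ℂ)).const_mul (Real.pi * Complex.I : ℂ)).cexp
  have h3 : HasFDerivAt (chr k) _ x := h2
  have hex : Complex.exp (Real.pi * Complex.I * ∑ i, (k i : ℂ) * ((x i : ℝ) : ℂ)) = chr k x := rfl
  rw [h3.fderiv, hex]
  simp only [smul_apply, sum_apply, ContinuousLinearMap.comp_apply,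
    ContinuousLinearMap.proj_apply, smul_eq_mul, Complex.ofRealCLM_apply]
  rw [Finset.sum_eq_single i]
  · simp; ring
  · intro j _ hj; simp [Pi.single_eq_of_ne hj]
  · simp

theorem chr_add_single {d : ℕ} (k : Fin d → ℤ) (i : Fin d) (x : Fin d → ℝ) :
    chr k (x + Pi.single i 2) = chr k x := by
  have : (Real.pi * Complex.I * ∑ j, (k j : ℂ) * (((x + Pi.single i 2 : Fin d → ℝ) j : ℝ) : ℂ))
      = (Real.pi * Complex.I * ∑ j, (k j : ℂ) * ((x j : ℝ) : ℂ))
        + (k i : ℤ) * (2 * Real.pi * Complex.I) := by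
    have : ∀ j, (k j : ℂ) * (((x + Pi.single i 2 : Fin d → ℝ) j : ℝ) : ℂ)
        = (k j : ℂ) * ((x j : ℝ) : ℂ) + if j = i then (k i : ℂ) * 2 else 0 := by
      intro j
      by_cases h : j = i
      · subst h; simp; ring
      · simp [h]
    simp only [this, Finset.sum_add_distrib, Finset.sum_ite_eq', Finset.mem_univ, if_true]
    ring
  rw [chr, this, Complex.exp_add, Complex.exp_int_mul_two_pi_mul_I, mul_one, chr]

theorem integrableOn_cell_of_continuous {d : ℕ} {E : Type*} [NormedAddCommGroup E]
    {ψ : (Fin d → ℝ) → E} (h : Continuous ψ) : IntegrableOn ψ (cell d) := by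
  refine (h.continuousOn.integrableOn_compact (isCompact_Icc (a := fun _ => (-1 : ℝ))
    (b := fun _ => (1 : ℝ)))).mono_set ?_
  intro x hx
  exact ⟨fun i => (hx i trivial).1.le, fun i => (hx i trivial).2.le⟩

/-- The integral over the cell of a derivative of a periodic function vanishes. -/
theorem integral_fderiv_periodic {d : ℕ} {ψ : (Fin d → ℝ) → ℂ} (h : ContDiff ℝ 1 ψ) (i : Fin d)
    (hp : ∀ x, ψ (x + Pi.single i 2) = ψ x) :
    ∫ x in cell d, fderiv ℝ ψ x (Pi.single i 1) = 0 := by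
  obtain _ | n := d
  · exact i.elim0
  have hbox : (cell (n + 1) : Set (Fin (n + 1) → ℝ)) =ᵐ[volume]
      Icc (fun _ => (-1 : ℝ)) (fun _ => 1) := by
    rw [cell]; exact Measure.univ_pi_Ioo_ae_eq_Icc
  rw [setIntegral_congr_set hbox]
  have hd : Continuous fun x => fderiv ℝ ψ x := h.continuous_fderiv one_ne_zero
  -- Divergence theorem for the vector field with the single component `ψ` in direction `i`. The two
  -- faces orthogonal to `i` contribute equal integrals by periodicity, the others nothing.
  have key := integral_divergence_of_hasFDerivAt_off_countable (E := ℂ)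
    (a := fun _ : Fin (n + 1) => (-1 : ℝ)) (b := fun _ => (1 : ℝ)) (fun _ => by norm_num)
    (fun x => Pi.single i (ψ x))
    (fun x => (ContinuousLinearMap.single ℝ (fun _ : Fin (n + 1) => ℂ) i).comp (fderiv ℝ ψ x))
    ∅ countable_empty
    ((ContinuousLinearMap.single ℝ (fun _ : Fin (n + 1) => ℂ) i).continuous.comp
      h.continuous).continuousOn
    (fun x _ => (ContinuousLinearMap.single ℝ (fun _ : Fin (n + 1) => ℂ) i).hasFDerivAt.comp x
      ((h.differentiable one_ne_zero) x).hasFDerivAt)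
    (by
      refine Continuous.integrableOn_Icc ?_
      refine continuous_finsetSum _ fun j _ => ?_
      simp only [ContinuousLinearMap.comp_apply]
      exact (continuous_apply j).comp ((ContinuousLinearMap.single ℝ
        (fun _ : Fin (n + 1) => ℂ) i).continuous.comp (hd.clm_apply continuous_const)))
  have hsum : ∀ x, ∑ j, ((ContinuousLinearMap.single ℝ (fun _ : Fin (n + 1) => ℂ) i).comp
      (fderiv ℝ ψ x)) (Pi.single j 1) j = fderiv ℝ ψ x (Pi.single i 1) := by
    intro x
    rw [Finset.sum_eq_single i]
    · simp
    · intro j _ hj; simp [Pi.single_eq_of_ne hj]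
    · simp
  simp only [hsum] at key
  rw [key]
  refine Finset.sum_eq_zero fun j _ => ?_
  by_cases hj : j = i
  · subst hj
    simp only [Pi.single_eq_same]
    rw [sub_eq_zero]
    congr 1
    funext x
    rw [← hp (j.insertNth (-1) x)]
    congr 1
    funext l
    refine Fin.succAboveCases j ?_ (fun m => ?_) l
    · simp; norm_num
    · simp
  · simp [Pi.single_eq_of_ne hj]

theorem integral_chr {d : ℕ} (k : Fin d → ℤ) :
    ∫ x in cell d, chr k x = if k = 0 then 2 ^ d else 0 := by
  split_ifs with h
  · subst h
    simp [chr, cell, Measure.real, Real.volume_pi_Ioo]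
    norm_num
  · obtain ⟨i, hi⟩ := Function.ne_iff.mp h
    have := integral_fderiv_periodic ((contDiff_chr k).of_le (by exact_mod_cast le_top)) i
      (chr_add_single k i)
    simp only [fderiv_chr] at this
    rw [integral_const_mul] at this
    refine (mul_eq_zero.mp this).resolve_left ?_
    simpa [Real.pi_ne_zero] using hi

theorem memLp_of_continuous {d : ℕ} {φ : (Fin d → ℝ) → ℝ} (h : Continuous φ) :
    MemLp φ 2 (cellMeasure d) := by
  obtain ⟨C, hC⟩ := (isCompact_Icc (a := fun _ : Fin d => (-1 : ℝ))
    (b := fun _ => (1 : ℝ))).exists_bound_of_continuousOn h.continuousOn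
  refine MemLp.of_bound h.aestronglyMeasurable C ?_
  refine (ae_restrict_iff' (MeasurableSet.univ_pi fun _ => measurableSet_Ioo)).mpr
    (Filter.Eventually.of_forall fun x hx => hC x ?_)
  exact ⟨fun i => (hx i trivial).1.le, fun i => (hx i trivial).2.le⟩

/-- The element of `L²` given by a continuous function. -/
def contL2 {d : ℕ} (φ : (Fin d → ℝ) → ℝ) (h : Continuous φ) : L2 d := (memLp_of_continuous h).toLp

theorem coeFn_contL2 {d : ℕ} {φ : (Fin d → ℝ) → ℝ} (h : Continuous φ) :
    contL2 φ h =ᵐ[cellMeasure d] φ := (memLp_of_continuous h).coeFn_toLp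

theorem fourierCoef_contL2 {d : ℕ} {φ : (Fin d → ℝ) → ℝ} (h : Continuous φ) (k : Fin d → ℤ) :
    fourierCoef (contL2 φ h) k = ((2 : ℂ) ^ d)⁻¹ * ∫ x in cell d, (φ x : ℂ) * chr (-k) x := by
  rw [fourierCoef_eq]
  congr 1
  refine integral_congr_ae ?_
  filter_upwards [coeFn_contL2 h] with x hx
  rw [hx]

/-- The trigonometric polynomial `Re (c e^{iπ k·x})`. -/
def trigFun {d : ℕ} (k : Fin d → ℤ) (c : ℂ) (x : Fin d → ℝ) : ℝ := (c * chr k x).re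

@[fun_prop]
theorem continuous_trigFun {d : ℕ} (k : Fin d → ℤ) (c : ℂ) : Continuous (trigFun k c) :=
  Complex.continuous_re.comp (continuous_const.mul (continuous_chr k))

theorem isSmoothPeriodic_trigFun {d : ℕ} (k : Fin d → ℤ) (c : ℂ) :
    IsSmoothPeriodic (trigFun k c) :=
  ⟨Complex.reCLM.contDiff.comp (contDiff_const.mul (contDiff_chr k)), fun i x => by
    rw [trigFun, chr_add_single, trigFun]⟩

theorem classicalDeriv_trigFun {d : ℕ} (k : Fin d → ℤ) (c : ℂ) (i : Fin d) (x : Fin d → ℝ) :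
    classicalDeriv i (trigFun k c) x = trigFun k (Real.pi * Complex.I * k i * c) x := by
  have h1 : HasFDerivAt (chr k) (fderiv ℝ (chr k) x) x :=
    (((contDiff_chr k).differentiable (by simp)) x).hasFDerivAt
  have h2 : HasFDerivAt (trigFun k c) _ x := Complex.reCLM.hasFDerivAt.comp x (h1.const_mul c)
  rw [classicalDeriv, h2.fderiv]
  simp only [ContinuousLinearMap.comp_apply, smul_apply, fderiv_chr,
    Complex.reCLM_apply, trigFun, smul_eq_mul]
  congr 1
  ring

/-- The trigonometric monomial `Re (c e^{iπ k·x})` as an element of `L²`, linear in `c`. -/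
def trigL {d : ℕ} (k : Fin d → ℤ) : ℂ →L[ℝ] L2 d :=
  LinearMap.toContinuousLinearMap
    { toFun := fun c => contL2 (trigFun k c) (continuous_trigFun k c)
      map_add' := fun a b => by
        rw [contL2, contL2, contL2, ← MemLp.toLp_add]
        congr 1
        funext x
        simp [trigFun, add_mul]
      map_smul' := fun a b => by
        rw [contL2, contL2, RingHom.id_apply, ← MemLp.toLp_const_smul]
        congr 1
        funext x
        simp [trigFun, mul_assoc] }

theorem trigL_ae {d : ℕ} (k : Fin d → ℤ) (c : ℂ) : trigL k c =ᵐ[cellMeasure d] trigFun k c :=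
  coeFn_contL2 (continuous_trigFun k c)

/-- The real part of `c e_k` is half the sum of `c e_k` and its conjugate, which lives at `-k`. At
`k = l = 0` both terms fire and their mean is the real part of `c`. -/
theorem fourierCoef_trigL {d : ℕ} (k l : Fin d → ℤ) (c : ℂ) :
    fourierCoef (trigL k c) l
      = ((if k = l then c else 0) + (if k = -l then conj c else 0)) / 2 := by
  have h0 : fourierCoef (trigL k c) l = _ := fourierCoef_contL2 (continuous_trigFun k c) l
  rw [h0]
  have h1 : ∀ x, ((trigFun k c x : ℝ) : ℂ) * chr (-l) x
      = c / 2 * chr (k - l) x + conj c / 2 * chr (-k - l) x := by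
    intro x
    have h2 : ((trigFun k c x : ℝ) : ℂ) = (c * chr k x + conj (c * chr k x)) / 2 := by
      rw [Complex.add_conj, trigFun]; push_cast; ring
    rw [h2, map_mul, conj_chr, sub_eq_add_neg, sub_eq_add_neg, chr_add, chr_add]
    ring
  simp only [h1]
  rw [integral_add, integral_const_mul, integral_const_mul, integral_chr, integral_chr]
  · have e1 : (k - l = 0) ↔ k = l := sub_eq_zero
    have e2 : (-k - l = 0) ↔ k = -l := by
      rw [sub_eq_zero, neg_eq_iff_eq_neg]
    simp only [e1, e2]
    have : (2 : ℂ) ^ d ≠ 0 := by simp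
    split_ifs <;> field_simp <;> ring
  · exact ((integrableOn_cell_of_continuous (continuous_chr _)).const_mul _)
  · exact ((integrableOn_cell_of_continuous (continuous_chr _)).const_mul _)

/-- The cube of frequencies of size at most `N`. -/
def box (d N : ℕ) : Finset (Fin d → ℤ) := Fintype.piFinset fun _ => Finset.Icc (-(N : ℤ)) N

theorem mem_box {d N : ℕ} {k : Fin d → ℤ} : k ∈ box d N ↔ ∀ i, |k i| ≤ N := by
  simp [box, abs_le]

theorem neg_mem_box {d N : ℕ} {k : Fin d → ℤ} : -k ∈ box d N ↔ k ∈ box d N := by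
  simp [mem_box]

theorem tendsto_box (d : ℕ) : Filter.Tendsto (box d) Filter.atTop Filter.atTop := by
  refine Filter.tendsto_atTop_finset_of_monotone (fun m n h k hk => ?_) fun k => ?_
  · rw [mem_box] at hk ⊢
    exact fun i => (hk i).trans (by exact_mod_cast h)
  · refine ⟨∑ i, (k i).natAbs, mem_box.mpr fun i => ?_⟩
    rw [Int.abs_eq_natAbs]
    exact_mod_cast Finset.single_le_sum (f := fun i => (k i).natAbs) (fun _ _ => Nat.zero_le _)
      (Finset.mem_univ i)

/-- The Fourier partial sum. -/
def partialSum {d : ℕ} (N : ℕ) (f : L2 d) : L2 d := ∑ k ∈ box d N, trigL k (fourierCoef f k)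

/-- A frequency in the box is hit twice, by the summands at `k` and at `-k`, each with weight one
half. The box is symmetric and `f` is real, so the two halves agree. -/
theorem fourierCoef_partialSum {d : ℕ} (N : ℕ) (f : L2 d) (k : Fin d → ℤ) :
    fourierCoef (partialSum N f) k = if k ∈ box d N then fourierCoef f k else 0 := by
  rw [partialSum, fourierCoef_sum]
  simp only [fourierCoef_trigL]
  rw [← Finset.sum_div, Finset.sum_add_distrib, Finset.sum_ite_eq', Finset.sum_ite_eq']
  simp only [neg_mem_box, fourierCoef_neg, Complex.conj_conj]
  split_ifs <;> simp

theorem tendsto_partialSum {d : ℕ} (f : L2 d) :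
    Filter.Tendsto (fun N => partialSum N f) Filter.atTop (nhds f) := by
  have h1 : ∀ N, ‖partialSum N f - f‖ ^ 2
      = ‖f‖ ^ 2 - ∑ k ∈ box d N, 2 ^ d * ‖fourierCoef f k‖ ^ 2 := by
    intro N
    have h2 : HasSum (fun k => if k ∈ box d N then 2 ^ d * ‖fourierCoef f k‖ ^ 2 else (0 : ℝ))
        (∑ k ∈ box d N, if k ∈ box d N then 2 ^ d * ‖fourierCoef f k‖ ^ 2 else (0 : ℝ)) :=
      hasSum_sum_of_ne_finset_zero (fun k hk => by simp [hk])
    have h3 := (hasSum_sq_fourierCoef f).sub h2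
    rw [Finset.sum_congr rfl (g := fun k => 2 ^ d * ‖fourierCoef f k‖ ^ 2)
      (fun k hk => by simp [hk])] at h3
    refine (hasSum_sq_fourierCoef (partialSum N f - f)).unique (h3.congr_fun ?_)
    intro k
    rw [fourierCoef_sub, fourierCoef_partialSum]
    split_ifs <;> simp
  rw [tendsto_iff_norm_sub_tendsto_zero]
  have h2 := ((hasSum_sq_fourierCoef f).comp (tendsto_box d)).const_sub (‖f‖ ^ 2)
  rw [sub_self] at h2
  have h3 := h2.sqrt
  rw [Real.sqrt_zero] at h3
  refine h3.congr fun N => ?_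
  rw [Function.comp_apply, ← h1, Real.sqrt_sq (norm_nonneg _)]

/-- Fourier characterisation of weak derivatives. -/
theorem hasWeakDeriv_iff {d : ℕ} {i : Fin d} {f g : L2 d} :
    HasWeakDeriv i f g ↔ ∀ k, fourierCoef g k = Real.pi * Complex.I * k i * fourierCoef f k := by
  -- The pairing of `f` with a function is the zero frequency of their product, hence a sum over
  -- products of coefficients.
  have key : ∀ (f : L2 d) (φ : (Fin d → ℝ) → ℝ) (h : Continuous φ),
      HasSum (fun l => fourierCoef f l * fourierCoef (contL2 φ h) (-l))
        (((2 : ℂ) ^ d)⁻¹ * ((∫ x in cell d, f x * φ x : ℝ) : ℂ)) := by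
    intro f φ h
    have := hasSum_fourierCoef_mul f (contL2 φ h) 0
    simp only [zero_sub, neg_zero] at this
    convert this using 2
    rw [← integral_complex_ofReal]
    refine integral_congr_ae ?_
    filter_upwards [coeFn_contL2 h] with x hx
    rw [hx]; simp [chr]
  constructor
  · intro h k
    have h1 : ∀ c : ℂ, ∫ x in cell d, f x * trigFun (-k) (Real.pi * Complex.I * (-k i : ℤ) * c) x
        = - ∫ x in cell d, g x * trigFun (-k) c x := by
      intro c
      have := h _ (isSmoothPeriodic_trigFun (-k) c)
      simpa only [classicalDeriv_trigFun, Pi.neg_apply] using this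
    have h2 : ∀ (f : L2 d) (c : ℂ), ∫ x in cell d, f x * trigFun (-k) c x
        = (c * (2 ^ d * fourierCoef f k)).re := by
      intro f c
      rw [← integral_mul_chr_eq_fourierCoef, ← integral_const_mul, ← Complex.reCLM_apply,
        ← ContinuousLinearMap.integral_comp_comm _ ((integrable_mul_chr f (-k)).const_mul c)]
      refine integral_congr_ae (Filter.Eventually.of_forall fun x => ?_)
      simp only [trigFun, Complex.reCLM_apply]
      rw [← Complex.re_ofReal_mul]
      congr 1
      ring
    simp only [h2] at h1
    -- Test functions are real. The choices `c = 1` and `c = -i` give the two real equations that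
    -- make up the complex one.
    have e1 := h1 1
    have e2 := h1 (-Complex.I)
    have h3 : (2 : ℂ) ^ d = (((2 : ℝ) ^ d : ℝ) : ℂ) := by push_cast; rfl
    have hpos : (0 : ℝ) < 2 ^ d := by positivity
    rw [h3] at e1 e2
    simp only [Complex.mul_re, Complex.mul_im, Complex.ofReal_re, Complex.ofReal_im, Complex.I_re,
      Complex.I_im, Complex.one_re, Complex.one_im, Complex.neg_re, Complex.neg_im,
      Complex.intCast_re, Complex.intCast_im] at e1 e2
    refine Complex.ext ?_ ?_
    · refine mul_left_cancel₀ hpos.ne' ?_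
      simp only [Complex.mul_re, Complex.mul_im, Complex.ofReal_re, Complex.ofReal_im,
        Complex.I_re, Complex.I_im, Complex.intCast_re, Complex.intCast_im]
      push_cast at e1 e2
      linarith
    · refine mul_left_cancel₀ hpos.ne' ?_
      simp only [Complex.mul_re, Complex.mul_im, Complex.ofReal_re, Complex.ofReal_im,
        Complex.I_re, Complex.I_im, Complex.intCast_re, Complex.intCast_im]
      push_cast at e1 e2
      linarith
  · intro h φ hφ
    have hc : Continuous φ := hφ.1.continuous
    have hc' : Continuous (classicalDeriv i φ) :=
      (hφ.1.continuous_fderiv (by simp)).clm_apply continuous_const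
    have hd : ∀ k, fourierCoef (contL2 _ hc') k
        = Real.pi * Complex.I * k i * fourierCoef (contL2 φ hc) k := by
      intro k
      rw [fourierCoef_contL2, fourierCoef_contL2, mul_left_comm]
      congr 1
      have hφC : ContDiff ℝ 1 (fun x => (φ x : ℂ)) :=
        Complex.ofRealCLM.contDiff.comp (hφ.1.of_le (by exact_mod_cast le_top))
      have hψ : ContDiff ℝ 1 (fun x => (φ x : ℂ) * chr (-k) x) :=
        hφC.mul ((contDiff_chr (-k)).of_le (by exact_mod_cast le_top))
      have h0 := integral_fderiv_periodic hψ i (fun x => by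
        simp only [hφ.2, chr_add_single])
      have hfd : ∀ x, fderiv ℝ (fun x => (φ x : ℂ) * chr (-k) x) x (Pi.single i 1)
          = (classicalDeriv i φ x : ℂ) * chr (-k) x
            - Real.pi * Complex.I * k i * ((φ x : ℂ) * chr (-k) x) := by
        intro x
        have a1 : HasFDerivAt φ (fderiv ℝ φ x) x := (hφ.1.differentiable (by simp) x).hasFDerivAt
        have a2 : HasFDerivAt (chr (-k)) (fderiv ℝ (chr (-k)) x) x :=
          (((contDiff_chr (-k)).differentiable (by simp)) x).hasFDerivAt
        have a3 : HasFDerivAt (fun x => (φ x : ℂ)) (Complex.ofRealCLM.comp (fderiv ℝ φ x)) x :=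
          Complex.ofRealCLM.hasFDerivAt.comp x a1
        rw [(a3.fun_mul a2).fderiv]
        simp only [add_apply, smul_apply, fderiv_chr,
          ContinuousLinearMap.comp_apply, Complex.ofRealCLM_apply, smul_eq_mul, classicalDeriv,
          Pi.neg_apply]
        push_cast
        ring
      simp only [hfd] at h0
      rw [integral_sub, integral_const_mul, sub_eq_zero] at h0
      · exact h0
      · exact integrableOn_cell_of_continuous
          ((Complex.continuous_ofReal.comp hc').mul (continuous_chr _))
      · exact (show IntegrableOn _ _ _ from integrableOn_cell_of_continuous
          ((Complex.continuous_ofReal.comp hc).mul (continuous_chr _))).const_mul _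
    have s1 := key f _ hc'
    have s2 := (key g _ hc).neg
    have h3 := s1.unique (s2.congr_fun fun l => by
      rw [hd, h]; simp only [Pi.neg_apply]; push_cast; ring)
    have h4 : ((2 : ℂ) ^ d)⁻¹ ≠ 0 := by simp
    rw [← mul_neg] at h3
    exact_mod_cast mul_left_cancel₀ h4 h3

/-! ### Sobolev weights and derivatives in terms of coefficients. -/

/-- `1 + |πk|²`. -/
def wt {d : ℕ} (k : Fin d → ℤ) : ℝ := 1 + ∑ i, (Real.pi * (k i : ℝ)) ^ 2

theorem one_le_wt {d : ℕ} (k : Fin d → ℤ) : 1 ≤ wt k := by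
  rw [wt]; have := Finset.sum_nonneg (s := Finset.univ) fun i _ => sq_nonneg (Real.pi * (k i : ℝ))
  linarith

theorem wt_pos {d : ℕ} (k : Fin d → ℤ) : 0 < wt k := zero_lt_one.trans_le (one_le_wt k)

theorem sq_pi_mul_le_wt {d : ℕ} (k : Fin d → ℤ) (i : Fin d) : (Real.pi * (k i : ℝ)) ^ 2 ≤ wt k := by
  rw [wt]
  have := Finset.single_le_sum (s := Finset.univ) (f := fun i => (Real.pi * (k i : ℝ)) ^ 2)
    (fun i _ => sq_nonneg _) (Finset.mem_univ i)
  linarith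

/-- Summability with the `H¹` weight lets the multiplied coefficients be synthesised, so a weak
derivative exists. Whichever one is chosen in `pderiv`, its coefficients are forced. -/
theorem fourierCoef_pderiv {d : ℕ} {f : L2 d} (h : Summable fun k => wt k * ‖fourierCoef f k‖ ^ 2)
    (i : Fin d) (k : Fin d → ℤ) :
    fourierCoef (pderiv i f) k = Real.pi * Complex.I * k i * fourierCoef f k := by
  have hex : ∃ g, HasWeakDeriv i f g := by
    obtain ⟨g, hg⟩ := exists_fourierCoef_eq
      (fun k => Real.pi * Complex.I * k i * fourierCoef f k) (by
        refine Summable.of_nonneg_of_le (fun _ => by positivity) (fun k => ?_) h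
        rw [norm_mul, mul_pow]
        gcongr
        refine le_trans (le_of_eq ?_) (sq_pi_mul_le_wt k i)
        simp [mul_pow]) (fun k => by
        rw [fourierCoef_neg]; simp)
    exact ⟨g, hasWeakDeriv_iff.mpr hg⟩
  rw [pderiv, dif_pos hex]
  exact hasWeakDeriv_iff.mp hex.choose_spec k

theorem hNorm_sq {d : ℕ} (s : ℝ) (f : L2 d) :
    hNorm s f ^ (2 : ℝ) = ∑' k, ENNReal.ofReal (2 ^ d * wt k ^ s * ‖fourierCoef f k‖ ^ 2) := by
  rw [hNorm, ← ENNReal.rpow_mul]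
  norm_num
  rfl

theorem memH_iff {d : ℕ} (s : ℝ) (f : L2 d) :
    MemH s f ↔ Summable fun k => wt k ^ s * ‖fourierCoef f k‖ ^ 2 := by
  rw [MemH, ← ENNReal.rpow_lt_top_iff_of_pos (zero_lt_two' ℝ), hNorm_sq]
  have hnn : ∀ k : Fin d → ℤ, 0 ≤ 2 ^ d * wt k ^ s * ‖fourierCoef f k‖ ^ 2 := fun k =>
    mul_nonneg (mul_nonneg (by positivity) (Real.rpow_nonneg (wt_pos k).le _)) (sq_nonneg _)
  constructor
  · intro h
    have := ENNReal.summable_toReal h.ne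
    simp only [ENNReal.toReal_ofReal (hnn _)] at this
    have h2 := this.mul_left ((2 : ℝ) ^ d)⁻¹
    refine h2.congr fun k => ?_
    field_simp
  · intro h
    have h2 := h.mul_left ((2 : ℝ) ^ d)
    rw [← ENNReal.ofReal_tsum_of_nonneg hnn (by simpa only [mul_assoc] using h2)]
    exact ENNReal.ofReal_lt_top

/-! ### Parity in `z` and solenoidality as conditions on coefficients. -/

/-- The frequency `(k₀, k₁, -k₂)`. -/
def reflFreq (k : Fin 3 → ℤ) : Fin 3 → ℤ := ![k 0, k 1, -k 2]

/-- The parity signs of the components of a velocity field. -/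
def paritySign : Fin 3 → ℂ := ![1, 1, -1]

/-- The frequency `(h₀, h₁, 0)`. -/
def embFreq (h : Fin 2 → ℤ) : Fin 3 → ℤ := ![h 0, h 1, 0]

/-- The horizontal part of a frequency. -/
def horFreq (k : Fin 3 → ℤ) : Fin 2 → ℤ := ![k 0, k 1]

theorem reflFreq_reflFreq (k : Fin 3 → ℤ) : reflFreq (reflFreq k) = k := by
  funext i; fin_cases i <;> simp [reflFreq]

theorem reflFreq_neg (k : Fin 3 → ℤ) : reflFreq (-k) = -reflFreq k := by
  funext i; fin_cases i <;> simp [reflFreq]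

theorem horFreq_embFreq (h : Fin 2 → ℤ) : horFreq (embFreq h) = h := by
  funext i; fin_cases i <;> simp [horFreq, embFreq]

theorem embFreq_horFreq {k : Fin 3 → ℤ} (hk : k 2 = 0) : embFreq (horFreq k) = k := by
  funext i; fin_cases i <;> simp [horFreq, embFreq, hk]

theorem embFreq_injective : Function.Injective embFreq := fun a b h => by
  rw [← horFreq_embFreq a, h, horFreq_embFreq]

theorem reflFreq_mem_box {N : ℕ} {k : Fin 3 → ℤ} : reflFreq k ∈ box 3 N ↔ k ∈ box 3 N := by
  simp [mem_box, Fin.forall_fin_succ, reflFreq]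

theorem chr_reflect (k : Fin 3 → ℤ) (x : Fin 3 → ℝ) : chr k (reflect x) = chr (reflFreq k) x := by
  simp [chr, reflect, reflFreq, Fin.sum_univ_three]

theorem cellMeasure_eq_pi (d : ℕ) :
    cellMeasure d = Measure.pi fun _ : Fin d => (volume : Measure ℝ).restrict (Ioo (-1 : ℝ) 1) := by
  rw [cellMeasure, cell, volume_pi, Measure.restrict_pi_pi]

theorem measurePreserving_reflect : MeasurePreserving reflect (cellMeasure 3) (cellMeasure 3) := by
  rw [cellMeasure_eq_pi]
  have hneg : MeasurePreserving (fun x : ℝ => -x) ((volume : Measure ℝ).restrict (Ioo (-1 : ℝ) 1))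
      ((volume : Measure ℝ).restrict (Ioo (-1 : ℝ) 1)) := by
    have := (Measure.measurePreserving_neg (volume : Measure ℝ)).restrict_preimage
      (s := Ioo (-1 : ℝ) 1) measurableSet_Ioo
    simpa using this
  have h := measurePreserving_pi (fun _ : Fin 3 => (volume : Measure ℝ).restrict (Ioo (-1 : ℝ) 1))
    (fun _ : Fin 3 => (volume : Measure ℝ).restrict (Ioo (-1 : ℝ) 1))
    (f := ![id, id, fun x : ℝ => -x]) (fun i => by
      fin_cases i
      · exact MeasurePreserving.id _
      · exact MeasurePreserving.id _
      · exact hneg)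
  convert h using 1
  funext x i
  fin_cases i <;> simp [reflect]

theorem integral_comp_reflect (F : (Fin 3 → ℝ) → ℂ) (hF : AEStronglyMeasurable F (cellMeasure 3)) :
    ∫ x in cell 3, F x = ∫ x in cell 3, F (reflect x) := by
  have h := integral_map (μ := cellMeasure 3)
    measurePreserving_reflect.measurable.aemeasurable (f := F)
    (by rw [measurePreserving_reflect.map_eq]; exact hF)
  rwa [measurePreserving_reflect.map_eq] at h

/-- Evenness in `z` from the Fourier coefficients. -/
theorem isEvenZ_of_fourierCoef {p : L2 3} (h : ∀ k, fourierCoef p (reflFreq k) = fourierCoef p k) :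
    IsEvenZ p := by
  have hq := Lp.coeFn_compMeasurePreserving p measurePreserving_reflect
  have heq : Lp.compMeasurePreserving reflect measurePreserving_reflect p = p := by
    refine ext_fourierCoef fun k => ?_
    rw [← h k, fourierCoef_eq, fourierCoef_eq]
    congr 1
    rw [integral_comp_reflect _ (aesm_mul_chr p _)]
    refine integral_congr_ae ?_
    filter_upwards [hq] with x hx
    simp only [hx, Function.comp_apply, chr_reflect, ← reflFreq_neg, reflFreq_reflFreq]
  rw [heq] at hq
  exact hq.symm

theorem fourierCoef_parity {f : L2 3} {φ : (Fin 3 → ℝ) → ℝ} (hφ : Continuous φ)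
    (hf : f =ᵐ[cellMeasure 3] φ) {s : ℝ} (hs : ∀ x, φ (reflect x) = s * φ x) (k : Fin 3 → ℤ) :
    fourierCoef f (reflFreq k) = s * fourierCoef f k := by
  have h0 : ∀ k, fourierCoef f k = ((2 : ℂ) ^ 3)⁻¹ * ∫ x in cell 3, (φ x : ℂ) * chr (-k) x := by
    intro k
    rw [fourierCoef_eq]
    congr 1
    refine integral_congr_ae ?_
    filter_upwards [hf] with x hx
    rw [hx]
  have hm : Continuous fun x : Fin 3 → ℝ => (φ x : ℂ) * chr (-reflFreq k) x :=
    (Complex.continuous_ofReal.comp hφ).mul (continuous_chr _)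
  rw [h0, h0, integral_comp_reflect _ hm.aestronglyMeasurable, mul_left_comm]
  congr 1
  rw [← integral_const_mul (μ := cellMeasure 3) (s : ℂ) fun x => (φ x : ℂ) * chr (-k) x]
  refine integral_congr_ae (Filter.Eventually.of_forall fun x => ?_)
  simp only [chr_reflect, ← reflFreq_neg, reflFreq_reflFreq, hs]
  push_cast; ring

/-- A field given by its Fourier coefficients is divergence free. -/
def DivFreeCoef {d : ℕ} (c : Fin d → (Fin d → ℤ) → ℂ) : Prop := ∀ k, ∑ j, (k j : ℂ) * c j k = 0

/-- The horizontal components are even and the vertical component is odd in `z`. -/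
def ParityCoef (c : Fin 3 → (Fin 3 → ℤ) → ℂ) : Prop :=
  ∀ i k, c i (reflFreq k) = paritySign i * c i k

/-- Integration by parts over a period shows that the classical derivatives are weak derivatives.
Their sum vanishes, and the vanishing is read off mode by mode. -/
theorem divFreeCoef_of_classical {d : ℕ} {u : Fin d → L2 d} {φ : Fin d → (Fin d → ℝ) → ℝ}
    (hφ : ∀ i, IsSmoothPeriodic (φ i)) (hdiv : ∀ x, ∑ j, classicalDeriv j (φ j) x = 0)
    (hu : ∀ i, u i =ᵐ[cellMeasure d] φ i) : DivFreeCoef fun i => fourierCoef (u i) := by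
  have hc' : ∀ i, Continuous (classicalDeriv i (φ i)) := fun i =>
    ((hφ i).1.continuous_fderiv (by simp)).clm_apply continuous_const
  have hw : ∀ i, HasWeakDeriv i (u i) (contL2 _ (hc' i)) := by
    intro i ψ hψ
    have hcont : ∀ {ξ : (Fin d → ℝ) → ℝ}, IsSmoothPeriodic ξ → Continuous ξ := fun h =>
      h.1.continuous
    have hprod : IsSmoothPeriodic fun x => φ i x * ψ x :=
      ⟨(hφ i).1.mul hψ.1, fun j x => by simp only [(hφ i).2, hψ.2]⟩
    have hcψ : Continuous (classicalDeriv i ψ) :=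
      (hψ.1.continuous_fderiv (by simp)).clm_apply continuous_const
    have h0 := integral_fderiv_periodic (ψ := fun x => ((φ i x * ψ x : ℝ) : ℂ))
      (Complex.ofRealCLM.contDiff.comp (hprod.1.of_le (by exact_mod_cast le_top))) i
      (fun x => by simp only [(hφ i).2, hψ.2])
    have h1 : ∀ x, fderiv ℝ (fun x => ((φ i x * ψ x : ℝ) : ℂ)) x (Pi.single i 1)
        = ((φ i x * classicalDeriv i ψ x + classicalDeriv i (φ i) x * ψ x : ℝ) : ℂ) := by
      intro x
      have a1 := ((hφ i).1.differentiable (by simp) x).hasFDerivAt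
      have a2 := (hψ.1.differentiable (by simp) x).hasFDerivAt
      have a3 := (Complex.ofRealCLM.hasFDerivAt (x := φ i x * ψ x)).comp x (a1.fun_mul a2)
      have a4 : HasFDerivAt (fun x => ((φ i x * ψ x : ℝ) : ℂ)) _ x := a3
      rw [a4.fderiv]
      simp [classicalDeriv]
      ring
    simp only [h1] at h0
    rw [integral_complex_ofReal, Complex.ofReal_eq_zero, integral_add] at h0
    · have e1 : ∫ x in cell d, u i x * classicalDeriv i ψ x
          = ∫ x in cell d, φ i x * classicalDeriv i ψ x := by
        refine integral_congr_ae ?_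
        filter_upwards [hu i] with x hx
        rw [hx]
      have e2 : ∫ x in cell d, contL2 _ (hc' i) x * ψ x
          = ∫ x in cell d, classicalDeriv i (φ i) x * ψ x := by
        refine integral_congr_ae ?_
        filter_upwards [coeFn_contL2 (hc' i)] with x hx
        rw [hx]
      rw [e1, e2]; linarith
    · exact integrableOn_cell_of_continuous ((hcont (hφ i)).mul hcψ)
    · exact integrableOn_cell_of_continuous ((hc' i).mul (hcont hψ))
  intro k
  have hzero : ∑ i, contL2 _ (hc' i) = 0 := by
    refine Lp.ext ((Lp.coeFn_finsetSum _ _).trans ?_)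
    have hall : ∀ᵐ x ∂cellMeasure d, ∀ i, contL2 _ (hc' i) x = classicalDeriv i (φ i) x :=
      ae_all_iff.mpr fun i => coeFn_contL2 (hc' i)
    filter_upwards [hall, Lp.coeFn_zero ℝ 2 (cellMeasure d)] with x hx h0
    rw [h0]
    simp [hx, hdiv]
  have h2 : fourierCoef (∑ i, contL2 _ (hc' i)) k = 0 := by rw [hzero, fourierCoef_zero]
  rw [fourierCoef_sum] at h2
  simp only [fun i => hasWeakDeriv_iff.mp (hw i) k] at h2
  have h3 : (Real.pi * Complex.I : ℂ) * ∑ j, (k j : ℂ) * fourierCoef (u j) k = 0 := by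
    rw [← h2, Finset.mul_sum]
    exact Finset.sum_congr rfl fun j _ => by ring
  exact (mul_eq_zero.mp h3).resolve_left (by simp [Real.pi_ne_zero])

/-- Each mode imposes a condition through finitely many continuous functionals, so the condition
survives the `L²` closure in the definition of the solenoidal spaces. -/
theorem isClosed_divFreeCoef {d : ℕ} :
    IsClosed {u : Fin d → L2 d | DivFreeCoef fun i => fourierCoef (u i)} := by
  simp only [DivFreeCoef, ofPred_forall]
  refine isClosed_iInter fun k => isClosed_eq ?_ continuous_const
  exact continuous_finsetSum _ fun j _ =>
    continuous_const.mul ((fourierCoefL k).continuous.comp (continuous_apply j))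

theorem isClosed_parityCoef :
    IsClosed {u : Fin 3 → L2 3 | ParityCoef fun i => fourierCoef (u i)} := by
  simp only [ParityCoef, ofPred_forall]
  refine isClosed_iInter fun i => isClosed_iInter fun k => isClosed_eq ?_ ?_
  · exact (fourierCoefL _).continuous.comp (continuous_apply i)
  · exact continuous_const.mul ((fourierCoefL k).continuous.comp (continuous_apply i))

theorem divFreeCoef_of_mem_solenoidal2 {v : Fin 2 → L2 2} (h : v ∈ solenoidal2) :
    DivFreeCoef fun i => fourierCoef (v i) := by
  refine closure_minimal ?_ isClosed_divFreeCoef h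
  rintro u ⟨φ, h1, h2, h3⟩
  exact divFreeCoef_of_classical h1 h2 h3

theorem divFreeCoef_of_mem_solenoidal3 {v : Fin 3 → L2 3} (h : v ∈ solenoidal3) :
    DivFreeCoef fun i => fourierCoef (v i) := by
  refine closure_minimal ?_ isClosed_divFreeCoef h
  rintro u ⟨φ, h1, h2, -, h3⟩
  exact divFreeCoef_of_classical h1 h2 h3

theorem parityCoef_of_mem_solenoidal3 {v : Fin 3 → L2 3} (h : v ∈ solenoidal3) :
    ParityCoef fun i => fourierCoef (v i) := by
  refine closure_minimal ?_ isClosed_parityCoef h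
  rintro u ⟨φ, h1, -, h2, h3⟩ i k
  fin_cases i
  · simpa [paritySign] using fourierCoef_parity (s := 1) (h1 0).1.continuous (h3 0)
      (fun x => by rw [(h2 x).1, one_mul]) k
  · simpa [paritySign] using fourierCoef_parity (s := 1) (h1 1).1.continuous (h3 1)
      (fun x => by rw [(h2 x).2.1, one_mul]) k
  · simpa [paritySign] using fourierCoef_parity (s := -1) (h1 2).1.continuous (h3 2)
      (fun x => by rw [(h2 x).2.2, neg_one_mul]) k

/-- Partial sums over boxes approximate the field and are admissible smooth fields: solenoidality
holds separately at every frequency, and parity is kept because the boxes are invariant under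
`reflFreq`. -/
theorem mem_solenoidal3 {u : Fin 3 → L2 3} (hd : DivFreeCoef fun i => fourierCoef (u i))
    (hp : ParityCoef fun i => fourierCoef (u i)) : u ∈ solenoidal3 := by
  refine mem_closure_of_tendsto (f := fun N i => partialSum N (u i)) (b := Filter.atTop)
    (tendsto_pi_nhds.mpr fun i => tendsto_partialSum (u i)) (Filter.Eventually.of_forall fun N => ?_)
  refine ⟨fun i x => ∑ k ∈ box 3 N, trigFun k (fourierCoef (u i) k) x, ?_, ?_, ?_, ?_⟩
  · intro i
    refine ⟨ContDiff.sum fun k _ => (isSmoothPeriodic_trigFun k _).1, fun j x => ?_⟩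
    exact Finset.sum_congr rfl fun k _ => (isSmoothPeriodic_trigFun k _).2 j x
  · intro x
    have h1 : ∀ j, classicalDeriv j (fun x => ∑ k ∈ box 3 N, trigFun k (fourierCoef (u j) k) x) x
        = ∑ k ∈ box 3 N, trigFun k (Real.pi * Complex.I * k j * fourierCoef (u j) k) x := by
      intro j
      rw [classicalDeriv, fderiv_fun_sum fun k _ =>
        ((isSmoothPeriodic_trigFun k _).1.differentiable (by simp)) x, sum_apply]
      exact Finset.sum_congr rfl fun k _ => classicalDeriv_trigFun k _ j x
    simp only [h1]
    rw [Finset.sum_comm]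
    refine Finset.sum_eq_zero fun k _ => ?_
    simp only [trigFun, ← Complex.re_sum, ← Finset.sum_mul]
    have : ∑ j, (Real.pi * Complex.I * k j * fourierCoef (u j) k : ℂ)
        = Real.pi * Complex.I * ∑ j, (k j : ℂ) * fourierCoef (u j) k := by
      rw [Finset.mul_sum]; exact Finset.sum_congr rfl fun j _ => by ring
    rw [this, hd k]; simp
  · intro x
    have h1 : ∀ i, ∑ k ∈ box 3 N, trigFun k (fourierCoef (u i) k) (reflect x)
        = ∑ k ∈ box 3 N, trigFun k (paritySign i * fourierCoef (u i) k) x := by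
      intro i
      refine Finset.sum_nbij' reflFreq reflFreq (fun k hk => reflFreq_mem_box.mpr hk)
        (fun k hk => reflFreq_mem_box.mpr hk) (fun k _ => reflFreq_reflFreq k)
        (fun k _ => reflFreq_reflFreq k) (fun k _ => ?_)
      rw [trigFun, chr_reflect, trigFun]
      have := hp i (reflFreq k)
      simp only [reflFreq_reflFreq] at this
      rw [this]
    refine ⟨?_, ?_, ?_⟩
    · simp [h1, paritySign]
    · simp [h1, paritySign]
    · simp only [h1]; simp [paritySign, trigFun]
  · intro i
    have hall : ∀ᵐ x ∂cellMeasure 3, ∀ k, trigL k (fourierCoef (u i) k) x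
        = trigFun k (fourierCoef (u i) k) x := ae_all_iff.mpr fun k => trigL_ae k _
    refine (Lp.coeFn_finsetSum _ _).trans ?_
    filter_upwards [hall] with x hx
    simp [hx]

/-! ### Vertical average and lift on the Fourier side. -/

theorem chr_embFreq (h : Fin 2 → ℤ) (y : Fin 2 → ℝ) (z : ℝ) :
    chr (-embFreq h) ![y 0, y 1, z] = chr (-h) y := by
  simp [chr, embFreq, Fin.sum_univ_three, Fin.sum_univ_two]

theorem integral_cell3_eq {F : (Fin 3 → ℝ) → ℂ} (hF : Integrable F (cellMeasure 3)) :
    ∫ x in cell 3, F x = ∫ y in cell 2, ∫ z in Ioo (-1 : ℝ) 1, F ![y 0, y 1, z] := by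
  have hs := splitZ_measurePreserving.symm splitZ
  have h1 : ∫ x in cell 3, F x = ∫ q, F (splitZ.symm q)
      ∂((volume.restrict (Ioo (-1 : ℝ) 1)).prod (cellMeasure 2)) :=
    (hs.integral_comp' (f := splitZ.symm) F).symm
  have hi : Integrable (fun q => F (splitZ.symm q))
      ((volume.restrict (Ioo (-1 : ℝ) 1)).prod (cellMeasure 2)) := hs.integrable_comp_of_integrable hF
  rw [h1, integral_prod_symm _ hi]
  simp only [splitZ_symm_apply]

/-- Fubini: the character with frequency `(h₀, h₁, 0)` does not depend on `z`, and the factor one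
half of the average accounts for the two normalisations `2⁻²` and `2⁻³`. -/
theorem fourierCoef_verticalAverage (f : L2 3) (h : Fin 2 → ℤ) :
    fourierCoef (verticalAverage f) h = fourierCoef f (embFreq h) := by
  rw [fourierCoef_eq, fourierCoef_eq, integral_cell3_eq (integrable_mul_chr f _)]
  have h1 : ∫ y in cell 2, (verticalAverage f y : ℂ) * chr (-h) y
      = ∫ y in cell 2, (1 / 2 : ℂ) *
        ∫ z in Ioo (-1 : ℝ) 1, (f ![y 0, y 1, z] : ℂ) * chr (-embFreq h) ![y 0, y 1, z] := by
    refine integral_congr_ae ?_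
    filter_upwards [(memLp_verticalAverage f).coeFn_toLp] with y hy
    rw [verticalAverage, hy]
    simp only [chr_embFreq]
    rw [integral_mul_const, integral_complex_ofReal]
    push_cast
    ring
  rw [h1, integral_const_mul]
  ring

theorem integral_exp_vertical {m : ℤ} (hm : m ≠ 0) :
    ∫ z in Ioo (-1 : ℝ) 1, Complex.exp (Real.pi * Complex.I * (m * (z : ℂ))) = 0 := by
  have hc : (Real.pi * Complex.I * m : ℂ) ≠ 0 := by
    simp [Real.pi_ne_zero, hm]
  rw [← integral_Ioc_eq_integral_Ioo, ← intervalIntegral.integral_of_le (by norm_num)]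
  have := integral_exp_mul_complex (a := -1) (b := 1) hc
  simp only [← mul_assoc]
  rw [this, div_eq_zero_iff]
  left
  rw [sub_eq_zero, Complex.exp_eq_exp_iff_exists_int]
  exact ⟨m, by push_cast; ring⟩

theorem fourierCoef_lift (g : L2 2) (k : Fin 3 → ℤ) :
    fourierCoef (lift g) k = if k 2 = 0 then fourierCoef g (horFreq k) else 0 := by
  have hi : Integrable (fun x : Fin 3 → ℝ => (g ![x 0, x 1] : ℂ) * chr (-k) x) (cellMeasure 3) := by
    refine (integrable_mul_chr (lift g) (-k)).congr ?_
    filter_upwards [(memLp_lift g).coeFn_toLp] with x hx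
    rw [lift, hx]
  have h1 : ∫ x in cell 3, (lift g x : ℂ) * chr (-k) x
      = ∫ x in cell 3, (g ![x 0, x 1] : ℂ) * chr (-k) x := by
    refine integral_congr_ae ?_
    filter_upwards [(memLp_lift g).coeFn_toLp] with x hx
    rw [lift, hx]
  have hch : ∀ (y : Fin 2 → ℝ) (z : ℝ), chr (-k) ![y 0, y 1, z]
      = chr (-horFreq k) y * Complex.exp (Real.pi * Complex.I * ((-k 2 : ℤ) * (z : ℂ))) := by
    intro y z
    rw [chr, chr, ← Complex.exp_add]
    congr 1
    simp [horFreq, Fin.sum_univ_three, Fin.sum_univ_two]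
    ring
  have hy : ∀ y : Fin 2 → ℝ, (![y 0, y 1] : Fin 2 → ℝ) = y := by
    intro y; funext i; fin_cases i <;> rfl
  rw [fourierCoef_eq, h1, integral_cell3_eq hi]
  simp only [hch, Matrix.cons_val_zero, Matrix.cons_val_one, hy]
  have h2 : ∀ y : Fin 2 → ℝ, ∫ z in Ioo (-1 : ℝ) 1, (g y : ℂ) * (chr (-horFreq k) y
      * Complex.exp (Real.pi * Complex.I * ((-k 2 : ℤ) * (z : ℂ))))
      = (g y : ℂ) * chr (-horFreq k) y *
        ∫ z in Ioo (-1 : ℝ) 1, Complex.exp (Real.pi * Complex.I * ((-k 2 : ℤ) * (z : ℂ))) := by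
    intro y
    rw [← integral_const_mul]
    simp only [mul_assoc]
  simp only [h2, integral_mul_const]
  split_ifs with hk
  · rw [fourierCoef_eq]
    simp [hk]
    norm_num
    ring
  · rw [integral_exp_vertical (neg_ne_zero.mpr hk)]
    simp

theorem embFreq_tsum_le (f : L2 3) :
    ∑' h, 2 ^ 2 * ‖fourierCoef f (embFreq h)‖ ^ 2 ≤ ‖f‖ ^ 2 := by
  have h3 := hasSum_sq_fourierCoef f
  have hs : Summable fun k => (2 : ℝ) ^ 2 * ‖fourierCoef f k‖ ^ 2 := by
    refine (h3.summable.mul_left (1 / 2 : ℝ)).congr fun k => by ring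
  rw [← h3.tsum_eq]
  refine (tsum_comp_le_tsum_of_inj hs (fun _ => by positivity) embFreq_injective).trans ?_
  refine hs.tsum_le_tsum (fun k => ?_) h3.summable
  nlinarith [sq_nonneg ‖fourierCoef f k‖]

/-- The vertical average as a continuous linear map. -/
def verticalAverageL : L2 3 →L[ℝ] L2 2 :=
  LinearMap.mkContinuous
    { toFun := verticalAverage
      map_add' := fun f g => ext_fourierCoef fun h => by
        simp only [fourierCoef_add, fourierCoef_verticalAverage]
      map_smul' := fun a f => ext_fourierCoef fun h => by
        simp only [fourierCoef_smul, fourierCoef_verticalAverage, RingHom.id_apply] } 1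
    (fun f => by
      rw [one_mul]
      refine (pow_le_pow_iff_left₀ (norm_nonneg _) (norm_nonneg _) two_ne_zero).mp ?_
      rw [← (hasSum_sq_fourierCoef _).tsum_eq]
      simp only [LinearMap.coe_mk, AddHom.coe_mk, fourierCoef_verticalAverage]
      exact embFreq_tsum_le f)

theorem verticalAverageL_apply (f : L2 3) : verticalAverageL f = verticalAverage f := rfl

/-! ### Lattice sums -/

theorem summable_int_one_add_sq : Summable fun j : ℤ => (1 + (j : ℝ) ^ 2) ^ (-(2 / 3) : ℝ) := by
  have h1 : Summable fun j : ℤ => |(j : ℝ)| ^ (-(4 / 3) : ℝ) + if j = 0 then 1 else 0 :=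
    (Real.summable_abs_int_rpow (by norm_num)).add
      (summable_of_ne_finset_zero (s := {0}) (fun j hj => by simpa using hj))
  refine Summable.of_nonneg_of_le (fun j => by positivity) (fun j => ?_) h1
  split_ifs with h
  · subst h; simp
  · have hj : 0 < |(j : ℝ)| := abs_pos.mpr (by exact_mod_cast h)
    rw [add_zero, show (-(4 / 3) : ℝ) = 2 * (-(2 / 3)) by norm_num, Real.rpow_mul hj.le]
    refine Real.rpow_le_rpow_of_nonpos (by positivity) ?_ (by norm_num)
    rw [Real.rpow_two, sq_abs]; linarith [sq_nonneg (j : ℝ)]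

theorem one_le_pi_sq : (1 : ℝ) ≤ Real.pi ^ 2 := by nlinarith [Real.pi_gt_three]

theorem one_add_sq_le_wt {d : ℕ} (k : Fin d → ℤ) (i : Fin d) : 1 + (k i : ℝ) ^ 2 ≤ wt k := by
  rw [wt]
  have := Finset.single_le_sum (s := Finset.univ) (f := fun i => (Real.pi * (k i : ℝ)) ^ 2)
    (fun i _ => sq_nonneg _) (Finset.mem_univ i)
  simp only [mul_pow] at this ⊢
  nlinarith [one_le_pi_sq, sq_nonneg (k i : ℝ)]

/-- The weight dominates every `1 + kᵢ²`, so `wt k ^ 2` dominates the product of the `(1 +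
kᵢ²)^{2/3}` as long as `2d/3 ≤ 2`. The product separates the variables, and each factor decays like
`|j|^{-4/3}`. This is where the dimension restriction enters. -/
theorem summable_wt {d : ℕ} (hd : d ≤ 3) : Summable fun k : Fin d → ℤ => (wt k ^ 2)⁻¹ := by
  set g : ℤ → ℝ := fun j => (1 + (j : ℝ) ^ 2) ^ (-(2 / 3) : ℝ) with hg
  have hg0 : ∀ j, 0 ≤ g j := fun j => by positivity
  have hle : ∀ k : Fin d → ℤ, (wt k ^ 2)⁻¹ ≤ ∏ i, g (k i) := by
    intro k
    have h1 : ∏ i, (1 + (k i : ℝ) ^ 2) ^ (2 / 3 : ℝ) ≤ wt k ^ 2 := by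
      calc ∏ i, (1 + (k i : ℝ) ^ 2) ^ (2 / 3 : ℝ) ≤ ∏ _i : Fin d, wt k ^ (2 / 3 : ℝ) :=
            Finset.prod_le_prod (fun i _ => by positivity) fun i _ =>
              Real.rpow_le_rpow (by positivity) (one_add_sq_le_wt k i) (by norm_num)
        _ = wt k ^ ((2 / 3 : ℝ) * d) := by
            rw [Finset.prod_const, Finset.card_univ, Fintype.card_fin, Real.rpow_mul (wt_pos k).le,
              Real.rpow_natCast]
        _ ≤ wt k ^ (2 : ℝ) := Real.rpow_le_rpow_of_exponent_le (one_le_wt k) (by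
            have : (d : ℝ) ≤ 3 := by exact_mod_cast hd
            linarith)
        _ = wt k ^ 2 := Real.rpow_two _
    have h2 : ∏ i, g (k i) = (∏ i, (1 + (k i : ℝ) ^ 2) ^ (2 / 3 : ℝ))⁻¹ := by
      rw [← Finset.prod_inv_distrib]
      exact Finset.prod_congr rfl fun i _ => Real.rpow_neg (by positivity) _
    rw [h2]
    exact inv_anti₀ (Finset.prod_pos fun i _ => by positivity) h1
  refine summable_of_sum_le (c := (∑' j, g j) ^ d) (fun k => inv_nonneg.mpr (sq_nonneg _)) fun s => ?_
  obtain ⟨N, hN⟩ := (Filter.tendsto_atTop.mp (tendsto_box d) s).exists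
  calc ∑ k ∈ s, (wt k ^ 2)⁻¹ ≤ ∑ k ∈ s, ∏ i, g (k i) := Finset.sum_le_sum fun k _ => hle k
    _ ≤ ∑ k ∈ box d N, ∏ i, g (k i) := Finset.sum_le_sum_of_subset_of_nonneg hN
        fun k _ _ => Finset.prod_nonneg fun i _ => hg0 (k i)
    _ = ∏ _i : Fin d, ∑ j ∈ Finset.Icc (-(N : ℤ)) N, g j := by
        rw [box, Finset.prod_univ_sum]
    _ ≤ ∏ _i : Fin d, ∑' j, g j := Finset.prod_le_prod
        (fun i _ => Finset.sum_nonneg fun j _ => hg0 j)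
        (fun i _ => summable_int_one_add_sq.sum_le_tsum _ fun j _ => hg0 j)
    _ = (∑' j, g j) ^ d := by simp

/-- The sum `∑ₖ (1 + |πk|²)^{-2}` over `ℤᵈ`. -/
def latticeConst (d : ℕ) : ℝ := ∑' k : Fin d → ℤ, (wt k ^ 2)⁻¹

theorem latticeConst_nonneg (d : ℕ) : 0 ≤ latticeConst d :=
  tsum_nonneg fun _ => inv_nonneg.mpr (sq_nonneg _)

theorem sum_inv_wt_le {d : ℕ} (hd : d ≤ 3) (s : Finset (Fin d → ℤ)) :
    ∑ k ∈ s, (wt k ^ 2)⁻¹ ≤ latticeConst d :=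
  (summable_wt hd).sum_le_tsum _ fun _ _ => by positivity

theorem sum_inv_wt_sub_le {d : ℕ} (hd : d ≤ 3) (s : Finset (Fin d → ℤ)) (k : Fin d → ℤ) :
    ∑ l ∈ s, (wt (k - l) ^ 2)⁻¹ ≤ latticeConst d := by
  have h := (Equiv.subLeft k).summable_iff.mpr (summable_wt hd)
  have h2 := (Equiv.subLeft k).tsum_eq fun k : Fin d → ℤ => (wt k ^ 2)⁻¹
  refine (h.sum_le_tsum s fun _ _ => inv_nonneg.mpr (sq_nonneg _)).trans ?_
  rw [latticeConst, ← h2]; rfl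

/-- The square of the smaller of the two weights is at most the mixed product, since the exponents
add up to 2. -/
theorem inv_wt_mul_le {d : ℕ} {a b : ℝ} (ha : 0 ≤ a) (hb : 0 ≤ b) (hab : a + b = 2)
    (k l : Fin d → ℤ) :
    (wt k ^ a * wt l ^ b)⁻¹ ≤ (wt k ^ 2)⁻¹ + (wt l ^ 2)⁻¹ := by
  rcases le_total (wt k) (wt l) with h | h
  · have : wt k ^ 2 ≤ wt k ^ a * wt l ^ b := by
      rw [← Real.rpow_two, ← hab, Real.rpow_add (wt_pos k)]
      have := Real.rpow_le_rpow (wt_pos k).le h hb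
      have := Real.rpow_nonneg (wt_pos k).le a
      gcongr
    have h2 := inv_anti₀ (pow_pos (wt_pos k) 2) this
    have := inv_nonneg.mpr (pow_pos (wt_pos l) 2).le
    linarith
  · have : wt l ^ 2 ≤ wt k ^ a * wt l ^ b := by
      rw [← Real.rpow_two, ← hab, Real.rpow_add (wt_pos l)]
      have := Real.rpow_le_rpow (wt_pos l).le h ha
      have := Real.rpow_nonneg (wt_pos l).le b
      gcongr
    have h2 := inv_anti₀ (pow_pos (wt_pos l) 2) this
    have := inv_nonneg.mpr (pow_pos (wt_pos k) 2).le
    linarith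

theorem sum_le_sum_of_support {ι : Type*} {s t : Finset ι} {f : ι → ℝ}
    (h0 : ∀ i, 0 ≤ f i) (h : ∀ i ∉ t, f i = 0) : ∑ i ∈ s, f i ≤ ∑ i ∈ t, f i := by
  classical
  calc ∑ i ∈ s, f i = ∑ i ∈ s ∩ t, f i :=
        (Finset.sum_subset Finset.inter_subset_left fun i hi hit => h i fun ht =>
          hit (Finset.mem_inter.mpr ⟨hi, ht⟩)).symm
    _ ≤ ∑ i ∈ t, f i := Finset.sum_le_sum_of_subset_of_nonneg Finset.inter_subset_right
        fun i _ _ => h0 i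

/-- The product estimate `H^a · H^b ⊆ L²`, `a + b = 2`, for finite convolutions. -/
theorem sum_sq_conv_le {d : ℕ} (hd : d ≤ 3) {a b : ℝ} (ha : 0 ≤ a) (hb : 0 ≤ b) (hab : a + b = 2)
    (B B' : Finset (Fin d → ℤ)) (f g : (Fin d → ℤ) → ℝ) (hg : ∀ k ∉ B, g k = 0) :
    ∑ k ∈ B', (∑ l ∈ B, f l * g (k - l)) ^ 2
      ≤ 2 * latticeConst d * ((∑ k ∈ B, wt k ^ a * f k ^ 2) * ∑ k ∈ B, wt k ^ b * g k ^ 2) := by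
  have hC := latticeConst_nonneg d
  have hwn : ∀ (k : Fin d → ℤ) (s : ℝ), 0 < wt k ^ s := fun k s => Real.rpow_pos_of_pos (wt_pos k) s
  have h1 : ∀ k, (∑ l ∈ B, f l * g (k - l)) ^ 2 ≤ (2 * latticeConst d) *
      ∑ l ∈ B, (wt l ^ a * f l ^ 2) * (wt (k - l) ^ b * g (k - l) ^ 2) := by
    intro k
    -- Cauchy-Schwarz with both Sobolev weights inserted. The sum of the inverse weights over `l` is
    -- bounded uniformly in `k`, and what remains is a plain convolution of the weighted squares.
    have hcs := Finset.sum_sq_le_sum_mul_sum_of_sq_le_mul B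
      (r := fun l => f l * g (k - l)) (f := fun l => (wt l ^ a * wt (k - l) ^ b)⁻¹)
      (g := fun l => (wt l ^ a * f l ^ 2) * (wt (k - l) ^ b * g (k - l) ^ 2))
      (fun l _ => inv_nonneg.mpr (mul_pos (hwn _ _) (hwn _ _)).le)
      (fun l _ => mul_nonneg (mul_nonneg (hwn _ _).le (sq_nonneg _))
        (mul_nonneg (hwn _ _).le (sq_nonneg _)))
      (fun l _ => by
        have := (hwn l a).ne'; have := (hwn (k - l) b).ne'
        refine le_of_eq ?_
        field_simp)
    refine hcs.trans (mul_le_mul_of_nonneg_right ?_ (Finset.sum_nonneg fun l _ =>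
      mul_nonneg (mul_nonneg (hwn _ _).le (sq_nonneg _)) (mul_nonneg (hwn _ _).le (sq_nonneg _))))
    calc ∑ l ∈ B, (wt l ^ a * wt (k - l) ^ b)⁻¹
        ≤ ∑ l ∈ B, ((wt l ^ 2)⁻¹ + (wt (k - l) ^ 2)⁻¹) :=
          Finset.sum_le_sum fun l _ => inv_wt_mul_le ha hb hab l (k - l)
      _ ≤ 2 * latticeConst d := by
          rw [Finset.sum_add_distrib]
          linarith [sum_inv_wt_le hd B, sum_inv_wt_sub_le hd B k]
  refine (Finset.sum_le_sum fun k _ => h1 k).trans ?_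
  rw [← Finset.mul_sum, Finset.sum_comm]
  refine mul_le_mul_of_nonneg_left ?_ (by positivity)
  rw [Finset.sum_mul]
  refine Finset.sum_le_sum fun l _ => ?_
  rw [← Finset.mul_sum]
  refine mul_le_mul_of_nonneg_left ?_ (mul_nonneg (hwn _ _).le (sq_nonneg _))
  have h2 : ∑ k ∈ B', wt (k - l) ^ b * g (k - l) ^ 2
      = ∑ k ∈ B'.map (Equiv.subRight l).toEmbedding, wt k ^ b * g k ^ 2 := by
    simp [Finset.sum_map]
  rw [h2]
  exact sum_le_sum_of_support (fun k => mul_nonneg (hwn _ _).le (sq_nonneg _))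
    fun k hk => by simp [hg k hk]

/-- Cauchy-Schwarz for series in `[0,∞]`. -/
theorem ennreal_tsum_mul_sq_le {ι : Type*} (f g : ι → ℝ≥0∞) :
    (∑' i, f i * g i) ^ 2 ≤ (∑' i, f i ^ 2) * ∑' i, g i ^ 2 := by
  let _ : MeasurableSpace ι := ⊤
  have h := ENNReal.lintegral_mul_le_Lp_mul_Lq Measure.count
    (p := 2) (q := 2) (by constructor <;> norm_num) (f := f) (g := g)
    (Measurable.of_discrete.aemeasurable) (Measurable.of_discrete.aemeasurable)
  simp only [lintegral_count, Pi.mul_apply, ENNReal.rpow_two] at h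
  have h2 := pow_le_pow_left' h 2
  rw [mul_pow] at h2
  refine h2.trans (le_of_eq ?_)
  rw [← ENNReal.rpow_two, ← ENNReal.rpow_two, ← ENNReal.rpow_mul, ← ENNReal.rpow_mul]
  norm_num

/-- `ℓ¹ ∗ ℓ² ⊆ ℓ²` in the weighted form `H² · L² ⊆ L²`. -/
theorem tsum_sq_conv_le {d : ℕ} (hd : d ≤ 3) (f g : (Fin d → ℤ) → ℝ≥0∞) :
    ∑' k, (∑' l, f l * g (k - l)) ^ 2 ≤ ENNReal.ofReal (latticeConst d) *
      ((∑' k, ENNReal.ofReal (wt k ^ 2) * f k ^ 2) * ∑' k, g k ^ 2) := by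
  set w : (Fin d → ℤ) → ℝ≥0∞ := fun k => ENNReal.ofReal (wt k) with hw
  have hw0 : ∀ k, w k ≠ 0 := fun k => by simpa [hw] using wt_pos k
  have hwt : ∀ k, w k ≠ ∞ := fun k => ENNReal.ofReal_ne_top
  have hw2 : ∀ k, ENNReal.ofReal (wt k ^ 2) = w k ^ 2 := fun k =>
    ENNReal.ofReal_pow (wt_pos k).le 2
  have h1 : ∀ k, (∑' l, f l * g (k - l)) ^ 2 ≤ (∑' l, (w l ^ 2)⁻¹) *
      ∑' l, (w l ^ 2 * f l ^ 2) * g (k - l) ^ 2 := by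
    intro k
    have := ennreal_tsum_mul_sq_le (fun l => (w l)⁻¹) fun l => w l * f l * g (k - l)
    have e : ∀ l, (w l)⁻¹ * (w l * f l * g (k - l)) = f l * g (k - l) := by
      intro l
      rw [mul_assoc, ← mul_assoc, ENNReal.inv_mul_cancel (hw0 l) (hwt l), one_mul]
    simp only [e] at this
    refine this.trans (le_of_eq ?_)
    simp only [ENNReal.inv_pow, mul_pow]
  have hC : ∑' l, (w l ^ 2)⁻¹ = ENNReal.ofReal (latticeConst d) := by
    rw [latticeConst, ENNReal.ofReal_tsum_of_nonneg (fun k => by positivity) (summable_wt hd)]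
    refine tsum_congr fun k => ?_
    rw [ENNReal.ofReal_inv_of_pos (by have := wt_pos k; positivity), hw2]
  refine (ENNReal.tsum_le_tsum h1).trans ?_
  rw [ENNReal.tsum_mul_left, hC, ENNReal.tsum_comm]
  refine mul_le_mul_right ?_ _
  rw [← ENNReal.tsum_mul_right]
  refine ENNReal.tsum_le_tsum fun l => ?_
  rw [ENNReal.tsum_mul_left, hw2]
  refine mul_le_mul_right (le_of_eq ?_) _
  exact (Equiv.subRight l).tsum_eq fun k => g k ^ 2

/-! ### A product estimate with vertical integration -/

/-- Telescoping: consecutive square roots satisfy `t⁻¹ ≤ 2 (t - s)` when `t² = s² + 1`. The sum is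
then counted over both signs. -/
theorem sum_Icc_inv_sqrt_le (M : ℕ) :
    ∑ j ∈ Finset.Icc (-(M : ℤ)) M, (Real.sqrt (1 + |(j : ℝ)|))⁻¹ ≤ 4 * Real.sqrt (1 + M) := by
  rw [Finset.sum_Icc_of_even_eq_range (fun n => by simp)]
  have h : ∀ M : ℕ, ∑ n ∈ Finset.range (M + 1), (Real.sqrt (1 + |((n : ℤ) : ℝ)|))⁻¹
      ≤ 2 * Real.sqrt (1 + M) := by
    intro M
    induction M with
    | zero => simp
    | succ M ih =>
      rw [Finset.sum_range_succ]
      refine (add_le_add_left ih _).trans ?_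
      simp only [Int.cast_natCast, Nat.abs_cast]
      have h1 : 0 < Real.sqrt (1 + (M + 1 : ℕ)) := Real.sqrt_pos.mpr (by positivity)
      have h2 : Real.sqrt (1 + M) ≤ Real.sqrt (1 + (M + 1 : ℕ)) :=
        Real.sqrt_le_sqrt (by push_cast; linarith)
      have h3 := Real.sq_sqrt (show (0 : ℝ) ≤ 1 + M by positivity)
      have h4 := Real.sq_sqrt (show (0 : ℝ) ≤ 1 + (M + 1 : ℕ) by positivity)
      set s := Real.sqrt (1 + M)
      set t := Real.sqrt (1 + (M + 1 : ℕ))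
      have h5 : t * t⁻¹ = 1 := mul_inv_cancel₀ h1.ne'
      push_cast at h4
      have h6 : t⁻¹ ≤ 2 * (t - s) := by
        rw [inv_le_iff_one_le_mul₀ h1]
        nlinarith
      linarith
  have := h M
  simp only [nsmul_eq_mul]
  have h0 : 0 ≤ (Real.sqrt (1 + |((0 : ℤ) : ℝ)|))⁻¹ := by positivity
  push_cast at *
  linarith

/-- `|j|⁻²` with value `0` at `j = 0` is summable over the integers. -/
theorem summable_int_inv_sq : Summable fun j : ℤ => ((j : ℝ) ^ 2)⁻¹ := by
  simpa using (Real.summable_one_div_int_pow (p := 2)).mpr one_lt_two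

/-- `max (|k₀|, |k₁|)`. -/
def horSize (k : Fin 3 → ℤ) : ℕ := max (k 0).natAbs (k 1).natAbs

/-- For integers `|n| ≤ n²`, so `(1 + |k₀|)(1 + |k₁|)` is at most quadratic in the frequency. The
product form lets the two horizontal sums be taken separately. -/
theorem sqrt_mul_sqrt_le_sqrt_wt (k : Fin 3 → ℤ) :
    Real.sqrt (1 + |(k 0 : ℝ)|) * Real.sqrt (1 + |(k 1 : ℝ)|) ≤ Real.sqrt (wt k) := by
  rw [← Real.sqrt_mul (by positivity)]
  refine Real.sqrt_le_sqrt ?_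
  have hint : ∀ n : ℤ, |(n : ℝ)| ≤ (n : ℝ) ^ 2 := by
    intro n
    rw [← Int.cast_abs, ← sq_abs, ← Int.cast_abs]
    exact_mod_cast Int.le_self_sq |n|
  have h0 := hint (k 0)
  have h1 := hint (k 1)
  rw [wt, Fin.sum_univ_three]
  simp only [mul_pow]
  have hp : (3 : ℝ) ≤ Real.pi ^ 2 := by nlinarith [Real.pi_gt_three]
  nlinarith [sq_nonneg (|(k 0 : ℝ)| - |(k 1 : ℝ)|), sq_abs (k 0 : ℝ), sq_abs (k 1 : ℝ),
    mul_nonneg (sub_nonneg.mpr hp) (sq_nonneg (k 0 : ℝ)),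
    mul_nonneg (sub_nonneg.mpr hp) (sq_nonneg (k 1 : ℝ)),
    mul_nonneg (sub_nonneg.mpr hp) (sq_nonneg (k 2 : ℝ)), sq_nonneg (k 2 : ℝ)]

theorem one_add_horSize_le (k : Fin 3 → ℤ) : (1 : ℝ) + horSize k ≤ 2 * Real.sqrt (wt k) := by
  have h1 : (1 : ℝ) ≤ Real.sqrt (wt k) := Real.one_le_sqrt.mpr (one_le_wt k)
  have h2 : (horSize k : ℝ) ≤ Real.sqrt (wt k) := by
    refine Real.le_sqrt_of_sq_le ?_
    rw [horSize]
    rcases le_total (k 0).natAbs (k 1).natAbs with h | h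
    · rw [max_eq_right h, Nat.cast_natAbs, Int.cast_abs, sq_abs]
      linarith [one_add_sq_le_wt k 1]
    · rw [max_eq_left h, Nat.cast_natAbs, Int.cast_abs, sq_abs]
      linarith [one_add_sq_le_wt k 0]
  linarith

/-- The constant in the product estimate with vertical integration. -/
def vertConst : ℝ := 32 * ∑' j : ℤ, ((j : ℝ) ^ 2)⁻¹

theorem vertConst_nonneg : 0 ≤ vertConst :=
  mul_nonneg (by norm_num) (tsum_nonneg fun _ => by positivity)

/-- The restriction bounds both horizontal components of `l` by `M = horSize l'`. Each horizontal
sum of `(1 + |j|)^{-1/2}` is of order `(1 + M)^{1/2}`, the vertical sum converges, and `1 + M ≤ 2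
√(wt l')`. A weight of order one on `l` thus gets traded for one on `l'`. -/
theorem sum_horSize_le (B : Finset (Fin 3 → ℤ)) (l' : Fin 3 → ℤ) :
    ∑ l ∈ B with horSize l ≤ horSize l', (Real.sqrt (wt l))⁻¹ * (((l 2 + l' 2 : ℤ) : ℝ) ^ 2)⁻¹
      ≤ vertConst * Real.sqrt (wt l') := by
  obtain ⟨N, hN⟩ := (Filter.tendsto_atTop.mp (tendsto_box 3) B).exists
  set M := horSize l' with hM
  obtain ⟨α, hα⟩ : ∃ α : ℤ → ℝ, α = fun j : ℤ => (Real.sqrt (1 + |(j : ℝ)|))⁻¹ := ⟨_, rfl⟩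
  obtain ⟨β, hβ⟩ : ∃ β : ℤ → ℝ, β = fun j : ℤ => (((j + l' 2 : ℤ) : ℝ) ^ 2)⁻¹ := ⟨_, rfl⟩
  have hα0 : ∀ j, 0 ≤ α j := fun j => by rw [hα]; positivity
  have hβ0 : ∀ j, 0 ≤ β j := fun j => by rw [hβ]; positivity
  have h1 : ∑ l ∈ B with horSize l ≤ M,
      (Real.sqrt (wt l))⁻¹ * (((l 2 + l' 2 : ℤ) : ℝ) ^ 2)⁻¹
      ≤ ∑ l ∈ Fintype.piFinset ![Finset.Icc (-(M : ℤ)) M, Finset.Icc (-(M : ℤ)) M,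
        Finset.Icc (-(N : ℤ)) N], ∏ i, (![α, α, β] : Fin 3 → ℤ → ℝ) i (l i) := by
    refine (Finset.sum_le_sum (g := fun l => ∏ i, (![α, α, β] : Fin 3 → ℤ → ℝ) i (l i))
      fun l _ => ?_).trans
      (Finset.sum_le_sum_of_subset_of_nonneg ?_ fun l _ _ => ?_)
    · rw [Fin.prod_univ_three]
      change _ ≤ α (l 0) * α (l 1) * β (l 2)
      rw [hα, hβ]
      refine mul_le_mul_of_nonneg_right ?_ (by positivity)
      rw [← mul_inv]
      exact inv_anti₀ (by positivity) (sqrt_mul_sqrt_le_sqrt_wt l)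
    · intro l hl
      rw [Finset.mem_filter] at hl
      have hb := mem_box.mp (hN hl.1) 2
      have h3 := hl.2
      rw [horSize, max_le_iff] at h3
      rw [abs_le] at hb
      rw [Fintype.mem_piFinset]
      intro i
      fin_cases i
      · change l 0 ∈ Finset.Icc (-(M : ℤ)) M
        rw [Finset.mem_Icc]; omega
      · change l 1 ∈ Finset.Icc (-(M : ℤ)) M
        rw [Finset.mem_Icc]; omega
      · change l 2 ∈ Finset.Icc (-(N : ℤ)) N
        rw [Finset.mem_Icc]; omega
    · rw [Fin.prod_univ_three]
      exact mul_nonneg (mul_nonneg (hα0 _) (hα0 _)) (hβ0 _)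
  refine h1.trans ?_
  rw [← Finset.prod_univ_sum, Fin.prod_univ_three]
  change (∑ j ∈ Finset.Icc (-(M : ℤ)) M, α j) * (∑ j ∈ Finset.Icc (-(M : ℤ)) M, α j)
    * (∑ j ∈ Finset.Icc (-(N : ℤ)) N, β j) ≤ _
  have h2 : ∑ j ∈ Finset.Icc (-(M : ℤ)) M, α j ≤ 4 * Real.sqrt (1 + M) := by
    rw [hα]; exact sum_Icc_inv_sqrt_le M
  have h20 : 0 ≤ ∑ j ∈ Finset.Icc (-(M : ℤ)) M, α j := Finset.sum_nonneg fun _ _ => hα0 _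
  have h3 : ∑ j ∈ Finset.Icc (-(N : ℤ)) N, β j ≤ ∑' j : ℤ, ((j : ℝ) ^ 2)⁻¹ := by
    have hs := (Equiv.addRight (l' 2)).summable_iff.mpr summable_int_inv_sq
    have := hs.sum_le_tsum (Finset.Icc (-(N : ℤ)) N) fun _ _ => by
      simp only [Function.comp_apply]; positivity
    rw [← (Equiv.addRight (l' 2)).tsum_eq fun j : ℤ => ((j : ℝ) ^ 2)⁻¹, hβ]
    exact this
  have h30 : 0 ≤ ∑ j ∈ Finset.Icc (-(N : ℤ)) N, β j := Finset.sum_nonneg fun _ _ => hβ0 _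
  have hZ : 0 ≤ ∑' j : ℤ, ((j : ℝ) ^ 2)⁻¹ := tsum_nonneg fun _ => by positivity
  calc _ ≤ (4 * Real.sqrt (1 + M)) * (4 * Real.sqrt (1 + M)) * ∑' j : ℤ, ((j : ℝ) ^ 2)⁻¹ := by
        gcongr
    _ = 16 * (1 + M) * ∑' j : ℤ, ((j : ℝ) ^ 2)⁻¹ := by
        have := Real.mul_self_sqrt (show (0 : ℝ) ≤ 1 + M by positivity)
        linear_combination (16 * ∑' j : ℤ, ((j : ℝ) ^ 2)⁻¹) * this
    _ ≤ 16 * (2 * Real.sqrt (wt l')) * ∑' j : ℤ, ((j : ℝ) ^ 2)⁻¹ := by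
        gcongr; exact one_add_horSize_le l'
    _ = _ := by rw [vertConst]; ring

/-- Half of the trilinear form in the duality proof of `sum_sq_vert_conv_le`, over pairs in which
`l` has no larger horizontal size. Cauchy-Schwarz in `l` uses `sum_horSize_le`; its gain of `√(wt
l')` is compensated by the weight in a second Cauchy-Schwarz in `l'`. The relation `p` is kept free
so that it can be the weak or the strict comparison. -/
theorem sq_sum_horSize_le (p : (Fin 3 → ℤ) → (Fin 3 → ℤ) → Prop)
    [∀ l l', Decidable (p l l')] (hp : ∀ l l', p l l' → horSize l ≤ horSize l')
    (B : Finset (Fin 3 → ℤ)) (f g φ : (Fin 3 → ℤ) → ℝ) (Φ : ℝ)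
    (hφ : ∀ l, ∑ l' ∈ B, φ (l + l') ^ 2 ≤ Φ) :
    (∑ l' ∈ B, g l' * ∑ l ∈ B with p l l',
        f l * (φ (l + l') * |((l 2 + l' 2 : ℤ) : ℝ)|⁻¹)) ^ 2
      ≤ vertConst * ((∑ l ∈ B, Real.sqrt (wt l) * f l ^ 2) *
          ∑ l ∈ B, Real.sqrt (wt l) * g l ^ 2) * Φ := by
  have hs : ∀ l : Fin 3 → ℤ, 0 < Real.sqrt (wt l) := fun l => Real.sqrt_pos.mpr (wt_pos l)
  set I : (Fin 3 → ℤ) → ℝ := fun l' => ∑ l ∈ B with p l l',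
    f l * (φ (l + l') * |((l 2 + l' 2 : ℤ) : ℝ)|⁻¹) with hI
  have hIle : ∀ l', (I l') ^ 2 ≤ vertConst * Real.sqrt (wt l') *
      ∑ l ∈ B, Real.sqrt (wt l) * f l ^ 2 * φ (l + l') ^ 2 := by
    intro l'
    have hcs := Finset.sum_sq_le_sum_mul_sum_of_sq_le_mul
      (B.filter fun l => p l l')
      (r := fun l => f l * (φ (l + l') * |((l 2 + l' 2 : ℤ) : ℝ)|⁻¹))
      (f := fun l => (Real.sqrt (wt l))⁻¹ * (((l 2 + l' 2 : ℤ) : ℝ) ^ 2)⁻¹)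
      (g := fun l => Real.sqrt (wt l) * f l ^ 2 * φ (l + l') ^ 2)
      (fun l _ => by have := hs l; positivity) (fun l _ => by have := hs l; positivity)
      (fun l _ => by
        have := (hs l).ne'
        rw [mul_pow, mul_pow, inv_pow, sq_abs]
        refine le_of_eq ?_
        field_simp)
    refine hcs.trans ?_
    refine mul_le_mul ((Finset.sum_le_sum_of_subset_of_nonneg
      (Finset.monotone_filter_right B fun l _ => hp l l') fun l _ _ => by positivity).trans
      (sum_horSize_le B l')) ?_
      (Finset.sum_nonneg fun l _ => by have := hs l; positivity)
      (mul_nonneg vertConst_nonneg (hs l').le)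
    exact Finset.sum_le_sum_of_subset_of_nonneg (Finset.filter_subset _ _)
      fun l _ _ => by have := hs l; positivity
  have hcs2 := Finset.sum_sq_le_sum_mul_sum_of_sq_le_mul B
    (r := fun l' => g l' * I l') (f := fun l' => Real.sqrt (wt l') * g l' ^ 2)
    (g := fun l' => (Real.sqrt (wt l'))⁻¹ * I l' ^ 2)
    (fun l _ => by have := hs l; positivity) (fun l _ => by have := hs l; positivity)
    (fun l _ => by have := (hs l).ne'; refine le_of_eq ?_; field_simp)
  refine hcs2.trans ?_
  have h3 : ∑ l' ∈ B, (Real.sqrt (wt l'))⁻¹ * I l' ^ 2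
      ≤ vertConst * (∑ l ∈ B, Real.sqrt (wt l) * f l ^ 2) * Φ := by
    calc ∑ l' ∈ B, (Real.sqrt (wt l'))⁻¹ * I l' ^ 2
        ≤ ∑ l' ∈ B, vertConst * ∑ l ∈ B, Real.sqrt (wt l) * f l ^ 2 * φ (l + l') ^ 2 := by
          refine Finset.sum_le_sum fun l' _ => ?_
          have := mul_le_mul_of_nonneg_left (hIle l') (inv_nonneg.mpr (hs l').le)
          refine this.trans (le_of_eq ?_)
          have := (hs l').ne'
          field_simp
      _ = vertConst * ∑ l ∈ B, Real.sqrt (wt l) * f l ^ 2 * ∑ l' ∈ B, φ (l + l') ^ 2 := by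
          rw [← Finset.mul_sum, Finset.sum_comm]
          simp only [Finset.mul_sum]
      _ ≤ vertConst * ∑ l ∈ B, Real.sqrt (wt l) * f l ^ 2 * Φ := by
          refine mul_le_mul_of_nonneg_left (Finset.sum_le_sum fun l _ => ?_) vertConst_nonneg
          exact mul_le_mul_of_nonneg_left (hφ l) (by have := hs l; positivity)
      _ = _ := by rw [← Finset.sum_mul]; ring
  refine (mul_le_mul_of_nonneg_left h3 (Finset.sum_nonneg fun l _ => by
    have := hs l; positivity)).trans (le_of_eq ?_)
  ring

/-- The product estimate `∂_z⁻¹ (H^{1/2} · H^{1/2}) ⊆ L²` for finite convolutions. -/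
theorem sum_sq_vert_conv_le (B B' : Finset (Fin 3 → ℤ)) (f g : (Fin 3 → ℤ) → ℝ)
    (hg : ∀ k ∉ B, g k = 0) :
    ∑ k ∈ B', (|(k 2 : ℝ)|⁻¹ * ∑ l ∈ B, f l * g (k - l)) ^ 2
      ≤ 4 * vertConst * ((∑ l ∈ B, Real.sqrt (wt l) * f l ^ 2) *
          ∑ l ∈ B, Real.sqrt (wt l) * g l ^ 2) := by
  -- Duality against the quantity itself: with `Φ` the left-hand side, expanding one factor writes
  -- `Φ` as a trilinear form in `f`, `g`, `φ`, and `φ` has squared norm `Φ`.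
  set φ : (Fin 3 → ℤ) → ℝ := fun k =>
    if k ∈ B' then |(k 2 : ℝ)|⁻¹ * ∑ l ∈ B, f l * g (k - l) else 0 with hφd
  set Φ := ∑ k ∈ B', φ k ^ 2 with hΦ
  have hΦ0 : 0 ≤ Φ := Finset.sum_nonneg fun _ _ => sq_nonneg _
  have hφ : ∀ l, ∑ l' ∈ B, φ (l + l') ^ 2 ≤ Φ := by
    intro l
    have h2 : ∑ l' ∈ B, φ (l + l') ^ 2
        = ∑ k ∈ B.map (Equiv.addLeft l).toEmbedding, φ k ^ 2 := by simp [Finset.sum_map]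
    rw [h2]
    exact sum_le_sum_of_support (fun k => sq_nonneg _) fun k hk => by simp [hφd, hk]
  have hexp : Φ = ∑ l ∈ B, ∑ l' ∈ B, f l * g l' * (φ (l + l') * |((l 2 + l' 2 : ℤ) : ℝ)|⁻¹) := by
    have h1 : Φ = ∑ k ∈ B', ∑ l ∈ B, f l * g (k - l) * (φ k * |(k 2 : ℝ)|⁻¹) := by
      rw [hΦ]
      refine Finset.sum_congr rfl fun k hk => ?_
      rw [← Finset.sum_mul, sq]
      conv_lhs => enter [2]; rw [hφd]
      simp only [hk, if_true]
      ring
    rw [h1, Finset.sum_comm]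
    refine Finset.sum_congr rfl fun l _ => ?_
    have e1 : ∑ k ∈ B', f l * g (k - l) * (φ k * |(k 2 : ℝ)|⁻¹)
        = ∑' k, f l * g (k - l) * (φ k * |(k 2 : ℝ)|⁻¹) :=
      (tsum_eq_sum fun k hk => by simp [hφd, hk]).symm
    have e2 : ∑ l' ∈ B, f l * g l' * (φ (l + l') * |((l 2 + l' 2 : ℤ) : ℝ)|⁻¹)
        = ∑' l', f l * g l' * (φ (l + l') * |((l 2 + l' 2 : ℤ) : ℝ)|⁻¹) :=
      (tsum_eq_sum fun k hk => by simp [hg k hk]).symm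
    rw [e1, e2, ← (Equiv.addLeft l).tsum_eq]
    refine tsum_congr fun l' => ?_
    simp
  -- The pairs are divided according to which frequency has the larger horizontal size. The
  -- comparison is strict in `T₂`, so that ties are counted once.
  set T₁ := ∑ l' ∈ B, g l' * ∑ l ∈ B with horSize l ≤ horSize l',
        f l * (φ (l + l') * |((l 2 + l' 2 : ℤ) : ℝ)|⁻¹) with hT₁
  set T₂ := ∑ l' ∈ B, f l' * ∑ l ∈ B with horSize l < horSize l',
        g l * (φ (l + l') * |((l 2 + l' 2 : ℤ) : ℝ)|⁻¹) with hT₂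
  have hsum : Φ = T₁ + T₂ := by
    have e1 : T₁ = ∑ l ∈ B, ∑ l' ∈ B, if horSize l ≤ horSize l' then
        f l * g l' * (φ (l + l') * |((l 2 + l' 2 : ℤ) : ℝ)|⁻¹) else 0 := by
      rw [hT₁, Finset.sum_comm]
      refine Finset.sum_congr rfl fun l' _ => ?_
      rw [Finset.mul_sum, Finset.sum_filter]
      refine Finset.sum_congr rfl fun l _ => ?_
      split_ifs <;> ring
    have e2 : T₂ = ∑ l ∈ B, ∑ l' ∈ B, if horSize l ≤ horSize l' then 0 else
        f l * g l' * (φ (l + l') * |((l 2 + l' 2 : ℤ) : ℝ)|⁻¹) := by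
      rw [hT₂]
      refine Finset.sum_congr rfl fun l' _ => ?_
      rw [Finset.mul_sum, Finset.sum_filter]
      refine Finset.sum_congr rfl fun l _ => ?_
      rw [add_comm l l', add_comm (l 2) (l' 2)]
      split_ifs <;> first | omega | ring
    rw [hexp, e1, e2, ← Finset.sum_add_distrib]
    refine Finset.sum_congr rfl fun l _ => ?_
    rw [← Finset.sum_add_distrib]
    refine Finset.sum_congr rfl fun l' _ => ?_
    split_ifs <;> ring
  set P := (∑ l ∈ B, Real.sqrt (wt l) * f l ^ 2) * ∑ l ∈ B, Real.sqrt (wt l) * g l ^ 2 with hP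
  have hP0 : 0 ≤ P := mul_nonneg (Finset.sum_nonneg fun l _ => by positivity)
    (Finset.sum_nonneg fun l _ => by positivity)
  have b1 : T₁ ^ 2 ≤ vertConst * P * Φ := sq_sum_horSize_le _ (fun _ _ h => h) B f g φ Φ hφ
  have b2 : T₂ ^ 2 ≤ vertConst * P * Φ := by
    have := sq_sum_horSize_le (fun l l' => horSize l < horSize l') (fun _ _ h => h.le) B g f φ Φ hφ
    rwa [mul_comm (∑ l ∈ B, Real.sqrt (wt l) * g l ^ 2)] at this
  have hfin : Φ ≤ 4 * vertConst * P := by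
    by_contra hcon
    push Not at hcon
    have hpos : 0 < Φ := lt_of_le_of_lt (mul_nonneg (mul_nonneg (by norm_num) vertConst_nonneg) hP0) hcon
    have : Φ ^ 2 ≤ 4 * (vertConst * P * Φ) := by
      rw [hsum] at b1 b2 ⊢
      nlinarith [sq_nonneg (T₁ - T₂)]
    nlinarith
  refine le_trans (le_of_eq ?_) hfin
  rw [hΦ]
  refine Finset.sum_congr rfl fun k hk => ?_
  simp [hφd, hk]

/-! ### The equations for the Fourier coefficients -/

/-- Convolution of coefficients. -/
def conv {d : ℕ} (f g : (Fin d → ℤ) → ℂ) (k : Fin d → ℤ) : ℂ := ∑' l, f l * g (k - l)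

/-- The Fourier coefficients of `∑ⱼ ∂ⱼ(uⱼ vᵢ)`. -/
def nl {d : ℕ} (U V : Fin d → (Fin d → ℤ) → ℂ) (i : Fin d) (k : Fin d → ℤ) : ℂ :=
  Real.pi * Complex.I * ∑ j, (k j : ℂ) * conv (U j) (V i) k

/-- The symbol of the anisotropic Leray projection, with pressure gradient `(κᵢ ∂ᵢ p)ᵢ`. -/
def leray {d : ℕ} (κ : Fin d → ℝ) (N : Fin d → (Fin d → ℤ) → ℂ) (i : Fin d) (k : Fin d → ℤ) : ℂ :=
  N i k - κ i * k i * (∑ j, (k j : ℂ) * N j k) / ((∑ j, κ j * (k j : ℝ) ^ 2 : ℝ) : ℂ)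

/-- The symbol of `-∑ⱼ μⱼ ∂ⱼ²`. -/
def visc {d : ℕ} (μ : Fin d → ℝ) (k : Fin d → ℤ) : ℝ := ∑ j, μ j * (Real.pi * (k j : ℝ)) ^ 2

/-- The sum of the moduli of the components. -/
def amp {d : ℕ} (U : Fin d → (Fin d → ℤ) → ℂ) (k : Fin d → ℤ) : ℝ≥0∞ := ∑ i, ‖U i k‖ₑ

/-- Solutions of the Navier-Stokes equations at the level of Fourier coefficients. -/
structure CoefSol {d : ℕ} (κ μ : Fin d → ℝ) (T : ℝ) (U : ℝ → Fin d → (Fin d → ℤ) → ℂ) : Prop where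
  div : ∀ t ∈ Icc 0 T, DivFreeCoef (U t)
  bdd : ∃ M : ℝ≥0∞, M ≠ ∞ ∧ ∀ t ∈ Icc 0 T, ∑' k, amp (U t) k ^ 2 ≤ M
  h2 : ∫⁻ t in Ioo 0 T, ∑' k, ENNReal.ofReal (wt k ^ 2) * amp (U t) k ^ 2 < ∞
  int : ∀ i k, IntervalIntegrable (fun s => visc μ k * U s i k + leray κ (nl (U s) (U s)) i k)
    volume 0 T
  cont : ∀ i k, ContinuousOn (fun t => U t i k) (Icc 0 T)
  eq : ∀ t ∈ Icc 0 T, ∀ i k, U t i k = U 0 i k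
    - ∫ s in (0 : ℝ)..t, (visc μ k * U s i k + leray κ (nl (U s) (U s)) i k)

theorem enorm_conv_le {d : ℕ} (f g : (Fin d → ℤ) → ℂ) (k : Fin d → ℤ) :
    ‖conv f g k‖ₑ ≤ ∑' l, ‖f l‖ₑ * ‖g (k - l)‖ₑ := by
  refine enorm_tsum_le_tsum_enorm.trans (le_of_eq ?_)
  simp only [enorm_mul]

theorem summable_conv {d : ℕ} {f g : (Fin d → ℤ) → ℂ} (hf : ∑' k, ‖f k‖ₑ ^ 2 ≠ ∞)
    (hg : ∑' k, ‖g k‖ₑ ^ 2 ≠ ∞) (k : Fin d → ℤ) : Summable fun l => f l * g (k - l) := by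
  refine Summable.of_norm (tsum_enorm_ne_top_iff_summable_norm.mp ?_)
  simp only [enorm_mul]
  have h := ennreal_tsum_mul_sq_le (fun l => ‖f l‖ₑ) fun l => ‖g (k - l)‖ₑ
  have h2 : ∑' l, ‖g (k - l)‖ₑ ^ 2 = ∑' l, ‖g l‖ₑ ^ 2 :=
    (Equiv.subLeft k).tsum_eq fun l => ‖g l‖ₑ ^ 2
  rw [h2] at h
  intro htop
  rw [htop] at h
  exact (ENNReal.mul_lt_top hf.lt_top hg.lt_top).ne (top_le_iff.mp (by simpa using h))

theorem tsum_comp_sq_ne_top {d : ℕ} {U : Fin d → (Fin d → ℤ) → ℂ}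
    (hU : ∑' k, amp U k ^ 2 ≠ ∞) (i : Fin d) : ∑' k, ‖U i k‖ₑ ^ 2 ≠ ∞ := by
  refine ne_top_of_le_ne_top hU (ENNReal.tsum_le_tsum fun k => ?_)
  exact pow_le_pow_left' (Finset.single_le_sum (f := fun i => ‖U i k‖ₑ) (fun _ _ => zero_le)
    (Finset.mem_univ i)) 2

theorem conv_sub {d : ℕ} {f f' g g' : (Fin d → ℤ) → ℂ} (hf : ∑' k, ‖f k‖ₑ ^ 2 ≠ ∞)
    (hf' : ∑' k, ‖f' k‖ₑ ^ 2 ≠ ∞) (hg : ∑' k, ‖g k‖ₑ ^ 2 ≠ ∞) (hg' : ∑' k, ‖g' k‖ₑ ^ 2 ≠ ∞)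
    (k : Fin d → ℤ) :
    conv f g k - conv f' g' k = conv (f - f') g k + conv f' (g - g') k := by
  simp only [conv, Pi.sub_apply, sub_mul, mul_sub]
  rw [(summable_conv hf hg k).tsum_sub (summable_conv hf' hg k),
    (summable_conv hf' hg k).tsum_sub (summable_conv hf' hg' k)]
  ring

/-- The norm bound of the anisotropic Leray projection. -/
def lerayConst {d : ℕ} (κ : Fin d → ℝ) : ℝ := 1 + ∑ i, ∑ j, (1 + κ i / κ j)

theorem lerayConst_nonneg {d : ℕ} {κ : Fin d → ℝ} (hκ : ∀ i, 0 < κ i) : 0 ≤ lerayConst κ :=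
  add_nonneg zero_le_one (Finset.sum_nonneg fun i _ => Finset.sum_nonneg fun j _ =>
    add_nonneg zero_le_one (div_nonneg (hκ i).le (hκ j).le))

/-- The constant depends on the ratios of the `κᵢ` and degenerates as `ε → 0`. It serves qualitative
purposes such as uniqueness and regularity, and quantitative ones only when all `κᵢ = 1`. The bound
uniform in `ε` is `norm_leray_le_vert`. -/
theorem norm_leray_le {d : ℕ} {κ : Fin d → ℝ} (hκ : ∀ i, 0 < κ i)
    (N : Fin d → (Fin d → ℤ) → ℂ) (i : Fin d) (k : Fin d → ℤ) :
    ‖leray κ N i k‖ ≤ lerayConst κ * ∑ j, ‖N j k‖ := by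
  set S : ℝ := ∑ j, κ j * (k j : ℝ) ^ 2 with hS
  have hSj : ∀ j, κ j * (k j : ℝ) ^ 2 ≤ S := fun j =>
    Finset.single_le_sum (f := fun j => κ j * (k j : ℝ) ^ 2)
      (fun j _ => mul_nonneg (hκ j).le (sq_nonneg _)) (Finset.mem_univ j)
  have hS0 : 0 ≤ S := Finset.sum_nonneg fun j _ => mul_nonneg (hκ j).le (sq_nonneg _)
  have hnn : ∀ i j, 0 ≤ 1 + κ i / κ j := fun i j =>
    add_nonneg zero_le_one (div_nonneg (hκ i).le (hκ j).le)
  have h1 : ∀ j, κ i * |(k i : ℝ)| * |(k j : ℝ)| / S ≤ lerayConst κ - 1 := by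
    intro j
    have h2 : κ i * |(k i : ℝ)| * |(k j : ℝ)| ≤ (1 + κ i / κ j) * S := by
      have e : κ i * (k j : ℝ) ^ 2 = κ i / κ j * (κ j * (k j : ℝ) ^ 2) := by
        have := (hκ j).ne'; field_simp
      have a1 := hSj i
      have a2 := mul_le_mul_of_nonneg_left (hSj j) (div_nonneg (hκ i).le (hκ j).le)
      rw [← e] at a2
      nlinarith [sq_abs (k i : ℝ), sq_abs (k j : ℝ), (hκ i).le,
        mul_nonneg (hκ i).le (sq_nonneg (|(k i : ℝ)| - |(k j : ℝ)|)),
        mul_nonneg (hκ i).le (sq_nonneg (k i : ℝ)), mul_nonneg (hκ i).le (sq_nonneg (k j : ℝ))]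
    have h3 : (1 + κ i / κ j) ≤ lerayConst κ - 1 := by
      rw [lerayConst, add_sub_cancel_left]
      exact (Finset.single_le_sum (f := fun j => 1 + κ i / κ j) (fun j _ => hnn i j)
        (Finset.mem_univ j)).trans (Finset.single_le_sum (f := fun i => ∑ j, (1 + κ i / κ j))
        (fun i _ => Finset.sum_nonneg fun j _ => hnn i j) (Finset.mem_univ i))
    refine (div_le_of_le_mul₀ hS0 (hnn i j) h2).trans h3
  have h4 : ‖(κ i : ℂ) * k i * (∑ j, (k j : ℂ) * N j k) / ((S : ℝ) : ℂ)‖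
      ≤ (lerayConst κ - 1) * ∑ j, ‖N j k‖ := by
    rw [norm_div, norm_mul, norm_mul, Complex.norm_real, Complex.norm_real, Complex.norm_intCast,
      Real.norm_of_nonneg hS0, Real.norm_of_nonneg (hκ i).le, mul_div_right_comm]
    calc _ ≤ κ i * |(k i : ℝ)| / S * ∑ j, |(k j : ℝ)| * ‖N j k‖ := by
          refine mul_le_mul_of_nonneg_left ((norm_sum_le _ _).trans (le_of_eq ?_))
            (div_nonneg (mul_nonneg (hκ i).le (abs_nonneg _)) hS0)
          simp [Complex.norm_intCast]
      _ = ∑ j, (κ i * |(k i : ℝ)| * |(k j : ℝ)| / S) * ‖N j k‖ := by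
          rw [Finset.mul_sum]; exact Finset.sum_congr rfl fun j _ => by ring
      _ ≤ ∑ j, (lerayConst κ - 1) * ‖N j k‖ := Finset.sum_le_sum fun j _ =>
          mul_le_mul_of_nonneg_right (h1 j) (norm_nonneg _)
      _ = _ := by rw [Finset.mul_sum]
  have h5 : ‖N i k‖ ≤ ∑ j, ‖N j k‖ :=
    Finset.single_le_sum (f := fun j => ‖N j k‖) (fun _ _ => norm_nonneg _) (Finset.mem_univ i)
  rw [leray]
  refine (norm_sub_le _ _).trans ?_
  linarith

theorem leray_sub {d : ℕ} (κ : Fin d → ℝ) (N N' : Fin d → (Fin d → ℤ) → ℂ) (i : Fin d)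
    (k : Fin d → ℤ) : leray κ N i k - leray κ N' i k = leray κ (N - N') i k := by
  simp only [leray, Pi.sub_apply, mul_sub, Finset.sum_sub_distrib]
  ring

theorem nl_zero_freq {d : ℕ} (U V : Fin d → (Fin d → ℤ) → ℂ) (i : Fin d) : nl U V i 0 = 0 := by
  simp [nl]

theorem nl_sub {d : ℕ} {U V : Fin d → (Fin d → ℤ) → ℂ} (hU : ∑' k, amp U k ^ 2 ≠ ∞)
    (hV : ∑' k, amp V k ^ 2 ≠ ∞) (i : Fin d) (k : Fin d → ℤ) :
    nl U U i k - nl V V i k = nl (U - V) U i k + nl V (U - V) i k := by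
  simp only [nl, Pi.sub_apply]
  rw [← mul_sub, ← mul_add, ← Finset.sum_sub_distrib, ← Finset.sum_add_distrib]
  congr 1
  refine Finset.sum_congr rfl fun j _ => ?_
  rw [← mul_sub, ← mul_add, conv_sub (tsum_comp_sq_ne_top hU j) (tsum_comp_sq_ne_top hV j)
    (tsum_comp_sq_ne_top hU i) (tsum_comp_sq_ne_top hV i)]

/-- Convolution of amplitudes. -/
def econv {d : ℕ} (f g : (Fin d → ℤ) → ℝ≥0∞) (k : Fin d → ℤ) : ℝ≥0∞ := ∑' l, f l * g (k - l)

theorem econv_comm {d : ℕ} (f g : (Fin d → ℤ) → ℝ≥0∞) : econv f g = econv g f := by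
  funext k
  rw [econv, ← (Equiv.subLeft k).tsum_eq]
  refine tsum_congr fun l => ?_
  simp [mul_comm]

/-- The derivative is left outside the product. The factor is written as `wt k - 1`, not `wt k`, so
that it vanishes at `k = 0` and is matched exactly by the viscosity. -/
theorem enorm_nl_le {d : ℕ} (U V : Fin d → (Fin d → ℤ) → ℂ) (k : Fin d → ℤ) :
    ∑ i, ‖nl U V i k‖ₑ ≤ ENNReal.ofReal (Real.sqrt (wt k - 1)) * econv (amp U) (amp V) k := by
  have h1 : ∀ j, ‖(Real.pi * Complex.I * (k j : ℂ) : ℂ)‖ₑ ≤ ENNReal.ofReal (Real.sqrt (wt k - 1)) := by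
    intro j
    rw [← ofReal_norm]
    refine ENNReal.ofReal_le_ofReal (Real.le_sqrt_of_sq_le ?_)
    have := Finset.single_le_sum (s := Finset.univ) (f := fun i => (Real.pi * (k i : ℝ)) ^ 2)
      (fun i _ => sq_nonneg _) (Finset.mem_univ j)
    rw [wt, add_sub_cancel_left]
    refine le_trans (le_of_eq ?_) this
    simp [mul_pow]
  have h2 : ∀ i, ‖nl U V i k‖ₑ ≤ ENNReal.ofReal (Real.sqrt (wt k - 1)) *
      ∑ j, ∑' l, ‖U j l‖ₑ * ‖V i (k - l)‖ₑ := by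
    intro i
    rw [nl, Finset.mul_sum, Finset.mul_sum]
    refine (enorm_sum_le _ _).trans (Finset.sum_le_sum fun j _ => ?_)
    rw [← mul_assoc, enorm_mul]
    exact mul_le_mul' (h1 j) (enorm_conv_le _ _ _)
  refine (Finset.sum_le_sum fun i _ => h2 i).trans (le_of_eq ?_)
  rw [← Finset.mul_sum, econv]
  congr 1
  simp only [amp, Finset.sum_mul_sum]
  rw [Summable.tsum_finsetSum fun _ _ => ENNReal.summable, Finset.sum_comm]
  refine Finset.sum_congr rfl fun j _ => ?_
  rw [Summable.tsum_finsetSum fun _ _ => ENNReal.summable]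

/-! ### Uniqueness: smoothing of single modes and Gronwall. -/

theorem wt_sub_one_le_visc {d : ℕ} {μ : Fin d → ℝ} (hμ : ∀ i, 1 ≤ μ i) (k : Fin d → ℤ) :
    wt k - 1 ≤ visc μ k := by
  rw [wt, add_sub_cancel_left, visc]
  exact Finset.sum_le_sum fun i _ => le_mul_of_one_le_left (sq_nonneg _) (hμ i)

theorem wt_sub_one_pos {d : ℕ} {k : Fin d → ℤ} (hk : k ≠ 0) : 0 < wt k - 1 := by
  obtain ⟨i, hi⟩ := Function.ne_iff.mp hk
  rw [wt, add_sub_cancel_left]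
  refine Finset.sum_pos' (fun _ _ => sq_nonneg _) ⟨i, Finset.mem_univ i, ?_⟩
  have : (k i : ℝ) ≠ 0 := by exact_mod_cast hi
  have := Real.pi_ne_zero
  positivity

/-- Smoothing estimate for the scalar equation `a' = -λ a + f`. -/
theorem sq_le_of_integral_eq {l t : ℝ} (hl : 0 < l) (ht : 0 ≤ t) {a f : ℝ → ℝ}
    (hf : IntervalIntegrable (fun s => -(l * a s) + f s) volume 0 t)
    (hf2 : IntervalIntegrable (fun s => f s ^ 2) volume 0 t)
    (ha : ∀ s ∈ Icc 0 t, a s = ∫ r in (0 : ℝ)..s, (-(l * a r) + f r)) :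
    a t ^ 2 ≤ (2 * l)⁻¹ * ∫ s in (0 : ℝ)..t, f s ^ 2 := by
  set g : ℝ → ℝ := fun s => -(l * a s) + f s with hg
  set A : ℝ → ℝ := fun s => ∫ r in (0 : ℝ)..s, g r with hA
  have hac : AbsolutelyContinuousOnInterval A 0 t :=
    hf.absolutelyContinuousOnInterval_intervalIntegral (by simp)
  have hd : ∀ᵐ s, s ∈ uIcc 0 t → HasDerivAt A (g s) s := by
    filter_upwards [hf.ae_hasDerivAt_integral] with s hs hst using hs hst 0 (by simp)
  have h1 := hac.integral_deriv_mul_eq_sub hac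
  have hA0 : A 0 = 0 := by simp [hA]
  have hAt : ∀ s ∈ Icc 0 t, A s = a s := fun s hs => (ha s hs).symm
  rw [hA0, hAt t ⟨ht, le_rfl⟩] at h1
  have h2 : a t ^ 2 = ∫ s in (0 : ℝ)..t, (deriv A s * A s + A s * deriv A s) := by rw [h1]; ring
  rw [h2, ← intervalIntegral.integral_const_mul]
  refine intervalIntegral.integral_mono_ae_restrict ht ?_ (hf2.const_mul _) ?_
  · exact (hac.intervalIntegrable_deriv.mul_continuousOn hac.continuousOn).add
      (hac.intervalIntegrable_deriv.continuousOn_mul hac.continuousOn)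
  · have : ∀ᵐ s ∂volume.restrict (Icc 0 t), s ∈ uIcc 0 t → HasDerivAt A (g s) s :=
      ae_restrict_of_ae hd
    filter_upwards [this, ae_restrict_mem measurableSet_Icc] with s hs hst
    rw [(hs (by rwa [uIcc_of_le ht])).deriv, hAt s hst, hg]
    -- Completing the square: the derivative of `a²` is at most `(2l)⁻¹ f²`.
    have h3 : (2 * l)⁻¹ * f s ^ 2 - ((-(l * a s) + f s) * a s + a s * (-(l * a s) + f s))
        = (2 * l)⁻¹ * (2 * l * a s - f s) ^ 2 := by field_simp; ring
    have h4 : 0 ≤ (2 * l)⁻¹ * (2 * l * a s - f s) ^ 2 := by positivity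
    linarith

/-- The rate `l` is real, so real and imaginary parts satisfy the scalar equation separately. If the
right-hand side is infinite there is nothing to prove; otherwise the forcing is square integrable.
-/
theorem enorm_sq_le_of_integral_eq {l t : ℝ} (hl : 0 < l) (ht : 0 ≤ t) {a f : ℝ → ℂ}
    (hac : ContinuousOn a (Icc 0 t)) (hf : IntervalIntegrable f volume 0 t)
    (ha : ∀ s ∈ Icc 0 t, a s = ∫ r in (0 : ℝ)..s, (-(l * a r) + f r)) :
    ‖a t‖ₑ ^ 2 ≤ ENNReal.ofReal ((2 * l)⁻¹) * ∫⁻ s in Ioo 0 t, ‖f s‖ₑ ^ 2 := by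
  by_cases hfin : ∫⁻ s in Ioo 0 t, ‖f s‖ₑ ^ 2 = ∞
  · rw [hfin, ENNReal.mul_top (by simpa using hl)]; exact le_top
  rw [← uIcc_of_le ht] at hac
  have hgi : IntervalIntegrable (fun s => -(l * a s) + f s) volume 0 t :=
    ((continuousOn_const.mul hac).intervalIntegrable).neg.add hf
  have hnorm : IntervalIntegrable (fun s => ‖f s‖ ^ 2) volume 0 t := by
    rw [intervalIntegrable_iff_integrableOn_Ioo_of_le ht]
    have hm := ((intervalIntegrable_iff_integrableOn_Ioo_of_le ht).mp hf).aestronglyMeasurable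
    refine ⟨hm.norm.pow 2, ?_⟩
    refine lt_of_eq_of_lt ?_ (lt_top_iff_ne_top.mpr hfin)
    refine lintegral_congr fun s => ?_
    simp
  have hpart : ∀ φ : ℂ →L[ℝ] ℝ, (∀ z, |φ z| ≤ ‖z‖) →
      (φ (a t)) ^ 2 ≤ (2 * l)⁻¹ * ∫ s in (0 : ℝ)..t, (φ (f s)) ^ 2 := by
    intro φ hφ
    have hlin : ∀ s, φ (-(l * a s) + f s) = -(l * φ (a s)) + φ (f s) := by
      intro s
      rw [map_add, map_neg, ← Complex.real_smul, map_smul, smul_eq_mul]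
    refine sq_le_of_integral_eq (a := fun s => φ (a s)) (f := fun s => φ (f s)) hl ht ?_ ?_
      fun s hs => ?_
    · simp only [← hlin]
      rw [intervalIntegrable_iff] at hgi ⊢
      exact φ.integrable_comp hgi
    · refine hnorm.mono_fun ?_ (Filter.Eventually.of_forall fun s => ?_)
      · exact (φ.continuous.comp_aestronglyMeasurable hf.aestronglyMeasurable_restrict_uIoc).pow 2
      · simp only []
        rw [Real.norm_of_nonneg (sq_nonneg _), Real.norm_of_nonneg (sq_nonneg _), ← sq_abs]
        exact pow_le_pow_left₀ (abs_nonneg _) (hφ _) 2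
    · simp only [← hlin]
      rw [φ.intervalIntegral_comp_comm (hgi.mono_set (by
        rw [uIcc_of_le hs.1, uIcc_of_le ht]; exact Icc_subset_Icc le_rfl hs.2)), ← ha s hs]
  have hre := hpart Complex.reCLM (fun z => Complex.abs_re_le_norm z)
  have him := hpart Complex.imCLM (fun z => Complex.abs_im_le_norm z)
  simp only [Complex.reCLM_apply, Complex.imCLM_apply] at hre him
  have hIr : IntervalIntegrable (fun s => (f s).re ^ 2) volume 0 t :=
    hnorm.mono_fun ((Complex.continuous_re.comp_aestronglyMeasurable
      hf.aestronglyMeasurable_restrict_uIoc).pow 2) (Filter.Eventually.of_forall fun s => by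
        simp only []
        rw [Real.norm_of_nonneg (sq_nonneg _), Real.norm_of_nonneg (sq_nonneg _), ← sq_abs]
        exact pow_le_pow_left₀ (abs_nonneg _) (Complex.abs_re_le_norm _) 2)
  have hIi : IntervalIntegrable (fun s => (f s).im ^ 2) volume 0 t :=
    hnorm.mono_fun ((Complex.continuous_im.comp_aestronglyMeasurable
      hf.aestronglyMeasurable_restrict_uIoc).pow 2) (Filter.Eventually.of_forall fun s => by
        simp only []
        rw [Real.norm_of_nonneg (sq_nonneg _), Real.norm_of_nonneg (sq_nonneg _), ← sq_abs]
        exact pow_le_pow_left₀ (abs_nonneg _) (Complex.abs_im_le_norm _) 2)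
  have hreal : ‖a t‖ ^ 2 ≤ (2 * l)⁻¹ * ∫ s in (0 : ℝ)..t, ‖f s‖ ^ 2 := by
    have e : ∀ z : ℂ, ‖z‖ ^ 2 = z.re ^ 2 + z.im ^ 2 := fun z => by
      rw [Complex.sq_norm, Complex.normSq_apply]; ring
    simp only [e]
    rw [intervalIntegral.integral_add hIr hIi, mul_add]
    exact add_le_add hre him
  have h5 : ‖a t‖ₑ ^ 2 = ENNReal.ofReal (‖a t‖ ^ 2) := by
    rw [ENNReal.ofReal_pow (norm_nonneg _), ofReal_norm]
  rw [h5]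
  refine (ENNReal.ofReal_le_ofReal hreal).trans ?_
  rw [ENNReal.ofReal_mul (by positivity)]
  refine mul_le_mul_right (le_of_eq ?_) _
  rw [intervalIntegral.integral_of_le ht, integral_Ioc_eq_integral_Ioo,
    ofReal_integral_eq_lintegral_ofReal
      ((intervalIntegrable_iff_integrableOn_Ioo_of_le ht).mp hnorm)
      (Filter.Eventually.of_forall fun s => sq_nonneg _)]
  refine lintegral_congr fun s => ?_
  rw [ENNReal.ofReal_pow (norm_nonneg _), ofReal_norm]

/-- Gronwall's lemma with an integrable kernel. -/
theorem eq_zero_of_le_lintegral {T : ℝ} {D H : ℝ → ℝ≥0∞} {M : ℝ≥0∞} (hM : M ≠ ∞)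
    (hDM : ∀ t ∈ Icc 0 T, D t ≤ M) (hH : ∫⁻ t in Ioo 0 T, H t ≠ ∞)
    (hD : ∀ t ∈ Icc 0 T, D t ≤ ∫⁻ s in Ioo 0 t, H s * D s) :
    ∀ t ∈ Icc 0 T, D t = 0 := by
  -- Absolute continuity of the integral provides a step length `r` such that `H` has integral below
  -- one half on intervals of that length. Advancing by `r`, the finite supremum `S` of `D`
  -- satisfies `S ≤ S/2`, hence vanishes.
  obtain ⟨δ, hδ, hsmall⟩ := exists_pos_setLIntegral_lt_of_measure_lt hH
    (ε := (2 : ℝ≥0∞)⁻¹) (by simp)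
  obtain ⟨r, hr0, hrδ⟩ : ∃ r : ℝ, 0 < r ∧ ENNReal.ofReal r < δ := by
    obtain ⟨q, hq0, hq⟩ := ENNReal.lt_iff_exists_nnreal_btwn.mp hδ
    exact ⟨q, by simpa using hq0, by simpa using hq⟩
  have step : ∀ n : ℕ, ∀ t ∈ Icc 0 T, t ≤ n * r → D t = 0 := by
    intro n
    induction n with
    | zero =>
      intro t ht h0
      have : t = 0 := le_antisymm (by simpa using h0) ht.1
      subst this
      have := hD 0 ht
      simpa using this
    | succ n ih =>
      set S : ℝ≥0∞ := ⨆ t ∈ Icc 0 (min T ((n + 1 : ℕ) * r)), D t with hS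
      have hSM : S ≤ M := iSup₂_le (ι := ℝ) (κ := fun t => t ∈ Icc 0 (min T ((n + 1 : ℕ) * r)))
        (f := fun t _ => D t) fun t (ht : t ∈ Icc 0 (min T ((n + 1 : ℕ) * r))) =>
          hDM t ⟨ht.1, ht.2.trans (min_le_left _ _)⟩
      have hle : ∀ t ∈ Icc 0 (min T ((n + 1 : ℕ) * r)), D t ≤ 2⁻¹ * S := by
        intro t ht'
        have ht : t ∈ Icc 0 T := ⟨ht'.1, ht'.2.trans (min_le_left _ _)⟩
        have htr : t ≤ (n + 1 : ℕ) * r := ht'.2.trans (min_le_right _ _)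
        have h1 : ∫⁻ s in Ioo 0 t, H s * D s
            ≤ ∫⁻ s in Ioo 0 t, (Ioo (n * r) t).indicator H s * S := by
          refine setLIntegral_mono' measurableSet_Ioo fun s hs => ?_
          have hsT : s ∈ Icc 0 T := ⟨hs.1.le, hs.2.le.trans ht.2⟩
          by_cases hsn : s ≤ n * r
          · rw [ih s hsT hsn, mul_zero]; exact zero_le
          · rw [indicator_of_mem (Set.mem_Ioo.mpr ⟨lt_of_not_ge hsn, hs.2⟩)]
            exact mul_le_mul_right (le_iSup₂_of_le (ι := ℝ)
              (κ := fun t => t ∈ Icc 0 (min T ((n + 1 : ℕ) * r))) (f := fun t _ => D t) s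
              (show s ∈ Icc 0 (min T ((n + 1 : ℕ) * r)) from ⟨hs.1.le, hs.2.le.trans ht'.2⟩)
              le_rfl) _
        refine (hD t ht).trans (h1.trans ?_)
        rw [lintegral_mul_const' _ _ (ne_top_of_le_ne_top hM hSM),
          lintegral_indicator measurableSet_Ioo, Measure.restrict_restrict measurableSet_Ioo]
        refine mul_le_mul_left (le_trans ?_ (hsmall (Ioo (n * r) t ∩ Ioo 0 t) ?_).le) _
        · refine lintegral_mono' ?_ le_rfl
          rw [Measure.restrict_restrict (measurableSet_Ioo.inter measurableSet_Ioo)]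
          have hsub : Ioo (n * r) t ∩ Ioo 0 t ⊆ Ioo (n * r) t ∩ Ioo 0 t ∩ Ioo 0 T :=
            fun s hs => ⟨hs, hs.2.1, hs.2.2.trans_le ht.2⟩
          exact Measure.restrict_mono hsub le_rfl
        · refine lt_of_le_of_lt ((Measure.restrict_apply_le _ _).trans
            ((measure_mono inter_subset_left).trans ?_)) hrδ
          rw [Real.volume_Ioo]
          refine ENNReal.ofReal_le_ofReal ?_
          push_cast at htr
          linarith
      have hS0 : S = 0 := by
        by_contra hne
        have h2 : S ≤ 2⁻¹ * S := iSup₂_le hle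
        have h3 : 2⁻¹ * S < S := by
          rw [mul_comm, ← div_eq_mul_inv]
          exact ENNReal.half_lt_self hne (ne_top_of_le_ne_top hM hSM)
        exact absurd h2 (not_le.mpr h3)
      intro t ht htr
      have := hle t ⟨ht.1, le_min ht.2 htr⟩
      rw [hS0, mul_zero] at this
      exact le_antisymm this zero_le
  intro t ht
  obtain ⟨n, hn⟩ := exists_nat_ge (t / r)
  exact step n t ht (by rwa [div_le_iff₀ hr0] at hn)

theorem ennreal_add_sq_le (x y : ℝ≥0∞) : (x + y) ^ 2 ≤ 4 * (x ^ 2 + y ^ 2) := by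
  rcases le_total x y with h | h
  · calc (x + y) ^ 2 ≤ (y + y) ^ 2 := by gcongr
      _ = 4 * y ^ 2 := by ring
      _ ≤ _ := by gcongr; exact le_add_self
  · calc (x + y) ^ 2 ≤ (x + x) ^ 2 := by gcongr
      _ = 4 * x ^ 2 := by ring
      _ ≤ _ := by gcongr; exact le_self_add

theorem ennreal_sum_sq_le {ι : Type*} [Fintype ι] (f : ι → ℝ≥0∞) :
    (∑ i, f i) ^ 2 ≤ Fintype.card ι * ∑ i, f i ^ 2 := by
  have := ennreal_tsum_mul_sq_le (fun _ : ι => (1 : ℝ≥0∞)) f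
  simpa [tsum_fintype] using this

theorem CoefSol.aemeasurable_amp {d : ℕ} {κ μ : Fin d → ℝ} {T : ℝ}
    {U : ℝ → Fin d → (Fin d → ℤ) → ℂ} (hU : CoefSol κ μ T U) (k : Fin d → ℤ) :
    AEMeasurable (fun t => amp (U t) k) (volume.restrict (Ioo 0 T)) :=
  Finset.aemeasurable_fun_sum _ fun i _ =>
    (((hU.cont i k).mono Ioo_subset_Icc_self).aestronglyMeasurable measurableSet_Ioo).enorm

/-- Uniqueness for the coefficient equations. -/
theorem CoefSol.unique {d : ℕ} (hd : d ≤ 3) {κ μ : Fin d → ℝ} (hκ : ∀ i, 0 < κ i)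
    (hμ : ∀ i, 1 ≤ μ i) {T : ℝ} {U V : ℝ → Fin d → (Fin d → ℤ) → ℂ} (hU : CoefSol κ μ T U)
    (hV : CoefSol κ μ T V) (h0 : U 0 = V 0) : ∀ t ∈ Icc 0 T, U t = V t := by
  obtain ⟨MU, hMU, hUb⟩ := hU.bdd
  obtain ⟨MV, hMV, hVb⟩ := hV.bdd
  have hUf : ∀ t ∈ Icc 0 T, ∑' k, amp (U t) k ^ 2 ≠ ∞ := fun t ht =>
    ne_top_of_le_ne_top hMU (hUb t ht)
  have hVf : ∀ t ∈ Icc 0 T, ∑' k, amp (V t) k ^ 2 ≠ ∞ := fun t ht =>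
    ne_top_of_le_ne_top hMV (hVb t ht)
  set D : ℝ → ℝ≥0∞ := fun t => ∑' k, amp (U t - V t) k ^ 2 with hDdef
  set F : Fin d → (Fin d → ℤ) → ℝ → ℂ := fun i k s =>
    -(leray κ (nl (U s) (U s)) i k - leray κ (nl (V s) (V s)) i k) with hF
  set HU : ℝ → ℝ≥0∞ := fun t => ∑' k, ENNReal.ofReal (wt k ^ 2) * amp (U t) k ^ 2 with hHU
  set HV : ℝ → ℝ≥0∞ := fun t => ∑' k, ENNReal.ofReal (wt k ^ 2) * amp (V t) k ^ 2 with hHV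
  have hampsub : ∀ t k, amp (U t - V t) k ≤ amp (U t) k + amp (V t) k := by
    intro t k
    simp only [amp, ← Finset.sum_add_distrib]
    exact Finset.sum_le_sum fun i _ => enorm_sub_le
  have hDb : ∀ t ∈ Icc 0 T, D t ≤ 4 * (MU + MV) := by
    intro t ht
    calc D t ≤ ∑' k, 4 * (amp (U t) k ^ 2 + amp (V t) k ^ 2) :=
          ENNReal.tsum_le_tsum fun k => (pow_le_pow_left' (hampsub t k) 2).trans
            (ennreal_add_sq_le _ _)
      _ = 4 * (∑' k, amp (U t) k ^ 2 + ∑' k, amp (V t) k ^ 2) := by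
          rw [ENNReal.tsum_mul_left, ENNReal.tsum_add]
      _ ≤ _ := by gcongr; exacts [hUb t ht, hVb t ht]
  have hvc : ∀ (W : ℝ → Fin d → (Fin d → ℤ) → ℂ), CoefSol κ μ T W → ∀ i k, 0 ≤ T →
      IntervalIntegrable (fun s => (visc μ k : ℂ) * W s i k) volume 0 T := by
    intro W hW i k hT
    refine ContinuousOn.intervalIntegrable ?_
    rw [uIcc_of_le hT]
    exact continuousOn_const.mul (hW.cont i k)
  have hlint : ∀ (W : ℝ → Fin d → (Fin d → ℤ) → ℂ), CoefSol κ μ T W → ∀ i k, 0 ≤ T →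
      IntervalIntegrable (fun s => leray κ (nl (W s) (W s)) i k) volume 0 T := by
    intro W hW i k hT
    have := (hW.int i k).sub (hvc W hW i k hT)
    simpa using this
  have hFint : 0 ≤ T → ∀ i k, IntervalIntegrable (F i k) volume 0 T := fun hT i k =>
    ((hlint U hU i k hT).sub (hlint V hV i k hT)).neg
  set A : ℝ≥0∞ := ENNReal.ofReal (lerayConst κ) with hA
  -- pointwise bound of the forcing
  have hFb : ∀ s ∈ Icc 0 T, ∀ i k, ‖F i k s‖ₑ ≤ A * (ENNReal.ofReal (Real.sqrt (wt k - 1)) *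
      (econv (amp (U s)) (amp (U s - V s)) k + econv (amp (V s)) (amp (U s - V s)) k)) := by
    intro s hs i k
    have h1 : ‖F i k s‖ₑ ≤ A * ∑ j, ‖nl (U s) (U s) j k - nl (V s) (V s) j k‖ₑ := by
      rw [hF, enorm_neg, leray_sub, ← ofReal_norm]
      refine (ENNReal.ofReal_le_ofReal (norm_leray_le hκ _ i k)).trans ?_
      rw [ENNReal.ofReal_mul (lerayConst_nonneg hκ),
        ENNReal.ofReal_sum_of_nonneg fun _ _ => norm_nonneg _]
      simp only [ofReal_norm, Pi.sub_apply, hA, le_refl]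
    refine h1.trans (mul_le_mul_right ?_ _)
    simp only [nl_sub (hUf s hs) (hVf s hs)]
    refine (Finset.sum_le_sum fun j _ => enorm_add_le _ _).trans ?_
    rw [Finset.sum_add_distrib, mul_add]
    refine add_le_add ((enorm_nl_le _ _ k).trans (le_of_eq ?_)) (enorm_nl_le _ _ k)
    rw [econv_comm]
  -- smoothing for each mode
  have hmode : ∀ t ∈ Icc 0 T, ∀ i k, ‖(U t - V t) i k‖ₑ ^ 2 ≤
      ENNReal.ofReal ((2 * visc μ k)⁻¹) * ∫⁻ s in Ioo 0 t, ‖F i k s‖ₑ ^ 2 := by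
    intro t ht i k
    have hT : 0 ≤ T := ht.1.trans ht.2
    have hsub : ∀ s ∈ Icc 0 t, (U s - V s) i k = ∫ r in (0 : ℝ)..s,
        (-(visc μ k * (U r - V r) i k) + F i k r) := by
      intro s hs
      have hs' : s ∈ Icc 0 T := ⟨hs.1, hs.2.trans ht.2⟩
      have hss : uIcc 0 s ⊆ uIcc 0 T := by
        rw [uIcc_of_le hs.1, uIcc_of_le hT]; exact Icc_subset_Icc le_rfl hs'.2
      have e1 := hU.eq s hs' i k
      have e2 := hV.eq s hs' i k
      rw [Pi.sub_apply, Pi.sub_apply, e1, e2, h0, sub_sub_sub_cancel_left,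
        ← intervalIntegral.integral_sub ((hV.int i k).mono_set hss) ((hU.int i k).mono_set hss)]
      refine intervalIntegral.integral_congr fun r _ => ?_
      simp only [hF, Pi.sub_apply]
      ring
    -- The mean is not damped, so the smoothing estimate is unavailable at `k = 0`; but there the
    -- transport term vanishes too and the mean is constant.
    by_cases hk : k = 0
    · have h2 := hsub t ⟨ht.1, le_rfl⟩
      have h3 : ∀ r, -((visc μ k : ℂ) * (U r - V r) i k) + F i k r = 0 := by
        intro r
        subst hk
        simp [hF, visc, leray, nl_zero_freq]
      simp only [h3, intervalIntegral.integral_zero] at h2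
      rw [h2]
      simp
    · have hl : 0 < visc μ k := (wt_sub_one_pos hk).trans_le (wt_sub_one_le_visc hμ k)
      refine enorm_sq_le_of_integral_eq (a := fun s => (U s - V s) i k) hl ht.1 ?_ ?_ hsub
      · exact ((hU.cont i k).sub (hV.cont i k)).mono (Icc_subset_Icc le_rfl ht.2)
      · refine (hFint hT i k).mono_set ?_
        rw [uIcc_of_le ht.1, uIcc_of_le hT]
        exact Icc_subset_Icc le_rfl ht.2
  set L : ℝ≥0∞ := ENNReal.ofReal (latticeConst d) with hL
  set C : ℝ≥0∞ := d * d * A ^ 2 * 4 * L with hC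
  have hCtop : C ≠ ∞ := by
    simp only [hC, hA, hL]
    exact ENNReal.mul_ne_top (ENNReal.mul_ne_top (ENNReal.mul_ne_top (ENNReal.mul_ne_top
      (by simp) (by simp)) (by simp)) (by simp)) (by simp)
  have hpt : ∀ s ∈ Icc 0 T, ∑ i, ∑' k, ENNReal.ofReal ((2 * visc μ k)⁻¹) * ‖F i k s‖ₑ ^ 2 ≤
      d * A ^ 2 * 4 * L * ((HU s + HV s) * D s) := by
    intro s hs
    have h1 : ∀ i : Fin d, ∑' k, ENNReal.ofReal ((2 * visc μ k)⁻¹) * ‖F i k s‖ₑ ^ 2 ≤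
        A ^ 2 * 4 * L * ((HU s + HV s) * D s) := by
      intro i
      have h2 : ∀ k, ENNReal.ofReal ((2 * visc μ k)⁻¹) * ‖F i k s‖ₑ ^ 2 ≤
          A ^ 2 * (4 * (econv (amp (U s)) (amp (U s - V s)) k ^ 2
            + econv (amp (V s)) (amp (U s - V s)) k ^ 2)) := by
        intro k
        refine (mul_le_mul_right (pow_le_pow_left' (hFb s hs i k) 2) _).trans ?_
        set X := econv (amp (U s)) (amp (U s - V s)) k + econv (amp (V s)) (amp (U s - V s)) k
        -- The gain of the smoothing estimate cancels the derivative of the transport term. This is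
        -- what allows `D` to be an `L²` distance.
        have h3 : ENNReal.ofReal ((2 * visc μ k)⁻¹) * ENNReal.ofReal (Real.sqrt (wt k - 1)) ^ 2
            ≤ 1 := by
          rw [← ENNReal.ofReal_pow (Real.sqrt_nonneg _), Real.sq_sqrt (by
            linarith [one_le_wt k]), ← ENNReal.ofReal_mul' (by linarith [one_le_wt k])]
          refine ENNReal.ofReal_le_one.mpr ?_
          have h4 := wt_sub_one_le_visc hμ k
          have h5 := one_le_wt k
          rw [inv_mul_eq_div]
          exact div_le_one_of_le₀ (by linarith) (by linarith)
        calc _ = (ENNReal.ofReal ((2 * visc μ k)⁻¹) * ENNReal.ofReal (Real.sqrt (wt k - 1)) ^ 2)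
              * (A ^ 2 * X ^ 2) := by ring
          _ ≤ 1 * (A ^ 2 * X ^ 2) := by gcongr
          _ ≤ _ := by rw [one_mul]; gcongr; exact ennreal_add_sq_le _ _
      refine (ENNReal.tsum_le_tsum h2).trans ?_
      rw [ENNReal.tsum_mul_left, ENNReal.tsum_mul_left, ENNReal.tsum_add]
      have h3 := tsum_sq_conv_le hd (amp (U s)) (amp (U s - V s))
      have h4 := tsum_sq_conv_le hd (amp (V s)) (amp (U s - V s))
      calc _ ≤ A ^ 2 * (4 * (L * (HU s * D s) + L * (HV s * D s))) := by
            gcongr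
            exacts [h3, h4]
        _ = _ := by ring
    refine (Finset.sum_le_sum fun i _ => h1 i).trans (le_of_eq ?_)
    rw [Finset.sum_const, Finset.card_univ, Fintype.card_fin, nsmul_eq_mul]
    ring
  have hHfin : ∫⁻ t in Ioo 0 T, C * (HU t + HV t) ≠ ∞ := by
    rw [lintegral_const_mul' _ _ hCtop]
    have hmU : AEMeasurable HU (volume.restrict (Ioo 0 T)) :=
      AEMeasurable.tsum fun k => ((hU.aemeasurable_amp k).pow_const 2).const_mul _
    rw [lintegral_add_left' hmU]
    exact ENNReal.mul_ne_top hCtop (ENNReal.add_ne_top.mpr ⟨hU.h2.ne, hV.h2.ne⟩)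
  have hDint : ∀ t ∈ Icc 0 T, D t ≤ ∫⁻ s in Ioo 0 t, (C * (HU s + HV s)) * D s := by
    intro t ht
    have hT : 0 ≤ T := ht.1.trans ht.2
    have hmeas : ∀ i k, AEMeasurable (fun s => ENNReal.ofReal ((2 * visc μ k)⁻¹) * ‖F i k s‖ₑ ^ 2)
        (volume.restrict (Ioo 0 t)) := by
      intro i k
      have h1 := ((intervalIntegrable_iff_integrableOn_Ioo_of_le hT).mp
        (hFint hT i k)).aestronglyMeasurable
      exact ((h1.mono_measure (Measure.restrict_mono (Ioo_subset_Ioo le_rfl ht.2)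
        le_rfl)).enorm.pow_const 2).const_mul _
    calc D t ≤ ∑' k, d * ∑ i, ‖(U t - V t) i k‖ₑ ^ 2 := ENNReal.tsum_le_tsum fun k => by
          simpa [amp] using ennreal_sum_sq_le fun i => ‖(U t - V t) i k‖ₑ
      _ = d * ∑ i, ∑' k, ‖(U t - V t) i k‖ₑ ^ 2 := by
          rw [ENNReal.tsum_mul_left, Summable.tsum_finsetSum fun _ _ => ENNReal.summable]
      _ ≤ d * ∑ i, ∑' k, ∫⁻ s in Ioo 0 t,
            ENNReal.ofReal ((2 * visc μ k)⁻¹) * ‖F i k s‖ₑ ^ 2 := by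
          refine mul_le_mul_right (Finset.sum_le_sum fun i _ => ENNReal.tsum_le_tsum fun k => ?_) _
          rw [lintegral_const_mul' _ _ (by simp)]
          exact hmode t ht i k
      _ = d * ∫⁻ s in Ioo 0 t, ∑ i, ∑' k,
            ENNReal.ofReal ((2 * visc μ k)⁻¹) * ‖F i k s‖ₑ ^ 2 := by
          rw [lintegral_finsetSum' _ fun i _ => AEMeasurable.tsum (hmeas i)]
          congr 1
          exact Finset.sum_congr rfl fun i _ => (lintegral_tsum (hmeas i)).symm
      _ ≤ d * ∫⁻ s in Ioo 0 t, d * A ^ 2 * 4 * L * ((HU s + HV s) * D s) := by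
          refine mul_le_mul_right (setLIntegral_mono' measurableSet_Ioo fun s hs => ?_) _
          exact hpt s ⟨hs.1.le, hs.2.le.trans ht.2⟩
      _ = _ := by
          rw [← lintegral_const_mul' _ _ (by simp)]
          refine lintegral_congr fun s => ?_
          rw [hC]; ring
  have hD0 := eq_zero_of_le_lintegral (ENNReal.mul_ne_top (by simp) (ENNReal.add_ne_top.mpr
    ⟨hMU, hMV⟩)) hDb hHfin hDint
  intro t ht
  have h1 := hD0 t ht
  rw [hDdef] at h1
  funext i k
  have h2 := ENNReal.tsum_eq_zero.mp h1 k
  have h3 := (Finset.sum_eq_zero_iff.mp (pow_eq_zero_iff (two_ne_zero) |>.mp h2)) i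
    (Finset.mem_univ i)
  simpa [sub_eq_zero] using h3

/-! ### From strong solutions to coefficient solutions -/

theorem summable_of_tsum_ofReal_ne_top {ι : Type*} {f : ι → ℝ} (hf : ∀ i, 0 ≤ f i)
    (h : ∑' i, ENNReal.ofReal (f i) ≠ ∞) : Summable f := by
  have := ENNReal.summable_toReal h
  simpa [ENNReal.toReal_ofReal (hf _)] using this

theorem enorm_sq_eq_tsum {d : ℕ} (f : L2 d) :
    ‖f‖ₑ ^ 2 = ∑' k, 2 ^ d * ‖fourierCoef f k‖ₑ ^ 2 := by
  have h := hasSum_sq_fourierCoef f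
  have h1 : ‖f‖ₑ ^ 2 = ENNReal.ofReal (‖f‖ ^ 2) := by
    rw [ENNReal.ofReal_pow (norm_nonneg _), ofReal_norm]
  rw [h1, ← h.tsum_eq, ENNReal.ofReal_tsum_of_nonneg (fun k => by positivity) h.summable]
  refine tsum_congr fun k => ?_
  rw [ENNReal.ofReal_mul (by positivity), ENNReal.ofReal_pow (norm_nonneg _), ofReal_norm,
    ENNReal.ofReal_pow zero_le_two, ENNReal.ofReal_ofNat]

theorem hNorm_sq_eq {d : ℕ} (s : ℝ) (f : L2 d) :
    hNorm s f ^ (2 : ℝ) = 2 ^ d * ∑' k, ENNReal.ofReal (wt k ^ s) * ‖fourierCoef f k‖ₑ ^ 2 := by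
  rw [hNorm_sq, ← ENNReal.tsum_mul_left]
  refine tsum_congr fun k => ?_
  rw [ENNReal.ofReal_mul (mul_nonneg (by positivity) (Real.rpow_nonneg (wt_pos k).le _)),
    ENNReal.ofReal_mul (by positivity), ENNReal.ofReal_pow (norm_nonneg _), ofReal_norm,
    ENNReal.ofReal_pow zero_le_two, ENNReal.ofReal_ofNat, mul_assoc]

theorem memH_two_summable {d : ℕ} {f : L2 d} (h : MemH 2 f) :
    Summable fun k => wt k ^ 2 * ‖fourierCoef f k‖ ^ 2 := by
  simpa using (memH_iff 2 f).mp h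

theorem memH_two_summable_wt {d : ℕ} {f : L2 d} (h : MemH 2 f) :
    Summable fun k => wt k * ‖fourierCoef f k‖ ^ 2 := by
  refine Summable.of_nonneg_of_le (fun k => mul_nonneg (wt_pos k).le (sq_nonneg _)) (fun k => ?_)
    (memH_two_summable h)
  exact mul_le_mul_of_nonneg_right (by nlinarith [one_le_wt k]) (sq_nonneg _)

/-- Young's inequality splits `2 |f̂|` into `wt² |f̂|²`, summable by hypothesis, and `wt⁻²`,
summable for `d ≤ 3`. Via `ae_abs_le_tsum` this is the embedding of `H²` in `L^∞`. -/
theorem memH_two_summable_norm {d : ℕ} (hd : d ≤ 3) {f : L2 d} (h : MemH 2 f) :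
    Summable fun k => ‖fourierCoef f k‖ := by
  refine Summable.of_nonneg_of_le (fun k => norm_nonneg _) (fun k => ?_)
    ((memH_two_summable h).add (summable_wt hd))
  have h1 := wt_pos k
  have h2 : 0 ≤ (wt k * ‖fourierCoef f k‖ - (wt k)⁻¹) ^ 2 := sq_nonneg _
  have h3 : (wt k * ‖fourierCoef f k‖ - (wt k)⁻¹) ^ 2
      = wt k ^ 2 * ‖fourierCoef f k‖ ^ 2 + (wt k ^ 2)⁻¹ - 2 * ‖fourierCoef f k‖ := by
    field_simp
    ring
  nlinarith [norm_nonneg (fourierCoef f k)]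

theorem fourierCoef_pderiv_pderiv {d : ℕ} {f : L2 d} (h : MemH 2 f) (i : Fin d) (k : Fin d → ℤ) :
    fourierCoef (pderiv i (pderiv i f)) k = -(Real.pi * (k i : ℝ)) ^ 2 * fourierCoef f k := by
  have h1 := memH_two_summable_wt h
  rw [fourierCoef_pderiv, fourierCoef_pderiv h1]
  · push_cast
    linear_combination (Real.pi * (k i : ℂ)) ^ 2 * fourierCoef f k * Complex.I_sq
  · refine Summable.of_nonneg_of_le (fun k => mul_nonneg (wt_pos k).le (sq_nonneg _)) (fun k => ?_)
      (memH_two_summable h)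
    rw [fourierCoef_pderiv h1, norm_mul, mul_pow, ← mul_assoc, sq (wt k)]
    refine mul_le_mul_of_nonneg_right (mul_le_mul_of_nonneg_left ?_ (wt_pos k).le) (sq_nonneg _)
    refine le_trans (le_of_eq ?_) (sq_pi_mul_le_wt k i)
    simp [mul_pow]

/-- A function with summable Fourier coefficients is essentially bounded. -/
theorem ae_abs_le_tsum {d : ℕ} {f : L2 d} (hf : Summable fun k => ‖fourierCoef f k‖) :
    ∀ᵐ x ∂cellMeasure d, |f x| ≤ ∑' k, ‖fourierCoef f k‖ := by
  have h1 := tendstoInMeasure_of_tendsto_Lp (tendsto_partialSum f)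
  obtain ⟨ns, -, h2⟩ := h1.exists_seq_tendsto_ae
  have h3 : ∀ N, ∀ᵐ x ∂cellMeasure d, |partialSum N f x| ≤ ∑' k, ‖fourierCoef f k‖ := by
    intro N
    have h4 : ∀ᵐ x ∂cellMeasure d, ∀ k ∈ box d N,
        (trigL k (fourierCoef f k) : L2 d) x = trigFun k (fourierCoef f k) x :=
      (Finset.eventually_all _).mpr fun k _ => trigL_ae k _
    filter_upwards [h4, Lp.coeFn_finsetSum (box d N) fun k => trigL k (fourierCoef f k)] with x hx hs
    rw [partialSum, hs, Finset.sum_apply, Finset.sum_congr rfl hx]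
    refine (Finset.abs_sum_le_sum_abs _ _).trans (le_trans (Finset.sum_le_sum fun k _ => ?_)
      (hf.sum_le_tsum _ fun _ _ => norm_nonneg _))
    refine (Complex.abs_re_le_norm _).trans ?_
    rw [norm_mul, norm_chr, mul_one]
  filter_upwards [h2, ae_all_iff.mpr h3] with x hx hb
  exact le_of_tendsto (hx.abs) (Filter.Eventually.of_forall fun n => hb _)

theorem exists_mul {d : ℕ} {f : L2 d} (hf : Summable fun k => ‖fourierCoef f k‖) (g : L2 d) :
    ∃ h : L2 d, (h =ᵐ[cellMeasure d] fun x => f x * g x) ∧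
      ∀ k, HasSum (fun l => fourierCoef f l * fourierCoef g (k - l)) (fourierCoef h k) := by
  have hm : MemLp (fun x => f x * g x) 2 (cellMeasure d) := by
    refine MemLp.of_le_mul (Lp.memLp g) ((Lp.aestronglyMeasurable f).mul (Lp.aestronglyMeasurable g))
      (c := ∑' k, ‖fourierCoef f k‖) ?_
    filter_upwards [ae_abs_le_tsum hf] with x hx
    rw [norm_mul]
    exact mul_le_mul_of_nonneg_right hx (norm_nonneg _)
  refine ⟨hm.toLp, hm.coeFn_toLp, fun k => ?_⟩
  have h1 := hasSum_fourierCoef_mul f g k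
  have h2 : fourierCoef hm.toLp k
      = ((2 : ℂ) ^ d)⁻¹ * ∫ x in cell d, ((f x * g x : ℝ) : ℂ) * chr (-k) x := by
    rw [fourierCoef_eq]
    congr 1
    refine integral_congr_ae ?_
    filter_upwards [hm.coeFn_toLp] with x hx
    rw [hx]
  rwa [h2]

theorem tsum_amp_sq_le {d : ℕ} (u : Fin d → L2 d) :
    ∑' k, amp (fun i => fourierCoef (u i)) k ^ 2 ≤ d * ∑ i, ‖u i‖ₑ ^ 2 := by
    calc _ ≤ ∑' k, (d : ℝ≥0∞) * ∑ i, ‖fourierCoef (u i) k‖ₑ ^ 2 := ENNReal.tsum_le_tsum fun k => by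
          simpa [amp] using ennreal_sum_sq_le fun i => ‖fourierCoef (u i) k‖ₑ
      _ = d * ∑ i, ∑' k, ‖fourierCoef (u i) k‖ₑ ^ 2 := by
          rw [ENNReal.tsum_mul_left, Summable.tsum_finsetSum fun _ _ => ENNReal.summable]
      _ ≤ _ := by
          refine mul_le_mul_right (Finset.sum_le_sum fun i _ => ?_) _
          rw [enorm_sq_eq_tsum]
          exact ENNReal.tsum_le_tsum fun k => le_mul_of_one_le_left zero_le
            (one_le_pow₀ one_le_two)

theorem amp_sq_ne_top {d : ℕ} (u : Fin d → L2 d) :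
    ∑' k, amp (fun i => fourierCoef (u i)) k ^ 2 ≠ ∞ := by
  have h := tsum_amp_sq_le u
  refine ne_top_of_le_ne_top (ENNReal.mul_ne_top (by simp) ?_) h
  exact ENNReal.sum_ne_top.mpr fun i _ => by simp

/-- For divergence free coefficients the transport term has convection form. -/
theorem hasSum_nl {d : ℕ} {U V : Fin d → (Fin d → ℤ) → ℂ} (hU : ∑' k, amp U k ^ 2 ≠ ∞)
    (hV : ∑' k, amp V k ^ 2 ≠ ∞) (hdiv : DivFreeCoef U) (i : Fin d) (k : Fin d → ℤ) :
    HasSum (fun l => ∑ j, U j l * (Real.pi * Complex.I * ((k - l) j : ℤ) * V i (k - l)))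
      (nl U V i k) := by
  have h1 : HasSum (fun l => Real.pi * Complex.I * ∑ j, (k j : ℂ) * (U j l * V i (k - l)))
      (nl U V i k) :=
    (hasSum_sum fun j _ => ((summable_conv (tsum_comp_sq_ne_top hU j) (tsum_comp_sq_ne_top hV i)
      k).hasSum.mul_left _)).mul_left _
  have h2 : (fun l => ∑ j, U j l * (Real.pi * Complex.I * ((k - l) j : ℤ) * V i (k - l)))
      = fun l => Real.pi * Complex.I * ∑ j, (k j : ℂ) * (U j l * V i (k - l)) := by
    funext l
    have h3 : ∑ j, U j l * (Real.pi * Complex.I * ((k - l) j : ℤ) * V i (k - l))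
        = Real.pi * Complex.I * ∑ j, (k j : ℂ) * (U j l * V i (k - l))
          - Real.pi * Complex.I * V i (k - l) * ∑ j, (l j : ℂ) * U j l := by
      rw [Finset.mul_sum, Finset.mul_sum, ← Finset.sum_sub_distrib]
      refine Finset.sum_congr rfl fun j _ => ?_
      rw [Pi.sub_apply]; push_cast; ring
    rw [h3, hdiv l, mul_zero, sub_zero]
  rwa [h2]

/-- At a time with `u ∈ H²` the field is essentially bounded, so the pointwise product `u·∇u` lies
in `L²` and its coefficients are convolutions. Solenoidality moves the derivative outside and
identifies them with `nl`. -/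
theorem exists_convection {d : ℕ} (hd : d ≤ 3) {u : Fin d → L2 d} (hu : ∀ i, MemH 2 (u i))
    (hdiv : DivFreeCoef fun i => fourierCoef (u i)) (i : Fin d) :
    ∃ n : L2 d, (n =ᵐ[cellMeasure d] fun x => ∑ j, u j x * pderiv j (u i) x) ∧
      ∀ k, fourierCoef n k = nl (fun i => fourierCoef (u i)) (fun i => fourierCoef (u i)) i k := by
  choose h h1 h2 using fun j => exists_mul (memH_two_summable_norm hd (hu j)) (pderiv j (u i))
  refine ⟨∑ j, h j, ?_, fun k => ?_⟩
  · filter_upwards [Lp.coeFn_finsetSum Finset.univ h, ae_all_iff.mpr h1] with x hx hx2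
    rw [hx, Finset.sum_apply]
    exact Finset.sum_congr rfl fun j _ => hx2 j
  · rw [fourierCoef_sum]
    refine (hasSum_sum fun j _ => h2 j k).unique ?_
    have := hasSum_nl (amp_sq_ne_top u) (amp_sq_ne_top u) hdiv i k
    simpa only [fourierCoef_pderiv (memH_two_summable_wt (hu i))] using this

/-- The momentum balance in Fourier space, for a single time. -/
theorem momentum_iff {d : ℕ} (hd : d ≤ 3) {κ μ : Fin d → ℝ} {u g : Fin d → L2 d} {p : L2 d}
    (hu : ∀ i, MemH 2 (u i)) (hp : MemH 1 p) (hdiv : DivFreeCoef fun i => fourierCoef (u i)) :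
    (∀ᵐ x ∂cellMeasure d, ∀ i, g i x + ∑ j, u j x * pderiv j (u i) x
      - (∑ j, μ j • pderiv j (pderiv j (u i)) : L2 d) x + κ i * pderiv i p x = 0) ↔
    ∀ i k, fourierCoef (g i) k
      + nl (fun i => fourierCoef (u i)) (fun i => fourierCoef (u i)) i k
      + visc μ k * fourierCoef (u i) k + κ i * (Real.pi * Complex.I * k i * fourierCoef p k) = 0 := by
  choose n hn hnk using fun i => exists_convection hd hu hdiv i
  rw [ae_all_iff]
  refine forall_congr' fun i => ?_
  have hp' : Summable fun k => wt k * ‖fourierCoef p k‖ ^ 2 := by simpa using (memH_iff 1 p).mp hp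
  have hc : ∀ k, fourierCoef (g i + n i - ∑ j, μ j • pderiv j (pderiv j (u i)) + κ i • pderiv i p) k
      = fourierCoef (g i) k + nl (fun i => fourierCoef (u i)) (fun i => fourierCoef (u i)) i k
      + visc μ k * fourierCoef (u i) k
      + κ i * (Real.pi * Complex.I * k i * fourierCoef p k) := by
    intro k
    rw [fourierCoef_add, fourierCoef_sub, fourierCoef_add, fourierCoef_sum, fourierCoef_smul, hnk,
      fourierCoef_pderiv hp']
    simp only [fourierCoef_smul, fourierCoef_pderiv_pderiv (hu i), visc]
    push_cast
    rw [Finset.sum_mul, sub_eq_add_neg, ← Finset.sum_neg_distrib]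
    congr 2
    exact Finset.sum_congr rfl fun j _ => by ring
  have hae : (g i + n i - ∑ j, μ j • pderiv j (pderiv j (u i)) + κ i • pderiv i p : L2 d)
      =ᵐ[cellMeasure d] fun x => g i x + ∑ j, u j x * pderiv j (u i) x
      - (∑ j, μ j • pderiv j (pderiv j (u i)) : L2 d) x + κ i * pderiv i p x := by
    filter_upwards [Lp.coeFn_add (g i + n i - ∑ j, μ j • pderiv j (pderiv j (u i)))
      (κ i • pderiv i p), Lp.coeFn_sub (g i + n i) (∑ j, μ j • pderiv j (pderiv j (u i))),
      Lp.coeFn_add (g i) (n i), Lp.coeFn_smul (κ i) (pderiv i p), hn i] with x h1 h2 h3 h4 h5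
    rw [h1, Pi.add_apply, h2, Pi.sub_apply, h3, Pi.add_apply, h4, Pi.smul_apply, h5, smul_eq_mul]
  constructor
  · intro h k
    rw [← hc]
    have h0 : (g i + n i - ∑ j, μ j • pderiv j (pderiv j (u i)) + κ i • pderiv i p : L2 d) = 0 := by
      refine Lp.ext ?_
      filter_upwards [hae, h, Lp.coeFn_zero ℝ 2 (cellMeasure d)] with x h1 h2 h3
      rw [h1, h2, h3]; rfl
    rw [h0, fourierCoef_zero]
  · intro h
    have h0 : (g i + n i - ∑ j, μ j • pderiv j (pderiv j (u i)) + κ i • pderiv i p : L2 d) = 0 :=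
      ext_fourierCoef fun k => by rw [hc, h, fourierCoef_zero]
    rw [h0] at hae
    filter_upwards [hae, Lp.coeFn_zero ℝ 2 (cellMeasure d)] with x h1 h2
    rw [← h1, h2]; rfl

theorem sum_kappa_ne_zero {d : ℕ} {κ : Fin d → ℝ} (hκ : ∀ i, 0 < κ i) {k : Fin d → ℤ}
    (hk : k ≠ 0) : ((∑ j, κ j * (k j : ℝ) ^ 2 : ℝ) : ℂ) ≠ 0 := by
  obtain ⟨i, hi⟩ := Function.ne_iff.mp hk
  have : (k i : ℝ) ≠ 0 := by exact_mod_cast hi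
  have h : 0 < ∑ j, κ j * (k j : ℝ) ^ 2 :=
    Finset.sum_pos' (fun j _ => mul_nonneg (hκ j).le (sq_nonneg _))
      ⟨i, Finset.mem_univ i, mul_pos (hκ i) (by positivity)⟩
  exact_mod_cast h.ne'

/-- Elimination of the pressure. -/
theorem eq_neg_leray_of_momentum {d : ℕ} {κ μ : Fin d → ℝ} (hκ : ∀ i, 0 < κ i)
    {U G N : Fin d → (Fin d → ℤ) → ℂ} {P : (Fin d → ℤ) → ℂ} (hU : DivFreeCoef U)
    (hG : DivFreeCoef G)
    (h : ∀ i k, G i k + N i k + visc μ k * U i k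
      + κ i * (Real.pi * Complex.I * k i * P k) = 0) (i : Fin d) (k : Fin d → ℤ) :
    G i k = -(visc μ k * U i k + leray κ N i k) := by
  -- The divergence of the momentum equation kills the time derivative and the viscous term and
  -- leaves an algebraic equation for the pressure.
  have h1 : ∑ j, (k j : ℂ) * N j k
      + Real.pi * Complex.I * P k * ((∑ j, κ j * (k j : ℝ) ^ 2 : ℝ) : ℂ) = 0 := by
    have h2 : ∑ j, (k j : ℂ) * (G j k + N j k + visc μ k * U j k
      + κ j * (Real.pi * Complex.I * k j * P k)) = 0 := by simp [h]
    have h3 : ∑ j, (k j : ℂ) * (G j k + N j k + visc μ k * U j k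
      + κ j * (Real.pi * Complex.I * k j * P k)) = ∑ j, (k j : ℂ) * G j k + ∑ j, (k j : ℂ) * N j k
        + visc μ k * ∑ j, (k j : ℂ) * U j k
        + Real.pi * Complex.I * P k * ((∑ j, κ j * (k j : ℝ) ^ 2 : ℝ) : ℂ) := by
      push_cast
      simp only [Finset.mul_sum, ← Finset.sum_add_distrib]
      exact Finset.sum_congr rfl fun j _ => by ring
    rw [h3, hU k, hG k] at h2
    simpa using h2
  by_cases hk : k = 0
  · have := h i k
    simp only [hk, Pi.zero_apply, Int.cast_zero, mul_zero, zero_mul, add_zero] at this ⊢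
    simp only [leray, Pi.zero_apply, Int.cast_zero, mul_zero, zero_mul, zero_div, sub_zero]
    linear_combination this
  · have hS := sum_kappa_ne_zero hκ hk
    have h4 : (∑ j, (k j : ℂ) * N j k) / ((∑ j, κ j * (k j : ℝ) ^ 2 : ℝ) : ℂ)
        = -(Real.pi * Complex.I * P k) := by
      rw [div_eq_iff hS]; linear_combination h1
    rw [leray, mul_div_assoc, h4]
    linear_combination h i k

theorem ae_hasDerivAt_of_memH1L2 {d : ℕ} {T : ℝ} (hT : 0 < T) {f : ℝ → L2 d} (hf : MemH1L2 T f) :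
    IntervalIntegrable (deriv f) volume 0 T ∧
    ∀ᵐ t ∂volume.restrict (Ioo 0 T), HasDerivAt f (deriv f t) t := by
  have hi : IntervalIntegrable (deriv f) volume 0 T := by
    rw [intervalIntegrable_iff_integrableOn_Ioo_of_le hT.le]
    exact hf.1.integrable one_le_two
  refine ⟨hi, ?_⟩
  rw [ae_restrict_iff' measurableSet_Ioo]
  filter_upwards [hi.ae_hasDerivAt_integral] with t ht htT
  have h1 := ht (by rw [uIcc_of_le hT.le]; exact Ioo_subset_Icc_self htT) 0 (by simp)
  refine (h1.const_add (f 0)).congr_of_eventuallyEq ?_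
  filter_upwards [Ioo_mem_nhds htT.1 htT.2] with s hs
  exact hf.2 s (Ioo_subset_Icc_self hs)

theorem MemH1L2.continuousOn {d : ℕ} {T : ℝ} (hT : 0 < T) {f : ℝ → L2 d} (hf : MemH1L2 T f) :
    ContinuousOn f (Icc 0 T) := by
  have h := intervalIntegral.continuousOn_primitive_interval (μ := volume) (a := 0) (b := T)
    (f := deriv f) (by
      rw [uIcc_of_le hT.le]
      exact (intervalIntegrable_iff_integrableOn_Icc_of_le hT.le).mp
        (ae_hasDerivAt_of_memH1L2 hT hf).1)
  rw [uIcc_of_le hT.le] at h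
  exact (continuousOn_const.add h).congr fun t ht => hf.2 t ht

theorem MemL2H.aemeasurable_hNorm_sq {d : ℕ} {T s : ℝ} {p : ℝ → L2 d} (hp : MemL2H T s p) :
    AEMeasurable (fun t => hNorm s (p t) ^ (2 : ℝ)) (volume.restrict (Ioo 0 T)) := by
  simp only [hNorm_sq_eq]
  refine (AEMeasurable.tsum fun k => AEMeasurable.const_mul ?_ _).const_mul _
  exact (((fourierCoefL k).continuous.comp_aestronglyMeasurable hp.1).enorm).pow_const 2

theorem MemL2H.ae_memH {d : ℕ} {T s : ℝ} {p : ℝ → L2 d} (hp : MemL2H T s p) :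
    ∀ᵐ t ∂volume.restrict (Ioo 0 T), MemH s (p t) := by
  have h2 := hp.2
  rw [lqhNorm] at h2
  filter_upwards [ae_lt_top' hp.aemeasurable_hNorm_sq ((ENNReal.rpow_lt_top_iff_of_pos (by norm_num)).mp h2).ne] with t ht
  exact (ENNReal.rpow_lt_top_iff_of_pos (by norm_num)).mp ht

/-- The Fourier coefficients of a strong solution solve the coefficient equations. -/
theorem coefSol_of_strong {d : ℕ} (hd : d ≤ 3) {κ μ : Fin d → ℝ} (hκ : ∀ i, 0 < κ i) {T : ℝ}
    (hT : 0 < T) {u : ℝ → Fin d → L2 d} {p : ℝ → L2 d} (hE : ∀ i, MemE1 T fun t => u t i)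
    (hdiv : ∀ t ∈ Icc 0 T, DivFreeCoef fun i => fourierCoef (u t i)) (hp : MemL2H T 1 p)
    (hmom : ∀ᵐ t ∂volume.restrict (Ioo 0 T), ∀ᵐ x ∂cellMeasure d, ∀ i,
      deriv (fun s => u s i) t x + ∑ j, u t j x * pderiv j (u t i) x
      - (∑ j, μ j • pderiv j (pderiv j (u t i)) : L2 d) x + κ i * pderiv i (p t) x = 0) :
    CoefSol κ μ T fun t i => fourierCoef (u t i) := by
  have hDer := fun i => ae_hasDerivAt_of_memH1L2 hT (hE i).2
  have hcontu := fun i => (hE i).2.continuousOn hT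
  have hcoef : ∀ i k, ∀ t ∈ Icc 0 T, fourierCoef (u t i) k
      = fourierCoef (u 0 i) k + ∫ s in (0 : ℝ)..t, fourierCoef (deriv (fun s => u s i) s) k := by
    intro i k t ht
    have h1 := congrArg (fourierCoefL k) ((hE i).2.2 t ht)
    rw [map_add, ← ContinuousLinearMap.intervalIntegral_comp_comm] at h1
    · exact h1
    · refine (hDer i).1.mono_set ?_
      rw [uIcc_of_le ht.1, uIcc_of_le hT.le]
      exact Icc_subset_Icc le_rfl ht.2
  have hcoefm : ∀ i k, ContinuousOn (fun t => fourierCoef (u t i) k) (Icc 0 T) := fun i k =>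
    (fourierCoefL k).continuous.comp_continuousOn (hcontu i)
  have hu2 := fun i => (hE i).1.ae_memH
  have hp1 := hp.ae_memH
  have hg : ∀ᵐ t ∂volume.restrict (Ioo 0 T), ∀ i k, fourierCoef (deriv (fun s => u s i) t) k
      = -(visc μ k * fourierCoef (u t i) k
        + leray κ (nl (fun i => fourierCoef (u t i)) fun i => fourierCoef (u t i)) i k) := by
    filter_upwards [ae_all_iff.mpr hu2, hp1, hmom, ae_all_iff.mpr fun i => (hDer i).2,
      ae_restrict_mem measurableSet_Ioo] with t h2 h1 hm hder htT
    have hdt := hdiv t (Ioo_subset_Icc_self htT)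
    -- The divergence vanishes for all times near `t`, so its time derivative vanishes at `t`.
    have hgd : DivFreeCoef fun i => fourierCoef (deriv (fun s => u s i) t) := by
      intro k
      have h3 : HasDerivAt (fun s => ∑ j, (k j : ℂ) * fourierCoef (u s j) k)
          (∑ j, (k j : ℂ) * fourierCoef (deriv (fun s => u s j) t) k) t :=
        HasDerivAt.fun_sum fun j _ =>
          ((fourierCoefL k).hasFDerivAt.comp_hasDerivAt t (hder j)).const_mul _
      refine h3.unique ((hasDerivAt_const t (0 : ℂ)).congr_of_eventuallyEq ?_)
      filter_upwards [Ioo_mem_nhds htT.1 htT.2] with s hs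
      exact hdiv s (Ioo_subset_Icc_self hs) k
    exact eq_neg_leray_of_momentum hκ hdt hgd ((momentum_iff hd h2 h1 hdt).mp hm)
  have hgu : ∀ i k, ∀ᵐ t ∂volume.restrict (uIoc 0 T), fourierCoef (deriv (fun s => u s i) t) k
      = -(visc μ k * fourierCoef (u t i) k
        + leray κ (nl (fun i => fourierCoef (u t i)) fun i => fourierCoef (u t i)) i k) := by
    intro i k
    rw [uIoc_of_le hT.le, ← restrict_Ioo_eq_restrict_Ioc]
    filter_upwards [hg] with t ht using ht i k
  have hgint : ∀ i k, IntervalIntegrable (fun s => fourierCoef (deriv (fun s => u s i) s) k)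
      volume 0 T := by
    intro i k
    have := (hDer i).1
    rw [intervalIntegrable_iff] at this ⊢
    exact (fourierCoefL k).integrable_comp this
  refine ⟨hdiv, ?_, ?_, fun i k => ?_, hcoefm, fun t ht i k => ?_⟩
  · obtain ⟨M, hM⟩ : ∃ M : ℝ, ∀ t ∈ Icc 0 T, ∀ i, ‖u t i‖ ≤ M := by
      choose C hC using fun i => isCompact_Icc.exists_bound_of_continuousOn (hcontu i)
      refine ⟨∑ i, |C i|, fun t ht i => (hC i t ht).trans ((le_abs_self _).trans ?_)⟩
      exact Finset.single_le_sum (f := fun i => |C i|) (fun _ _ => abs_nonneg _) (Finset.mem_univ i)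
    refine ⟨d * ∑ _i : Fin d, ENNReal.ofReal M ^ 2, ENNReal.mul_ne_top (by simp)
      (ENNReal.sum_ne_top.mpr fun _ _ => by simp), fun t ht => ?_⟩
    refine (tsum_amp_sq_le (u t)).trans ?_
    gcongr with i
    rw [← ofReal_norm]
    exact ENNReal.ofReal_le_ofReal (hM t ht i)
  · have h1 : ∀ t, ∑' k, ENNReal.ofReal (wt k ^ 2) * amp (fun i => fourierCoef (u t i)) k ^ 2
        ≤ d * ∑ i, hNorm 2 (u t i) ^ (2 : ℝ) := by
      intro t
      calc _ ≤ ∑' k, (d : ℝ≥0∞) * ∑ i, ENNReal.ofReal (wt k ^ 2) * ‖fourierCoef (u t i) k‖ₑ ^ 2 := by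
            refine ENNReal.tsum_le_tsum fun k => ?_
            rw [← Finset.mul_sum, mul_left_comm]
            gcongr
            simpa [amp] using ennreal_sum_sq_le fun i => ‖fourierCoef (u t i) k‖ₑ
        _ = d * ∑ i, ∑' k, ENNReal.ofReal (wt k ^ 2) * ‖fourierCoef (u t i) k‖ₑ ^ 2 := by
            rw [ENNReal.tsum_mul_left, Summable.tsum_finsetSum fun _ _ => ENNReal.summable]
        _ ≤ _ := by
            gcongr with i
            rw [hNorm_sq_eq]
            refine le_mul_of_one_le_of_le (one_le_pow₀ one_le_two) (le_of_eq ?_)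
            simp
    refine (lintegral_mono h1).trans_lt ?_
    rw [lintegral_const_mul' _ _ (by simp), lintegral_finsetSum' _ fun i _ => (hE i).1.aemeasurable_hNorm_sq]
    exact ENNReal.mul_lt_top (by simp) (ENNReal.sum_lt_top.mpr fun i _ =>
      (ENNReal.rpow_lt_top_iff_of_pos (by norm_num)).mp (hE i).1.2)
  · refine (hgint i k).neg.congr_ae ?_
    filter_upwards [hgu i k] with t ht
    rw [Pi.neg_apply, ht, neg_neg]
  · rw [hcoef i k t ht, sub_eq_add_neg, ← intervalIntegral.integral_neg]
    congr 1
    refine intervalIntegral.integral_congr_ae ?_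
    have := hgu i k
    rw [ae_restrict_iff' measurableSet_uIoc] at this
    filter_upwards [this] with s hs hst
    refine hs ?_
    rw [uIoc_of_le ht.1] at hst
    rw [uIoc_of_le hT.le]
    exact ⟨hst.1, hst.2.trans ht.2⟩

/-! ### From coefficient solutions to strong solutions -/

/-- The coefficients of a real-valued function. -/
def IsRealCoef {d : ℕ} (c : (Fin d → ℤ) → ℂ) : Prop := ∀ k, c (-k) = conj (c k)

open Classical in
/-- The function with given Fourier coefficients. -/
def synth {d : ℕ} (c : (Fin d → ℤ) → ℂ) : L2 d :=
  if h : (Summable fun k => ‖c k‖ ^ 2) ∧ IsRealCoef c then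
    (exists_fourierCoef_eq c h.1 h.2).choose else 0

theorem summable_sq_of_ne_top {ι : Type*} {c : ι → ℂ} (h : ∑' k, ‖c k‖ₑ ^ 2 ≠ ∞) :
    Summable fun k => ‖c k‖ ^ 2 := by
  refine summable_of_tsum_ofReal_ne_top (fun k => sq_nonneg _) ?_
  simpa only [ENNReal.ofReal_pow (norm_nonneg _), ofReal_norm] using h

theorem fourierCoef_synth {d : ℕ} {c : (Fin d → ℤ) → ℂ} (h : ∑' k, ‖c k‖ₑ ^ 2 ≠ ∞)
    (hr : IsRealCoef c) (k : Fin d → ℤ) : fourierCoef (synth c) k = c k := by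
  have h' : (Summable fun k => ‖c k‖ ^ 2) ∧ IsRealCoef c := ⟨summable_sq_of_ne_top h, hr⟩
  rw [synth, dif_pos h']
  exact (exists_fourierCoef_eq c h'.1 h'.2).choose_spec k

/-- `F` is the pointwise limit of its Fourier partial sums, and these are finite combinations of
fixed functions with measurable coefficients. -/
theorem aestronglyMeasurable_of_fourierCoef {d : ℕ} {ν : Measure ℝ} {F : ℝ → L2 d}
    (h : ∀ k, AEStronglyMeasurable (fun t => fourierCoef (F t) k) ν) :
    AEStronglyMeasurable F ν := by
  refine aestronglyMeasurable_of_tendsto_ae Filter.atTop (f := fun N t => partialSum N (F t))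
    (fun N => ?_) (Filter.Eventually.of_forall fun t => tendsto_partialSum (F t))
  simp only [partialSum]
  exact Finset.aestronglyMeasurable_fun_sum _ fun k _ =>
    (trigL k).continuous.comp_aestronglyMeasurable (h k)

theorem memLp_synth {d : ℕ} {ν : Measure ℝ} {c : ℝ → (Fin d → ℤ) → ℂ}
    (hm : ∀ k, AEStronglyMeasurable (fun t => c t k) ν) (hr : ∀ᵐ t ∂ν, IsRealCoef (c t))
    (hfin : ∫⁻ t, ∑' k, ‖c t k‖ₑ ^ 2 ∂ν ≠ ∞) :
    MemLp (fun t => synth (c t)) 2 ν ∧ ∀ᵐ t ∂ν, ∀ k, fourierCoef (synth (c t)) k = c t k := by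
  have hc : ∀ᵐ t ∂ν, ∀ k, fourierCoef (synth (c t)) k = c t k := by
    have hm2 : AEMeasurable (fun t => ∑' k, ‖c t k‖ₑ ^ 2) ν :=
      AEMeasurable.tsum fun k => (hm k).enorm.pow_const 2
    filter_upwards [hr, ae_lt_top' hm2 hfin] with t h1 h2 k using fourierCoef_synth h2.ne h1 k
  refine ⟨⟨aestronglyMeasurable_of_fourierCoef fun k => (hm k).congr ?_, ?_⟩, hc⟩
  · filter_upwards [hc] with t ht using (ht k).symm
  · rw [eLpNorm_lt_top_iff_lintegral_rpow_enorm_lt_top (by norm_num) (by norm_num)]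
    have : ∫⁻ t, ‖synth (c t)‖ₑ ^ (2 : ℝ≥0∞).toReal ∂ν = ∫⁻ t, 2 ^ d * ∑' k, ‖c t k‖ₑ ^ 2 ∂ν := by
      refine lintegral_congr_ae ?_
      filter_upwards [hc] with t ht
      rw [ENNReal.toReal_ofNat, ENNReal.rpow_ofNat, enorm_sq_eq_tsum, ENNReal.tsum_mul_left]
      simp only [ht]
    rw [this, lintegral_const_mul' _ _ (by simp)]
    exact ENNReal.mul_lt_top (by simp) hfin.lt_top

theorem IsRealCoef.conv {d : ℕ} {f g : (Fin d → ℤ) → ℂ} (hf : IsRealCoef f) (hg : IsRealCoef g) :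
    IsRealCoef (conv f g) := by
  intro k
  rw [AnisoNS.conv, AnisoNS.conv, Complex.conj_tsum, ← (Equiv.neg _).tsum_eq]
  refine tsum_congr fun l => ?_
  rw [map_mul, ← hf, ← hg, Equiv.neg_apply]
  congr 2
  abel

theorem IsRealCoef.nl {d : ℕ} {U V : Fin d → (Fin d → ℤ) → ℂ} (hU : ∀ i, IsRealCoef (U i))
    (hV : ∀ i, IsRealCoef (V i)) (i : Fin d) : IsRealCoef (nl U V i) := by
  intro k
  simp only [AnisoNS.nl, (hU _).conv (hV _) k, map_mul, map_sum, Complex.conj_ofReal,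
    Complex.conj_I, Pi.neg_apply, Int.cast_neg, map_intCast, neg_mul, Finset.sum_neg_distrib,
    mul_neg]

theorem IsRealCoef.leray {d : ℕ} {κ : Fin d → ℝ} {N : Fin d → (Fin d → ℤ) → ℂ}
    (hN : ∀ i, IsRealCoef (N i)) (i : Fin d) : IsRealCoef (leray κ N i) := by
  intro k
  simp only [AnisoNS.leray, hN _ k, map_mul, map_sum, map_sub, map_div₀, Complex.conj_ofReal,
    Pi.neg_apply, Int.cast_neg, map_intCast, neg_mul, Finset.sum_neg_distrib,
    mul_neg, neg_neg, neg_sq]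

/-- The Fourier coefficients of the pressure. -/
def pres {d : ℕ} (κ : Fin d → ℝ) (N : Fin d → (Fin d → ℤ) → ℂ) (k : Fin d → ℤ) : ℂ :=
  Complex.I * (∑ j, (k j : ℂ) * N j k) / (Real.pi * ((∑ j, κ j * (k j : ℝ) ^ 2 : ℝ) : ℂ))

theorem IsRealCoef.pres {d : ℕ} {κ : Fin d → ℝ} {N : Fin d → (Fin d → ℤ) → ℂ}
    (hN : ∀ i, IsRealCoef (N i)) : IsRealCoef (pres κ N) := by
  intro k
  simp only [AnisoNS.pres, hN _ k, map_mul, map_sum, map_div₀, Complex.conj_ofReal,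
    Pi.neg_apply, Int.cast_neg, map_intCast, neg_mul, Finset.sum_neg_distrib,
    mul_neg, neg_sq, Complex.conj_I]

theorem gradient_pres {d : ℕ} {κ : Fin d → ℝ} (N : Fin d → (Fin d → ℤ) → ℂ)
    (i : Fin d) (k : Fin d → ℤ) :
    κ i * (Real.pi * Complex.I * k i * pres κ N k) = leray κ N i k - N i k := by
  rw [pres, leray]
  have hpi : (Real.pi : ℂ) ≠ 0 := by exact_mod_cast Real.pi_ne_zero
  rw [mul_div_mul_comm, div_eq_mul_inv Complex.I]
  have : (Real.pi : ℂ) * Complex.I * k i * (Complex.I * (Real.pi : ℂ)⁻¹ *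
      ((∑ j, (k j : ℂ) * N j k) / ((∑ j, κ j * (k j : ℝ) ^ 2 : ℝ) : ℂ)))
      = -(k i * ((∑ j, (k j : ℂ) * N j k) / ((∑ j, κ j * (k j : ℝ) ^ 2 : ℝ) : ℂ))) := by
    field_simp
    rw [Complex.I_sq]; ring
  rw [this]
  ring

theorem enorm_leray_le {d : ℕ} {κ : Fin d → ℝ} (hκ : ∀ i, 0 < κ i)
    (N : Fin d → (Fin d → ℤ) → ℂ) (i : Fin d) (k : Fin d → ℤ) :
    ‖leray κ N i k‖ₑ ≤ ENNReal.ofReal (lerayConst κ) * amp N k := by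
  rw [← ofReal_norm]
  refine (ENNReal.ofReal_le_ofReal (norm_leray_le hκ _ i k)).trans ?_
  rw [ENNReal.ofReal_mul (lerayConst_nonneg hκ),
    ENNReal.ofReal_sum_of_nonneg fun _ _ => norm_nonneg _]
  simp only [ofReal_norm, amp, le_refl]

theorem norm_pi_mul_I_mul_int_sq (n : ℤ) :
    ‖(Real.pi * Complex.I * (n : ℂ) : ℂ)‖ ^ 2 = (Real.pi * (n : ℝ)) ^ 2 := by
  simp [mul_pow]

/-- The convective form puts the derivative on the second factor. The transport term is then
estimated in `L²` by `H² · H¹` norms, as regularity of strong solutions requires. -/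
theorem amp_nl_le {d : ℕ} {U : Fin d → (Fin d → ℤ) → ℂ} (hU : ∑' k, amp U k ^ 2 ≠ ∞)
    (hdiv : DivFreeCoef U) (k : Fin d → ℤ) :
    amp (nl U U) k ≤ econv (amp U) (fun k => ENNReal.ofReal (Real.sqrt (wt k)) * amp U k) k := by
  have h1 : ∀ i, ‖nl U U i k‖ₑ ≤ ∑' l, ∑ j, ‖U j l‖ₑ *
      (ENNReal.ofReal (Real.sqrt (wt (k - l))) * ‖U i (k - l)‖ₑ) := by
    intro i
    rw [← (hasSum_nl hU hU hdiv i k).tsum_eq]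
    refine enorm_tsum_le_tsum_enorm.trans (ENNReal.tsum_le_tsum fun l => ?_)
    refine (enorm_sum_le _ _).trans (Finset.sum_le_sum fun j _ => ?_)
    rw [enorm_mul, enorm_mul]
    gcongr
    rw [← ofReal_norm]
    refine ENNReal.ofReal_le_ofReal (Real.le_sqrt_of_sq_le ?_)
    rw [norm_pi_mul_I_mul_int_sq]
    exact sq_pi_mul_le_wt (k - l) j
  refine (Finset.sum_le_sum fun i _ => h1 i).trans (le_of_eq ?_)
  rw [← Summable.tsum_finsetSum fun _ _ => ENNReal.summable, econv]
  refine tsum_congr fun l => ?_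
  simp only [amp, Finset.mul_sum, Finset.sum_mul]

/-- The `L²` norm of the transport term. -/
theorem tsum_amp_nl_sq_le {d : ℕ} (hd : d ≤ 3) {U : Fin d → (Fin d → ℤ) → ℂ}
    (hU : ∑' k, amp U k ^ 2 ≠ ∞) (hdiv : DivFreeCoef U) :
    ∑' k, amp (nl U U) k ^ 2 ≤ ENNReal.ofReal (latticeConst d) *
      ((∑' k, ENNReal.ofReal (wt k ^ 2) * amp U k ^ 2) *
        ∑' k, ENNReal.ofReal (wt k) * amp U k ^ 2) := by
  have h1 := tsum_sq_conv_le hd (amp U) fun k => ENNReal.ofReal (Real.sqrt (wt k)) * amp U k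
  refine (ENNReal.tsum_le_tsum fun k => pow_le_pow_left' (amp_nl_le hU hdiv k) 2).trans
    (h1.trans (le_of_eq ?_))
  congr 2
  refine tsum_congr fun k => ?_
  rw [mul_pow, ← ENNReal.ofReal_pow (Real.sqrt_nonneg _), Real.sq_sqrt (wt_pos k).le]

theorem wt_le_two_mul {d : ℕ} {k : Fin d → ℤ} (hk : k ≠ 0) : wt k ≤ 2 * (wt k - 1) := by
  obtain ⟨i, hi⟩ := Function.ne_iff.mp hk
  have h1 : (1 : ℝ) ≤ (k i : ℝ) ^ 2 := by
    have : (1 : ℤ) ≤ (k i) ^ 2 := Int.one_le_abs hi |>.trans (by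
      rw [← sq_abs]; nlinarith [Int.one_le_abs hi])
    exact_mod_cast this
  have h2 : (1 : ℝ) ≤ (Real.pi * k i) ^ 2 := by
    rw [mul_pow]; nlinarith [one_le_pi_sq]
  have h3 := Finset.single_le_sum (s := Finset.univ) (f := fun i => (Real.pi * (k i : ℝ)) ^ 2)
    (fun i _ => sq_nonneg _) (Finset.mem_univ i)
  rw [wt]
  linarith

theorem exists_kappa_bound {d : ℕ} {κ : Fin d → ℝ} (hκ : ∀ i, 0 < κ i) :
    ∃ c : ℝ, 0 ≤ c ∧ ∀ i, (κ i)⁻¹ ≤ c :=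
  ⟨∑ i, (κ i)⁻¹, Finset.sum_nonneg fun i _ => (inv_pos.mpr (hκ i)).le, fun i =>
    Finset.single_le_sum (f := fun i => (κ i)⁻¹) (fun i _ => (inv_pos.mpr (hκ i)).le)
      (Finset.mem_univ i)⟩

/-- The scaled pressure gradient is the difference of the projected and the unprojected term, so it
is bounded by the latter. The mean is zero, hence the gradient controls the full `H¹` norm. The
constant depends on `κ`, which is harmless for existence. -/
theorem pres_bound {d : ℕ} {κ : Fin d → ℝ} (hκ : ∀ i, 0 < κ i) :
    ∃ C : ℝ≥0∞, C ≠ ∞ ∧ ∀ (N : Fin d → (Fin d → ℤ) → ℂ) (k : Fin d → ℤ),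
      ENNReal.ofReal (wt k) * ‖pres κ N k‖ₑ ^ 2 ≤ C * amp N k ^ 2 := by
  obtain ⟨c, hc0, hc⟩ := exists_kappa_bound hκ
  set B : ℝ≥0∞ := ENNReal.ofReal c * (ENNReal.ofReal (lerayConst κ) + 1) with hB
  refine ⟨2 * d * B ^ 2, ENNReal.mul_ne_top (by simp [ENNReal.mul_eq_top]) (by
    simp [hB, ENNReal.mul_eq_top]), fun N k => ?_⟩
  by_cases hk : k = 0
  · subst hk; simp [pres]
  have h1 : ∀ i, ENNReal.ofReal ((Real.pi * (k i : ℝ)) ^ 2) * ‖pres κ N k‖ₑ ^ 2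
      ≤ (B * amp N k) ^ 2 := by
    intro i
    have h2 : ‖(Real.pi * Complex.I * k i * pres κ N k : ℂ)‖ₑ ≤ B * amp N k := by
      have h3 : (Real.pi * Complex.I * k i * pres κ N k : ℂ)
          = ((κ i)⁻¹ : ℝ) * (leray κ N i k - N i k) := by
        rw [← gradient_pres]
        have : (κ i : ℂ) ≠ 0 := by exact_mod_cast (hκ i).ne'
        push_cast
        field_simp
      rw [h3, enorm_mul, hB, mul_assoc]
      refine mul_le_mul' ?_ ?_
      · rw [← ofReal_norm, Complex.norm_real, Real.norm_of_nonneg (inv_pos.mpr (hκ i)).le]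
        exact ENNReal.ofReal_le_ofReal (hc i)
      · refine enorm_sub_le.trans ?_
        rw [add_mul, one_mul]
        exact add_le_add (enorm_leray_le hκ N i k) (Finset.single_le_sum (f := fun i => ‖N i k‖ₑ)
          (fun _ _ => zero_le) (Finset.mem_univ i))
    refine le_trans (le_of_eq ?_) (pow_le_pow_left' h2 2)
    rw [enorm_mul _ (pres κ N k), mul_pow _ ‖pres κ N k‖ₑ, ← ofReal_norm (Real.pi * Complex.I * k i),
      ← ENNReal.ofReal_pow (norm_nonneg _), norm_pi_mul_I_mul_int_sq]
  calc ENNReal.ofReal (wt k) * ‖pres κ N k‖ₑ ^ 2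
      ≤ ENNReal.ofReal (2 * ∑ i, (Real.pi * (k i : ℝ)) ^ 2) * ‖pres κ N k‖ₑ ^ 2 := by
        gcongr
        refine (wt_le_two_mul hk).trans (le_of_eq ?_)
        rw [wt, add_sub_cancel_left]
    _ = 2 * ∑ i, ENNReal.ofReal ((Real.pi * (k i : ℝ)) ^ 2) * ‖pres κ N k‖ₑ ^ 2 := by
        rw [ENNReal.ofReal_mul zero_le_two, ENNReal.ofReal_ofNat,
          ENNReal.ofReal_sum_of_nonneg fun _ _ => sq_nonneg _, mul_assoc, Finset.sum_mul]
    _ ≤ 2 * ∑ _i : Fin d, (B * amp N k) ^ 2 := by gcongr with i; exact h1 i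
    _ = _ := by
        rw [Finset.sum_const, Finset.card_univ, Fintype.card_fin, nsmul_eq_mul]; ring

theorem visc_le {d : ℕ} (μ : Fin d → ℝ) (k : Fin d → ℤ) : |visc μ k| ≤ (∑ i, |μ i|) * wt k := by
  rw [visc, Finset.sum_mul]
  refine (Finset.abs_sum_le_sum_abs _ _).trans (Finset.sum_le_sum fun i _ => ?_)
  rw [abs_mul, abs_of_nonneg (sq_nonneg (Real.pi * (k i : ℝ)))]
  exact mul_le_mul_of_nonneg_left (sq_pi_mul_le_wt k i) (abs_nonneg _)

theorem aestronglyMeasurable_conv {d : ℕ} {ν : Measure ℝ} {f g : ℝ → (Fin d → ℤ) → ℂ}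
    (hf : ∀ k, AEStronglyMeasurable (fun t => f t k) ν)
    (hg : ∀ k, AEStronglyMeasurable (fun t => g t k) ν) (k : Fin d → ℤ) :
    AEStronglyMeasurable (fun t => conv (f t) (g t) k) ν := by
  simp only [conv]
  exact (AEMeasurable.tsum fun l => ((hf l).mul (hg (k - l))).aemeasurable).aestronglyMeasurable

theorem CoefSol.aesm {d : ℕ} {κ μ : Fin d → ℝ} {T : ℝ}
    {U : ℝ → Fin d → (Fin d → ℤ) → ℂ} (hU : CoefSol κ μ T U) (i : Fin d) (k : Fin d → ℤ) :
    AEStronglyMeasurable (fun t => U t i k) (volume.restrict (Ioo 0 T)) :=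
  ((hU.cont i k).mono Ioo_subset_Icc_self).aestronglyMeasurable measurableSet_Ioo

theorem CoefSol.aesm_nl {d : ℕ} {κ μ : Fin d → ℝ} {T : ℝ}
    {U : ℝ → Fin d → (Fin d → ℤ) → ℂ} (hU : CoefSol κ μ T U) (i : Fin d) (k : Fin d → ℤ) :
    AEStronglyMeasurable (fun t => nl (U t) (U t) i k) (volume.restrict (Ioo 0 T)) := by
  simp only [nl]
  exact (Finset.aestronglyMeasurable_fun_sum _ fun j _ =>
    (aestronglyMeasurable_conv (hU.aesm j) (hU.aesm i) k).const_mul _).const_mul _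

/-- The time derivative of a coefficient solution. -/
def rhs {d : ℕ} (κ μ : Fin d → ℝ) (U : Fin d → (Fin d → ℤ) → ℂ) (i : Fin d) (k : Fin d → ℤ) : ℂ :=
  -(visc μ k * U i k + leray κ (nl U U) i k)

theorem IsRealCoef.rhs {d : ℕ} {κ μ : Fin d → ℝ} {U : Fin d → (Fin d → ℤ) → ℂ}
    (hU : ∀ i, IsRealCoef (U i)) (i : Fin d) : IsRealCoef (rhs κ μ U i) := by
  intro k
  have h : visc μ (-k) = visc μ k := by simp [visc]
  simp only [AnisoNS.rhs, hU i k, IsRealCoef.leray (IsRealCoef.nl hU hU) i k, h, map_neg, map_add,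
    map_mul, Complex.conj_ofReal]

/-- A coefficient solution of a real field with bounded `H¹` norm is a strong solution. -/
theorem CoefSol.exists_strong {d : ℕ} (hd : d ≤ 3) {κ μ : Fin d → ℝ} (hκ : ∀ i, 0 < κ i) {T : ℝ}
    (hT : 0 < T) {U : ℝ → Fin d → (Fin d → ℤ) → ℂ} (hU : CoefSol κ μ T U)
    (hr : ∀ t ∈ Icc 0 T, ∀ i, IsRealCoef (U t i))
    (h1 : ∃ M : ℝ≥0∞, M ≠ ∞ ∧ ∀ t ∈ Icc 0 T, ∑' k, ENNReal.ofReal (wt k) * amp (U t) k ^ 2 ≤ M) :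
    ∃ (u : ℝ → Fin d → L2 d) (p : ℝ → L2 d),
      (∀ t ∈ Icc 0 T, ∀ i k, fourierCoef (u t i) k = U t i k) ∧
      (∀ i, MemE1 T fun t => u t i) ∧
      (∀ i, ∀ᵐ t ∂volume.restrict (Ioo 0 T), HasDerivAt (fun s => u s i) (deriv (fun s => u s i) t) t
        ∧ ∀ k, fourierCoef (deriv (fun s => u s i) t) k = rhs κ μ (U t) i k) ∧
      (∀ᵐ t ∂volume.restrict (Ioo 0 T), ∀ i, MemH 2 (u t i)) ∧
      MemL2H T 1 p ∧
      (∀ᵐ t ∂volume.restrict (Ioo 0 T), ∀ k, fourierCoef (p t) k = pres κ (nl (U t) (U t)) k) ∧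
      ∀ᵐ t ∂volume.restrict (Ioo 0 T), ∀ᵐ x ∂cellMeasure d, ∀ i,
        deriv (fun s => u s i) t x + ∑ j, u t j x * pderiv j (u t i) x
        - (∑ j, μ j • pderiv j (pderiv j (u t i)) : L2 d) x + κ i * pderiv i (p t) x = 0 := by
  obtain ⟨M, hM, hMb⟩ := h1
  obtain ⟨M0, hM0, hM0b⟩ := hU.bdd
  have hfin : ∀ t ∈ Icc 0 T, ∑' k, amp (U t) k ^ 2 ≠ ∞ := fun t ht =>
    ne_top_of_le_ne_top hM0 (hM0b t ht)
  have hsingle : ∀ (W : Fin d → (Fin d → ℤ) → ℂ) i k, ‖W i k‖ₑ ≤ amp W k := fun W i k =>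
    Finset.single_le_sum (f := fun i => ‖W i k‖ₑ) (fun _ _ => zero_le) (Finset.mem_univ i)
  set u : ℝ → Fin d → L2 d := fun t i => synth (U t i) with hu
  have hcoef : ∀ t ∈ Icc 0 T, ∀ i k, fourierCoef (u t i) k = U t i k := fun t ht i k =>
    fourierCoef_synth (tsum_comp_sq_ne_top (hfin t ht) i) (hr t ht i) k
  set p : ℝ → L2 d := fun t => synth (pres κ (nl (U t) (U t))) with hp
  set H : ℝ → ℝ≥0∞ := fun t => ∑' k, ENNReal.ofReal (wt k ^ 2) * amp (U t) k ^ 2 with hH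
  set L : ℝ≥0∞ := ENNReal.ofReal (latticeConst d) with hL
  -- The bounded `H¹` norm leaves only the squared `H²` norm `H`, which is integrable in time.
  -- Pressure gradient and time derivative inherit this.
  have hNL : ∀ t ∈ Ioo 0 T, ∑' k, amp (nl (U t) (U t)) k ^ 2 ≤ L * M * H t := by
    intro t ht
    have ht' := Ioo_subset_Icc_self ht
    refine (tsum_amp_nl_sq_le hd (hfin t ht') (hU.div t ht')).trans ?_
    calc _ ≤ L * (H t * M) := by gcongr; exact hMb t ht'
      _ = _ := by ring
  have hHfin : ∀ c : ℝ≥0∞, c ≠ ∞ → ∫⁻ t in Ioo 0 T, c * H t ≠ ∞ := by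
    intro c hc
    rw [lintegral_const_mul' _ _ hc]
    exact ENNReal.mul_ne_top hc hU.h2.ne
  have hrae : ∀ᵐ t ∂volume.restrict (Ioo 0 T), ∀ i, IsRealCoef (U t i) := by
    filter_upwards [ae_restrict_mem measurableSet_Ioo] with t ht
    exact hr t (Ioo_subset_Icc_self ht)
  have hmp : ∀ k, AEStronglyMeasurable (fun t => pres κ (nl (U t) (U t)) k)
      (volume.restrict (Ioo 0 T)) := by
    intro k
    simp only [pres, div_eq_mul_inv]
    exact ((Finset.aestronglyMeasurable_fun_sum _ fun j _ =>
      (hU.aesm_nl j k).const_mul _).const_mul _).mul_const _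
  have hml : ∀ i k, AEStronglyMeasurable (fun t => rhs κ μ (U t) i k)
      (volume.restrict (Ioo 0 T)) := by
    intro i k
    simp only [rhs, leray, div_eq_mul_inv]
    refine (((hU.aesm i k).const_mul _).add ((hU.aesm_nl i k).sub (AEStronglyMeasurable.mul_const
      (AEStronglyMeasurable.const_mul ?_ _) _))).neg
    exact Finset.aestronglyMeasurable_fun_sum _ fun j _ => (hU.aesm_nl j k).const_mul _
  -- the pressure
  obtain ⟨C, hC, hCb⟩ := pres_bound hκ
  have hpH : ∫⁻ t in Ioo 0 T, ∑' k, ENNReal.ofReal (wt k) * ‖pres κ (nl (U t) (U t)) k‖ₑ ^ 2 ≠ ∞ := by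
    refine ne_top_of_le_ne_top (hHfin (C * (L * M)) (ENNReal.mul_ne_top hC
      (ENNReal.mul_ne_top (by simp [hL]) hM))) (setLIntegral_mono' measurableSet_Ioo fun t ht => ?_)
    refine (ENNReal.tsum_le_tsum fun k => hCb _ k).trans ?_
    rw [ENNReal.tsum_mul_left, mul_assoc]
    gcongr
    exact hNL t ht
  have hpL := memLp_synth hmp (by
      filter_upwards [hrae] with t ht using IsRealCoef.pres (IsRealCoef.nl ht ht))
    (ne_top_of_le_ne_top hpH (lintegral_mono fun t => ENNReal.tsum_le_tsum fun k =>
      le_mul_of_one_le_left zero_le (by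
        rw [ENNReal.one_le_ofReal]; exact one_le_wt k)))
  have hpmem : MemL2H T 1 p := by
    refine ⟨hpL.1.1, ?_⟩
    rw [lqhNorm]
    refine (ENNReal.rpow_lt_top_iff_of_pos (by norm_num)).mpr ?_
    have : ∫⁻ t in Ioo 0 T, hNorm 1 (p t) ^ (2 : ℝ) = ∫⁻ t in Ioo 0 T, 2 ^ d *
        ∑' k, ENNReal.ofReal (wt k) * ‖pres κ (nl (U t) (U t)) k‖ₑ ^ 2 := by
      refine lintegral_congr_ae ?_
      filter_upwards [hpL.2] with t ht
      rw [hNorm_sq_eq]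
      simp only [hp, ht, Real.rpow_one]
    rw [this, lintegral_const_mul' _ _ (by simp)]
    exact ENNReal.mul_lt_top (by simp) hpH.lt_top
  -- the time derivative
  have hg : ∀ i, ∫⁻ t in Ioo 0 T, ∑' k, ‖rhs κ μ (U t) i k‖ₑ ^ 2 ≠ ∞ := by
    intro i
    set A : ℝ≥0∞ := ENNReal.ofReal (∑ i, |μ i|) with hA
    set B : ℝ≥0∞ := ENNReal.ofReal (lerayConst κ) with hB
    refine ne_top_of_le_ne_top (hHfin (4 * (A ^ 2 + B ^ 2 * (L * M))) (ENNReal.mul_ne_top (by simp)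
      (ENNReal.add_ne_top.mpr ⟨by simp [hA], ENNReal.mul_ne_top (by simp [hB])
        (ENNReal.mul_ne_top (by simp [hL]) hM)⟩))) (setLIntegral_mono' measurableSet_Ioo fun t ht => ?_)
    have h2 : ∀ k, ‖rhs κ μ (U t) i k‖ₑ ^ 2 ≤ 4 * (A ^ 2 * (ENNReal.ofReal (wt k ^ 2) * amp (U t) k ^ 2)
        + B ^ 2 * amp (nl (U t) (U t)) k ^ 2) := by
      intro k
      have h3 : ‖rhs κ μ (U t) i k‖ₑ ≤ A * (ENNReal.ofReal (wt k) * amp (U t) k)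
          + B * amp (nl (U t) (U t)) k := by
        rw [rhs, enorm_neg]
        refine (enorm_add_le _ _).trans (add_le_add ?_ (enorm_leray_le hκ _ i k))
        rw [enorm_mul, ← mul_assoc]
        refine mul_le_mul' ?_ (hsingle _ i k)
        rw [← ofReal_norm, Complex.norm_real, hA, ← ENNReal.ofReal_mul
          (Finset.sum_nonneg fun _ _ => abs_nonneg _)]
        exact ENNReal.ofReal_le_ofReal (visc_le μ k)
      refine (pow_le_pow_left' h3 2).trans ((ennreal_add_sq_le _ _).trans (le_of_eq ?_))
      rw [ENNReal.ofReal_pow (wt_pos k).le]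
      ring
    refine (ENNReal.tsum_le_tsum h2).trans ?_
    rw [ENNReal.tsum_mul_left, ENNReal.tsum_add, ENNReal.tsum_mul_left, ENNReal.tsum_mul_left]
    calc _ ≤ 4 * (A ^ 2 * H t + B ^ 2 * (L * M * H t)) := by gcongr; exact hNL t ht
      _ = _ := by ring
  have hgL := fun i => memLp_synth (hml i) (by
    filter_upwards [hrae] with t ht using IsRealCoef.rhs ht i) (hg i)
  set g : Fin d → ℝ → L2 d := fun i t => synth (rhs κ μ (U t) i) with hgdef
  have hgi : ∀ i, IntervalIntegrable (g i) volume 0 T := by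
    intro i
    rw [intervalIntegrable_iff_integrableOn_Ioo_of_le hT.le]
    exact (hgL i).1.integrable one_le_two
  have hui : ∀ i, ∀ t ∈ Icc 0 T, u t i = u 0 i + ∫ s in (0 : ℝ)..t, g i s := by
    intro i t ht
    refine ext_fourierCoef fun k => ?_
    have hsub : uIcc 0 t ⊆ uIcc 0 T := by
      rw [uIcc_of_le ht.1, uIcc_of_le hT.le]; exact Icc_subset_Icc le_rfl ht.2
    rw [fourierCoef_add, hcoef t ht, hcoef 0 ⟨le_rfl, hT.le⟩, ← fourierCoefL_apply,
      ← ContinuousLinearMap.intervalIntegral_comp_comm _ ((hgi i).mono_set hsub), hU.eq t ht,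
      sub_eq_add_neg, ← intervalIntegral.integral_neg]
    congr 1
    refine intervalIntegral.integral_congr_ae ?_
    have := (hgL i).2
    rw [restrict_Ioo_eq_restrict_Ioc, ae_restrict_iff' measurableSet_Ioc] at this
    filter_upwards [this] with s hs hst
    rw [uIoc_of_le ht.1] at hst
    exact (hs ⟨hst.1, hst.2.trans ht.2⟩ k).symm
  have hder : ∀ i, ∀ᵐ t ∂volume.restrict (Ioo 0 T), HasDerivAt (fun s => u s i) (g i t) t := by
    intro i
    rw [ae_restrict_iff' measurableSet_Ioo]
    filter_upwards [(hgi i).ae_hasDerivAt_integral] with t ht htT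
    have h1 := ht (by rw [uIcc_of_le hT.le]; exact Ioo_subset_Icc_self htT) 0 (by simp)
    refine (h1.const_add (u 0 i)).congr_of_eventuallyEq ?_
    filter_upwards [Ioo_mem_nhds htT.1 htT.2] with s hs
    exact hui i s (Ioo_subset_Icc_self hs)
  have hdg : ∀ i, deriv (fun s => u s i) =ᵐ[volume.restrict (Ioo 0 T)] g i := by
    intro i
    filter_upwards [hder i] with t ht using ht.deriv
  have hdc : ∀ i, ∀ᵐ t ∂volume.restrict (Ioo 0 T),
      HasDerivAt (fun s => u s i) (deriv (fun s => u s i) t) t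
        ∧ ∀ k, fourierCoef (deriv (fun s => u s i) t) k = rhs κ μ (U t) i k := by
    intro i
    filter_upwards [hder i, (hgL i).2] with t h1 h2
    rw [h1.deriv]
    exact ⟨h1, h2⟩
  have hH2 : ∀ i, ∀ t ∈ Ioo 0 T, hNorm 2 (u t i) ^ (2 : ℝ) ≤ 2 ^ d * H t := by
    intro i t ht
    rw [hNorm_sq_eq]
    refine mul_le_mul_right (ENNReal.tsum_le_tsum fun k => ?_) _
    rw [Real.rpow_two, hcoef t (Ioo_subset_Icc_self ht)]
    gcongr
    exact hsingle _ i k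
  have hmem : ∀ᵐ t ∂volume.restrict (Ioo 0 T), ∀ i, MemH 2 (u t i) := by
    have hHm : AEMeasurable H (volume.restrict (Ioo 0 T)) :=
      AEMeasurable.tsum fun k => ((hU.aemeasurable_amp k).pow_const 2).const_mul _
    filter_upwards [ae_lt_top' hHm hU.h2.ne, ae_restrict_mem measurableSet_Ioo] with t ht htT i
    refine (ENNReal.rpow_lt_top_iff_of_pos (zero_lt_two' ℝ)).mp ((hH2 i t htT).trans_lt ?_)
    exact ENNReal.mul_lt_top (by simp) ht
  refine ⟨u, p, hcoef, fun i => ⟨⟨?_, ?_⟩, ?_, fun t ht => ?_⟩, hdc, hmem, hpmem, hpL.2, ?_⟩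
  · refine aestronglyMeasurable_of_fourierCoef fun k => (hU.aesm i k).congr ?_
    filter_upwards [ae_restrict_mem measurableSet_Ioo] with t ht
    exact (hcoef t (Ioo_subset_Icc_self ht) i k).symm
  · rw [lqhNorm]
    refine (ENNReal.rpow_lt_top_iff_of_pos (by norm_num)).mpr ?_
    exact (setLIntegral_mono' measurableSet_Ioo fun t ht => hH2 i t ht).trans_lt
      (hHfin _ (by simp)).lt_top
  · exact (memLp_congr_ae (hdg i)).mpr (hgL i).1
  · refine (hui i t ht).trans ?_
    congr 1
    refine intervalIntegral.integral_congr_ae ?_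
    have := hdg i
    rw [Filter.EventuallyEq, restrict_Ioo_eq_restrict_Ioc, ae_restrict_iff' measurableSet_Ioc] at this
    filter_upwards [this] with s hs hst
    rw [uIoc_of_le ht.1] at hst
    exact (hs ⟨hst.1, hst.2.trans ht.2⟩).symm
  · have hpH1 : ∀ᵐ t ∂volume.restrict (Ioo 0 T), MemH 1 (p t) := by
      have hm : AEMeasurable (fun t => ∑' k, ENNReal.ofReal (wt k) *
          ‖pres κ (nl (U t) (U t)) k‖ₑ ^ 2) (volume.restrict (Ioo 0 T)) :=
        AEMeasurable.tsum fun k => ((hmp k).enorm.pow_const 2).const_mul _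
      filter_upwards [ae_lt_top' hm hpH, hpL.2] with t ht htc
      refine (ENNReal.rpow_lt_top_iff_of_pos (zero_lt_two' ℝ)).mp ?_
      rw [hNorm_sq_eq]
      simp only [hp, htc, Real.rpow_one]
      exact ENNReal.mul_lt_top (by simp) ht
    filter_upwards [hmem, hpH1, hpL.2, ae_all_iff.mpr hdc, ae_restrict_mem measurableSet_Ioo] with
      t h2 h3 h4 h5 htT
    have hc : (fun i => fourierCoef (u t i)) = U t := by
      funext i k; exact hcoef t (Ioo_subset_Icc_self htT) i k
    refine (momentum_iff hd h2 h3 (by rw [hc]; exact hU.div t (Ioo_subset_Icc_self htT))).mpr ?_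
    intro i k
    rw [hc, (h5 i).2 k, hcoef t (Ioo_subset_Icc_self htT), h4 k, gradient_pres, rhs]
    ring

/-! ### Estimates for finitely supported coefficient families -/

/-- The square root of the Sobolev weight. -/
def rt {d : ℕ} (k : Fin d → ℤ) : ℝ := Real.sqrt (wt k)

theorem rt_sq {d : ℕ} (k : Fin d → ℤ) : rt k ^ 2 = wt k := Real.sq_sqrt (wt_pos k).le

theorem one_le_rt {d : ℕ} (k : Fin d → ℤ) : 1 ≤ rt k := Real.one_le_sqrt.mpr (one_le_wt k)

theorem rt_pos {d : ℕ} (k : Fin d → ℤ) : 0 < rt k := zero_lt_one.trans_le (one_le_rt k)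

theorem pi_mul_abs_le_rt {d : ℕ} (k : Fin d → ℤ) (i : Fin d) : Real.pi * |(k i : ℝ)| ≤ rt k := by
  refine Real.le_sqrt_of_sq_le ?_
  rw [mul_pow, sq_abs, ← mul_pow]
  exact sq_pi_mul_le_wt k i

theorem abs_le_rt {d : ℕ} (k : Fin d → ℤ) (i : Fin d) : |(k i : ℝ)| ≤ rt k := by
  have := pi_mul_abs_le_rt k i
  nlinarith [Real.pi_gt_three, abs_nonneg (k i : ℝ)]

/-- The squared modulus of a coefficient vector. -/
def nsq (U : Fin 3 → (Fin 3 → ℤ) → ℂ) (k : Fin 3 → ℤ) : ℝ := ∑ i, ‖U i k‖ ^ 2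

/-- The modulus of a coefficient vector. -/
def nrm (U : Fin 3 → (Fin 3 → ℤ) → ℂ) (k : Fin 3 → ℤ) : ℝ := Real.sqrt (nsq U k)

theorem nsq_nonneg (U : Fin 3 → (Fin 3 → ℤ) → ℂ) (k : Fin 3 → ℤ) : 0 ≤ nsq U k :=
  Finset.sum_nonneg fun _ _ => sq_nonneg _

theorem nrm_nonneg (U : Fin 3 → (Fin 3 → ℤ) → ℂ) (k : Fin 3 → ℤ) : 0 ≤ nrm U k := Real.sqrt_nonneg _

theorem nrm_sq (U : Fin 3 → (Fin 3 → ℤ) → ℂ) (k : Fin 3 → ℤ) : nrm U k ^ 2 = nsq U k :=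
  Real.sq_sqrt (nsq_nonneg U k)

theorem norm_le_nrm (U : Fin 3 → (Fin 3 → ℤ) → ℂ) (i : Fin 3) (k : Fin 3 → ℤ) :
    ‖U i k‖ ≤ nrm U k :=
  Real.le_sqrt_of_sq_le (Finset.single_le_sum (f := fun i => ‖U i k‖ ^ 2)
    (fun _ _ => sq_nonneg _) (Finset.mem_univ i))

/-- A weighted energy. -/
def wsum (B : Finset (Fin 3 → ℤ)) (w : (Fin 3 → ℤ) → ℝ) (U : Fin 3 → (Fin 3 → ℤ) → ℂ) : ℝ :=
  ∑ k ∈ B, w k * nsq U k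

theorem wsum_nonneg {B : Finset (Fin 3 → ℤ)} {w : (Fin 3 → ℤ) → ℝ} (hw : ∀ k, 0 ≤ w k)
    (U : Fin 3 → (Fin 3 → ℤ) → ℂ) : 0 ≤ wsum B w U :=
  Finset.sum_nonneg fun k _ => mul_nonneg (hw k) (nsq_nonneg U k)

/-- Coefficients supported in a finite set. -/
def SuppIn (B : Finset (Fin 3 → ℤ)) (U : Fin 3 → (Fin 3 → ℤ) → ℂ) : Prop :=
  ∀ i, ∀ k ∉ B, U i k = 0

theorem SuppIn.nrm {B : Finset (Fin 3 → ℤ)} {U : Fin 3 → (Fin 3 → ℤ) → ℂ} (h : SuppIn B U)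
    {k : Fin 3 → ℤ} (hk : k ∉ B) : nrm U k = 0 := by
  simp [AnisoNS.nrm, nsq, h _ k hk]

theorem SuppIn.amp_ne_top {B : Finset (Fin 3 → ℤ)} {U : Fin 3 → (Fin 3 → ℤ) → ℂ}
    (h : SuppIn B U) : ∑' k, amp U k ^ 2 ≠ ∞ := by
  rw [tsum_eq_sum (s := B) fun k hk => by simp [amp, h _ k hk]]
  exact ENNReal.sum_ne_top.mpr fun k _ => by simp [amp]

theorem SuppIn.sub {B : Finset (Fin 3 → ℤ)} {U V : Fin 3 → (Fin 3 → ℤ) → ℂ} (hU : SuppIn B U)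
    (hV : SuppIn B V) : SuppIn B (U - V) := fun i k hk => by simp [hU i k hk, hV i k hk]

theorem DivFreeCoef.sub {d : ℕ} {U V : Fin d → (Fin d → ℤ) → ℂ} (hU : DivFreeCoef U)
    (hV : DivFreeCoef V) : DivFreeCoef (U - V) := fun k => by
  simp only [Pi.sub_apply, mul_sub, Finset.sum_sub_distrib, hU k, hV k, sub_zero]

/-- The energy controlling the quadratic terms. -/
def crit (B : Finset (Fin 3 → ℤ)) (U : Fin 3 → (Fin 3 → ℤ) → ℂ) : ℝ := wsum B (fun k => rt k ^ 3) U

theorem crit_nonneg (B : Finset (Fin 3 → ℤ)) (U : Fin 3 → (Fin 3 → ℤ) → ℂ) : 0 ≤ crit B U :=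
  wsum_nonneg (fun k => pow_nonneg (rt_pos k).le 3) U

/-- The case `H^{3/2} · H^{1/2} ⊆ L²` of the product estimate, with the derivative on the second
factor; both fields are then measured in `H^{3/2}`. -/
theorem sum_sq_conv_rt_le (B B' : Finset (Fin 3 → ℤ)) {U V : Fin 3 → (Fin 3 → ℤ) → ℂ}
    (hV : SuppIn B V) :
    ∑ k ∈ B', (∑ l ∈ B, nrm U l * (rt (k - l) * nrm V (k - l))) ^ 2
      ≤ 2 * latticeConst 3 * (crit B U * crit B V) := by
  have h := sum_sq_conv_le (d := 3) le_rfl (a := 3 / 2) (b := 1 / 2) (by norm_num) (by norm_num)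
    (by norm_num) B B' (nrm U) (fun k => rt k * nrm V k) (fun k hk => by simp [hV.nrm hk])
  refine h.trans (le_of_eq ?_)
  have e1 : ∀ k : Fin 3 → ℤ, wt k ^ (1 / 2 : ℝ) = rt k := fun k => (Real.sqrt_eq_rpow _).symm
  have e2 : ∀ k : Fin 3 → ℤ, wt k ^ (3 / 2 : ℝ) = rt k ^ 3 := fun k => by
    rw [← e1, ← Real.rpow_natCast, ← Real.rpow_mul (wt_pos k).le]; norm_num
  simp only [e1, e2, mul_pow, nrm_sq, crit, wsum]
  congr 2
  exact Finset.sum_congr rfl fun k _ => by ring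

theorem sum_sq_vert_rt_le (B B' : Finset (Fin 3 → ℤ)) {U V : Fin 3 → (Fin 3 → ℤ) → ℂ}
    (hV : SuppIn B V) :
    ∑ k ∈ B', (|(k 2 : ℝ)|⁻¹ * ∑ l ∈ B, (rt l * nrm U l) * (rt (k - l) * nrm V (k - l))) ^ 2
      ≤ 4 * vertConst * (crit B U * crit B V) := by
  have h := sum_sq_vert_conv_le B B' (fun k => rt k * nrm U k) (fun k => rt k * nrm V k)
    (fun k hk => by simp [hV.nrm hk])
  refine h.trans (le_of_eq ?_)
  simp only [mul_pow, nrm_sq, crit, wsum, ← rt.eq_def]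
  congr 2 <;> exact Finset.sum_congr rfl fun k _ => by ring

theorem SuppIn.conv_eq {B : Finset (Fin 3 → ℤ)} {U : Fin 3 → (Fin 3 → ℤ) → ℂ} (hU : SuppIn B U)
    (j : Fin 3) (g : (Fin 3 → ℤ) → ℂ) (k : Fin 3 → ℤ) :
    conv (U j) g k = ∑ l ∈ B, U j l * g (k - l) := by
  rw [conv, tsum_eq_sum (s := B) fun l hl => by rw [hU j l hl, zero_mul]]

theorem nl_eq_sum {B : Finset (Fin 3 → ℤ)} {U V : Fin 3 → (Fin 3 → ℤ) → ℂ} (hU : SuppIn B U)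
    (hdiv : DivFreeCoef U) (i : Fin 3) (k : Fin 3 → ℤ) :
    nl U V i k = Real.pi * Complex.I * ∑ l ∈ B, ∑ j, (((k - l) j : ℤ) : ℂ) * U j l * V i (k - l) := by
  simp only [nl, hU.conv_eq, Finset.mul_sum]
  rw [Finset.sum_comm]
  refine Finset.sum_congr rfl fun l _ => ?_
  have h1 : ∑ j, (Real.pi * Complex.I * ((k j : ℂ) * (U j l * V i (k - l)))
      - Real.pi * Complex.I * ((((k - l) j : ℤ) : ℂ) * U j l * V i (k - l)))
      = Real.pi * Complex.I * V i (k - l) * ∑ j, (l j : ℂ) * U j l := by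
    rw [Finset.mul_sum]
    refine Finset.sum_congr rfl fun j _ => ?_
    rw [Pi.sub_apply]; push_cast; ring
  rw [hdiv l, mul_zero, Finset.sum_sub_distrib, sub_eq_zero] at h1
  exact h1

theorem norm_nl_le {B : Finset (Fin 3 → ℤ)} {U V : Fin 3 → (Fin 3 → ℤ) → ℂ} (hU : SuppIn B U)
    (hdiv : DivFreeCoef U) (i : Fin 3) (k : Fin 3 → ℤ) :
    ‖nl U V i k‖ ≤ 3 * ∑ l ∈ B, nrm U l * (rt (k - l) * nrm V (k - l)) := by
  rw [nl_eq_sum hU hdiv, norm_mul, norm_mul, Complex.norm_I, mul_one, Complex.norm_real,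
    Real.norm_of_nonneg Real.pi_pos.le]
  calc _ ≤ Real.pi * ∑ l ∈ B, ∑ j, |(((k - l) j : ℤ) : ℝ)| * ‖U j l‖ * ‖V i (k - l)‖ := by
        refine mul_le_mul_of_nonneg_left ((norm_sum_le _ _).trans (Finset.sum_le_sum fun l _ =>
          (norm_sum_le _ _).trans (le_of_eq ?_))) Real.pi_pos.le
        simp only [norm_mul, Complex.norm_intCast]
    _ = ∑ l ∈ B, ∑ j, (Real.pi * |(((k - l) j : ℤ) : ℝ)|) * ‖U j l‖ * ‖V i (k - l)‖ := by
        simp only [Finset.mul_sum, mul_assoc]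
    _ ≤ ∑ l ∈ B, ∑ _j : Fin 3, rt (k - l) * nrm U l * nrm V (k - l) := by
        gcongr with l _ j _
        · exact mul_nonneg (rt_pos _).le (nrm_nonneg _ _)
        · exact (rt_pos _).le
        · exact pi_mul_abs_le_rt _ _
        · exact norm_le_nrm U j l
        · exact norm_le_nrm V i _
    _ = _ := by
        rw [Finset.mul_sum]
        refine Finset.sum_congr rfl fun l _ => ?_
        rw [Finset.sum_const, Finset.card_univ, Fintype.card_fin, nsmul_eq_mul]
        push_cast; ring

/-- For solenoidal fields `div (u·∇v) = ∑ ∂ᵢuⱼ ∂ⱼvᵢ`: no factor carries two derivatives.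
Solenoidality of `V` is what lets `kᵢ` be replaced by `lᵢ`. -/
theorem norm_div_nl_le {B : Finset (Fin 3 → ℤ)} {U V : Fin 3 → (Fin 3 → ℤ) → ℂ} (hU : SuppIn B U)
    (hdiv : DivFreeCoef U) (hdivV : DivFreeCoef V) (k : Fin 3 → ℤ) :
    ‖∑ i, (k i : ℂ) * nl U V i k‖
      ≤ 9 * ∑ l ∈ B, (rt l * nrm U l) * (rt (k - l) * nrm V (k - l)) := by
  have h1 : ∑ i, (k i : ℂ) * nl U V i k = Real.pi * Complex.I * ∑ l ∈ B, ∑ i, ∑ j,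
      (((k - l) j : ℤ) : ℂ) * U j l * ((l i : ℂ) * V i (k - l)) := by
    simp only [nl_eq_sum hU hdiv, Finset.mul_sum]
    rw [Finset.sum_comm]
    refine Finset.sum_congr rfl fun l _ => ?_
    have h2 : ∑ i, ∑ j, ((k i : ℂ) * (Real.pi * Complex.I *
          ((((k - l) j : ℤ) : ℂ) * U j l * V i (k - l)))
        - Real.pi * Complex.I * ((((k - l) j : ℤ) : ℂ) * U j l * ((l i : ℂ) * V i (k - l))))
        = (Real.pi * Complex.I * ∑ j, (((k - l) j : ℤ) : ℂ) * U j l)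
          * ∑ i, (((k - l) i : ℤ) : ℂ) * V i (k - l) := by
      rw [Finset.mul_sum (a := Real.pi * Complex.I * ∑ j, (((k - l) j : ℤ) : ℂ) * U j l)]
      simp only [Finset.mul_sum, Finset.sum_mul]
      refine Finset.sum_congr rfl fun i _ => Finset.sum_congr rfl fun j _ => ?_
      simp only [Pi.sub_apply]; push_cast; ring
    rw [hdivV (k - l), mul_zero] at h2
    simp only [Finset.sum_sub_distrib, sub_eq_zero] at h2
    exact h2
  rw [h1, norm_mul, norm_mul, Complex.norm_I, mul_one, Complex.norm_real,
    Real.norm_of_nonneg Real.pi_pos.le]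
  calc _ ≤ Real.pi * ∑ l ∈ B, ∑ i, ∑ j, |(((k - l) j : ℤ) : ℝ)| * ‖U j l‖ *
          (|(l i : ℝ)| * ‖V i (k - l)‖) := by
        refine mul_le_mul_of_nonneg_left ((norm_sum_le _ _).trans (Finset.sum_le_sum fun l _ =>
          (norm_sum_le _ _).trans (Finset.sum_le_sum fun i _ =>
            (norm_sum_le _ _).trans (le_of_eq ?_)))) Real.pi_pos.le
        simp only [norm_mul, Complex.norm_intCast]
    _ = ∑ l ∈ B, ∑ i, ∑ j, (Real.pi * |(((k - l) j : ℤ) : ℝ)|) * ‖U j l‖ *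
          (|(l i : ℝ)| * ‖V i (k - l)‖) := by
        simp only [Finset.mul_sum, mul_assoc]
    _ ≤ ∑ l ∈ B, ∑ _i : Fin 3, ∑ _j : Fin 3, rt (k - l) * nrm U l * (rt l * nrm V (k - l)) := by
        gcongr with l _ i _ j _
        · exact mul_nonneg (rt_pos _).le (nrm_nonneg _ _)
        · exact (rt_pos _).le
        · exact pi_mul_abs_le_rt _ _
        · exact norm_le_nrm U j l
        · exact (rt_pos _).le
        · exact abs_le_rt l i
        · exact norm_le_nrm V i _
    _ = _ := by
        rw [Finset.mul_sum]
        refine Finset.sum_congr rfl fun l _ => ?_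
        simp only [Finset.sum_const, Finset.card_univ, Fintype.card_fin, nsmul_eq_mul]
        push_cast; ring

/-- The constant of the bilinear estimates. -/
def bilConst : ℝ := 2000 * (latticeConst 3 + vertConst) + 1

theorem bilConst_pos : 0 < bilConst := by
  have h1 := latticeConst_nonneg 3
  have h2 := vertConst_nonneg
  rw [bilConst]; positivity

theorem sum_nl_sq_le {B B' : Finset (Fin 3 → ℤ)} {U V : Fin 3 → (Fin 3 → ℤ) → ℂ} (hU : SuppIn B U)
    (hV : SuppIn B V) (hdiv : DivFreeCoef U) :
    ∑ k ∈ B', nsq (nl U V) k ≤ bilConst * (crit B U * crit B V) := by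
  have h := sum_sq_conv_rt_le B B' (U := U) hV
  have h0 := mul_nonneg (crit_nonneg B U) (crit_nonneg B V)
  calc ∑ k ∈ B', nsq (nl U V) k
      ≤ ∑ k ∈ B', ∑ _i : Fin 3, (3 * ∑ l ∈ B, nrm U l * (rt (k - l) * nrm V (k - l))) ^ 2 :=
        Finset.sum_le_sum fun k _ => Finset.sum_le_sum fun i _ =>
          pow_le_pow_left₀ (norm_nonneg _) (norm_nl_le hU hdiv i k) 2
    _ = 27 * ∑ k ∈ B', (∑ l ∈ B, nrm U l * (rt (k - l) * nrm V (k - l))) ^ 2 := by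
        rw [Finset.mul_sum]
        refine Finset.sum_congr rfl fun k _ => ?_
        simp only [Finset.sum_const, Finset.card_univ, Fintype.card_fin, nsmul_eq_mul]
        push_cast; ring
    _ ≤ 27 * (2 * latticeConst 3 * (crit B U * crit B V)) := by gcongr
    _ ≤ _ := by
        rw [bilConst]
        nlinarith [mul_nonneg (latticeConst_nonneg 3) h0, mul_nonneg vertConst_nonneg h0]

/-- The admissible coefficients of the pressure gradient. -/
structure Admissible (κ : Fin 3 → ℝ) : Prop where
  zero : κ 0 = 1
  one : κ 1 = 1
  two : 1 ≤ κ 2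

theorem Admissible.pos {κ : Fin 3 → ℝ} (h : Admissible κ) (i : Fin 3) : 0 < κ i := by
  fin_cases i
  · simp [h.zero]
  · simp [h.one]
  · exact zero_lt_one.trans_le h.two

/-- The multiplier `κᵢ |kᵢ| / ∑ κⱼ kⱼ²` is at most `|k₂|⁻¹`: for `i = 2` by dropping the horizontal
terms, for horizontal `i` by Young's inequality and `κ₂ ≥ 1`. Nothing depends on the size of `κ₂`,
so the bound is uniform in `ε ≤ 1`. -/
theorem norm_leray_le_vert {κ : Fin 3 → ℝ} (hκ : Admissible κ) (N : Fin 3 → (Fin 3 → ℤ) → ℂ)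
    (i : Fin 3) {k : Fin 3 → ℤ} (hk : k 2 ≠ 0) :
    ‖leray κ N i k‖ ≤ ‖N i k‖ + |(k 2 : ℝ)|⁻¹ * ‖∑ j, (k j : ℂ) * N j k‖ := by
  have hm : (0 : ℝ) < |(k 2 : ℝ)| := abs_pos.mpr (by exact_mod_cast hk)
  have hS : 0 < ∑ j, κ j * (k j : ℝ) ^ 2 :=
    Finset.sum_pos' (fun j _ => mul_nonneg (hκ.pos j).le (sq_nonneg _))
      ⟨2, Finset.mem_univ 2, mul_pos (hκ.pos 2) (by rw [← sq_abs]; positivity)⟩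
  have h1 : κ i * |(k i : ℝ)| * |(k 2 : ℝ)| ≤ ∑ j, κ j * (k j : ℝ) ^ 2 := by
    rw [Fin.sum_univ_three, hκ.zero, hκ.one]
    have h2 := hκ.two
    have a0 := sq_abs (k 0 : ℝ)
    have a1 := sq_abs (k 1 : ℝ)
    have a2 := sq_abs (k 2 : ℝ)
    have hp := mul_nonneg (sub_nonneg.mpr h2) (sq_nonneg (k 2 : ℝ))
    fin_cases i
    · simp only [Fin.zero_eta, hκ.zero]
      nlinarith [sq_nonneg (|(k 0 : ℝ)| - |(k 2 : ℝ)|), sq_nonneg (k 0 : ℝ), sq_nonneg (k 1 : ℝ),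
        sq_nonneg (k 2 : ℝ)]
    · simp only [Fin.mk_one, hκ.one]
      nlinarith [sq_nonneg (|(k 1 : ℝ)| - |(k 2 : ℝ)|), sq_nonneg (k 0 : ℝ), sq_nonneg (k 1 : ℝ),
        sq_nonneg (k 2 : ℝ)]
    · simp only [Fin.reduceFinMk]
      nlinarith [sq_nonneg (k 0 : ℝ), sq_nonneg (k 1 : ℝ)]
  rw [leray]
  refine (norm_sub_le _ _).trans (add_le_add le_rfl ?_)
  rw [norm_div, norm_mul, norm_mul, Complex.norm_real, Complex.norm_real, Complex.norm_intCast,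
    Real.norm_of_nonneg hS.le, Real.norm_of_nonneg (hκ.pos i).le, mul_div_right_comm]
  refine mul_le_mul_of_nonneg_right ?_ (norm_nonneg _)
  rw [div_le_iff₀ hS, inv_mul_eq_div, le_div_iff₀ hm]
  exact h1

/-- The first term in `norm_leray_le_vert` is handled by `H^{3/2} · H^{1/2} ⊆ L²`, the second by
`∂_z⁻¹ (H^{1/2} · H^{1/2}) ⊆ L²` because the divergence spreads the derivatives over both factors.
The constant is independent of `κ`. -/
theorem sum_leray_sq_le {κ : Fin 3 → ℝ} (hκ : Admissible κ) {B B' : Finset (Fin 3 → ℤ)}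
    {U V : Fin 3 → (Fin 3 → ℤ) → ℂ} (hU : SuppIn B U) (hV : SuppIn B V) (hdiv : DivFreeCoef U)
    (hdivV : DivFreeCoef V) :
    ∑ k ∈ B' with k 2 ≠ 0, nsq (leray κ (nl U V)) k ≤ bilConst * (crit B U * crit B V) := by
  have h := sum_sq_conv_rt_le B (B'.filter fun k => k 2 ≠ 0) (U := U) hV
  have h' := sum_sq_vert_rt_le B (B'.filter fun k => k 2 ≠ 0) (U := U) hV
  have h0 := mul_nonneg (crit_nonneg B U) (crit_nonneg B V)
  set f : (Fin 3 → ℤ) → ℝ := fun k => ∑ l ∈ B, nrm U l * (rt (k - l) * nrm V (k - l)) with hf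
  set g : (Fin 3 → ℤ) → ℝ := fun k => |(k 2 : ℝ)|⁻¹ *
    ∑ l ∈ B, (rt l * nrm U l) * (rt (k - l) * nrm V (k - l)) with hg
  calc ∑ k ∈ B' with k 2 ≠ 0, nsq (leray κ (nl U V)) k
      ≤ ∑ k ∈ B' with k 2 ≠ 0, ∑ _i : Fin 3, (18 * f k ^ 2 + 162 * g k ^ 2) := by
        refine Finset.sum_le_sum fun k hk => Finset.sum_le_sum fun i _ => ?_
        have hk2 := (Finset.mem_filter.mp hk).2
        have h1 : ‖leray κ (nl U V) i k‖ ≤ 3 * f k + 9 * g k := by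
          refine (norm_leray_le_vert hκ _ i hk2).trans (add_le_add (norm_nl_le hU hdiv i k) ?_)
          rw [hg, mul_left_comm]
          exact mul_le_mul_of_nonneg_left (norm_div_nl_le hU hdiv hdivV k) (by positivity)
        refine (pow_le_pow_left₀ (norm_nonneg _) h1 2).trans ?_
        nlinarith [sq_nonneg (3 * f k - 9 * g k)]
    _ = 54 * ∑ k ∈ B' with k 2 ≠ 0, f k ^ 2 + 486 * ∑ k ∈ B' with k 2 ≠ 0, g k ^ 2 := by
        rw [Finset.mul_sum, Finset.mul_sum, ← Finset.sum_add_distrib]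
        refine Finset.sum_congr rfl fun k _ => ?_
        simp only [Finset.sum_const, Finset.card_univ, Fintype.card_fin, nsmul_eq_mul]
        push_cast; ring
    _ ≤ 54 * (2 * latticeConst 3 * (crit B U * crit B V))
        + 486 * (4 * vertConst * (crit B U * crit B V)) := by gcongr
    _ ≤ _ := by
        rw [bilConst]
        nlinarith [mul_nonneg (latticeConst_nonneg 3) h0, mul_nonneg vertConst_nonneg h0]

/-! ### Barotropic and baroclinic coefficients -/

/-- The barotropic modes. -/
def bt (U : Fin 3 → (Fin 3 → ℤ) → ℂ) (i : Fin 3) (k : Fin 3 → ℤ) : ℂ := if k 2 = 0 then U i k else 0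

/-- The baroclinic modes. -/
def bc (U : Fin 3 → (Fin 3 → ℤ) → ℂ) (i : Fin 3) (k : Fin 3 → ℤ) : ℂ := if k 2 = 0 then 0 else U i k

theorem bt_add_bc (U : Fin 3 → (Fin 3 → ℤ) → ℂ) : bt U + bc U = U := by
  funext i k
  by_cases hk : k 2 = 0 <;> simp [bt, bc, hk]

theorem SuppIn.bt {B : Finset (Fin 3 → ℤ)} {U : Fin 3 → (Fin 3 → ℤ) → ℂ} (h : SuppIn B U) :
    SuppIn B (bt U) := fun i k hk => by simp [AnisoNS.bt, h i k hk]

theorem SuppIn.bc {B : Finset (Fin 3 → ℤ)} {U : Fin 3 → (Fin 3 → ℤ) → ℂ} (h : SuppIn B U) :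
    SuppIn B (bc U) := fun i k hk => by simp [AnisoNS.bc, h i k hk]

theorem DivFreeCoef.bt {U : Fin 3 → (Fin 3 → ℤ) → ℂ} (h : DivFreeCoef U) :
    DivFreeCoef (bt U) := fun k => by
  by_cases hk : k 2 = 0
  · simpa [AnisoNS.bt, hk] using h k
  · simp [AnisoNS.bt, hk]

theorem DivFreeCoef.bc {U : Fin 3 → (Fin 3 → ℤ) → ℂ} (h : DivFreeCoef U) :
    DivFreeCoef (bc U) := fun k => by
  by_cases hk : k 2 = 0
  · simp [AnisoNS.bc, hk]
  · simpa [AnisoNS.bc, hk] using h k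

theorem nl_add_add {B : Finset (Fin 3 → ℤ)} {U U' : Fin 3 → (Fin 3 → ℤ) → ℂ} (hU : SuppIn B U)
    (hU' : SuppIn B U') (V V' : Fin 3 → (Fin 3 → ℤ) → ℂ) (i : Fin 3) (k : Fin 3 → ℤ) :
    nl (U + U') (V + V') i k = nl U V i k + nl U V' i k + (nl U' V i k + nl U' V' i k) := by
  have hs : SuppIn B (U + U') := fun i k hk => by simp [hU i k hk, hU' i k hk]
  simp only [nl, hU.conv_eq, hU'.conv_eq, hs.conv_eq, ← mul_add, ← Finset.sum_add_distrib]
  congr 1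
  refine Finset.sum_congr rfl fun j _ => ?_
  congr 1
  simp only [Pi.add_apply]
  exact Finset.sum_congr rfl fun l _ => by ring

/-- Vertical frequencies add in a convolution. This and the next two lemmas list the combinations of
barotropic and baroclinic factors that cannot reach a given vertical frequency. -/
theorem nl_bt_bt_eq_zero (U V : Fin 3 → (Fin 3 → ℤ) → ℂ) (i : Fin 3) {k : Fin 3 → ℤ} (hk : k 2 ≠ 0) :
    nl (bt U) (bt V) i k = 0 := by
  have h : ∀ j, conv (bt U j) (bt V i) k = 0 := by
    intro j
    rw [conv]
    refine (tsum_congr fun l => ?_).trans tsum_zero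
    by_cases hl : l 2 = 0
    · have : (k - l) 2 ≠ 0 := by simpa [hl] using hk
      rw [bt, bt, if_neg this, mul_zero]
    · simp [bt, hl]
  simp [nl, h]

theorem nl_bt_bc_eq_zero (U V : Fin 3 → (Fin 3 → ℤ) → ℂ) (i : Fin 3) {k : Fin 3 → ℤ} (hk : k 2 = 0) :
    nl (bt U) (bc V) i k = 0 := by
  have h : ∀ j, conv (bt U j) (bc V i) k = 0 := by
    intro j
    rw [conv]
    refine (tsum_congr fun l => ?_).trans tsum_zero
    by_cases hl : l 2 = 0
    · have : (k - l) 2 = 0 := by simp [hl, hk]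
      simp [bc, this]
    · simp [bt, hl]
  simp [nl, h]

theorem nl_bc_bt_eq_zero (U V : Fin 3 → (Fin 3 → ℤ) → ℂ) (i : Fin 3) {k : Fin 3 → ℤ} (hk : k 2 = 0) :
    nl (bc U) (bt V) i k = 0 := by
  have h : ∀ j, conv (bc U j) (bt V i) k = 0 := by
    intro j
    rw [conv]
    refine (tsum_congr fun l => ?_).trans tsum_zero
    by_cases hl : l 2 = 0
    · simp [bc, hl]
    · have : (k - l) 2 ≠ 0 := by simpa [hk] using hl
      rw [bt, if_neg this, mul_zero]
  simp [nl, h]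

theorem nl_barotropic {B : Finset (Fin 3 → ℤ)} {U : Fin 3 → (Fin 3 → ℤ) → ℂ} (hU : SuppIn B U)
    (i : Fin 3) {k : Fin 3 → ℤ} (hk : k 2 = 0) :
    nl U U i k = nl (bt U) (bt U) i k + nl (bc U) (bc U) i k := by
  conv_lhs => rw [← bt_add_bc U]
  rw [nl_add_add hU.bt hU.bc, nl_bt_bc_eq_zero _ _ _ hk, nl_bc_bt_eq_zero _ _ _ hk, add_zero,
    zero_add]

theorem nl_baroclinic {B : Finset (Fin 3 → ℤ)} {U : Fin 3 → (Fin 3 → ℤ) → ℂ} (hU : SuppIn B U)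
    (i : Fin 3) {k : Fin 3 → ℤ} (hk : k 2 ≠ 0) :
    nl U U i k = nl (bt U) (bc U) i k + nl (bc U) (bt U) i k + nl (bc U) (bc U) i k := by
  conv_lhs => rw [← bt_add_bc U]
  rw [nl_add_add hU.bt hU.bc, nl_bt_bt_eq_zero _ _ _ hk, zero_add, add_assoc]

theorem leray_congr {d : ℕ} {κ : Fin d → ℝ} {N N' : Fin d → (Fin d → ℤ) → ℂ} {k : Fin d → ℤ}
    (h : ∀ i, N i k = N' i k) (i : Fin d) : leray κ N i k = leray κ N' i k := by
  simp only [leray, h]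

theorem leray_add {d : ℕ} (κ : Fin d → ℝ) (N N' : Fin d → (Fin d → ℤ) → ℂ) (i : Fin d)
    (k : Fin d → ℤ) : leray κ (N + N') i k = leray κ N i k + leray κ N' i k := by
  simp only [leray, Pi.add_apply, mul_add, Finset.sum_add_distrib]
  ring

theorem nsq_add_le (U V : Fin 3 → (Fin 3 → ℤ) → ℂ) (k : Fin 3 → ℤ) :
    nsq (U + V) k ≤ 2 * (nsq U k + nsq V k) := by
  simp only [nsq, ← Finset.sum_add_distrib, Finset.mul_sum]
  refine Finset.sum_le_sum fun i _ => ?_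
  refine (pow_le_pow_left₀ (norm_nonneg _) (norm_add_le _ _) 2).trans ?_
  nlinarith [sq_nonneg (‖U i k‖ - ‖V i k‖)]

/-- The baroclinic part of the projected transport term. -/
theorem sum_leray_baroclinic_le {κ : Fin 3 → ℝ} (hκ : Admissible κ) {B : Finset (Fin 3 → ℤ)}
    {U : Fin 3 → (Fin 3 → ℤ) → ℂ} (hU : SuppIn B U) (hdiv : DivFreeCoef U) :
    ∑ k ∈ B with k 2 ≠ 0, nsq (leray κ (nl U U)) k
      ≤ 8 * bilConst * ((crit B (bt U) + crit B (bc U)) * crit B (bc U)) := by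
  have h1 := sum_leray_sq_le hκ (B' := B) hU.bt hU.bc hdiv.bt hdiv.bc
  have h2 := sum_leray_sq_le hκ (B' := B) hU.bc hU.bt hdiv.bc hdiv.bt
  have h3 := sum_leray_sq_le hκ (B' := B) hU.bc hU.bc hdiv.bc hdiv.bc
  have h4 : ∀ k ∈ B.filter (fun k => k 2 ≠ 0), nsq (leray κ (nl U U)) k
      ≤ 4 * nsq (leray κ (nl (bt U) (bc U))) k + 4 * nsq (leray κ (nl (bc U) (bt U))) k
        + 2 * nsq (leray κ (nl (bc U) (bc U))) k := by
    intro k hk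
    have hk2 := (Finset.mem_filter.mp hk).2
    have e : nsq (leray κ (nl U U)) k = nsq ((leray κ (nl (bt U) (bc U))
        + leray κ (nl (bc U) (bt U))) + leray κ (nl (bc U) (bc U))) k := by
      simp only [nsq, Pi.add_apply, ← leray_add]
      refine Finset.sum_congr rfl fun i _ => ?_
      rw [leray_congr (fun i => ?_) i]
      exact nl_baroclinic hU i hk2
    rw [e]
    have a1 := nsq_add_le (leray κ (nl (bt U) (bc U)) + leray κ (nl (bc U) (bt U)))
      (leray κ (nl (bc U) (bc U))) k
    have a2 := nsq_add_le (leray κ (nl (bt U) (bc U))) (leray κ (nl (bc U) (bt U))) k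
    linarith
  refine (Finset.sum_le_sum h4).trans ?_
  rw [Finset.sum_add_distrib, Finset.sum_add_distrib, ← Finset.mul_sum, ← Finset.mul_sum,
    ← Finset.mul_sum]
  have h0 := mul_nonneg bilConst_pos.le (mul_nonneg (crit_nonneg B (bc U)) (crit_nonneg B (bc U)))
  nlinarith

/-! ### Cancellation of the two-dimensional transport term -/

/-- Detailed conservation of energy and enstrophy for one triad of plane waves. Each solenoidal mode
is a rotated gradient `s (-a₁, a₀)`; after elimination of the third frequency the claim is a
polynomial identity. A zero frequency has no stream function and is treated apart. -/
theorem triad_identity {p a0 a1 b0 b1 c0 c1 xa ya xb yb xc yc : ℂ}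
    (h0 : a0 + b0 + c0 = 0) (h1 : a1 + b1 + c1 = 0)
    (ha : (a0 = 0 ∧ a1 = 0) ∨ ∃ s, xa = -s * a1 ∧ ya = s * a0)
    (hb : (b0 = 0 ∧ b1 = 0) ∨ ∃ s, xb = -s * b1 ∧ yb = s * b0)
    (hc : (c0 = 0 ∧ c1 = 0) ∨ ∃ s, xc = -s * c1 ∧ yc = s * c0) :
    (1 + p * (a0 ^ 2 + a1 ^ 2)) * (a0 * xb + a1 * yb) * (xa * xc + ya * yc)
      + (1 + p * (a0 ^ 2 + a1 ^ 2)) * (a0 * xc + a1 * yc) * (xa * xb + ya * yb)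
      + (1 + p * (b0 ^ 2 + b1 ^ 2)) * (b0 * xa + b1 * ya) * (xb * xc + yb * yc)
      + (1 + p * (b0 ^ 2 + b1 ^ 2)) * (b0 * xc + b1 * yc) * (xb * xa + yb * ya)
      + (1 + p * (c0 ^ 2 + c1 ^ 2)) * (c0 * xa + c1 * ya) * (xc * xb + yc * yb)
      + (1 + p * (c0 ^ 2 + c1 ^ 2)) * (c0 * xb + c1 * yb) * (xc * xa + yc * ya) = 0 := by
  obtain rfl : c0 = -a0 - b0 := by linear_combination h0
  obtain rfl : c1 = -a1 - b1 := by linear_combination h1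
  rcases hc with ⟨hc0, hc1⟩ | ⟨s, rfl, rfl⟩
  · obtain rfl : b0 = -a0 := by linear_combination -hc0
    obtain rfl : b1 = -a1 := by linear_combination -hc1
    rcases ha with ⟨rfl, rfl⟩ | ⟨s, rfl, rfl⟩
    · ring
    · rcases hb with ⟨hb0, hb1⟩ | ⟨s', rfl, rfl⟩
      · rw [neg_eq_zero] at hb0 hb1
        subst hb0 hb1
        ring
      · ring
  · rcases ha with ⟨rfl, rfl⟩ | ⟨s, rfl, rfl⟩
    · rcases hb with ⟨rfl, rfl⟩ | ⟨s', rfl, rfl⟩ <;> ring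
    · rcases hb with ⟨rfl, rfl⟩ | ⟨s', rfl, rfl⟩ <;> ring

theorem exists_stream {a0 a1 : ℤ} {x y : ℂ} (h : (a0 : ℂ) * x + a1 * y = 0) :
    ((a0 : ℂ) = 0 ∧ (a1 : ℂ) = 0) ∨ ∃ s : ℂ, x = -s * a1 ∧ y = s * a0 := by
  by_cases h0 : a0 = 0
  · by_cases h1 : a1 = 0
    · left; simp [h0, h1]
    · right
      have h1' : (a1 : ℂ) ≠ 0 := by exact_mod_cast h1
      refine ⟨-x / a1, by field_simp, ?_⟩
      simp only [h0, Int.cast_zero, zero_mul, zero_add, mul_eq_zero, h1', false_or] at h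
      simp [h0, h]
  · right
    have h0' : (a0 : ℂ) ≠ 0 := by exact_mod_cast h0
    refine ⟨y / a0, ?_, by field_simp⟩
    field_simp
    linear_combination h

/-- The sum is invariant under permutations of the three indices, so it equals its own
symmetrisation. -/
theorem sum_triads_eq_zero {ι : Type*} (B : Finset ι) (F : ι → ι → ι → ℂ)
    (h : ∀ a b c, F a b c + F a c b + F b a c + F b c a + F c a b + F c b a = 0) :
    ∑ a ∈ B, ∑ b ∈ B, ∑ c ∈ B, F a b c = 0 := by
  have h1 : ∑ a ∈ B, ∑ b ∈ B, ∑ c ∈ B, F a c b = ∑ a ∈ B, ∑ b ∈ B, ∑ c ∈ B, F a b c :=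
    Finset.sum_congr rfl fun a _ => Finset.sum_comm
  have h2 : ∑ a ∈ B, ∑ b ∈ B, ∑ c ∈ B, F b a c = ∑ a ∈ B, ∑ b ∈ B, ∑ c ∈ B, F a b c :=
    Finset.sum_comm
  have h3 : ∑ a ∈ B, ∑ b ∈ B, ∑ c ∈ B, F b c a = ∑ a ∈ B, ∑ b ∈ B, ∑ c ∈ B, F a b c := by
    rw [← h1, Finset.sum_comm]
  have h4 : ∑ a ∈ B, ∑ b ∈ B, ∑ c ∈ B, F c a b = ∑ a ∈ B, ∑ b ∈ B, ∑ c ∈ B, F a b c := by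
    rw [← h2]
    exact Finset.sum_congr rfl fun a _ => Finset.sum_comm
  have h5 : ∑ a ∈ B, ∑ b ∈ B, ∑ c ∈ B, F c b a = ∑ a ∈ B, ∑ b ∈ B, ∑ c ∈ B, F a b c := by
    rw [← h4, Finset.sum_comm]
  have h6 : ∑ a ∈ B, ∑ b ∈ B, ∑ c ∈ B,
      (F a b c + F a c b + F b a c + F b c a + F c a b + F c b a) = 0 := by simp [h]
  simp only [Finset.sum_add_distrib] at h6
  rw [h1, h2, h3, h4, h5] at h6
  linear_combination h6 / 6

/-- In two dimensions `u·∇u` is orthogonal to `u` and to `Δu`; the weight `wt` combines both. The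
cancellation takes place inside each triad and therefore survives truncation to a symmetric set of
frequencies. -/
theorem barotropic_cancellation {B : Finset (Fin 3 → ℤ)} (hB : ∀ k, -k ∈ B ↔ k ∈ B)
    {W : Fin 3 → (Fin 3 → ℤ) → ℂ} (hW : SuppIn B W) (hdiv : DivFreeCoef W)
    (hr : ∀ i, IsRealCoef (W i)) (hb : ∀ i k, k 2 ≠ 0 → W i k = 0) (h2 : ∀ k, W 2 k = 0) :
    ∑ k ∈ B, (wt k : ℂ) * ∑ i, conj (W i k) * nl W W i k = 0 := by
  set F : (Fin 3 → ℤ) → (Fin 3 → ℤ) → (Fin 3 → ℤ) → ℂ := fun a b c =>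
    if a + b + c = 0 then
      (wt a : ℂ) * (∑ j, (a j : ℂ) * W j b) * ∑ i, W i a * W i c else 0 with hF
  have hcf : ∀ i j a, conv (W j) (W i) (-a)
      = ∑ b ∈ B, ∑ c ∈ B, if a + b + c = 0 then W j b * W i c else 0 := by
    intro i j a
    rw [hW.conv_eq]
    refine Finset.sum_congr rfl fun b _ => ?_
    have : ∀ c, (a + b + c = 0) ↔ (c = -a - b) := fun c => by
      constructor
      · intro h; rw [eq_sub_iff_add_eq, eq_neg_iff_add_eq_zero, ← h]; abel
      · rintro rfl; abel
    simp only [this, Finset.sum_ite_eq']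
    split_ifs with hc
    · rfl
    · rw [hW i _ hc, mul_zero]
  -- Reality turns the conjugate at `k` into the coefficient at `a = -k`, so that the three
  -- frequencies of a triad enter symmetrically through `a + b + c = 0`.
  have h1 : ∑ k ∈ B, (wt k : ℂ) * ∑ i, conj (W i k) * nl W W i k
      = -(Real.pi * Complex.I) * ∑ a ∈ B, ∑ b ∈ B, ∑ c ∈ B, F a b c := by
    rw [Finset.mul_sum]
    refine Finset.sum_bij' (fun k _ => -k) (fun k _ => -k) (fun k hk => (hB k).mpr hk)
      (fun k hk => (hB k).mpr hk) (fun k _ => neg_neg k) (fun k _ => neg_neg k) fun k _ => ?_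
    have hw : wt (-k) = wt k := by simp [wt]
    have hnl : ∀ i, nl W W i k = -(Real.pi * Complex.I) * ∑ b ∈ B, ∑ c ∈ B,
        ∑ j, if -k + b + c = 0 then (((-k) j : ℤ) : ℂ) * (W j b * W i c) else 0 := by
      intro i
      have h3 : ∀ j, conv (W j) (W i) k
          = ∑ b ∈ B, ∑ c ∈ B, if -k + b + c = 0 then W j b * W i c else 0 := by
        intro j
        rw [← hcf i j (-k), neg_neg]
      simp only [nl, h3]
      rw [neg_mul, ← mul_neg]
      congr 1
      simp only [Finset.mul_sum, ← Finset.sum_neg_distrib]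
      rw [Finset.sum_comm]
      refine Finset.sum_congr rfl fun b _ => ?_
      rw [Finset.sum_comm]
      refine Finset.sum_congr rfl fun c _ => Finset.sum_congr rfl fun j _ => ?_
      split_ifs <;> simp
    simp only [hnl, hF, hw, ← hr _ k]
    simp only [Finset.mul_sum]
    rw [Finset.sum_comm]
    refine Finset.sum_congr rfl fun b _ => ?_
    rw [Finset.sum_comm]
    refine Finset.sum_congr rfl fun c _ => ?_
    split_ifs
    · simp only [Finset.mul_sum, Finset.sum_mul]
      refine Finset.sum_congr rfl fun i _ => Finset.sum_congr rfl fun j _ => ?_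
      ring
    · simp
  rw [h1, sum_triads_eq_zero B F fun a b c => ?_, mul_zero]
  have hcomm : ∀ x y z : Fin 3 → ℤ, x + y + z = a + b + c →
      (F x y z = if a + b + c = 0 then
        (wt x : ℂ) * (∑ j, (x j : ℂ) * W j y) * ∑ i, W i x * W i z else 0) := by
    intro x y z h
    simp only [hF, h]
  rw [hcomm a b c rfl, hcomm a c b (by abel), hcomm b a c (by abel), hcomm b c a (by abel),
    hcomm c a b (by abel), hcomm c b a (by abel)]
  split_ifs with habc
  swap
  · simp
  by_cases ha2 : a 2 ≠ 0
  · simp [hb _ a ha2]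
  by_cases hb2 : b 2 ≠ 0
  · simp [hb _ b hb2]
  by_cases hc2 : c 2 ≠ 0
  · simp [hb _ c hc2]
  rw [not_not] at ha2 hb2 hc2
  have hd : ∀ k, (k 0 : ℂ) * W 0 k + k 1 * W 1 k = 0 := fun k => by
    have := hdiv k
    rwa [Fin.sum_univ_three, h2, mul_zero, add_zero] at this
  have hz : ∀ i, ((a i : ℤ) : ℂ) + b i + c i = 0 := fun i => by
    have := congrFun habc i
    simp only [Pi.add_apply, Pi.zero_apply] at this
    exact_mod_cast this
  have hwt : ∀ k : Fin 3 → ℤ, k 2 = 0 → (wt k : ℂ) = 1 + (Real.pi : ℂ) ^ 2 * ((k 0 : ℂ) ^ 2 + (k 1 : ℂ) ^ 2) := by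
    intro k hk
    rw [wt, Fin.sum_univ_three, hk]
    push_cast; ring
  have key := triad_identity (p := (Real.pi : ℂ) ^ 2) (hz 0) (hz 1) (exists_stream (hd a))
    (exists_stream (hd b)) (exists_stream (hd c))
  simp only [Fin.sum_univ_three, h2, hwt a ha2, hwt b hb2, hwt c hc2, mul_zero, add_zero]
  exact key

/-! ### Differential inequalities for the Galerkin approximation -/

/-- Twice the real part of the inner product, that is, the derivative of the squared modulus. -/
def pair (X Y : Fin 3 → (Fin 3 → ℤ) → ℂ) (k : Fin 3 → ℤ) : ℝ :=
  ∑ i, 2 * (conj (X i k) * Y i k).re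

/-- Young's inequality. The damping contributes `-2l` times the squared modulus, half of which is
spent on absorbing the forcing. -/
theorem pair_le {X Y : Fin 3 → (Fin 3 → ℤ) → ℂ} {P : Fin 3 → ℂ} {l : ℝ} (hl : 0 < l)
    {k : Fin 3 → ℤ} (hY : ∀ i, Y i k = -(l * X i k + P i)) :
    pair X Y k ≤ -(l * nsq X k) + l⁻¹ * ∑ i, ‖P i‖ ^ 2 := by
  rw [pair, nsq, Finset.mul_sum, Finset.mul_sum, ← Finset.sum_neg_distrib, ← Finset.sum_add_distrib]
  refine Finset.sum_le_sum fun i _ => ?_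
  have e : conj (X i k) * Y i k = ((-(l * ‖X i k‖ ^ 2) : ℝ) : ℂ) - conj (X i k) * P i := by
    rw [hY]
    push_cast
    rw [← Complex.conj_mul']
    ring
  have h1 : |(conj (X i k) * P i).re| ≤ ‖X i k‖ * ‖P i‖ := by
    refine (Complex.abs_re_le_norm _).trans ?_
    rw [norm_mul, Complex.norm_conj]
  rw [e, Complex.sub_re, Complex.ofReal_re]
  have h2 := (abs_le.mp h1).1
  have h3 : 0 ≤ l⁻¹ * (l * ‖X i k‖ - ‖P i‖) ^ 2 := by positivity
  have h4 : l⁻¹ * (l * ‖X i k‖ - ‖P i‖) ^ 2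
      = l * ‖X i k‖ ^ 2 - 2 * (‖X i k‖ * ‖P i‖) + l⁻¹ * ‖P i‖ ^ 2 := by
    field_simp; ring
  linarith

/-- The viscosities `(1, 1, δ)`. -/
def aniso (δ : ℝ) : Fin 3 → ℝ := ![1, 1, δ]

theorem visc_aniso_of_eq_zero (δ : ℝ) {k : Fin 3 → ℤ} (hk : k 2 = 0) :
    visc (aniso δ) k = wt k - 1 := by
  simp [visc, wt, Fin.sum_univ_three, aniso, hk]

/-- For `k₂ ≠ 0` the vertical viscosity alone is at least `9δ`, which pays for `√δ`, for the
constant in the weight and for the vertical part of the weight. This is the gain that drives the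
convergence as `δ → ∞`. -/
theorem add_sq_le_visc {δ : ℝ} (hδ : 1 ≤ δ) {k : Fin 3 → ℤ} (hk : k 2 ≠ 0) :
    (rt k + Real.sqrt δ) ^ 2 ≤ 4 * visc (aniso δ) k := by
  have h1 := rt_sq k
  have h2 := Real.sq_sqrt (zero_le_one.trans hδ)
  have h3 : (1 : ℝ) ≤ (k 2 : ℝ) ^ 2 := by
    have : (1 : ℤ) ≤ (k 2) ^ 2 := Int.one_le_abs hk |>.trans (by
      rw [← sq_abs]; nlinarith [Int.one_le_abs hk])
    exact_mod_cast this
  have h4 : (9 : ℝ) ≤ (Real.pi * (k 2 : ℝ)) ^ 2 := by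
    rw [mul_pow]; nlinarith [Real.pi_gt_three, sq_nonneg (Real.pi - 3)]
  have h5 : visc (aniso δ) k = (Real.pi * (k 0 : ℝ)) ^ 2 + (Real.pi * (k 1 : ℝ)) ^ 2
      + δ * (Real.pi * (k 2 : ℝ)) ^ 2 := by
    simp [visc, Fin.sum_univ_three, aniso]
  have h6 : wt k = 1 + ((Real.pi * (k 0 : ℝ)) ^ 2 + (Real.pi * (k 1 : ℝ)) ^ 2
      + (Real.pi * (k 2 : ℝ)) ^ 2) := by
    simp [wt, Fin.sum_univ_three]
  rw [h5]
  nlinarith [sq_nonneg (rt k - Real.sqrt δ), sq_nonneg (Real.pi * (k 0 : ℝ)),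
    sq_nonneg (Real.pi * (k 1 : ℝ)), mul_nonneg (sub_nonneg.mpr hδ) (sub_nonneg.mpr h4)]

/-- The weight of the baroclinic energy. -/
def bcw (δ : ℝ) (k : Fin 3 → ℤ) : ℝ := rt k ^ 3 / (rt k + Real.sqrt δ)

theorem rt_add_sqrt_pos (δ : ℝ) (k : Fin 3 → ℤ) : 0 < rt k + Real.sqrt δ :=
  add_pos_of_pos_of_nonneg (rt_pos k) (Real.sqrt_nonneg δ)

theorem bcw_pos (δ : ℝ) (k : Fin 3 → ℤ) : 0 < bcw δ k :=
  div_pos (pow_pos (rt_pos k) 3) (rt_add_sqrt_pos δ k)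

theorem nsq_bt (U : Fin 3 → (Fin 3 → ℤ) → ℂ) (k : Fin 3 → ℤ) :
    nsq (bt U) k = if k 2 = 0 then nsq U k else 0 := by
  by_cases hk : k 2 = 0 <;> simp [nsq, bt, hk]

theorem nsq_bc (U : Fin 3 → (Fin 3 → ℤ) → ℂ) (k : Fin 3 → ℤ) :
    nsq (bc U) k = if k 2 = 0 then 0 else nsq U k := by
  by_cases hk : k 2 = 0 <;> simp [nsq, bc, hk]

theorem pair_bc (U Y : Fin 3 → (Fin 3 → ℤ) → ℂ) (k : Fin 3 → ℤ) :
    pair (bc U) Y k = if k 2 = 0 then 0 else pair U Y k := by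
  by_cases hk : k 2 = 0 <;> simp [pair, bc, hk]

theorem pair_bt (U Y : Fin 3 → (Fin 3 → ℤ) → ℂ) (k : Fin 3 → ℤ) :
    pair (bt U) Y k = if k 2 = 0 then pair U Y k else 0 := by
  by_cases hk : k 2 = 0 <;> simp [pair, bt, hk]

/-- The projected transport term is bounded in plain `L²`, so the forcing in the weighted energy
balance is affordable precisely when the weight is at most a constant times the viscosity symbol. -/
theorem baroclinic_energy_le {κ : Fin 3 → ℝ} (hκ : Admissible κ) {δ : ℝ} (hδ : 1 ≤ δ)
    {B : Finset (Fin 3 → ℤ)} {U : Fin 3 → (Fin 3 → ℤ) → ℂ} (hU : SuppIn B U)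
    (hdiv : DivFreeCoef U) :
    ∑ k ∈ B, bcw δ k * pair (bc U) (rhs κ (aniso δ) U) k
      ≤ -wsum B (fun k => bcw δ k * visc (aniso δ) k) (bc U)
        + 32 * bilConst * ((crit B (bt U) + crit B (bc U)) * crit B (bc U)) := by
  have h1 := sum_leray_baroclinic_le hκ hU hdiv
  have h2 : ∀ k ∈ B, bcw δ k * pair (bc U) (rhs κ (aniso δ) U) k
      ≤ -(bcw δ k * visc (aniso δ) k * nsq (bc U) k)
        + if k 2 ≠ 0 then 4 * nsq (leray κ (nl U U)) k else 0 := by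
    intro k _
    by_cases hk : k 2 = 0
    · simp [pair_bc, nsq_bc, hk]
    rw [pair_bc, nsq_bc, if_neg hk, if_neg hk, if_pos hk]
    have hr := rt_pos k
    have hq := rt_add_sqrt_pos δ k
    have h3 := add_sq_le_visc hδ hk
    have hl : 0 < visc (aniso δ) k := by nlinarith [pow_pos hq 2]
    have h4 := pair_le (X := U) (Y := rhs κ (aniso δ) U) (P := fun i => leray κ (nl U U) i k) hl
      (k := k) fun i => rfl
    -- The weight is at most `(rt k + √δ)²`, which the viscosity symbol controls up to the factor 4.
    have h5 : bcw δ k * (visc (aniso δ) k)⁻¹ ≤ 4 := by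
      rw [bcw, ← div_eq_mul_inv, div_div, div_le_iff₀ (mul_pos hq hl)]
      have h6 : rt k ≤ rt k + Real.sqrt δ := le_add_of_nonneg_right (Real.sqrt_nonneg δ)
      calc rt k ^ 3 ≤ (rt k + Real.sqrt δ) ^ 3 := pow_le_pow_left₀ hr.le h6 3
        _ = (rt k + Real.sqrt δ) * (rt k + Real.sqrt δ) ^ 2 := by ring
        _ ≤ (rt k + Real.sqrt δ) * (4 * visc (aniso δ) k) := by gcongr
        _ = _ := by ring
    have h7 := mul_le_mul_of_nonneg_left h4 (bcw_pos δ k).le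
    have h8 := mul_le_mul_of_nonneg_right h5 (nsq_nonneg (leray κ (nl U U)) k)
    rw [← nsq.eq_def (leray κ (nl U U))] at h7
    nlinarith
  refine (Finset.sum_le_sum h2).trans ?_
  rw [Finset.sum_add_distrib, Finset.sum_neg_distrib, ← Finset.sum_filter, ← Finset.mul_sum, wsum]
  linarith

/-- At `k₂ = 0` the scaled pressure gradient is an ordinary horizontal gradient, orthogonal to
solenoidal fields, since `κ` differs from 1 only in the vertical slot. -/
theorem sum_conj_mul_leray {κ : Fin 3 → ℝ} (hκ : Admissible κ) {X : Fin 3 → (Fin 3 → ℤ) → ℂ}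
    (hX : DivFreeCoef X) (N : Fin 3 → (Fin 3 → ℤ) → ℂ) {k : Fin 3 → ℤ} (hk : k 2 = 0) :
    ∑ i, conj (X i k) * leray κ N i k = ∑ i, conj (X i k) * N i k := by
  have h1 := hX k
  rw [Fin.sum_univ_three, hk, Int.cast_zero, zero_mul, add_zero] at h1
  have h2 := congrArg conj h1
  simp only [map_add, map_mul, map_intCast, map_zero] at h2
  simp only [leray, mul_sub, Finset.sum_sub_distrib, sub_eq_self]
  generalize ((∑ j, κ j * (k j : ℝ) ^ 2 : ℝ) : ℂ) = S
  simp only [Fin.sum_univ_three, hκ.zero, hκ.one, hk, Int.cast_zero, mul_zero, zero_mul, zero_div,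
    add_zero, Complex.ofReal_one, one_mul]
  linear_combination ((↑(k 0) * N 0 k + ↑(k 1) * N 1 k) / S) * h2

theorem sum_conj_mul_eq_pair (X Y : Fin 3 → (Fin 3 → ℤ) → ℂ) (k : Fin 3 → ℤ) :
    pair X Y k = 2 * (∑ i, conj (X i k) * Y i k).re := by
  rw [pair, Complex.re_sum, Finset.mul_sum]

theorem pair_rhs_barotropic {κ : Fin 3 → ℝ} (hκ : Admissible κ) (δ : ℝ)
    {X U : Fin 3 → (Fin 3 → ℤ) → ℂ} (hX : DivFreeCoef X) {k : Fin 3 → ℤ} (hk : k 2 = 0) :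
    pair X (rhs κ (aniso δ) U) k
      = pair X (fun i k => -((wt k - 1 : ℝ) * U i k + nl U U i k)) k := by
  rw [sum_conj_mul_eq_pair, sum_conj_mul_eq_pair]
  congr 2
  simp only [rhs, visc_aniso_of_eq_zero δ hk, mul_neg, mul_add, Finset.sum_neg_distrib,
    Finset.sum_add_distrib, sum_conj_mul_leray hκ hX _ hk]

theorem pair_add (X Y Z : Fin 3 → (Fin 3 → ℤ) → ℂ) (k : Fin 3 → ℤ) :
    pair X (Y + Z) k = pair X Y k + pair X Z k := by
  simp only [pair, Pi.add_apply, mul_add, Complex.add_re, Finset.sum_add_distrib]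

theorem inv_wt_sub_one_mul_le {k : Fin 3 → ℤ} (hk : k ≠ 0) : wt k * (wt k - 1)⁻¹ ≤ 2 := by
  have h1 := wt_sub_one_pos hk
  rw [← div_eq_mul_inv, div_le_iff₀ h1]
  exact wt_le_two_mul hk

theorem wt_zero {d : ℕ} : wt (0 : Fin d → ℤ) = 1 := by simp [wt]

/-- Absorption of a forcing term without mean in the barotropic equation. -/
theorem wt_mul_pair_le {X Y : Fin 3 → (Fin 3 → ℤ) → ℂ} {P : Fin 3 → ℂ}
    {k : Fin 3 → ℤ} (hY : ∀ i, Y i k = -(((wt k - 1 : ℝ) : ℂ) * X i k + P i))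
    (hP : k = 0 → ∀ i, P i = 0) :
    wt k * pair X Y k ≤ -(wt k * (wt k - 1) * nsq X k) + 2 * ∑ i, ‖P i‖ ^ 2 := by
  by_cases hk : k = 0
  · have : ∀ i, Y i k = 0 := fun i => by rw [hY, hP hk]; simp [hk, wt_zero]
    have h0 : pair X Y k = 0 := by simp [pair, this]
    have h1 : wt k - 1 = 0 := by rw [hk, wt_zero, sub_self]
    rw [h0, h1, mul_zero, zero_mul, neg_zero, zero_add]
    exact mul_nonneg zero_le_two (Finset.sum_nonneg fun i _ => sq_nonneg _)
  · have h1 := wt_sub_one_pos hk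
    have h2 := pair_le h1 hY
    have h3 := mul_le_mul_of_nonneg_left h2 (wt_pos k).le
    have h4 := mul_le_mul_of_nonneg_right (inv_wt_sub_one_mul_le hk)
      (Finset.sum_nonneg (s := Finset.univ) fun i _ => sq_nonneg ‖P i‖)
    nlinarith

/-- The self-interaction cancels and mixed terms cannot reach `k₂ = 0`, so only baroclinic times
baroclinic remains as forcing. It has no mean and is absorbed by the dissipation. -/
theorem barotropic_energy_le {κ : Fin 3 → ℝ} (hκ : Admissible κ) (δ : ℝ)
    {B : Finset (Fin 3 → ℤ)} (hB : ∀ k, -k ∈ B ↔ k ∈ B) {U : Fin 3 → (Fin 3 → ℤ) → ℂ}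
    (hU : SuppIn B U) (hdiv : DivFreeCoef U) (hr : ∀ i, IsRealCoef (U i)) (hp : ParityCoef U) :
    ∑ k ∈ B, wt k * pair (bt U) (rhs κ (aniso δ) U) k
      ≤ -wsum B (fun k => wt k * (wt k - 1)) (bt U) + 2 * bilConst * crit B (bc U) ^ 2 := by
  -- The vertical velocity is odd in `z`, so its vertical average vanishes: the barotropic part is a
  -- genuinely two-dimensional field.
  have h2 : ∀ k, bt U 2 k = 0 := by
    intro k
    by_cases hk : k 2 = 0
    · have h3 := hp 2 k
      have h4 : reflFreq k = k := by funext i; fin_cases i <;> simp [reflFreq, hk]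
      rw [h4] at h3
      have h5 : U 2 k = -U 2 k := by simpa [paritySign] using h3
      have h6 : U 2 k = 0 := by linear_combination h5 / 2
      simp [bt, hk, h6]
    · simp [bt, hk]
  have hbr : ∀ i, IsRealCoef (bt U i) := by
    intro i k
    by_cases hk : k 2 = 0
    · simpa [bt, hk] using hr i k
    · simp [bt, hk]
  have hc := barotropic_cancellation hB hU.bt hdiv.bt hbr (fun i k hk => by simp [bt, hk]) h2
  have hc' : ∑ k ∈ B, wt k * pair (bt U) (-nl (bt U) (bt U)) k = 0 := by
    have := congrArg Complex.re hc
    rw [Complex.re_sum] at this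
    simp only [Complex.re_ofReal_mul, Complex.zero_re] at this
    simp only [sum_conj_mul_eq_pair, Pi.neg_apply, mul_neg, Finset.sum_neg_distrib, Complex.neg_re]
    rw [neg_eq_zero, ← mul_zero (2 : ℝ), ← this, Finset.mul_sum]
    exact Finset.sum_congr rfl fun k _ => by ring
  have h1 := sum_nl_sq_le (B' := B) hU.bc hU.bc hdiv.bc
  have h3 : ∀ k ∈ B, wt k * pair (bt U) (rhs κ (aniso δ) U) k
      ≤ -(wt k * (wt k - 1) * nsq (bt U) k) + 2 * nsq (nl (bc U) (bc U)) k
        + wt k * pair (bt U) (-nl (bt U) (bt U)) k := by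
    intro k _
    by_cases hk : k 2 = 0
    swap
    · rw [pair_bt, pair_bt, nsq_bt, if_neg hk, if_neg hk, if_neg hk]
      have := nsq_nonneg (nl (bc U) (bc U)) k
      linarith
    have e : pair (bt U) (rhs κ (aniso δ) U) k = pair (bt U)
        ((fun i k => -((wt k - 1 : ℝ) * bt U i k + nl (bc U) (bc U) i k)) + -nl (bt U) (bt U)) k := by
      rw [pair_rhs_barotropic hκ δ hdiv.bt hk]
      refine Finset.sum_congr rfl fun i _ => ?_
      simp only [Pi.add_apply, Pi.neg_apply]
      rw [nl_barotropic hU i hk]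
      have : bt U i k = U i k := by simp [bt, hk]
      rw [this]
      congr 3
      ring
    rw [e, pair_add, mul_add]
    refine add_le_add (wt_mul_pair_le (fun i => rfl) fun h i => ?_) le_rfl
    rw [h, nl_zero_freq]
  refine (Finset.sum_le_sum h3).trans ?_
  rw [Finset.sum_add_distrib, Finset.sum_add_distrib, hc', Finset.sum_neg_distrib, ← Finset.mul_sum,
    wsum]
  nlinarith

/-- The equation for the difference of barotropic fields. -/
theorem difference_energy_le {κ : Fin 3 → ℝ} (hκ : Admissible κ) (δ : ℝ)
    {B : Finset (Fin 3 → ℤ)} {U V : Fin 3 → (Fin 3 → ℤ) → ℂ}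
    (hU : SuppIn B U) (hdiv : DivFreeCoef U) (hV : SuppIn B V) (hdivV : DivFreeCoef V)
    (hVb : bt V = V) :
    ∑ k ∈ B, wt k * pair (bt U - V) (rhs κ (aniso δ) U - rhs κ (aniso δ) V) k
      ≤ -wsum B (fun k => wt k * (wt k - 1)) (bt U - V) + 8 * bilConst *
        (crit B (bt U - V) * (crit B (bt U) + crit B V) + crit B (bc U) ^ 2) := by
  have hD := hU.bt.sub hV
  have hdD := hdiv.bt.sub hdivV
  have hbD : bt (bt U - V) = bt U - V := by
    rw [← hVb]; funext i k; by_cases hk : k 2 = 0 <;> simp [bt, hk]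
  set D := bt U - V with hDdef
  have h1 := sum_nl_sq_le (B' := B) hU.bc hU.bc hdiv.bc
  have h2 := sum_nl_sq_le (B' := B) hD hU.bt hdD
  have h3 := sum_nl_sq_le (B' := B) hV hD hdivV
  -- No cancellation is used for the difference. Two of the terms are linear in `D`; the third is
  -- the baroclinic forcing.
  have hdec : ∀ i, ∀ k : Fin 3 → ℤ, k 2 = 0 → nl U U i k - nl V V i k
      = ((nl D (bt U) + nl V D) + nl (bc U) (bc U)) i k := by
    intro i k hk
    rw [nl_barotropic hU i hk, add_sub_right_comm, nl_sub hU.bt.amp_ne_top hV.amp_ne_top]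
    rfl
  have h4 : ∀ k ∈ B, wt k * pair D (rhs κ (aniso δ) U - rhs κ (aniso δ) V) k
      ≤ -(wt k * (wt k - 1) * nsq D k) + (8 * nsq (nl D (bt U)) k + 8 * nsq (nl V D) k
        + 4 * nsq (nl (bc U) (bc U)) k) := by
    intro k _
    have hn1 := nsq_add_le (nl D (bt U) + nl V D) (nl (bc U) (bc U)) k
    have hn2 := nsq_add_le (nl D (bt U)) (nl V D) k
    by_cases hk : k 2 = 0
    swap
    · have e1 : pair D (rhs κ (aniso δ) U - rhs κ (aniso δ) V) k = 0 := by
        rw [← hbD, pair_bt, if_neg hk]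
      have e2 : nsq D k = 0 := by rw [← hbD, nsq_bt, if_neg hk]
      rw [e1, e2]
      have a1 := nsq_nonneg (nl D (bt U)) k
      have a2 := nsq_nonneg (nl V D) k
      have a3 := nsq_nonneg (nl (bc U) (bc U)) k
      linarith
    have e : pair D (rhs κ (aniso δ) U - rhs κ (aniso δ) V) k = pair D
        (fun i k => -((wt k - 1 : ℝ) * D i k + ((nl D (bt U) + nl V D) + nl (bc U) (bc U)) i k)) k := by
      have a1 := pair_rhs_barotropic hκ δ (U := U) hdD hk
      have a2 := pair_rhs_barotropic hκ δ (U := V) hdD hk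
      have a3 : pair D (rhs κ (aniso δ) U - rhs κ (aniso δ) V) k
          = pair D (rhs κ (aniso δ) U) k - pair D (rhs κ (aniso δ) V) k := by
        simp only [pair, Pi.sub_apply, mul_sub, Complex.sub_re, Finset.sum_sub_distrib]
      rw [a3, a1, a2, pair, pair, pair, ← Finset.sum_sub_distrib]
      refine Finset.sum_congr rfl fun i _ => ?_
      rw [← hdec i k hk, ← mul_sub, ← Complex.sub_re, ← mul_sub]
      congr 3
      have : D i k = U i k - V i k := by simp [hDdef, bt, hk]
      rw [this]
      ring
    rw [e]
    refine (wt_mul_pair_le (fun i => rfl) fun h i => ?_).trans ?_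
    · simp only [h, Pi.add_apply, nl_zero_freq, add_zero]
    · rw [← nsq.eq_def]
      linarith
  refine (Finset.sum_le_sum h4).trans ?_
  rw [Finset.sum_add_distrib, Finset.sum_neg_distrib, Finset.sum_add_distrib, Finset.sum_add_distrib,
    ← Finset.mul_sum, ← Finset.mul_sum, ← Finset.mul_sum, wsum]
  have h0 := mul_nonneg bilConst_pos.le (mul_nonneg (crit_nonneg B (bc U)) (crit_nonneg B (bc U)))
  nlinarith

/-! ### Global solutions of ordinary differential equations with a priori bounds -/

/-- Picard-Lindelöf on a ball of radius `L T`, which a curve of speed at most `L` cannot leave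
before time `T`. Constant extension makes the solution continuous on all of `ℝ`. -/
theorem exists_solution_of_bounded_lipschitz {E : Type*} [NormedAddCommGroup E] [NormedSpace ℝ E]
    [CompleteSpace E] {G : E → E} {K : NNReal} (hG : LipschitzWith K G) {L : NNReal}
    (hL : ∀ x, ‖G x‖ ≤ L) {T : ℝ} (hT : 0 ≤ T) (x₀ : E) :
    ∃ x : ℝ → E, Continuous x ∧ x 0 = x₀ ∧ ∀ t ∈ Ioo 0 T, HasDerivAt x (G (x t)) t := by
  have hP : IsPicardLindelof (fun _ => G) (tmin := 0) (tmax := T) ⟨0, le_rfl, hT⟩ x₀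
      (L * T.toNNReal) 0 L K :=
    IsPicardLindelof.of_time_independent (fun x _ => hL x) hG.lipschitzOnWith (by simp [hT])
  obtain ⟨α, h0, hα⟩ := hP.exists_eq_forall_mem_Icc_hasDerivWithinAt₀
  have hc : ContinuousOn α (Icc 0 T) := fun t ht => (hα t ht).continuousWithinAt
  refine ⟨IccExtend hT (domRestrict (Icc 0 T) α), ?_, ?_, fun t ht => ?_⟩
  · exact (continuousOn_iff_continuous_domRestrict.mp hc).Icc_extend'
  · rw [IccExtend_of_mem hT _ ⟨le_rfl, hT⟩]
    exact h0
  · have h1 := (hα t (Ioo_subset_Icc_self ht)).hasDerivAt (Icc_mem_nhds ht.1 ht.2)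
    rw [IccExtend_of_mem hT _ (Ioo_subset_Icc_self ht)]
    refine h1.congr_of_eventuallyEq ?_
    filter_upwards [Icc_mem_nhds ht.1 ht.2] with s hs
    rw [IccExtend_of_mem hT _ hs]
    rfl

/-- A continuity argument: the field is cut off outside a ball containing the admissible set `Q ≤
2`, which makes it globally solvable. The a priori improvement from `Q ≤ 2` to `Q ≤ 1` prevents the
solution from reaching the threshold, so the cut-off is never felt. -/
theorem exists_solution_of_apriori {E : Type*} [NormedAddCommGroup E] [NormedSpace ℝ E]
    [FiniteDimensional ℝ E] {F : E → E} (hF : ContDiff ℝ 1 F) {V : Submodule ℝ E}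
    (hV : ∀ x ∈ V, F x ∈ V) {Q : E → ℝ} (hQ : Continuous Q) {R : ℝ} (hR : 0 < R)
    (hQR : ∀ x ∈ V, Q x ≤ 2 → ‖x‖ ≤ R) {T : ℝ} (hT : 0 ≤ T) {x₀ : E} (hx₀ : x₀ ∈ V)
    (hQ₀ : Q x₀ ≤ 1)
    (hap : ∀ x : ℝ → E, Continuous x → x 0 = x₀ → (∀ t, x t ∈ V) → ∀ τ ∈ Icc 0 T,
      (∀ t ∈ Ioo 0 τ, HasDerivAt x (F (x t)) t) → (∀ t ∈ Icc 0 τ, Q (x t) ≤ 2) →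
      ∀ t ∈ Icc 0 τ, Q (x t) ≤ 1) :
    ∃ x : ℝ → E, Continuous x ∧ x 0 = x₀ ∧ (∀ t, x t ∈ V) ∧
      (∀ t ∈ Ioo 0 T, HasDerivAt x (F (x t)) t) ∧ ∀ t ∈ Icc 0 T, Q (x t) ≤ 1 := by
  -- A linear projection onto `V` is built into the truncated field so that it maps all of `E` into
  -- `V`; the solution then stays in `V` because its complementary part has zero derivative.
  obtain ⟨π, hπ⟩ := V.subtype.exists_leftInverse_of_injective (by simp)
  have hπV : ∀ x ∈ V, (π x : E) = x := fun x hx => by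
    have := congrArg Subtype.val (LinearMap.congr_fun hπ ⟨x, hx⟩)
    simpa using this
  set P : E →L[ℝ] E := LinearMap.toContinuousLinearMap (V.subtype ∘ₗ π) with hP
  have hPV : ∀ x, P x ∈ V := fun x => (π x).2
  have hPid : ∀ x ∈ V, P x = x := hπV
  let b : ContDiffBump (0 : E) := ⟨R, R + 1, hR, by linarith⟩
  set G : E → E := fun x => b x • F (P x) with hGdef
  have hG1 : ContDiff ℝ 1 G := b.contDiff.smul (hF.comp P.contDiff)
  have hGc : HasCompactSupport G := b.hasCompactSupport.smul_right
  obtain ⟨K, hK⟩ := hG1.lipschitzWith_of_hasCompactSupport hGc one_ne_zero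
  obtain ⟨C, hC⟩ := hGc.exists_bound_of_continuous hG1.continuous
  obtain ⟨y, hyc, hy0, hyd⟩ := exists_solution_of_bounded_lipschitz hK
    (L := ⟨max C 0, le_max_right _ _⟩) (fun x => (hC x).trans (le_max_left _ _)) hT x₀
  have hGV : ∀ x, G x ∈ V := fun x => V.smul_mem _ (hV _ (hPV x))
  set x : ℝ → E := fun t => y (max 0 (min t T)) with hx
  have hxc : Continuous x := hyc.comp (by fun_prop)
  have hxy : ∀ t ∈ Icc 0 T, x t = y t := fun t ht => by
    simp only [hx, min_eq_left ht.2, max_eq_right ht.1]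
  have hyV : ∀ t ∈ Icc 0 T, y t ∈ V := by
    have h1 : ∀ t ∈ Icc 0 T, (y t - P (y t)) - (y 0 - P (y 0)) = 0 := by
      intro t ht
      have hd : ∀ s ∈ Ioo 0 t, HasDerivAt (fun t => y t - P (y t)) 0 s := by
        intro s hs
        have h2 := hyd s ⟨hs.1, hs.2.trans_le ht.2⟩
        have h3 := h2.sub (P.hasFDerivAt.comp_hasDerivAt s h2)
        rw [hPid _ (hGV _), sub_self] at h3
        exact h3
      have h4 := intervalIntegral.integral_eq_sub_of_hasDerivAt_of_le ht.1
        (by fun_prop) hd (by simp)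
      rw [intervalIntegral.integral_zero] at h4
      exact h4.symm
    intro t ht
    have h2 := h1 t ht
    rw [hy0, hPid x₀ hx₀, sub_self, sub_zero, sub_eq_zero] at h2
    rw [h2]
    exact hPV _
  have hxV : ∀ t, x t ∈ V := fun t => hyV _ ⟨le_max_left _ _, max_le hT (min_le_right _ _)⟩
  have hx0 : x 0 = x₀ := by rw [hxy 0 ⟨le_rfl, hT⟩, hy0]
  have hGF : ∀ z ∈ V, Q z ≤ 2 → G z = F z := by
    intro z hz hQz
    have : b z = 1 := b.one_of_mem_closedBall (by simpa using hQR z hz hQz)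
    simp only [hGdef, this, one_smul, hPid z hz]
  have hxd : ∀ t ∈ Ioo 0 T, HasDerivAt x (G (x t)) t := by
    intro t ht
    rw [hxy t (Ioo_subset_Icc_self ht)]
    refine (hyd t ht).congr_of_eventuallyEq ?_
    filter_upwards [Icc_mem_nhds ht.1 ht.2] with s hs using hxy s hs
  have step : ∀ τ ∈ Icc 0 T, (∀ t ∈ Icc 0 τ, Q (x t) ≤ 2) → ∀ t ∈ Icc 0 τ, Q (x t) ≤ 1 := by
    intro τ hτ h2
    refine hap x hxc hx0 hxV τ hτ (fun t ht => ?_) h2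
    have h3 := hxd t ⟨ht.1, ht.2.trans_le hτ.2⟩
    rwa [hGF _ (hxV t) (h2 t (Ioo_subset_Icc_self ht))] at h3
  have hall : ∀ t ∈ Icc 0 T, Q (x t) ≤ 2 := by
    by_contra! hcon
    obtain ⟨t₁, ht₁, hQt₁⟩ := hcon
    have hcl : IsCompact (Icc 0 t₁ ∩ {t | 2 ≤ Q (x t)}) :=
      isCompact_Icc.inter_right (isClosed_le continuous_const (hQ.comp hxc))
    -- The first time with `Q ≥ 2`. Up to and including it `Q ≤ 2`, so the a priori bound gives `Q ≤
    -- 1` there, a contradiction.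
    obtain ⟨t₂, ht₂, hleast⟩ := hcl.exists_isLeast ⟨t₁, ⟨ht₁.1, le_rfl⟩, hQt₁.le⟩
    have ht₂T : t₂ ∈ Icc 0 T := ⟨ht₂.1.1, ht₂.1.2.trans ht₁.2⟩
    have hlt : ∀ s ∈ Ico 0 t₂, Q (x s) ≤ 2 := by
      intro s hs
      by_contra! h
      exact absurd (hleast ⟨⟨hs.1, hs.2.le.trans ht₂.1.2⟩, h.le⟩) (not_le.mpr hs.2)
    have hne : t₂ ≠ 0 := by
      rintro rfl
      have := ht₂.2
      rw [Set.mem_ofPred_eq, hx0] at this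
      linarith
    have hpos : 0 < t₂ := lt_of_le_of_ne ht₂.1.1 (Ne.symm hne)
    have hQ2 : Q (x t₂) ≤ 2 := by
      have hcl2 : IsClosed {s | Q (x s) ≤ 2} := isClosed_le (hQ.comp hxc) continuous_const
      have hmem : t₂ ∈ closure (Ico 0 t₂) := by
        rw [closure_Ico hpos.ne]; exact ⟨hpos.le, le_rfl⟩
      exact closure_minimal (fun s hs => hlt s hs) hcl2 hmem
    have := step t₂ ht₂T (fun s hs => by
      rcases eq_or_lt_of_le hs.2 with h | h
      · rw [h]; exact hQ2
      · exact hlt s ⟨hs.1, h⟩) t₂ ⟨hpos.le, le_rfl⟩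
    have h3 := ht₂.2
    rw [Set.mem_ofPred_eq] at h3
    linarith
  refine ⟨x, hxc, hx0, hxV, fun t ht => ?_, step T ⟨hT, le_rfl⟩ hall⟩
  rw [← hGF _ (hxV t) (hall t (Ioo_subset_Icc_self ht))]
  exact hxd t ht

/-- Gronwall's lemma with dissipation. -/
theorem gronwall_dissipation {τ : ℝ} {y y' ζ β γ : ℝ → ℝ} (hy : Continuous y)
    (hd : ∀ t ∈ Ioo 0 τ, HasDerivAt y (y' t) t) (hζ : Continuous ζ) (hβ : Continuous β)
    (hγ : Continuous γ) (hζ0 : ∀ t, 0 ≤ ζ t) (hβ0 : ∀ t, 0 ≤ β t) (hγ0 : ∀ t, 0 ≤ γ t)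
    (h : ∀ t ∈ Ioo 0 τ, y' t ≤ β t * y t + γ t - ζ t) :
    ∀ t ∈ Icc 0 τ, y t + ∫ s in (0 : ℝ)..t, ζ s
      ≤ Real.exp (∫ s in (0 : ℝ)..t, β s) * (y 0 + ∫ s in (0 : ℝ)..t, γ s) := by
  have hprim : ∀ g : ℝ → ℝ, Continuous g → ∀ t, HasDerivAt (fun t => ∫ s in (0 : ℝ)..t, g s) (g t) t :=
    fun g hg t => intervalIntegral.integral_hasDerivAt_right (hg.intervalIntegrable _ _)
      hg.aestronglyMeasurable.stronglyMeasurableAtFilter hg.continuousAt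
  have hnn : ∀ g : ℝ → ℝ, (∀ t, 0 ≤ g t) → ∀ t, 0 ≤ t → 0 ≤ ∫ s in (0 : ℝ)..t, g s :=
    fun g hg t ht => intervalIntegral.integral_nonneg ht fun s _ => hg s
  set b : ℝ → ℝ := fun t => ∫ s in (0 : ℝ)..t, β s with hb
  set Z : ℝ → ℝ := fun t => ∫ s in (0 : ℝ)..t, ζ s with hZ
  set Γ : ℝ → ℝ := fun t => ∫ s in (0 : ℝ)..t, γ s with hΓ
  -- The accumulated dissipation is included in the quantity with the integrating factor. The result
  -- is nonincreasing because `β Z ≥ 0` and `exp (-b) ≤ 1`; no sign of `y` is needed.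
  set H : ℝ → ℝ := fun t => Real.exp (-b t) * (y t + Z t) - Γ t with hH
  have hbc : Continuous b := continuous_iff_continuousAt.mpr fun t => (hprim β hβ t).continuousAt
  have hZc : Continuous Z := continuous_iff_continuousAt.mpr fun t => (hprim ζ hζ t).continuousAt
  have hΓc : Continuous Γ := continuous_iff_continuousAt.mpr fun t => (hprim γ hγ t).continuousAt
  have hHd : ∀ t ∈ Ioo 0 τ, HasDerivAt H (Real.exp (-b t) * (-β t) * (y t + Z t)
      + Real.exp (-b t) * (y' t + ζ t) - γ t) t := fun t ht =>
    (((hprim β hβ t).neg.exp).mul ((hd t ht).add (hprim ζ hζ t))).sub (hprim γ hγ t)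
  have hanti : AntitoneOn H (Icc 0 τ) := by
    refine antitoneOn_of_deriv_nonpos (convex_Icc 0 τ) (by fun_prop) ?_ ?_
    · rw [interior_Icc]
      exact fun t ht => (hHd t ht).differentiableAt.differentiableWithinAt
    · rw [interior_Icc]
      intro t ht
      rw [(hHd t ht).deriv]
      have h1 := h t ht
      have h2 := mul_nonneg (hβ0 t) (hnn ζ hζ0 t ht.1.le)
      have h3 : Real.exp (-b t) ≤ 1 := Real.exp_le_one_iff.mpr (neg_nonpos.mpr (hnn β hβ0 t ht.1.le))
      have h4 : Real.exp (-b t) * (-β t) * (y t + Z t) + Real.exp (-b t) * (y' t + ζ t)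
          = Real.exp (-b t) * (y' t + ζ t - β t * y t - β t * Z t) := by ring
      have h5 : y' t + ζ t - β t * y t - β t * Z t ≤ γ t := by
        have : 0 ≤ β t * Z t := h2
        linarith
      have h6 := mul_le_mul_of_nonneg_left h5 (Real.exp_pos (-b t)).le
      have h7 := mul_le_mul_of_nonneg_right h3 (hγ0 t)
      rw [h4]
      linarith
  intro t ht
  have h1 := hanti ⟨le_rfl, ht.1.trans ht.2⟩ ht ht.1
  have h2 : H 0 = y 0 := by simp [hH, hb, hZ, hΓ]
  rw [h2] at h1
  have h3 : y t + Z t = Real.exp (b t) * (Real.exp (-b t) * (y t + Z t)) := by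
    rw [← mul_assoc, ← Real.exp_add, add_neg_cancel, Real.exp_zero, one_mul]
  rw [h3]
  refine mul_le_mul_of_nonneg_left ?_ (Real.exp_pos _).le
  simp only [hH] at h1
  linarith

/-! ### A priori bounds for the Galerkin approximation -/

/-- Solutions of the Galerkin system on `(0, τ)`. -/
structure GalSol (κ : Fin 3 → ℝ) (δ : ℝ) (B : Finset (Fin 3 → ℤ)) (τ : ℝ)
    (X : ℝ → Fin 3 → (Fin 3 → ℤ) → ℂ) : Prop where
  supp : ∀ t, SuppIn B (X t)
  div : ∀ t, DivFreeCoef (X t)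
  real : ∀ t i, IsRealCoef (X t i)
  parity : ∀ t, ParityCoef (X t)
  cont : ∀ i k, Continuous fun t => X t i k
  deriv : ∀ t ∈ Ioo 0 τ, ∀ i, ∀ k ∈ B,
    HasDerivAt (fun s => X s i k) (rhs κ (aniso δ) (X t) i k) t

theorem continuous_wsum {B : Finset (Fin 3 → ℤ)} {w : (Fin 3 → ℤ) → ℝ}
    {X : ℝ → Fin 3 → (Fin 3 → ℤ) → ℂ} (hX : ∀ i k, Continuous fun t => X t i k) :
    Continuous fun t => wsum B w (X t) := by
  simp only [wsum, nsq]
  exact continuous_finsetSum _ fun k _ => continuous_const.mul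
    (continuous_finsetSum _ fun i _ => (hX i k).norm.pow 2)

theorem hasDerivAt_wsum {B : Finset (Fin 3 → ℤ)} {w : (Fin 3 → ℤ) → ℝ}
    {X : ℝ → Fin 3 → (Fin 3 → ℤ) → ℂ} {Y : Fin 3 → (Fin 3 → ℤ) → ℂ} {t : ℝ}
    (hX : ∀ i, ∀ k ∈ B, HasDerivAt (fun s => X s i k) (Y i k) t) :
    HasDerivAt (fun t => wsum B w (X t)) (∑ k ∈ B, w k * pair (X t) Y k) t := by
  simp only [wsum, nsq, pair]
  refine HasDerivAt.fun_sum fun k hk => HasDerivAt.const_mul _ (HasDerivAt.fun_sum fun i _ => ?_)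
  have := (hX i k hk).norm_sq
  rwa [Complex.inner, mul_comm (Y i k)] at this

theorem continuous_bt {X : ℝ → Fin 3 → (Fin 3 → ℤ) → ℂ} (hX : ∀ i k, Continuous fun t => X t i k)
    (i : Fin 3) (k : Fin 3 → ℤ) : Continuous fun t => bt (X t) i k := by
  by_cases hk : k 2 = 0
  · simpa [bt, hk] using hX i k
  · simpa [bt, hk] using continuous_const

theorem continuous_bc {X : ℝ → Fin 3 → (Fin 3 → ℤ) → ℂ} (hX : ∀ i k, Continuous fun t => X t i k)
    (i : Fin 3) (k : Fin 3 → ℤ) : Continuous fun t => bc (X t) i k := by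
  by_cases hk : k 2 = 0
  · simpa [bc, hk] using continuous_const
  · simpa [bc, hk] using hX i k

theorem hasDerivAt_wsum_bt {B : Finset (Fin 3 → ℤ)} {w : (Fin 3 → ℤ) → ℝ}
    {X : ℝ → Fin 3 → (Fin 3 → ℤ) → ℂ} {Y : Fin 3 → (Fin 3 → ℤ) → ℂ} {t : ℝ}
    (hX : ∀ i, ∀ k ∈ B, HasDerivAt (fun s => X s i k) (Y i k) t) :
    HasDerivAt (fun t => wsum B w (bt (X t))) (∑ k ∈ B, w k * pair (bt (X t)) Y k) t := by
  have h : HasDerivAt (fun t => wsum B w (bt (X t))) (∑ k ∈ B, w k * pair (bt (X t)) (bt Y) k) t := by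
    refine hasDerivAt_wsum fun i k hk => ?_
    by_cases hk2 : k 2 = 0
    · simpa [bt, hk2] using hX i k hk
    · simpa [bt, hk2] using hasDerivAt_const t (0 : ℂ)
  have e : ∀ k, pair (bt (X t)) (bt Y) k = pair (bt (X t)) Y k := fun k => by
    by_cases hk2 : k 2 = 0 <;> simp [pair, bt, hk2]
  simpa only [e] using h

theorem hasDerivAt_wsum_bc {B : Finset (Fin 3 → ℤ)} {w : (Fin 3 → ℤ) → ℝ}
    {X : ℝ → Fin 3 → (Fin 3 → ℤ) → ℂ} {Y : Fin 3 → (Fin 3 → ℤ) → ℂ} {t : ℝ}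
    (hX : ∀ i, ∀ k ∈ B, HasDerivAt (fun s => X s i k) (Y i k) t) :
    HasDerivAt (fun t => wsum B w (bc (X t))) (∑ k ∈ B, w k * pair (bc (X t)) Y k) t := by
  have h : HasDerivAt (fun t => wsum B w (bc (X t))) (∑ k ∈ B, w k * pair (bc (X t)) (bc Y) k) t := by
    refine hasDerivAt_wsum fun i k hk => ?_
    by_cases hk2 : k 2 = 0
    · simpa [bc, hk2] using hasDerivAt_const t (0 : ℂ)
    · simpa [bc, hk2] using hX i k hk
  have e : ∀ k, pair (bc (X t)) (bc Y) k = pair (bc (X t)) Y k := fun k => by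
    by_cases hk2 : k 2 = 0 <;> simp [pair, bc, hk2]
  simpa only [e] using h

theorem wsum_cauchy_schwarz (B : Finset (Fin 3 → ℤ)) {w u v : (Fin 3 → ℤ) → ℝ}
    (hu : ∀ k, 0 ≤ u k) (hv : ∀ k, 0 ≤ v k) (h : ∀ k, w k ^ 2 ≤ u k * v k)
    (U : Fin 3 → (Fin 3 → ℤ) → ℂ) : wsum B w U ^ 2 ≤ wsum B u U * wsum B v U := by
  refine Finset.sum_sq_le_sum_mul_sum_of_sq_le_mul B
    (fun k _ => mul_nonneg (hu k) (nsq_nonneg U k)) (fun k _ => mul_nonneg (hv k) (nsq_nonneg U k))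
    fun k _ => ?_
  have := mul_le_mul_of_nonneg_right (h k) (sq_nonneg (nsq U k))
  nlinarith

theorem wt_mul_sub_nonneg {d : ℕ} (k : Fin d → ℤ) : 0 ≤ wt k * (wt k - 1) :=
  mul_nonneg (wt_pos k).le (sub_nonneg.mpr (one_le_wt k))

/-- Interpolation of `H^{3/2}` between `H¹` and `H²`. The additional energy term restores the mean,
which the dissipation does not see. -/
theorem crit_sq_le (B : Finset (Fin 3 → ℤ)) (U : Fin 3 → (Fin 3 → ℤ) → ℂ) :
    crit B U ^ 2 ≤ wsum B wt U * (wsum B wt U + wsum B (fun k => wt k * (wt k - 1)) U) := by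
  have h1 := wsum_cauchy_schwarz B (w := fun k => rt k ^ 3) (u := wt) (v := fun k => wt k ^ 2)
    (fun k => (wt_pos k).le) (fun k => sq_nonneg _) (fun k => by
      rw [← rt_sq k]; exact le_of_eq (by ring)) U
  have h2 : wsum B (fun k => wt k ^ 2) U = wsum B wt U + wsum B (fun k => wt k * (wt k - 1)) U := by
    simp only [wsum, ← Finset.sum_add_distrib]
    exact Finset.sum_congr rfl fun k _ => by ring
  rwa [h2] at h1

theorem bcw_mul_visc_ge {δ : ℝ} (hδ : 1 ≤ δ) {k : Fin 3 → ℤ} (hk : k 2 ≠ 0) :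
    rt k ^ 3 * (rt k + Real.sqrt δ) ≤ 4 * (bcw δ k * visc (aniso δ) k) := by
  have h1 := add_sq_le_visc hδ hk
  have h2 := rt_add_sqrt_pos δ k
  have h3 : rt k ^ 3 * (rt k + Real.sqrt δ) = bcw δ k * (rt k + Real.sqrt δ) ^ 2 := by
    rw [bcw]; field_simp
  rw [h3]
  nlinarith [mul_le_mul_of_nonneg_left h1 (bcw_pos δ k).le]

/-- The weight `rt³` is the geometric mean of `rt³/(rt + √δ)` and `rt³ (rt + √δ)`; the second is
controlled by the dissipation. This explains the choice of `bcw`: no power of `δ` is lost here. -/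
theorem crit_bc_sq_le {δ : ℝ} (hδ : 1 ≤ δ) (B : Finset (Fin 3 → ℤ)) (U : Fin 3 → (Fin 3 → ℤ) → ℂ) :
    crit B (bc U) ^ 2 ≤ 4 * (wsum B (bcw δ) (bc U)
      * wsum B (fun k => bcw δ k * visc (aniso δ) k) (bc U)) := by
  have h1 := wsum_cauchy_schwarz B (w := fun k => rt k ^ 3) (u := bcw δ)
    (v := fun k => rt k ^ 3 * (rt k + Real.sqrt δ)) (fun k => (bcw_pos δ k).le)
    (fun k => mul_nonneg (pow_nonneg (rt_pos k).le 3) (rt_add_sqrt_pos δ k).le) (fun k => by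
      have := (rt_add_sqrt_pos δ k).ne'
      rw [bcw]; exact le_of_eq (by field_simp)) (bc U)
  have h2 : wsum B (fun k => rt k ^ 3 * (rt k + Real.sqrt δ)) (bc U)
      ≤ 4 * wsum B (fun k => bcw δ k * visc (aniso δ) k) (bc U) := by
    rw [wsum, wsum, Finset.mul_sum]
    refine Finset.sum_le_sum fun k _ => ?_
    rw [nsq_bc]
    split_ifs with hk
    · simp
    · have := mul_le_mul_of_nonneg_right (bcw_mul_visc_ge hδ hk) (nsq_nonneg U k)
      linarith
  have h3 : 0 ≤ wsum B (bcw δ) (bc U) := wsum_nonneg (fun k => (bcw_pos δ k).le) _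
  have := mul_le_mul_of_nonneg_left h2 h3
  unfold crit
  linarith

/-- The constant of the energy inequalities. -/
def dynConst : ℝ := 32 * bilConst

theorem dynConst_pos : 0 < dynConst := mul_pos (by norm_num) bilConst_pos

/-- The smallness conditions in the bootstrap argument. -/
structure SmallData (T eS yS : ℝ) : Prop where
  e_pos : 1 ≤ eS
  y_pos : 0 < yS
  y_le : 2 * yS ≤ 1
  s1 : 16 * dynConst * (2 * yS) ≤ 1
  s2 : 4 * dynConst ^ 2 * (2 * eS) * (2 * yS) ≤ 1 / 2
  s3 : 4 * dynConst ^ 2 * (2 * eS) ^ 2 * (2 * yS) * T ≤ 1 / 2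

/-- The growth factor of the baroclinic energy. -/
def growth (T eS : ℝ) : ℝ := Real.exp (4 * dynConst ^ 2 * (2 * eS) ^ 2 * (T + 1))

theorem growth_pos (T eS : ℝ) : 0 < growth T eS := Real.exp_pos _

/-- All conditions on `yS` are linear upper bounds, so the inverse of the sum of the coefficients
works. The size of `eS` is unrestricted. -/
theorem exists_smallData {T eS : ℝ} (hT : 0 ≤ T) (he : 1 ≤ eS) : ∃ yS, SmallData T eS yS := by
  have hK := dynConst_pos
  set A : ℝ := 2 + 32 * dynConst + 16 * dynConst ^ 2 * (2 * eS) + 16 * dynConst ^ 2 * (2 * eS) ^ 2 * T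
    with hA
  have a1 : 0 ≤ 16 * dynConst ^ 2 * (2 * eS) := by positivity
  have a2 : 0 ≤ 16 * dynConst ^ 2 * (2 * eS) ^ 2 * T := by positivity
  have hApos : 0 < A := by positivity
  have hi : A * A⁻¹ = 1 := mul_inv_cancel₀ hApos.ne'
  have hipos : 0 < A⁻¹ := inv_pos.mpr hApos
  refine ⟨A⁻¹, he, hipos, ?_, ?_, ?_, ?_⟩
  · have : 2 * A⁻¹ ≤ A * A⁻¹ := mul_le_mul_of_nonneg_right (by rw [hA]; linarith) hipos.le
    linarith
  · have : (32 * dynConst) * A⁻¹ ≤ A * A⁻¹ := mul_le_mul_of_nonneg_right (by rw [hA]; linarith) hipos.le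
    linarith
  · have : (16 * dynConst ^ 2 * (2 * eS)) * A⁻¹ ≤ A * A⁻¹ :=
      mul_le_mul_of_nonneg_right (by rw [hA]; linarith) hipos.le
    linarith
  · have : (16 * dynConst ^ 2 * (2 * eS) ^ 2 * T) * A⁻¹ ≤ A * A⁻¹ :=
      mul_le_mul_of_nonneg_right (by rw [hA]; linarith) hipos.le
    linarith

/-- Barotropic energy and dissipation, baroclinic energy and dissipation. -/
def btE (B : Finset (Fin 3 → ℤ)) (U : Fin 3 → (Fin 3 → ℤ) → ℂ) : ℝ := wsum B wt (bt U)

def btD (B : Finset (Fin 3 → ℤ)) (U : Fin 3 → (Fin 3 → ℤ) → ℂ) : ℝ :=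
  wsum B (fun k => wt k * (wt k - 1)) (bt U)

def bcE (δ : ℝ) (B : Finset (Fin 3 → ℤ)) (U : Fin 3 → (Fin 3 → ℤ) → ℂ) : ℝ := wsum B (bcw δ) (bc U)

def bcD (δ : ℝ) (B : Finset (Fin 3 → ℤ)) (U : Fin 3 → (Fin 3 → ℤ) → ℂ) : ℝ :=
  wsum B (fun k => bcw δ k * visc (aniso δ) k) (bc U)

theorem btE_nonneg (B : Finset (Fin 3 → ℤ)) (U : Fin 3 → (Fin 3 → ℤ) → ℂ) : 0 ≤ btE B U :=
  wsum_nonneg (fun k => (wt_pos k).le) _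

theorem btD_nonneg (B : Finset (Fin 3 → ℤ)) (U : Fin 3 → (Fin 3 → ℤ) → ℂ) : 0 ≤ btD B U :=
  wsum_nonneg wt_mul_sub_nonneg _

theorem bcE_nonneg (δ : ℝ) (B : Finset (Fin 3 → ℤ)) (U : Fin 3 → (Fin 3 → ℤ) → ℂ) : 0 ≤ bcE δ B U :=
  wsum_nonneg (fun k => (bcw_pos δ k).le) _

theorem visc_nonneg {δ : ℝ} (hδ : 1 ≤ δ) (k : Fin 3 → ℤ) : 0 ≤ visc (aniso δ) k := by
  refine Finset.sum_nonneg fun i _ => mul_nonneg ?_ (sq_nonneg _)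
  fin_cases i <;> simp [aniso]
  linarith

theorem bcD_nonneg {δ : ℝ} (hδ : 1 ≤ δ) (B : Finset (Fin 3 → ℤ)) (U : Fin 3 → (Fin 3 → ℤ) → ℂ) :
    0 ≤ bcD δ B U :=
  wsum_nonneg (fun k => mul_nonneg (bcw_pos δ k).le (visc_nonneg hδ k)) _

theorem le_of_sq_le_mul {a b c : ℝ} (hb : 0 ≤ b) (hc : 0 ≤ c) (h : a ^ 2 ≤ 4 * (b * c)) :
    a ≤ b + c := by
  refine le_of_sq_le_sq ?_ (add_nonneg hb hc)
  nlinarith [sq_nonneg (b - c)]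

/-- The a priori bounds under the bootstrap assumption. -/
theorem GalSol.apriori {κ : Fin 3 → ℝ} (hκ : Admissible κ) {δ : ℝ} (hδ : 1 ≤ δ)
    {B : Finset (Fin 3 → ℤ)} (hB : ∀ k, -k ∈ B ↔ k ∈ B) {T τ : ℝ} (hτ : τ ≤ T)
    {X : ℝ → Fin 3 → (Fin 3 → ℤ) → ℂ} (h : GalSol κ δ B τ X) {eS yS : ℝ} (hs : SmallData T eS yS)
    (he0 : btE B (X 0) + 1 ≤ eS) (hy0 : growth T eS * bcE δ B (X 0) ≤ yS)
    (hb : ∀ t ∈ Icc 0 τ, btE B (X t) ≤ 2 * eS ∧ bcE δ B (X t) ≤ 2 * yS) :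
    ∀ t ∈ Icc 0 τ, btE B (X t) ≤ eS ∧ ∫ s in (0 : ℝ)..t, btD B (X s) ≤ 2 * eS ∧
      bcE δ B (X t) + 2⁻¹ * ∫ s in (0 : ℝ)..t, bcD δ B (X s) ≤ growth T eS * bcE δ B (X 0) := by
  have hK := dynConst_pos
  set K := dynConst with hKdef
  have hec : Continuous fun t => btE B (X t) := continuous_wsum (continuous_bt h.cont)
  have hfc : Continuous fun t => btD B (X t) := continuous_wsum (continuous_bt h.cont)
  have hyc : Continuous fun t => bcE δ B (X t) := continuous_wsum (continuous_bc h.cont)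
  have hzc : Continuous fun t => bcD δ B (X t) := continuous_wsum (continuous_bc h.cont)
  -- The baroclinic self-interaction is a small multiple of the dissipation, by the bootstrap bound
  -- on the energy and `s1`.
  have hx2 : ∀ t ∈ Ioo 0 τ, K * crit B (bc (X t)) ^ 2 ≤ bcD δ B (X t) / 4 := by
    intro t ht
    have h1 := crit_bc_sq_le hδ B (X t)
    have h2 := (hb t (Ioo_subset_Icc_self ht)).2
    have h3 := bcD_nonneg hδ B (X t)
    have h4 := mul_le_mul_of_nonneg_right h2 h3
    have h5 := mul_le_mul_of_nonneg_right hs.s1 h3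
    change crit B (bc (X t)) ^ 2 ≤ 4 * (bcE δ B (X t) * bcD δ B (X t)) at h1
    nlinarith [mul_le_mul_of_nonneg_left (h1.trans (mul_le_mul_of_nonneg_left h4 zero_le_four)) hK.le]
  have hye : ∀ t ∈ Ioo 0 τ, ∑ k ∈ B, bcw δ k * pair (bc (X t)) (rhs κ (aniso δ) (X t)) k
      ≤ 4 * K ^ 2 * (2 * eS) * (2 * eS + btD B (X t)) * bcE δ B (X t) - 2⁻¹ * bcD δ B (X t) := by
    intro t ht
    have h1 := baroclinic_energy_le hκ hδ (h.supp t) (h.div t)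
    change _ ≤ -bcD δ B (X t) + K * _ at h1
    have h2 := hx2 t ht
    have h3 := (hb t (Ioo_subset_Icc_self ht)).1
    have n1 := btE_nonneg B (X t)
    have n2 := btD_nonneg B (X t)
    have n3 := bcE_nonneg δ B (X t)
    have n4 := bcD_nonneg hδ B (X t)
    have c1 : crit B (bt (X t)) ^ 2 ≤ btE B (X t) * (btE B (X t) + btD B (X t)) := crit_sq_le B _
    have c2 : crit B (bc (X t)) ^ 2 ≤ 4 * (bcE δ B (X t) * bcD δ B (X t)) := crit_bc_sq_le hδ B _
    have h4 : K * (crit B (bt (X t)) * crit B (bc (X t))) ≤ bcD δ B (X t) / 4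
        + 4 * K ^ 2 * (btE B (X t) * (btE B (X t) + btD B (X t))) * bcE δ B (X t) := by
      refine le_of_sq_le_mul (by positivity) (by positivity) ?_
      have := mul_le_mul c1 c2 (sq_nonneg _) (by positivity)
      have := mul_le_mul_of_nonneg_left this (sq_nonneg K)
      nlinarith
    have h5 : btE B (X t) * (btE B (X t) + btD B (X t)) ≤ (2 * eS) * (2 * eS + btD B (X t)) := by
      gcongr
      exact n1.trans h3
    have h6 := mul_le_mul_of_nonneg_left (mul_le_mul_of_nonneg_right h5 n3)
      (by positivity : (0 : ℝ) ≤ 4 * K ^ 2)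
    nlinarith
  have hee : ∀ t ∈ Ioo 0 τ, ∑ k ∈ B, wt k * pair (bt (X t)) (rhs κ (aniso δ) (X t)) k
      ≤ bcD δ B (X t) / 4 - btD B (X t) := by
    intro t ht
    have h1 := barotropic_energy_le hκ δ hB (h.supp t) (h.div t) (h.real t) (h.parity t)
    change _ ≤ -btD B (X t) + _ at h1
    have h2 := hx2 t ht
    have h3 : 2 * bilConst ≤ K := by rw [hKdef, dynConst]; linarith [bilConst_pos]
    have h4 := mul_le_mul_of_nonneg_right h3 (sq_nonneg (crit B (bc (X t))))
    linarith
  have hed := fun t ht => hasDerivAt_wsum_bt (w := wt) (h.deriv t ht)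
  have hyd := fun t ht => hasDerivAt_wsum_bc (w := bcw δ) (h.deriv t ht)
  have he1 := hs.e_pos
  have hy1 := hs.y_pos
  -- the crude bound
  have crude : ∀ t ∈ Icc 0 τ, ∫ s in (0 : ℝ)..t, btD B (X s) ≤ 2 * eS := by
    intro t ht
    -- The growth rate of the baroclinic energy contains the barotropic dissipation, whose integral
    -- is in turn bounded through the baroclinic dissipation. To break the circle, the bootstrap
    -- bound on the energy is used first, turning the growth term into a source; `s2` lets the
    -- integral of `btD` be absorbed.
    have hyP := gronwall_dissipation (y := fun t => bcE δ B (X t)) (ζ := fun t => 2⁻¹ * bcD δ B (X t))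
      (β := fun _ => 0)
      (γ := fun t => 4 * K ^ 2 * (2 * eS) * (2 * yS) * (2 * eS + btD B (X t))) hyc hyd (by fun_prop)
      continuous_const (by fun_prop)
      (fun t => mul_nonneg (by norm_num) (bcD_nonneg hδ B _)) (fun _ => le_rfl)
      (fun t => mul_nonneg (by positivity) (add_nonneg (by positivity) (btD_nonneg B _)))
      (fun s hs' => by
        have h1 := hye s hs'
        have h2 := (hb s (Ioo_subset_Icc_self hs')).2
        have n2 := btD_nonneg B (X s)
        have h3 : 4 * K ^ 2 * (2 * eS) * (2 * eS + btD B (X s)) * bcE δ B (X s)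
            ≤ 4 * K ^ 2 * (2 * eS) * (2 * eS + btD B (X s)) * (2 * yS) := by gcongr
        simp only [zero_mul, zero_add]
        linarith) t ht
    have heP := gronwall_dissipation (y := fun t => btE B (X t)) (ζ := fun t => btD B (X t))
      (β := fun _ => 0) (γ := fun t => bcD δ B (X t) / 4) hec hed hfc
      continuous_const (by fun_prop) (fun t => btD_nonneg B _) (fun _ => le_rfl)
      (fun t => div_nonneg (bcD_nonneg hδ B _) (by norm_num))
      (fun s hs' => by simpa using hee s hs') t ht
    simp only [intervalIntegral.integral_zero, Real.exp_zero, one_mul,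
      intervalIntegral.integral_const_mul, intervalIntegral.integral_div] at hyP heP
    rw [intervalIntegral.integral_add (by simp) (hfc.intervalIntegrable _ _),
      intervalIntegral.integral_const, smul_eq_mul, sub_zero] at hyP
    have n1 := btE_nonneg B (X t)
    have n3 := bcE_nonneg δ B (X t)
    have nf : 0 ≤ ∫ s in (0 : ℝ)..t, btD B (X s) :=
      intervalIntegral.integral_nonneg ht.1 fun s _ => btD_nonneg B _
    have s2 := mul_le_mul_of_nonneg_right hs.s2 nf
    have s3 : 4 * K ^ 2 * (2 * eS) * (2 * yS) * (t * (2 * eS)) ≤ 1 / 2 := by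
      refine le_trans ?_ hs.s3
      have : t ≤ T := ht.2.trans hτ
      calc 4 * K ^ 2 * (2 * eS) * (2 * yS) * (t * (2 * eS))
          ≤ 4 * K ^ 2 * (2 * eS) * (2 * yS) * (T * (2 * eS)) := by gcongr
        _ = _ := by ring
    have hy00 := (hb 0 ⟨le_rfl, ht.1.trans ht.2⟩).2
    have hyl := hs.y_le
    rw [mul_add] at hyP
    linarith
  intro t ht
  -- With the time integral of the rate now known, Gronwall bounds the baroclinic energy by a
  -- multiple of its initial value. This proportionality, not mere smallness, yields the rate in
  -- `δ`.
  have hyP := gronwall_dissipation (y := fun t => bcE δ B (X t)) (ζ := fun t => 2⁻¹ * bcD δ B (X t))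
    (β := fun t => 4 * K ^ 2 * (2 * eS) * (2 * eS + btD B (X t))) (γ := fun _ => 0) hyc hyd
    (by fun_prop) (by fun_prop) continuous_const
    (fun t => mul_nonneg (by norm_num) (bcD_nonneg hδ B _))
    (fun t => mul_nonneg (by positivity) (add_nonneg (by positivity) (btD_nonneg B _)))
    (fun _ => le_rfl) (fun s hs' => by simpa using hye s hs') t ht
  have heP := gronwall_dissipation (y := fun t => btE B (X t)) (ζ := fun t => btD B (X t))
    (β := fun _ => 0) (γ := fun t => bcD δ B (X t) / 4) hec hed hfc
    continuous_const (by fun_prop) (fun t => btD_nonneg B _) (fun _ => le_rfl)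
    (fun t => div_nonneg (bcD_nonneg hδ B _) (by norm_num))
    (fun s hs' => by simpa using hee s hs') t ht
  simp only [intervalIntegral.integral_zero, Real.exp_zero, one_mul, add_zero,
    intervalIntegral.integral_const_mul, intervalIntegral.integral_div] at hyP heP
  rw [intervalIntegral.integral_add (by simp) (hfc.intervalIntegrable _ _),
    intervalIntegral.integral_const, smul_eq_mul, sub_zero] at hyP
  have hcr := crude t ht
  have hexp : Real.exp (4 * K ^ 2 * (2 * eS) * (t * (2 * eS) + ∫ s in (0 : ℝ)..t, btD B (X s)))
      ≤ growth T eS := by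
    refine Real.exp_le_exp.mpr ?_
    have : t ≤ T := ht.2.trans hτ
    calc _ ≤ 4 * K ^ 2 * (2 * eS) * (T * (2 * eS) + 2 * eS) := by gcongr
      _ = _ := by ring
  have hyF := hyP.trans (mul_le_mul_of_nonneg_right hexp (bcE_nonneg δ B (X 0)))
  have nf : 0 ≤ ∫ s in (0 : ℝ)..t, btD B (X s) :=
    intervalIntegral.integral_nonneg ht.1 fun s _ => btD_nonneg B _
  have n3 := bcE_nonneg δ B (X t)
  have hyl := hs.y_le
  refine ⟨?_, hcr, hyF⟩
  linarith

/-- A priori bounds in the form needed later. -/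
structure GalBound (T eS : ℝ) (δ : ℝ) (B : Finset (Fin 3 → ℤ))
    (X : ℝ → Fin 3 → (Fin 3 → ℤ) → ℂ) : Prop where
  e : ∀ t ∈ Icc 0 T, btE B (X t) ≤ eS
  f : ∫ s in (0 : ℝ)..T, btD B (X s) ≤ 2 * eS
  y : ∀ t ∈ Icc 0 T, bcE δ B (X t) ≤ growth T eS * bcE δ B (X 0)
  z : ∫ s in (0 : ℝ)..T, bcD δ B (X s) ≤ 2 * growth T eS * bcE δ B (X 0)

/-! ### Existence of Galerkin approximations -/

theorem paritySign_mul_self (i : Fin 3) : paritySign i * paritySign i = 1 := by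
  fin_cases i <;> simp [paritySign]

theorem reflFreq_apply (k : Fin 3 → ℤ) (i : Fin 3) : ((reflFreq k i : ℤ) : ℂ) = paritySign i * k i := by
  fin_cases i <;> simp [paritySign, reflFreq]

theorem reflFreq_apply_sq (k : Fin 3 → ℤ) (i : Fin 3) : ((reflFreq k i : ℤ) : ℝ) ^ 2 = (k i : ℝ) ^ 2 := by
  fin_cases i <;> simp [reflFreq]

theorem reflFreq_sub (k l : Fin 3 → ℤ) : reflFreq (k - l) = reflFreq k - reflFreq l := by
  funext i
  fin_cases i <;> simp [reflFreq]
  ring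

theorem ParityCoef.nl {U : Fin 3 → (Fin 3 → ℤ) → ℂ} (hU : ParityCoef U) : ParityCoef (nl U U) := by
  intro i k
  have hc : ∀ j, conv (U j) (U i) (reflFreq k) = paritySign j * paritySign i * conv (U j) (U i) k := by
    intro j
    rw [conv, conv, ← tsum_mul_left]
    rw [← (Function.Involutive.toPerm reflFreq reflFreq_reflFreq).tsum_eq]
    refine tsum_congr fun l => ?_
    change U j (reflFreq l) * U i (reflFreq k - reflFreq l) = _
    rw [← reflFreq_sub, hU i, hU j]
    ring
  simp only [AnisoNS.nl, hc, reflFreq_apply, Finset.mul_sum]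
  refine Finset.sum_congr rfl fun j _ => ?_
  linear_combination (Real.pi * Complex.I * (k j) * paritySign i * conv (U j) (U i) k)
    * paritySign_mul_self j

theorem ParityCoef.leray {κ : Fin 3 → ℝ} {N : Fin 3 → (Fin 3 → ℤ) → ℂ} (hN : ParityCoef N) :
    ParityCoef (leray κ N) := by
  intro i k
  have h : ∑ j, ((reflFreq k j : ℤ) : ℂ) * N j (reflFreq k) = ∑ j, (k j : ℂ) * N j k :=
    Finset.sum_congr rfl fun j _ => by
      rw [reflFreq_apply, hN j k]
      linear_combination (k j * N j k) * paritySign_mul_self j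
  rw [AnisoNS.leray, AnisoNS.leray, h, hN i k, reflFreq_apply]
  simp only [reflFreq_apply_sq]
  ring

theorem ParityCoef.rhs {κ μ : Fin 3 → ℝ} {U : Fin 3 → (Fin 3 → ℤ) → ℂ} (hU : ParityCoef U) :
    ParityCoef (rhs κ μ U) := by
  intro i k
  have hv : visc μ (reflFreq k) = visc μ k := by simp only [visc, mul_pow, reflFreq_apply_sq]
  rw [AnisoNS.rhs, AnisoNS.rhs, hv, hU i k, hU.nl.leray i k]
  ring

/-- The projection is built to cancel the divergence of the transport term. Together with the
reality and parity statements this makes the space of admissible coefficients invariant under the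
Galerkin flow. -/
theorem DivFreeCoef.rhs {d : ℕ} {κ μ : Fin d → ℝ} (hκ : ∀ i, 0 < κ i) {U : Fin d → (Fin d → ℤ) → ℂ}
    (hU : DivFreeCoef U) : DivFreeCoef (rhs κ μ U) := by
  intro k
  by_cases hk : k = 0
  · simp [hk]
  have hs := sum_kappa_ne_zero hκ hk
  set S : ℂ := ∑ j, (k j : ℂ) * AnisoNS.nl U U j k with hS
  have e : ∀ i, (k i : ℂ) * AnisoNS.rhs κ μ U i k = -(visc μ k * (k i * U i k)) - k i * AnisoNS.nl U U i k
      + ((κ i * (k i : ℝ) ^ 2 : ℝ) : ℂ) * (S / ((∑ j, κ j * (k j : ℝ) ^ 2 : ℝ) : ℂ)) := fun i => by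
    rw [AnisoNS.rhs, AnisoNS.leray, ← hS]; push_cast; ring
  rw [Finset.sum_congr rfl fun i _ => e i, Finset.sum_add_distrib, Finset.sum_sub_distrib,
    Finset.sum_neg_distrib, ← Finset.mul_sum, hU k, ← Finset.sum_mul, ← Complex.ofReal_sum, ← hS,
    mul_div_cancel₀ _ hs]
  ring

/-- Extension by zero of coefficients given on a finite set. -/
def extZero (B : Finset (Fin 3 → ℤ)) (a : Fin 3 → B → ℂ) (i : Fin 3) (k : Fin 3 → ℤ) : ℂ :=
  if h : k ∈ B then a i ⟨k, h⟩ else 0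

theorem suppIn_extZero (B : Finset (Fin 3 → ℤ)) (a : Fin 3 → B → ℂ) : SuppIn B (extZero B a) :=
  fun _ _ hk => dif_neg hk

theorem contDiff_extZero (B : Finset (Fin 3 → ℤ)) (i : Fin 3) (k : Fin 3 → ℤ) :
    ContDiff ℝ 1 fun a : Fin 3 → B → ℂ => extZero B a i k := by
  unfold extZero
  split_ifs with h
  · exact (contDiff_apply ℝ ℂ (⟨k, h⟩ : B)).comp (contDiff_apply ℝ (B → ℂ) i)
  · exact contDiff_const

theorem contDiff_rhs_extZero (κ μ : Fin 3 → ℝ) (B : Finset (Fin 3 → ℤ)) (i : Fin 3) (k : Fin 3 → ℤ) :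
    ContDiff ℝ 1 fun a : Fin 3 → B → ℂ => rhs κ μ (extZero B a) i k := by
  have hc := contDiff_extZero B
  have hn : ∀ i k, ContDiff ℝ 1 fun a : Fin 3 → B → ℂ => nl (extZero B a) (extZero B a) i k := by
    intro i k
    simp only [nl, (suppIn_extZero B _).conv_eq]
    exact contDiff_const.mul (ContDiff.sum fun j _ => contDiff_const.mul
      (ContDiff.sum fun l _ => (hc j l).mul (hc i _)))
  unfold rhs leray
  exact ((contDiff_const.mul (hc i k)).add ((hn i k).sub ((contDiff_const.mul
    (ContDiff.sum fun j _ => contDiff_const.mul (hn j k))).div_const _))).neg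

/-- Coefficients of real solenoidal fields with the parity of velocity fields. -/
structure FieldCoef (U : Fin 3 → (Fin 3 → ℤ) → ℂ) : Prop where
  div : DivFreeCoef U
  real : ∀ i, IsRealCoef (U i)
  parity : ParityCoef U

/-- The real vector space of the admissible coefficient vectors supported in `B`. -/
def fieldSpace (B : Finset (Fin 3 → ℤ)) : Submodule ℝ (Fin 3 → B → ℂ) where
  carrier := {a | FieldCoef (extZero B a)}
  add_mem' := by
    intro a b ha hb
    have e : ∀ i k, extZero B (a + b) i k = extZero B a i k + extZero B b i k := fun i k => by
      by_cases h : k ∈ B <;> simp [extZero, h]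
    refine ⟨fun k => ?_, fun i k => ?_, fun i k => ?_⟩
    · simp only [e, mul_add, Finset.sum_add_distrib, ha.div k, hb.div k, add_zero]
    · simp only [e, map_add, ha.real i k, hb.real i k]
    · simp only [e, ha.parity i k, hb.parity i k, mul_add]
  zero_mem' := by
    have e : ∀ i k, extZero B 0 i k = 0 := fun i k => by
      by_cases h : k ∈ B <;> simp [extZero, h]
    exact ⟨fun k => by simp [e], fun i k => by simp [e], fun i k => by simp [e]⟩
  smul_mem' := by
    intro c a ha
    have e : ∀ i k, extZero B (c • a) i k = c * extZero B a i k := fun i k => by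
      by_cases h : k ∈ B <;> simp [extZero, h]
    refine ⟨fun k => ?_, fun i k => ?_, fun i k => ?_⟩
    · simp only [e, mul_left_comm _ (c : ℂ), ← Finset.mul_sum, ha.div k, mul_zero]
    · simp only [e, map_mul, ha.real i k, Complex.conj_ofReal]
    · simp only [e, ha.parity i k]; ring

theorem FieldCoef.truncate {U : Fin 3 → (Fin 3 → ℤ) → ℂ} (hU : FieldCoef U) {B : Finset (Fin 3 → ℤ)}
    (hB : ∀ k, -k ∈ B ↔ k ∈ B) (hB' : ∀ k, reflFreq k ∈ B ↔ k ∈ B) :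
    FieldCoef (extZero B fun i k => U i k) := by
  have e : ∀ i k, extZero B (fun i k => U i k) i k = if k ∈ B then U i k else 0 := fun i k => by
    simp [extZero]
  refine ⟨fun k => ?_, fun i k => ?_, fun i k => ?_⟩
  · by_cases h : k ∈ B <;> simp [e, h, hU.div k]
  · by_cases h : k ∈ B <;> simp [e, h, hB, hU.real i k]
  · by_cases h : k ∈ B <;> simp [e, h, hB', hU.parity i k]

theorem FieldCoef.rhs {κ μ : Fin 3 → ℝ} (hκ : ∀ i, 0 < κ i) {U : Fin 3 → (Fin 3 → ℤ) → ℂ}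
    (hU : FieldCoef U) : FieldCoef (rhs κ μ U) :=
  ⟨hU.div.rhs hκ, fun i => IsRealCoef.rhs hU.real i, hU.parity.rhs⟩

theorem rt_sq_le_bcw {δ : ℝ} (k : Fin 3 → ℤ) : rt k ^ 2 ≤ bcw δ k * (1 + Real.sqrt δ) := by
  have h1 := one_le_rt k
  have h2 := Real.sqrt_nonneg δ
  rw [bcw, div_mul_eq_mul_div, le_div_iff₀ (rt_add_sqrt_pos δ k)]
  nlinarith [mul_nonneg (sq_nonneg (rt k)) (mul_nonneg h2 (sub_nonneg.mpr h1))]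

/-- The energies bound every coefficient, but with a factor growing in `δ`. That suffices for
continuing the ordinary differential equation. -/
theorem nsq_le_energy {δ : ℝ} {B : Finset (Fin 3 → ℤ)} (U : Fin 3 → (Fin 3 → ℤ) → ℂ)
    {k : Fin 3 → ℤ} (hk : k ∈ B) : nsq U k ≤ btE B U + bcE δ B U * (1 + Real.sqrt δ) := by
  have h1 : wt k * nsq (bt U) k ≤ btE B U := Finset.single_le_sum (f := fun k => wt k * nsq (bt U) k)
    (fun k _ => mul_nonneg (wt_pos k).le (nsq_nonneg _ k)) hk
  have h2 : bcw δ k * nsq (bc U) k ≤ bcE δ B U :=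
    Finset.single_le_sum (f := fun k => bcw δ k * nsq (bc U) k)
      (fun k _ => mul_nonneg (bcw_pos δ k).le (nsq_nonneg _ k)) hk
  have h3 := rt_sq_le_bcw (δ := δ) k
  rw [rt_sq] at h3
  have h4 := one_le_wt k
  have h5 := Real.sqrt_nonneg δ
  have h6 : nsq U k = nsq (bt U) k + nsq (bc U) k := by
    by_cases h : k 2 = 0 <;> simp [nsq, bt, bc, h]
  have h7 := nsq_nonneg (bt U) k
  have h8 := nsq_nonneg (bc U) k
  nlinarith [mul_le_mul_of_nonneg_right h2 (by linarith : 0 ≤ 1 + Real.sqrt δ),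
    mul_le_mul_of_nonneg_right (h4.trans h3) h8, mul_le_mul_of_nonneg_right h4 h7]

theorem exists_galerkin {κ : Fin 3 → ℝ} (hκ : Admissible κ) {δ : ℝ} (hδ : 1 ≤ δ)
    {B : Finset (Fin 3 → ℤ)} (hB : ∀ k, -k ∈ B ↔ k ∈ B) (hB' : ∀ k, reflFreq k ∈ B ↔ k ∈ B) {T : ℝ}
    (hT : 0 ≤ T) {eS yS : ℝ} (hs : SmallData T eS yS) {U₀ : Fin 3 → (Fin 3 → ℤ) → ℂ}
    (hU₀ : FieldCoef U₀) (he0 : btE B U₀ + 1 ≤ eS) (hy0 : growth T eS * bcE δ B U₀ ≤ yS) :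
    ∃ X, GalSol κ δ B T X ∧ (∀ i k, X 0 i k = if k ∈ B then U₀ i k else 0) ∧ GalBound T eS δ B X := by
  have hext : ∀ {x : ℝ → Fin 3 → B → ℂ} {τ : ℝ}, Continuous x → (∀ t, x t ∈ fieldSpace B) →
      (∀ t ∈ Ioo 0 τ, HasDerivAt x (fun i k => rhs κ (aniso δ) (extZero B (x t)) i k) t) →
      GalSol κ δ B τ fun t => extZero B (x t) := fun {x τ} hx hV hd =>
    { supp := fun t => suppIn_extZero B _
      div := fun t => (hV t).div
      real := fun t => (hV t).real
      parity := fun t => (hV t).parity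
      cont := fun i k => (contDiff_extZero B i k).continuous.comp hx
      deriv := fun t ht i k hk => by
        simpa only [extZero, dif_pos hk] using
          hasDerivAt_pi.mp (hasDerivAt_pi.mp (hd t ht) i) ⟨k, hk⟩ }
  set x₀ : Fin 3 → B → ℂ := fun i k => U₀ i k with hx₀
  have hx0 : ∀ i k, extZero B x₀ i k = if k ∈ B then U₀ i k else 0 := fun i k => by
    simp [extZero, hx₀]
  have hws : ∀ w, wsum B w (bt (extZero B x₀)) = wsum B w (bt U₀) ∧
      wsum B w (bc (extZero B x₀)) = wsum B w (bc U₀) := fun w => by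
    constructor <;> refine Finset.sum_congr rfl fun k hk => ?_ <;>
    simp only [nsq, bt, bc, hx0, if_pos hk]
  have he0' : btE B (extZero B x₀) = btE B U₀ := (hws _).1
  have hy0' : bcE δ B (extZero B x₀) = bcE δ B U₀ := (hws _).2
  have hes : 0 < eS := zero_lt_one.trans_le hs.e_pos
  have hys := hs.y_pos
  have hbound : ∀ (x : ℝ → Fin 3 → B → ℂ), x 0 = x₀ → ∀ τ ≤ T,
      GalSol κ δ B τ (fun t => extZero B (x t)) →
      (∀ t ∈ Icc 0 τ, btE B (extZero B (x t)) ≤ 2 * eS ∧ bcE δ B (extZero B (x t)) ≤ 2 * yS) →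
      ∀ t ∈ Icc 0 τ, btE B (extZero B (x t)) ≤ eS ∧
        ∫ s in (0 : ℝ)..t, btD B (extZero B (x s)) ≤ 2 * eS ∧
        bcE δ B (extZero B (x t)) + 2⁻¹ * ∫ s in (0 : ℝ)..t, bcD δ B (extZero B (x s))
          ≤ growth T eS * bcE δ B U₀ := by
    intro x h0 τ hτ hg hb
    have := GalSol.apriori hκ hδ hB hτ hg hs (by rw [h0, he0']; exact he0)
      (by rw [h0, hy0']; exact hy0) hb
    simpa only [h0, hy0'] using this
  obtain ⟨x, hxc, h0, hxV, hxd, hxQ⟩ := exists_solution_of_apriori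
    (F := fun a : Fin 3 → B → ℂ => fun i k => rhs κ (aniso δ) (extZero B a) i k)
    (contDiff_pi.mpr fun i => contDiff_pi.mpr fun k => contDiff_rhs_extZero _ _ _ _ _)
    (V := fieldSpace B) (fun a ha => FieldCoef.truncate (FieldCoef.rhs hκ.pos ha) hB hB')
    -- Normalised so that `Q ≤ 2` is the bootstrap assumption of `GalSol.apriori` and `Q ≤ 1` its
    -- improvement.
    (Q := fun a => max (btE B (extZero B a) / eS) (bcE δ B (extZero B a) / yS))
    (by
      have h := fun i k => (contDiff_extZero B i k).continuous
      have hw : ∀ w, Continuous fun a : Fin 3 → B → ℂ => wsum B w (bt (extZero B a)) := fun w => by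
        simp only [wsum, nsq, bt]
        refine continuous_finsetSum _ fun k _ => continuous_const.mul
          (continuous_finsetSum _ fun i _ => ?_)
        split_ifs
        · exact (h i k).norm.pow 2
        · exact continuous_const
      have hw' : ∀ w, Continuous fun a : Fin 3 → B → ℂ => wsum B w (bc (extZero B a)) := fun w => by
        simp only [wsum, nsq, bc]
        refine continuous_finsetSum _ fun k _ => continuous_const.mul
          (continuous_finsetSum _ fun i _ => ?_)
        split_ifs
        · exact continuous_const
        · exact (h i k).norm.pow 2
      exact ((hw _).div_const _).max ((hw' _).div_const _))
    (R := 2 * eS + 2 * yS * (1 + Real.sqrt δ) + 1)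
    (by have := Real.sqrt_nonneg δ; positivity)
    (fun a _ hQ => by
      have hsq := Real.sqrt_nonneg δ
      have q1 := (div_le_iff₀ hes).mp ((le_max_left _ _).trans hQ)
      have q2 := (div_le_iff₀ hys).mp ((le_max_right _ _).trans hQ)
      have hR : 1 ≤ 2 * eS + 2 * yS * (1 + Real.sqrt δ) + 1 := by
        have : 0 ≤ 2 * eS + 2 * yS * (1 + Real.sqrt δ) := by positivity
        linarith
      refine (pi_norm_le_iff_of_nonneg (by linarith)).mpr fun i =>
        (pi_norm_le_iff_of_nonneg (by linarith)).mpr fun k => ?_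
      have h1 : ‖a i k‖ ^ 2 ≤ nsq (extZero B a) k := by
        have := Finset.single_le_sum (f := fun i => ‖extZero B a i k‖ ^ 2)
          (fun _ _ => sq_nonneg _) (Finset.mem_univ i)
        simpa [extZero, nsq] using this
      have h2 := nsq_le_energy (δ := δ) (extZero B a) k.2
      have h3 := mul_le_mul_of_nonneg_right q2 (by linarith : 0 ≤ 1 + Real.sqrt δ)
      refine le_of_sq_le_sq ?_ (by linarith)
      nlinarith)
    hT (x₀ := x₀) (FieldCoef.truncate hU₀ hB hB')
    (max_le (by rw [div_le_one hes, he0']; linarith) (by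
      rw [div_le_one hys, hy0']
      refine le_trans ?_ hy0
      refine le_mul_of_one_le_left (bcE_nonneg δ B U₀) (Real.one_le_exp ?_)
      positivity))
    (fun x hxc h0 hxV τ hτ hxd hQ t ht => by
      have hg := hext hxc hxV hxd
      have := hbound x h0 τ hτ.2 hg (fun t ht => ⟨(div_le_iff₀ hes).mp ((le_max_left _ _).trans (hQ t ht)),
        (div_le_iff₀ hys).mp ((le_max_right _ _).trans (hQ t ht))⟩) t ht
      refine max_le ((div_le_one hes).mpr this.1) ((div_le_one hys).mpr (le_trans ?_ hy0))
      have h2 : 0 ≤ ∫ s in (0 : ℝ)..t, bcD δ B (extZero B (x s)) :=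
        intervalIntegral.integral_nonneg ht.1 fun s _ => bcD_nonneg hδ B _
      linarith [this.2.2])
  have hg := hext hxc hxV hxd
  have hfin := hbound x h0 T le_rfl hg (fun t ht => by
    have q1 := (div_le_iff₀ hes).mp ((le_max_left _ _).trans (hxQ t ht))
    have q2 := (div_le_iff₀ hys).mp ((le_max_right _ _).trans (hxQ t ht))
    constructor <;> linarith)
  have hbc0 : bcE δ B (extZero B (x 0)) = bcE δ B U₀ := by rw [h0, hy0']
  refine ⟨fun t => extZero B (x t), hg, fun i k => by rw [← hx0, ← h0], ?_, ?_, ?_, ?_⟩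
  · exact fun t ht => (hfin t ht).1
  · exact (hfin T ⟨hT, le_rfl⟩).2.1
  · intro t ht
    have h2 : 0 ≤ ∫ s in (0 : ℝ)..t, bcD δ B (extZero B (x s)) :=
      intervalIntegral.integral_nonneg ht.1 fun s _ => bcD_nonneg hδ B _
    rw [hbc0]
    linarith [(hfin t ht).2.2]
  · rw [hbc0]
    have := (hfin T ⟨hT, le_rfl⟩).2.2
    linarith [bcE_nonneg δ B (extZero B (x T))]

/-! ### Comparison with the two-dimensional approximation -/

theorem intervalIntegral_add_of_continuous {f g : ℝ → ℝ} {a b : ℝ} (hf : Continuous f)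
    (hg : Continuous g) : ∫ s in a..b, (f s + g s) = (∫ s in a..b, f s) + ∫ s in a..b, g s :=
  intervalIntegral.integral_add (hf.intervalIntegrable _ _) (hg.intervalIntegrable _ _)

theorem Admissible.ones : Admissible fun _ => 1 := ⟨rfl, rfl, le_rfl⟩

theorem leray_eq_of_eq_zero {κ κ' : Fin 3 → ℝ} (hκ : Admissible κ) (hκ' : Admissible κ')
    (N : Fin 3 → (Fin 3 → ℤ) → ℂ) (i : Fin 3) {k : Fin 3 → ℤ} (hk : k 2 = 0) :
    leray κ N i k = leray κ' N i k := by
  have h1 : ∀ i, (κ i : ℂ) * k i = κ' i * k i := by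
    intro i
    fin_cases i <;> simp [hκ.zero, hκ.one, hκ'.zero, hκ'.one, hk]
  have h2 : ∑ j, κ j * (k j : ℝ) ^ 2 = ∑ j, κ' j * (k j : ℝ) ^ 2 := by
    simp [Fin.sum_univ_three, hκ.zero, hκ.one, hκ'.zero, hκ'.one, hk]
  rw [leray, leray, h1, h2]

/-- A `z`-independent field feels neither the vertical viscosity nor the vertical pressure
coefficient. One 2D approximation thus solves the Galerkin system for all `ε` and `δ`. -/
theorem rhs_eq_of_bt_eq {κ κ' : Fin 3 → ℝ} (hκ : Admissible κ) (hκ' : Admissible κ') (δ δ' : ℝ)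
    {V : Fin 3 → (Fin 3 → ℤ) → ℂ} (hV : bt V = V) : rhs κ (aniso δ) V = rhs κ' (aniso δ') V := by
  funext i k
  by_cases hk : k 2 = 0
  · rw [rhs, rhs, leray_eq_of_eq_zero hκ hκ' _ i hk, visc_aniso_of_eq_zero δ hk,
      visc_aniso_of_eq_zero δ' hk]
  · have h0 : V i k = 0 := by rw [← hV, bt, if_neg hk]
    have hn : ∀ j, nl V V j k = 0 := fun j => by rw [← hV]; exact nl_bt_bt_eq_zero V V j hk
    simp [rhs, leray, h0, hn]

theorem rhs_bt_eq_zero {κ : Fin 3 → ℝ} {δ : ℝ} {V : Fin 3 → (Fin 3 → ℤ) → ℂ} (hV : bt V = V)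
    (i : Fin 3) {k : Fin 3 → ℤ} (hk : k 2 ≠ 0) : rhs κ (aniso δ) V i k = 0 := by
  have h0 : V i k = 0 := by rw [← hV, bt, if_neg hk]
  have hn : ∀ j, nl V V j k = 0 := fun j => by rw [← hV]; exact nl_bt_bt_eq_zero V V j hk
  simp [rhs, leray, h0, hn]

theorem nsq_leray_le {κ : Fin 3 → ℝ} (hκ : ∀ i, 0 < κ i) (N : Fin 3 → (Fin 3 → ℤ) → ℂ)
    (k : Fin 3 → ℤ) : nsq (leray κ N) k ≤ 9 * lerayConst κ ^ 2 * nsq N k := by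
  have h1 : (∑ j, ‖N j k‖) ^ 2 ≤ 3 * nsq N k := by
    simpa [nsq] using sq_sum_le_card_mul_sum_sq (s := Finset.univ) (f := fun j => ‖N j k‖)
  calc nsq (leray κ N) k ≤ ∑ _i : Fin 3, (lerayConst κ * ∑ j, ‖N j k‖) ^ 2 :=
        Finset.sum_le_sum fun i _ => pow_le_pow_left₀ (norm_nonneg _) (norm_leray_le hκ N i k) 2
    _ = 3 * (lerayConst κ ^ 2 * (∑ j, ‖N j k‖) ^ 2) := by simp [mul_pow]
    _ ≤ 3 * (lerayConst κ ^ 2 * (3 * nsq N k)) := by gcongr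
    _ = _ := by ring

/-- The constant in the estimate of the difference of the time derivatives. -/
def derivConst : ℝ := 72 * lerayConst (fun _ : Fin 3 => (1 : ℝ)) ^ 2 * bilConst

theorem derivConst_nonneg : 0 ≤ derivConst :=
  mul_nonneg (mul_nonneg (by norm_num) (sq_nonneg _)) bilConst_pos.le

theorem sum_rhs_difference_le {κ : Fin 3 → ℝ} (hκ : Admissible κ) (δ : ℝ)
    {B : Finset (Fin 3 → ℤ)} {U V : Fin 3 → (Fin 3 → ℤ) → ℂ}
    (hU : SuppIn B U) (hdiv : DivFreeCoef U) (hV : SuppIn B V) (hdivV : DivFreeCoef V)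
    (hVb : bt V = V) :
    ∑ k ∈ B, nsq (bt (rhs κ (aniso δ) U) - rhs κ (aniso δ) V) k
      ≤ 2 * wsum B (fun k => wt k * (wt k - 1)) (bt U - V) + derivConst *
        (crit B (bt U - V) * (crit B (bt U) + crit B V) + crit B (bc U) ^ 2) := by
  have hD := hU.bt.sub hV
  have hdD := hdiv.bt.sub hdivV
  set D := bt U - V with hDdef
  have h1 := sum_nl_sq_le (B' := B) hU.bc hU.bc hdiv.bc
  have h2 := sum_nl_sq_le (B' := B) hD hU.bt hdD
  have h3 := sum_nl_sq_le (B' := B) hV hD hdivV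
  set L : ℝ := lerayConst (fun _ : Fin 3 => (1 : ℝ)) with hL
  have h4 : ∀ k ∈ B, nsq (bt (rhs κ (aniso δ) U) - rhs κ (aniso δ) V) k
      ≤ 2 * (wt k * (wt k - 1) * nsq D k) + 72 * L ^ 2 * (nsq (nl D (bt U)) k + nsq (nl V D) k
        + nsq (nl (bc U) (bc U)) k) := by
    intro k _
    have hL0 := sq_nonneg L
    have p1 := nsq_nonneg (nl D (bt U)) k
    have p2 := nsq_nonneg (nl V D) k
    have p3 := nsq_nonneg (nl (bc U) (bc U)) k
    have p4 := mul_nonneg (wt_mul_sub_nonneg k) (nsq_nonneg D k)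
    by_cases hk : k 2 = 0
    swap
    · have : nsq (bt (rhs κ (aniso δ) U) - rhs κ (aniso δ) V) k = 0 := by
        simp [nsq, bt, hk, rhs_bt_eq_zero hVb]
      rw [this]
      positivity
    set N : Fin 3 → (Fin 3 → ℤ) → ℂ := (nl D (bt U) + nl V D) + nl (bc U) (bc U) with hN
    have hdec : ∀ i, nl U U i k = (nl V V + N) i k := by
      intro i
      have : nl (bt U) (bt U) i k - nl V V i k = nl D (bt U) i k + nl V D i k :=
        nl_sub hU.bt.amp_ne_top hV.amp_ne_top i k
      simp only [hN, Pi.add_apply, nl_barotropic hU i hk]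
      linear_combination this
    set X : Fin 3 → (Fin 3 → ℤ) → ℂ := fun i k => (((wt k - 1 : ℝ)) : ℂ) * D i k with hX
    have e : nsq (bt (rhs κ (aniso δ) U) - rhs κ (aniso δ) V) k = nsq (X + leray (fun _ => 1) N) k := by
      refine Finset.sum_congr rfl fun i _ => ?_
      rw [← norm_neg]
      congr 2
      -- At `k₂ = 0` the projection agrees with the isotropic one, which keeps the constant
      -- independent of `ε`.
      have hl : leray κ (nl U U) i k = leray κ (nl V V) i k + leray (fun _ => 1) N i k := by
        rw [leray_congr hdec, leray_add, leray_eq_of_eq_zero hκ Admissible.ones N i hk]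
      simp only [Pi.sub_apply, Pi.add_apply, bt, if_pos hk, rhs, hl, hX, hDdef,
        visc_aniso_of_eq_zero δ hk]
      ring
    have eX : nsq X k = (wt k - 1) ^ 2 * nsq D k := by
      simp only [nsq, hX, norm_mul, mul_pow, ← Finset.mul_sum, Complex.norm_real, Real.norm_eq_abs,
        sq_abs]
    have hw : (wt k - 1) ^ 2 ≤ wt k * (wt k - 1) := by nlinarith [one_le_wt k]
    have q1 := nsq_add_le X (leray (fun _ => 1) N) k
    have q2 := nsq_leray_le (κ := fun _ => 1) (fun _ => one_pos) N k
    have q3 := nsq_add_le (nl D (bt U) + nl V D) (nl (bc U) (bc U)) k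
    have q4 := nsq_add_le (nl D (bt U)) (nl V D) k
    have q5 : nsq N k ≤ 4 * (nsq (nl D (bt U)) k + nsq (nl V D) k + nsq (nl (bc U) (bc U)) k) := by
      linarith
    have q6 := mul_le_mul_of_nonneg_left q5 (by positivity : 0 ≤ 9 * L ^ 2)
    have q7 := mul_le_mul_of_nonneg_right hw (nsq_nonneg D k)
    rw [e]
    linarith
  refine (Finset.sum_le_sum h4).trans ?_
  rw [Finset.sum_add_distrib, ← Finset.mul_sum, ← Finset.mul_sum, Finset.sum_add_distrib,
    Finset.sum_add_distrib, derivConst, ← hL]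
  change 2 * wsum B _ D + _ ≤ _
  have h5 : bilConst * (crit B D * crit B (bt U)) + bilConst * (crit B V * crit B D)
      + bilConst * (crit B (bc U) * crit B (bc U))
      = bilConst * (crit B D * (crit B (bt U) + crit B V) + crit B (bc U) ^ 2) := by ring
  have h6 := mul_le_mul_of_nonneg_left (add_le_add (add_le_add h2 h3) h1)
    (by positivity : 0 ≤ 72 * L ^ 2)
  rw [h5] at h6
  linarith

/-- Supremum of the energy times the integral of the dissipation, both proportional to the initial
baroclinic energy. Its square is of order `1/δ`, and the left side is the fourth power of the
`L⁴(H^{3/2})` norm. -/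
theorem GalBound.integral_crit_bc_sq_le {T eS δ : ℝ} (hT : 0 ≤ T) (hδ : 1 ≤ δ)
    {B : Finset (Fin 3 → ℤ)} {X : ℝ → Fin 3 → (Fin 3 → ℤ) → ℂ}
    (hX : ∀ i k, Continuous fun t => X t i k) (h : GalBound T eS δ B X) :
    ∫ s in (0 : ℝ)..T, crit B (bc (X s)) ^ 2 ≤ 8 * growth T eS ^ 2 * bcE δ B (X 0) ^ 2 := by
  set y0 := bcE δ B (X 0)
  have hy0 : 0 ≤ growth T eS * y0 := mul_nonneg (growth_pos T eS).le (bcE_nonneg δ B _)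
  have hzc : Continuous fun t => bcD δ B (X t) := continuous_wsum (continuous_bc hX)
  have hcc : Continuous fun t => crit B (bc (X t)) := continuous_wsum (continuous_bc hX)
  calc ∫ s in (0 : ℝ)..T, crit B (bc (X s)) ^ 2
      ≤ ∫ s in (0 : ℝ)..T, 4 * (growth T eS * y0) * bcD δ B (X s) := by
        refine intervalIntegral.integral_mono_on hT ((hcc.pow 2).intervalIntegrable _ _)
          ((continuous_const.mul hzc).intervalIntegrable _ _) fun s hs => ?_
        have h1 : crit B (bc (X s)) ^ 2 ≤ 4 * (bcE δ B (X s) * bcD δ B (X s)) := crit_bc_sq_le hδ B _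
        have h2 := mul_le_mul_of_nonneg_right (h.y s hs) (bcD_nonneg hδ B (X s))
        linarith
    _ = 4 * (growth T eS * y0) * ∫ s in (0 : ℝ)..T, bcD δ B (X s) :=
        intervalIntegral.integral_const_mul _ _
    _ ≤ 4 * (growth T eS * y0) * (2 * growth T eS * y0) := by gcongr; exact h.z
    _ = _ := by ring

/-- The constant in the comparison estimate. -/
def cmpConst (T eS : ℝ) : ℝ :=
  Real.exp (T / 2 + 64 * bilConst ^ 2 * (eS * (2 * eS * T + 4 * eS)))
    * (8 * bilConst * (8 * growth T eS ^ 2))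

theorem cmpConst_nonneg (T eS : ℝ) : 0 ≤ cmpConst T eS := by
  have := bilConst_pos
  unfold cmpConst
  positivity

/-- The difference starts at zero and obeys a Gronwall inequality whose rate is integrable by the
bounds on both barotropic flows; the only source is the baroclinic one. The third conclusion
concerns the time derivatives and is stated through a continuous majorant `G`, convenient to
integrate. -/
theorem galerkin_comparison {κ : Fin 3 → ℝ} (hκ : Admissible κ) {δ : ℝ} (hδ : 1 ≤ δ)
    {B : Finset (Fin 3 → ℤ)} {T : ℝ} (hT : 0 ≤ T) {X V : ℝ → Fin 3 → (Fin 3 → ℤ) → ℂ}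
    (hX : GalSol κ δ B T X) (hV : GalSol κ δ B T V) {eS : ℝ} (he : 0 ≤ eS) (hXb : GalBound T eS δ B X)
    (hVe : ∀ t ∈ Icc 0 T, btE B (V t) ≤ eS) (hVf : ∫ s in (0 : ℝ)..T, btD B (V s) ≤ 2 * eS)
    (hVt : ∀ t ∈ Icc 0 T, bt (V t) = V t) (h0 : ∀ i, ∀ k ∈ B, bt (X 0) i k = V 0 i k) :
    (∀ t ∈ Icc 0 T, wsum B wt (bt (X t) - V t) ≤ cmpConst T eS * bcE δ B (X 0) ^ 2) ∧
    ∫ s in (0 : ℝ)..T, wsum B (fun k => wt k * (wt k - 1)) (bt (X s) - V s)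
      ≤ 2 * cmpConst T eS * bcE δ B (X 0) ^ 2 ∧
    ∃ G : ℝ → ℝ, Continuous G ∧ (∀ t ∈ Icc 0 T,
      ∑ k ∈ B, nsq (bt (rhs κ (aniso δ) (X t)) - rhs κ (aniso δ) (V t)) k ≤ G t) ∧
      ∫ s in (0 : ℝ)..T, G s ≤ (4 * cmpConst T eS + derivConst * (cmpConst T eS * (T + 2
        + eS * (eS * T + 2 * eS)) + 8 * growth T eS ^ 2)) * bcE δ B (X 0) ^ 2 := by
  have hb := bilConst_pos
  set K := 8 * bilConst with hK
  have hK0 : 0 < K := by positivity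
  set M := cmpConst T eS * bcE δ B (X 0) ^ 2 with hM
  set D : ℝ → Fin 3 → (Fin 3 → ℤ) → ℂ := fun t => bt (X t) - V t with hDdef
  have hDc : ∀ i k, Continuous fun t => D t i k := fun i k =>
    (continuous_bt hX.cont i k).sub (hV.cont i k)
  have hyc : Continuous fun t => wsum B wt (D t) := continuous_wsum hDc
  have hzc : Continuous fun t => wsum B (fun k => wt k * (wt k - 1)) (D t) := continuous_wsum hDc
  have hfX : Continuous fun t => btD B (X t) := continuous_wsum (continuous_bt hX.cont)
  have hfV : Continuous fun t => btD B (V t) := continuous_wsum (continuous_bt hV.cont)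
  have hcD : Continuous fun t => crit B (D t) := continuous_wsum hDc
  have hcX : Continuous fun t => crit B (bt (X t)) := continuous_wsum (continuous_bt hX.cont)
  have hcV : Continuous fun t => crit B (V t) := continuous_wsum hV.cont
  have hcc : Continuous fun t => crit B (bc (X t)) := continuous_wsum (continuous_bc hX.cont)
  have hz0 : ∀ t, 0 ≤ wsum B (fun k => wt k * (wt k - 1)) (D t) :=
    fun t => wsum_nonneg wt_mul_sub_nonneg _
  have hy0 : ∀ t, 0 ≤ wsum B wt (D t) := fun t => wsum_nonneg (fun k => (wt_pos k).le) _
  -- A majorant of the squared `H^{3/2}` quantities of both flows, obtained by interpolation; its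
  -- integral depends on `T` and `eS` only.
  set S : ℝ → ℝ := fun t => 2 * eS * (2 * eS + btD B (X t) + btD B (V t)) with hSdef
  have hSc : Continuous S := by fun_prop
  have hS0 : ∀ t, 0 ≤ S t := fun t => by
    have := btD_nonneg B (X t)
    have := btD_nonneg B (V t)
    positivity
  have hs2 : ∀ t ∈ Icc 0 T, (crit B (bt (X t)) + crit B (V t)) ^ 2 ≤ S t := by
    intro t ht
    have c1 : crit B (bt (X t)) ^ 2 ≤ btE B (X t) * (btE B (X t) + btD B (X t)) := crit_sq_le B _
    have c2 : crit B (V t) ^ 2 ≤ btE B (V t) * (btE B (V t) + btD B (V t)) := by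
      have := crit_sq_le B (bt (V t))
      simpa only [btE, btD, hVt t ht] using this
    have n1 := btE_nonneg B (X t)
    have n2 := btD_nonneg B (X t)
    have n3 := btE_nonneg B (V t)
    have n4 := btD_nonneg B (V t)
    have d1 : btE B (X t) * (btE B (X t) + btD B (X t)) ≤ eS * (eS + btD B (X t)) :=
      mul_le_mul (hXb.e t ht) (by linarith [hXb.e t ht]) (by positivity) he
    have d2 : btE B (V t) * (btE B (V t) + btD B (V t)) ≤ eS * (eS + btD B (V t)) :=
      mul_le_mul (hVe t ht) (by linarith [hVe t ht]) (by positivity) he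
    simp only [hSdef]
    nlinarith [sq_nonneg (crit B (bt (X t)) - crit B (V t))]
  have hDcr : ∀ t, crit B (D t) ^ 2
      ≤ wsum B wt (D t) * (wsum B wt (D t) + wsum B (fun k => wt k * (wt k - 1)) (D t)) :=
    fun t => crit_sq_le B _
  have hint : ∀ t ∈ Icc 0 T, ∫ s in (0 : ℝ)..t, S s ≤ 2 * eS * (2 * eS * T + 4 * eS) := by
    intro t ht
    have hle : ∫ s in (0 : ℝ)..t, S s ≤ ∫ s in (0 : ℝ)..T, S s :=
      intervalIntegral.integral_mono_interval le_rfl ht.1 ht.2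
        (Filter.Eventually.of_forall hS0) (hSc.intervalIntegrable _ _)
    refine hle.trans ?_
    simp (disch := fun_prop) only [hSdef, intervalIntegral.integral_const_mul,
      intervalIntegral_add_of_continuous, intervalIntegral.integral_const, smul_eq_mul, sub_zero]
    refine mul_le_mul_of_nonneg_left ?_ (by positivity)
    linarith [hXb.f, hVf]
  have hx2 := hXb.integral_crit_bc_sq_le hT hδ hX.cont
  have hgr := gronwall_dissipation (y := fun t => wsum B wt (D t))
    (ζ := fun t => 2⁻¹ * wsum B (fun k => wt k * (wt k - 1)) (D t))
    (β := fun t => 1 / 2 + 2⁻¹ * K ^ 2 * S t) (γ := fun t => K * crit B (bc (X t)) ^ 2) hyc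
    (fun t ht => hasDerivAt_wsum (w := wt)
      (Y := bt (rhs κ (aniso δ) (X t)) - rhs κ (aniso δ) (V t)) fun i k hk => by
        refine HasDerivAt.sub ?_ (hV.deriv t ht i k hk)
        by_cases hk2 : k 2 = 0
        · simpa [bt, hk2] using hX.deriv t ht i k hk
        · simpa [bt, hk2] using hasDerivAt_const t (0 : ℂ))
    (by fun_prop) (by fun_prop) (by fun_prop) (fun t => mul_nonneg (by norm_num) (hz0 t))
    (fun t => add_nonneg (by norm_num) (mul_nonneg (by positivity) (hS0 t)))
    (fun t => mul_nonneg hK0.le (sq_nonneg _))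
    (fun t ht => by
      have ht' := Ioo_subset_Icc_self ht
      have h1 := difference_energy_le hκ δ (hX.supp t) (hX.div t) (hV.supp t) (hV.div t) (hVt t ht')
      have e : ∀ k, pair (D t) (bt (rhs κ (aniso δ) (X t)) - rhs κ (aniso δ) (V t)) k
          = pair (D t) (rhs κ (aniso δ) (X t) - rhs κ (aniso δ) (V t)) k := by
        intro k
        by_cases hk : k 2 = 0
        · simp [pair, bt, hk]
        · have hD0 : ∀ i, D t i k = 0 := fun i => by
            simp only [hDdef]; rw [← hVt t ht']; simp [bt, hk]
          simp [pair, hD0]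
      simp only [e]
      refine h1.trans ?_
      rw [← hK]
      have h2 : K * (crit B (D t) * (crit B (bt (X t)) + crit B (V t)))
          ≤ 2⁻¹ * (wsum B wt (D t) + wsum B (fun k => wt k * (wt k - 1)) (D t))
            + 2⁻¹ * K ^ 2 * S t * wsum B wt (D t) := by
        refine le_of_sq_le_mul (by linarith [hy0 t, hz0 t])
          (mul_nonneg (mul_nonneg (by positivity) (hS0 t)) (hy0 t)) ?_
        have := mul_le_mul (hDcr t) (hs2 t ht') (sq_nonneg _)
          (mul_nonneg (hy0 t) (by linarith [hy0 t, hz0 t]))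
        have := mul_le_mul_of_nonneg_left this (sq_nonneg K)
        nlinarith
      change -wsum B _ (D t) + K * (crit B (D t) * _ + _) ≤ _
      linarith)
  have hfin : ∀ t ∈ Icc 0 T, wsum B wt (D t)
      + 2⁻¹ * ∫ s in (0 : ℝ)..t, wsum B (fun k => wt k * (wt k - 1)) (D s) ≤ M := by
    intro t ht
    have h1 := hgr t ht
    have hD0 : wsum B wt (D 0) = 0 := Finset.sum_eq_zero fun k hk => by
      simp [nsq, hDdef, h0 _ k hk]
    simp only [hD0, zero_add, intervalIntegral.integral_const_mul] at h1
    refine h1.trans ?_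
    rw [hM, cmpConst, mul_assoc (Real.exp _)]
    have h2 : ∫ s in (0 : ℝ)..t, crit B (bc (X s)) ^ 2 ≤ ∫ s in (0 : ℝ)..T, crit B (bc (X s)) ^ 2 :=
      intervalIntegral.integral_mono_interval le_rfl ht.1 ht.2
        (Filter.Eventually.of_forall fun _ => sq_nonneg _) ((hcc.pow 2).intervalIntegrable _ _)
    refine mul_le_mul (Real.exp_le_exp.mpr ?_) ?_
      (mul_nonneg hK0.le (intervalIntegral.integral_nonneg ht.1 fun _ _ => sq_nonneg _))
      (Real.exp_pos _).le
    · simp (disch := fun_prop) only [intervalIntegral_add_of_continuous,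
        intervalIntegral.integral_const_mul, intervalIntegral.integral_const, smul_eq_mul, sub_zero]
      have := mul_le_mul_of_nonneg_left (hint t ht) (by positivity : 0 ≤ 2⁻¹ * K ^ 2)
      have e : 2⁻¹ * K ^ 2 * (2 * eS * (2 * eS * T + 4 * eS))
          = 64 * bilConst ^ 2 * (eS * (2 * eS * T + 4 * eS)) := by rw [hK]; ring
      linarith [ht.2]
    · have := mul_le_mul_of_nonneg_left (h2.trans hx2) hK0.le
      linarith
  have hzi : 0 ≤ ∫ s in (0 : ℝ)..T, wsum B (fun k => wt k * (wt k - 1)) (D s) :=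
    intervalIntegral.integral_nonneg hT fun s _ => hz0 s
  have hyM : ∀ t ∈ Icc 0 T, wsum B wt (D t) ≤ M := fun t ht => by
    have : 0 ≤ ∫ s in (0 : ℝ)..t, wsum B (fun k => wt k * (wt k - 1)) (D s) :=
      intervalIntegral.integral_nonneg ht.1 fun s _ => hz0 s
    linarith [hfin t ht]
  have hzM : ∫ s in (0 : ℝ)..T, wsum B (fun k => wt k * (wt k - 1)) (D s) ≤ 2 * M := by
    linarith [hfin T ⟨hT, le_rfl⟩, hy0 T]
  have hM0 : 0 ≤ M := mul_nonneg (cmpConst_nonneg T eS) (sq_nonneg _)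
  refine ⟨hyM, by linarith, fun t => 2 * wsum B (fun k => wt k * (wt k - 1)) (D t) + derivConst *
    ((M + wsum B (fun k => wt k * (wt k - 1)) (D t) + M * (S t / 4)) + crit B (bc (X t)) ^ 2),
    by fun_prop, ?_, ?_⟩
  · intro t ht
    refine (sum_rhs_difference_le hκ δ (hX.supp t) (hX.div t) (hV.supp t) (hV.div t)
      (hVt t ht)).trans ?_
    have h2 : crit B (D t) * (crit B (bt (X t)) + crit B (V t))
        ≤ (wsum B wt (D t) + wsum B (fun k => wt k * (wt k - 1)) (D t))
          + wsum B wt (D t) * (S t / 4) := by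
      refine le_of_sq_le_mul (by linarith [hy0 t, hz0 t])
        (mul_nonneg (hy0 t) (by linarith [hS0 t])) ?_
      have := mul_le_mul (hDcr t) (hs2 t ht) (sq_nonneg _)
        (mul_nonneg (hy0 t) (by linarith [hy0 t, hz0 t]))
      nlinarith
    have h3 := mul_le_mul_of_nonneg_right (hyM t ht) (by linarith [hS0 t] : 0 ≤ S t / 4)
    have h4 := mul_le_mul_of_nonneg_left (by linarith [hyM t ht] :
      crit B (D t) * (crit B (bt (X t)) + crit B (V t)) + crit B (bc (X t)) ^ 2 ≤
      (M + wsum B (fun k => wt k * (wt k - 1)) (D t) + M * (S t / 4)) + crit B (bc (X t)) ^ 2)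
      derivConst_nonneg
    change 2 * wsum B _ (D t) + derivConst * (crit B (D t) * _ + _) ≤ _
    linarith
  · have hi := hint T ⟨hT, le_rfl⟩
    simp (disch := fun_prop) only [intervalIntegral_add_of_continuous,
      intervalIntegral.integral_const_mul, intervalIntegral.integral_div,
      intervalIntegral.integral_const, smul_eq_mul, sub_zero]
    have h5 := mul_le_mul_of_nonneg_left hi hM0
    have h6 : T * M + (∫ s in (0 : ℝ)..T, wsum B (fun k => wt k * (wt k - 1)) (D s))
        + M * ((∫ s in (0 : ℝ)..T, S s) / 4) + ∫ s in (0 : ℝ)..T, crit B (bc (X s)) ^ 2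
        ≤ M * (T + 2 + eS * (eS * T + 2 * eS)) + 8 * growth T eS ^ 2 * bcE δ B (X 0) ^ 2 := by
      linarith
    have h7 := mul_le_mul_of_nonneg_left h6 derivConst_nonneg
    refine (add_le_add (mul_le_mul_of_nonneg_left hzM zero_le_two) h7).trans (le_of_eq ?_)
    rw [hM]
    ring

open Filter Topology

/-! ### Passage to the limit -/

/-- Arzelà-Ascoli for each of countably many modes: Tychonoff gives convergence at a dense sequence
of times for all modes simultaneously, and the Lipschitz bounds, uniform in `n`, extend it to all
times. -/
theorem exists_subseq_tendsto {ι : Type*} [Countable ι] {T : ℝ} (hT : 0 ≤ T)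
    {f : ℕ → ℝ → ι → ℂ} {R L : ι → ℝ} (hR : ∀ n, ∀ t ∈ Icc 0 T, ∀ j, ‖f n t j‖ ≤ R j)
    (hL : ∀ n, ∀ s ∈ Icc 0 T, ∀ t ∈ Icc 0 T, ∀ j, ‖f n t j - f n s j‖ ≤ L j * |t - s|) :
    ∃ φ : ℕ → ℕ, StrictMono φ ∧ ∃ g : ℝ → ι → ℂ, ∀ t ∈ Icc 0 T, ∀ j,
      Tendsto (fun n => f (φ n) t j) atTop (𝓝 (g t j)) := by
  have : Nonempty (Icc 0 T) := ⟨⟨0, le_rfl, hT⟩⟩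
  set q : ℕ → Icc 0 T := TopologicalSpace.denseSeq (Icc 0 T)
  have hK : IsCompact (Set.pi univ fun p : ℕ × ι => Metric.closedBall (0 : ℂ) (R p.2)) :=
    isCompact_univ_pi fun p => isCompact_closedBall _ _
  obtain ⟨a, -, φ, hφ, ha⟩ := hK.tendsto_subseq (x := fun n p => f n (q p.1) p.2) fun n => by
    simpa using fun m j => hR n _ (q m).2 j
  rw [tendsto_pi_nhds] at ha
  have hc : ∀ t ∈ Icc 0 T, ∀ j, ∃ z, Tendsto (fun n => f (φ n) t j) atTop (𝓝 z) := by
    intro t ht j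
    refine cauchySeq_tendsto_of_complete (Metric.cauchySeq_iff'.mpr fun ε hε => ?_)
    have hL0 : 0 < |L j| + 1 := by positivity
    obtain ⟨m, hm⟩ := (TopologicalSpace.denseRange_denseSeq (Icc 0 T)).exists_dist_lt ⟨t, ht⟩
      (div_pos (div_pos hε four_pos) hL0)
    have hm' : (|L j| + 1) * |t - q m| < ε / 4 := by
      rw [mul_comm, ← lt_div_iff₀ hL0]
      exact hm
    obtain ⟨N, hN⟩ := Metric.cauchySeq_iff'.mp (ha (m, j)).cauchySeq (ε / 2) (half_pos hε)
    have hnear : ∀ n, dist (f (φ n) t j) (f (φ n) (q m) j) < ε / 4 := fun n => by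
      rw [dist_eq_norm]
      refine ((hL (φ n) _ (q m).2 t ht j).trans ?_).trans_lt hm'
      exact mul_le_mul_of_nonneg_right ((le_abs_self _).trans (by linarith)) (abs_nonneg _)
    refine ⟨N, fun n hn => ?_⟩
    have h1 := hN n hn
    have h2 := hnear n
    have h3 := hnear N
    rw [dist_comm] at h3
    have h4 := dist_triangle4 (f (φ n) t j) (f (φ n) (q m) j) (f (φ N) (q m) j) (f (φ N) t j)
    simp only [Function.comp_apply] at h1
    linarith
  choose! g hg using hc
  exact ⟨φ, hφ, g, hg⟩

/-- The weighted energy of a coefficient family with values in `[0, ∞]`. -/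
def energy (w : (Fin 3 → ℤ) → ℝ) (Y : Fin 3 → (Fin 3 → ℤ) → ℂ) : ℝ≥0∞ :=
  ∑' k, ENNReal.ofReal (w k * nsq Y k)

theorem energy_eq {B : Finset (Fin 3 → ℤ)} {w : (Fin 3 → ℤ) → ℝ} (hw : ∀ k, 0 ≤ w k)
    {Y : Fin 3 → (Fin 3 → ℤ) → ℂ} (hY : SuppIn B Y) : energy w Y = ENNReal.ofReal (wsum B w Y) := by
  rw [energy, tsum_eq_sum (s := B) fun k hk => by simp [nsq, hY _ k hk], wsum,
    ENNReal.ofReal_sum_of_nonneg fun k _ => mul_nonneg (hw k) (nsq_nonneg Y k)]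

/-- Fatou's lemma for the counting measure on frequencies. -/
theorem energy_le_liminf {w : (Fin 3 → ℤ) → ℝ} {Y : Fin 3 → (Fin 3 → ℤ) → ℂ}
    {Z : ℕ → Fin 3 → (Fin 3 → ℤ) → ℂ} (h : ∀ i k, Tendsto (fun n => Z n i k) atTop (𝓝 (Y i k))) :
    energy w Y ≤ liminf (fun n => energy w (Z n)) atTop := by
  have h1 := lintegral_liminf_le (μ := Measure.count) (u := atTop)
    (f := fun n k => ENNReal.ofReal (w k * nsq (Z n) k)) fun n => measurable_of_countable _
  have h2 : ∀ k, liminf (fun n => ENNReal.ofReal (w k * nsq (Z n) k)) atTop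
      = ENNReal.ofReal (w k * nsq Y k) := fun k =>
    (ENNReal.tendsto_ofReal ((tendsto_finsetSum _ fun i _ => ((h i k).norm.pow 2)).const_mul
      (w k))).liminf_eq
  simpa only [h2, lintegral_count, energy] using h1

theorem energy_le_of_tendsto {w : (Fin 3 → ℤ) → ℝ} {Y : Fin 3 → (Fin 3 → ℤ) → ℂ}
    {Z : ℕ → Fin 3 → (Fin 3 → ℤ) → ℂ} (h : ∀ i k, Tendsto (fun n => Z n i k) atTop (𝓝 (Y i k)))
    {C : ℝ≥0∞} (hC : ∀ n, energy w (Z n) ≤ C) : energy w Y ≤ C :=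
  (energy_le_liminf h).trans (liminf_le_of_frequently_le' (Frequently.of_forall hC))

/-- Fatou in frequency, then in time. The power `p = 1` serves the `L²` in time bounds, `p = 2` the
`L⁴` bound on the baroclinic part. -/
theorem lintegral_energy_pow_le {w : (Fin 3 → ℤ) → ℝ} {T : ℝ} {Y : ℝ → Fin 3 → (Fin 3 → ℤ) → ℂ}
    {Z : ℕ → ℝ → Fin 3 → (Fin 3 → ℤ) → ℂ} (hZ : ∀ n i k, Continuous fun t => Z n t i k)
    (h : ∀ t ∈ Icc 0 T, ∀ i k, Tendsto (fun n => Z n t i k) atTop (𝓝 (Y t i k))) (p : ℕ)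
    {C : ℝ≥0∞} (hC : ∀ n, ∫⁻ t in Ioo 0 T, energy w (Z n t) ^ p ≤ C) :
    ∫⁻ t in Ioo 0 T, energy w (Y t) ^ p ≤ C := by
  have hm : ∀ n, Measurable fun t => energy w (Z n t) ^ p := fun n =>
    (Measurable.tsum fun k => (Continuous.measurable (continuous_const.mul
      (continuous_finsetSum _ fun i _ => ((hZ n i k).norm.pow 2)))).ennreal_ofReal).pow_const p
  calc ∫⁻ t in Ioo 0 T, energy w (Y t) ^ p
      ≤ ∫⁻ t in Ioo 0 T, liminf (fun n => energy w (Z n t) ^ p) atTop := by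
        refine setLIntegral_mono' measurableSet_Ioo fun t ht => ?_
        have h1 := pow_le_pow_left' (energy_le_liminf (w := w) (h t (Ioo_subset_Icc_self ht))) p
        refine h1.trans (le_of_eq ?_)
        exact (pow_left_mono p).map_liminf_of_continuousAt _ (ENNReal.continuous_pow p).continuousAt
    _ ≤ liminf (fun n => ∫⁻ t in Ioo 0 T, energy w (Z n t) ^ p) atTop := lintegral_liminf_le hm
    _ ≤ C := liminf_le_of_frequently_le' (Frequently.of_forall hC)

theorem amp_sq_le (Y : Fin 3 → (Fin 3 → ℤ) → ℂ) (k : Fin 3 → ℤ) :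
    amp Y k ^ 2 ≤ 3 * ENNReal.ofReal (nsq Y k) := by
  refine (ennreal_sum_sq_le _).trans (le_of_eq ?_)
  rw [nsq, ENNReal.ofReal_sum_of_nonneg fun _ _ => sq_nonneg _]
  simp [ENNReal.ofReal_pow]

theorem tsum_mul_amp_sq_le {w : (Fin 3 → ℤ) → ℝ} (hw : ∀ k, 0 ≤ w k) (Y : Fin 3 → (Fin 3 → ℤ) → ℂ) :
    ∑' k, ENNReal.ofReal (w k) * amp Y k ^ 2 ≤ 3 * energy w Y := by
  rw [energy, ← ENNReal.tsum_mul_left]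
  refine ENNReal.tsum_le_tsum fun k => (mul_le_mul_right (amp_sq_le Y k) _).trans (le_of_eq ?_)
  rw [ENNReal.ofReal_mul (hw k)]
  ring

theorem tsum_amp_sq_le_weighted {d : ℕ} (Y : Fin d → (Fin d → ℤ) → ℂ) :
    ∑' k, amp Y k ^ 2 ≤ ∑' k, ENNReal.ofReal (wt k) * amp Y k ^ 2 :=
  ENNReal.tsum_le_tsum fun k => le_mul_of_one_le_left zero_le
    (by simpa using ENNReal.ofReal_le_ofReal (one_le_wt k))

theorem amp_sub_sq_le {d : ℕ} (X Y : Fin d → (Fin d → ℤ) → ℂ) (k : Fin d → ℤ) :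
    amp (X - Y) k ^ 2 ≤ 4 * (amp X k ^ 2 + amp Y k ^ 2) := by
  refine le_trans (pow_le_pow_left' ?_ 2) (ennreal_add_sq_le _ _)
  simp only [amp, ← Finset.sum_add_distrib]
  exact Finset.sum_le_sum fun i _ => enorm_sub_le

/-- Rellich's theorem on the Fourier side: outside the box of size `N` the `H¹` bound leaves at most
`N⁻¹` times a constant, and inside there are finitely many convergent modes. -/
theorem tendsto_tsum_amp_sub {d : ℕ} {X : ℕ → Fin d → (Fin d → ℤ) → ℂ} {Y : Fin d → (Fin d → ℤ) → ℂ}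
    (h : ∀ i k, Tendsto (fun n => X n i k) atTop (𝓝 (Y i k))) {M : ℝ≥0∞} (hM : M ≠ ∞)
    (hX : ∀ n, ∑' k, ENNReal.ofReal (wt k) * amp (X n) k ^ 2 ≤ M)
    (hY : ∑' k, ENNReal.ofReal (wt k) * amp Y k ^ 2 ≤ M) :
    Tendsto (fun n => ∑' k, amp (X n - Y) k ^ 2) atTop (𝓝 0) := by
  have hw : ∀ n, ∑' k, ENNReal.ofReal (wt k) * amp (X n - Y) k ^ 2 ≤ 8 * M := fun n =>
    calc _ ≤ ∑' k, (4 * (ENNReal.ofReal (wt k) * amp (X n) k ^ 2)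
          + 4 * (ENNReal.ofReal (wt k) * amp Y k ^ 2)) := ENNReal.tsum_le_tsum fun k =>
            (mul_le_mul_right (amp_sub_sq_le _ _ k) _).trans (le_of_eq (by ring))
      _ = 4 * ∑' k, ENNReal.ofReal (wt k) * amp (X n) k ^ 2
          + 4 * ∑' k, ENNReal.ofReal (wt k) * amp Y k ^ 2 := by
            rw [ENNReal.tsum_add, ENNReal.tsum_mul_left, ENNReal.tsum_mul_left]
      _ ≤ 4 * M + 4 * M := by gcongr; exact hX n
      _ = 8 * M := by ring
  have htail : ∀ N n, ∑' k, amp (X n - Y) k ^ 2 ≤ ∑ k ∈ box d N, amp (X n - Y) k ^ 2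
      + (N : ℝ≥0∞)⁻¹ * (8 * M) := by
    intro N n
    calc ∑' k, amp (X n - Y) k ^ 2
        ≤ ∑' k, ((if k ∈ box d N then amp (X n - Y) k ^ 2 else 0)
          + (N : ℝ≥0∞)⁻¹ * (ENNReal.ofReal (wt k) * amp (X n - Y) k ^ 2)) := by
          refine ENNReal.tsum_le_tsum fun k => ?_
          split_ifs with hk
          · exact le_self_add
          · rw [zero_add, ← mul_assoc]
            refine le_mul_of_one_le_left zero_le ?_
            obtain ⟨i, hi⟩ : ∃ i, (N : ℤ) < |k i| := by simpa [mem_box] using hk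
            have hi' : (N : ℝ) < |(k i : ℝ)| := by exact_mod_cast hi
            have hN0 : (0 : ℝ) ≤ N := Nat.cast_nonneg N
            have h1 : (1 : ℝ) ≤ |(k i : ℝ)| := by
              have : (1 : ℤ) ≤ |k i| := by omega
              exact_mod_cast this
            have h2 : (N : ℝ) ≤ wt k := by
              refine le_trans ?_ (sq_pi_mul_le_wt k i)
              rw [mul_pow, ← sq_abs (k i : ℝ)]
              nlinarith [one_le_pi_sq]
            rw [mul_comm, ← div_eq_mul_inv, ENNReal.le_div_iff_mul_le (Or.inr (by simp [wt_pos k]))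
              (Or.inl (ENNReal.natCast_ne_top N)), one_mul, ← ENNReal.ofReal_natCast]
            exact ENNReal.ofReal_le_ofReal h2
      _ = ∑ k ∈ box d N, amp (X n - Y) k ^ 2
          + (N : ℝ≥0∞)⁻¹ * ∑' k, ENNReal.ofReal (wt k) * amp (X n - Y) k ^ 2 := by
          rw [ENNReal.tsum_add, ENNReal.tsum_mul_left, tsum_eq_sum (s := box d N) fun k hk => if_neg hk]
          congr 1
          exact Finset.sum_congr rfl fun k hk => if_pos hk
      _ ≤ _ := by gcongr; exact hw n
  rw [ENNReal.tendsto_nhds_zero]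
  intro ε hε
  have h8 : Tendsto (fun N : ℕ => (N : ℝ≥0∞)⁻¹ * (8 * M)) atTop (𝓝 0) := by
    have := ENNReal.Tendsto.mul_const ENNReal.tendsto_inv_nat_nhds_zero
      (Or.inr (ENNReal.mul_ne_top (by norm_num : (8 : ℝ≥0∞) ≠ ∞) hM))
    rwa [zero_mul] at this
  obtain ⟨N, hN⟩ := (ENNReal.tendsto_nhds_zero.mp h8 (ε / 2) (ENNReal.half_pos hε.ne')).exists
  have hfin : Tendsto (fun n => ∑ k ∈ box d N, amp (X n - Y) k ^ 2) atTop (𝓝 0) := by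
    have : Tendsto (fun n => ∑ k ∈ box d N, amp (X n - Y) k ^ 2) atTop
        (𝓝 (∑ k ∈ box d N, (∑ _i : Fin d, (0 : ℝ≥0∞)) ^ 2)) := by
      refine tendsto_finsetSum _ fun k _ => ((ENNReal.continuous_pow 2).tendsto _).comp
        (tendsto_finsetSum _ fun i _ => ?_)
      have := ((h i k).sub_const (Y i k)).enorm
      rwa [sub_self, enorm_zero] at this
    simpa using this
  filter_upwards [ENNReal.tendsto_nhds_zero.mp hfin (ε / 2) (ENNReal.half_pos hε.ne')] with n hn
  exact (htail N n).trans ((add_le_add hn hN).trans (ENNReal.add_halves ε).le)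

theorem econv_sq_le {d : ℕ} (f g : (Fin d → ℤ) → ℝ≥0∞) (k : Fin d → ℤ) :
    econv f g k ^ 2 ≤ (∑' l, f l ^ 2) * ∑' l, g l ^ 2 := by
  refine (ennreal_tsum_mul_sq_le _ _).trans (le_of_eq ?_)
  congr 1
  exact (Equiv.subLeft k).tsum_eq fun l => g l ^ 2

/-- A fixed frequency of the quadratic term is continuous in `ℓ²`; modewise convergence alone would
not pass to the limit in the convolution. -/
theorem tendsto_nl {d : ℕ} {X : ℕ → Fin d → (Fin d → ℤ) → ℂ} {Y : Fin d → (Fin d → ℤ) → ℂ}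
    {M : ℝ≥0∞} (hM : M ≠ ∞) (hX : ∀ n, ∑' k, amp (X n) k ^ 2 ≤ M) (hY : ∑' k, amp Y k ^ 2 ≤ M)
    (h : Tendsto (fun n => ∑' k, amp (X n - Y) k ^ 2) atTop (𝓝 0)) (i : Fin d) (k : Fin d → ℤ) :
    Tendsto (fun n => nl (X n) (X n) i k) atTop (𝓝 (nl Y Y i k)) := by
  rw [tendsto_iff_edist_tendsto_0]
  set c := ENNReal.ofReal (Real.sqrt (wt k - 1))
  have hle : ∀ n, edist (nl (X n) (X n) i k) (nl Y Y i k)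
      ≤ (c ^ 2 * 4 * (2 * M) * ∑' k, amp (X n - Y) k ^ 2) ^ (2 : ℝ)⁻¹ := by
    intro n
    refine (ENNReal.le_rpow_inv_iff two_pos).mpr ?_
    rw [ENNReal.rpow_two, edist_eq_enorm_sub, nl_sub (ne_top_of_le_ne_top hM (hX n)) (ne_top_of_le_ne_top hM hY)]
    have h1 : ‖nl (X n - Y) (X n) i k + nl Y (X n - Y) i k‖ₑ
        ≤ c * econv (amp (X n - Y)) (amp (X n)) k + c * econv (amp Y) (amp (X n - Y)) k :=
      (enorm_add_le _ _).trans (add_le_add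
        ((Finset.single_le_sum (f := fun i => ‖nl (X n - Y) (X n) i k‖ₑ) (fun _ _ => zero_le)
          (Finset.mem_univ i)).trans (enorm_nl_le _ _ k))
        ((Finset.single_le_sum (f := fun i => ‖nl Y (X n - Y) i k‖ₑ) (fun _ _ => zero_le)
          (Finset.mem_univ i)).trans (enorm_nl_le _ _ k)))
    calc _ ≤ (c * econv (amp (X n - Y)) (amp (X n)) k + c * econv (amp Y) (amp (X n - Y)) k) ^ 2 :=
          pow_le_pow_left' h1 2
      _ ≤ 4 * ((c * econv (amp (X n - Y)) (amp (X n)) k) ^ 2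
          + (c * econv (amp Y) (amp (X n - Y)) k) ^ 2) := ennreal_add_sq_le _ _
      _ ≤ 4 * (c ^ 2 * ((∑' k, amp (X n - Y) k ^ 2) * M) + c ^ 2 * (M * ∑' k, amp (X n - Y) k ^ 2)) := by
          rw [mul_pow, mul_pow]
          gcongr
          · exact (econv_sq_le _ _ k).trans (mul_le_mul_right (hX n) _)
          · exact (econv_sq_le _ _ k).trans (mul_le_mul_left hY _)
      _ = _ := by ring
  refine tendsto_of_tendsto_of_tendsto_of_le_of_le tendsto_const_nhds ?_ (fun _ => zero_le) hle
  have h1 := ENNReal.Tendsto.const_mul (a := c ^ 2 * 4 * (2 * M)) h (Or.inr (by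
    refine ENNReal.mul_ne_top (ENNReal.mul_ne_top (ENNReal.pow_ne_top ENNReal.ofReal_ne_top)
      (by norm_num)) (ENNReal.mul_ne_top (by norm_num) hM)))
  have h2 := ((ENNReal.continuous_rpow_const (y := (2 : ℝ)⁻¹)).tendsto _).comp h1
  simpa [Function.comp_def] using h2

theorem tendsto_rhs {d : ℕ} {κ μ : Fin d → ℝ} {X : ℕ → Fin d → (Fin d → ℤ) → ℂ}
    {Y : Fin d → (Fin d → ℤ) → ℂ} (h : ∀ i k, Tendsto (fun n => X n i k) atTop (𝓝 (Y i k)))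
    (hn : ∀ i k, Tendsto (fun n => nl (X n) (X n) i k) atTop (𝓝 (nl Y Y i k)))
    (i : Fin d) (k : Fin d → ℤ) :
    Tendsto (fun n => rhs κ μ (X n) i k) atTop (𝓝 (rhs κ μ Y i k)) :=
  (((h i k).const_mul _).add ((hn i k).sub (((tendsto_finsetSum _ fun j _ =>
    (hn j k).const_mul _).const_mul _).div_const _))).neg

theorem enorm_rhs_le {d : ℕ} {κ μ : Fin d → ℝ} (hκ : ∀ i, 0 < κ i) {Y : Fin d → (Fin d → ℤ) → ℂ}
    {M : ℝ≥0∞} (hY : ∑' k, amp Y k ^ 2 ≤ M) (i : Fin d) (k : Fin d → ℤ) :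
    ‖rhs κ μ Y i k‖ₑ ≤ ‖(visc μ k : ℂ)‖ₑ * (1 + M)
      + ENNReal.ofReal (lerayConst κ) * (ENNReal.ofReal (Real.sqrt (wt k - 1)) * M) := by
  have h1 : ‖Y i k‖ₑ ≤ 1 + M := by
    have h2 : ‖Y i k‖ₑ ^ 2 ≤ M := ((pow_le_pow_left' (Finset.single_le_sum (f := fun i => ‖Y i k‖ₑ)
      (fun _ _ => zero_le) (Finset.mem_univ i)) 2).trans (ENNReal.le_tsum k)).trans hY
    rcases le_total ‖Y i k‖ₑ 1 with h | h
    · exact h.trans le_self_add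
    · exact ((le_self_pow₀ h two_ne_zero).trans h2).trans le_add_self
  have h3 : econv (amp Y) (amp Y) k ≤ M := by
    have h4 : econv (amp Y) (amp Y) k ^ 2 ≤ M ^ 2 :=
      (econv_sq_le _ _ k).trans (by rw [sq]; exact mul_le_mul' hY hY)
    exact (ENNReal.pow_le_pow_left_iff two_ne_zero).mp h4
  rw [rhs, enorm_neg]
  refine (enorm_add_le _ _).trans (add_le_add ?_ ?_)
  · rw [enorm_mul]
    exact mul_le_mul_right h1 _
  · exact (enorm_leray_le hκ _ i k).trans (mul_le_mul_right ((enorm_nl_le Y Y k).trans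
      (mul_le_mul_right h3 _)) _)

theorem lintegral_ofReal_of_continuous {T : ℝ} (hT : 0 ≤ T) {f : ℝ → ℝ} (hf : Continuous f)
    (hf0 : ∀ t, 0 ≤ f t) :
    ∫⁻ t in Ioo 0 T, ENNReal.ofReal (f t) = ENNReal.ofReal (∫ t in (0 : ℝ)..T, f t) := by
  rw [← ofReal_integral_eq_lintegral_ofReal (hf.integrableOn_Icc.mono_set Ioo_subset_Icc_self)
    (Eventually.of_forall hf0), ← integral_Ioc_eq_integral_Ioo, ← intervalIntegral.integral_of_le hT]

theorem continuous_rhs {κ μ : Fin 3 → ℝ} {B : Finset (Fin 3 → ℤ)} {X : ℝ → Fin 3 → (Fin 3 → ℤ) → ℂ}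
    (hs : ∀ t, SuppIn B (X t)) (hX : ∀ i k, Continuous fun t => X t i k) (i : Fin 3) (k : Fin 3 → ℤ) :
    Continuous fun t => rhs κ μ (X t) i k := by
  have hn : ∀ i k, Continuous fun t => nl (X t) (X t) i k := by
    intro i k
    simp only [nl, (hs _).conv_eq]
    exact continuous_const.mul (continuous_finsetSum _ fun j _ => continuous_const.mul
      (continuous_finsetSum _ fun l _ => (hX j l).mul (hX i _)))
  unfold rhs leray
  exact ((continuous_const.mul (hX i k)).add ((hn i k).sub ((continuous_const.mul
    (continuous_finsetSum _ fun j _ => continuous_const.mul (hn j k))).div_const _))).neg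

theorem GalSol.sub_eq_integral {κ : Fin 3 → ℝ} {δ : ℝ} {B : Finset (Fin 3 → ℤ)} {T : ℝ}
    {X : ℝ → Fin 3 → (Fin 3 → ℤ) → ℂ} (h : GalSol κ δ B T X) {s t : ℝ} (hs : 0 ≤ s) (hst : s ≤ t)
    (ht : t ≤ T) (i : Fin 3) {k : Fin 3 → ℤ} (hk : k ∈ B) :
    ∫ r in s..t, rhs κ (aniso δ) (X r) i k = X t i k - X s i k :=
  intervalIntegral.integral_eq_sub_of_hasDerivAt_of_le hst (h.cont i k).continuousOn
    (fun r hr => h.deriv r ⟨hs.trans_lt hr.1, hr.2.trans_le ht⟩ i k hk)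
    ((continuous_rhs h.supp h.cont i k).intervalIntegrable _ _)

theorem FieldCoef.of_tendsto {X : ℕ → Fin 3 → (Fin 3 → ℤ) → ℂ} {Y : Fin 3 → (Fin 3 → ℤ) → ℂ}
    (h : ∀ i k, Tendsto (fun n => X n i k) atTop (𝓝 (Y i k))) (hX : ∀ n, FieldCoef (X n)) :
    FieldCoef Y where
  div k := tendsto_nhds_unique (tendsto_finsetSum _ fun j _ => (h j k).const_mul (k j : ℂ))
    (by simp only [(hX _).div k]; exact tendsto_const_nhds)
  real i k := tendsto_nhds_unique (h i (-k)) (by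
    simp only [(hX _).real i k]; exact (Complex.continuous_conj.tendsto _).comp (h i k))
  parity i k := tendsto_nhds_unique (h i (reflFreq k)) (by
    simp only [(hX _).parity i k]; exact (h i k).const_mul _)

/-- Compactness. The bounds `M`, `M₂` need to be uniform in `n` only, and they may depend on `δ`.
The `H¹` bound controls each mode of the right-hand side, hence gives equicontinuity, strong `ℓ²`
convergence at each time, and a dominating constant for the integrated equation. -/
theorem galerkin_limit {κ : Fin 3 → ℝ} (hκ : Admissible κ) {δ : ℝ} {T : ℝ} (hT : 0 < T)
    {B : ℕ → Finset (Fin 3 → ℤ)} (hB : Tendsto B atTop atTop) {X : ℕ → ℝ → Fin 3 → (Fin 3 → ℤ) → ℂ}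
    (hX : ∀ n, GalSol κ δ (B n) T (X n)) {M M₂ : ℝ}
    (h1 : ∀ n, ∀ t ∈ Icc 0 T, wsum (B n) wt (X n t) ≤ M)
    (h2 : ∀ n, ∫ s in (0 : ℝ)..T, wsum (B n) (fun k => wt k ^ 2) (X n s) ≤ M₂) :
    ∃ φ : ℕ → ℕ, StrictMono φ ∧ ∃ U : ℝ → Fin 3 → (Fin 3 → ℤ) → ℂ,
      (∀ t ∈ Icc 0 T, ∀ i k, Tendsto (fun n => X (φ n) t i k) atTop (𝓝 (U t i k))) ∧
      CoefSol κ (aniso δ) T U ∧ (∀ t ∈ Icc 0 T, FieldCoef (U t)) ∧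
      (∀ t ∈ Icc 0 T, energy wt (U t) ≤ ENNReal.ofReal M) ∧
      ∀ t ∈ Icc 0 T, ∀ i k, Tendsto (fun n => rhs κ (aniso δ) (X (φ n) t) i k) atTop
        (𝓝 (rhs κ (aniso δ) (U t) i k)) := by
  have hwt0 : ∀ k : Fin 3 → ℤ, 0 ≤ wt k := fun k => (wt_pos k).le
  set C : ℝ≥0∞ := 3 * ENNReal.ofReal M with hC
  have hCtop : C ≠ ∞ := ENNReal.mul_ne_top (by norm_num) ENNReal.ofReal_ne_top
  have hE : ∀ n, ∀ t ∈ Icc 0 T, energy wt (X n t) ≤ ENNReal.ofReal M := fun n t ht => by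
    rw [energy_eq hwt0 ((hX n).supp t)]
    exact ENNReal.ofReal_le_ofReal (h1 n t ht)
  have hW : ∀ n, ∀ t ∈ Icc 0 T, ∑' k, ENNReal.ofReal (wt k) * amp (X n t) k ^ 2 ≤ C := fun n t ht =>
    (tsum_mul_amp_sq_le hwt0 _).trans (mul_le_mul_right (hE n t ht) _)
  have hA : ∀ n, ∀ t ∈ Icc 0 T, ∑' k, amp (X n t) k ^ 2 ≤ C := fun n t ht =>
    (tsum_amp_sq_le_weighted _).trans (hW n t ht)
  set L : Fin 3 → (Fin 3 → ℤ) → ℝ≥0∞ := fun _ k => ‖(visc (aniso δ) k : ℂ)‖ₑ * (1 + C)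
      + ENNReal.ofReal (lerayConst κ) * (ENNReal.ofReal (Real.sqrt (wt k - 1)) * C) with hL
  have hLtop : ∀ i k, L i k ≠ ∞ := fun i k => ENNReal.add_ne_top.mpr
    ⟨ENNReal.mul_ne_top enorm_ne_top (ENNReal.add_ne_top.mpr ⟨ENNReal.one_ne_top, hCtop⟩),
      ENNReal.mul_ne_top ENNReal.ofReal_ne_top (ENNReal.mul_ne_top ENNReal.ofReal_ne_top hCtop)⟩
  have hrhs : ∀ n, ∀ t ∈ Icc 0 T, ∀ i k, ‖rhs κ (aniso δ) (X n t) i k‖ ≤ (L i k).toReal :=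
    fun n t ht i k => by
      rw [← toReal_enorm]
      exact ENNReal.toReal_mono (hLtop i k) (enorm_rhs_le hκ.pos (hA n t ht) i k)
  obtain ⟨φ, hφ, g, hg⟩ := exists_subseq_tendsto (ι := Fin 3 × (Fin 3 → ℤ)) hT.le
    (f := fun n t p => X n t p.1 p.2) (R := fun _ => (1 + C).toReal) (L := fun p => (L p.1 p.2).toReal)
    (fun n t ht p => by
      rw [← toReal_enorm]
      refine ENNReal.toReal_mono (ENNReal.add_ne_top.mpr ⟨ENNReal.one_ne_top, hCtop⟩) ?_
      have h2 : ‖X n t p.1 p.2‖ₑ ^ 2 ≤ C := ((pow_le_pow_left' (Finset.single_le_sum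
        (f := fun i => ‖X n t i p.2‖ₑ) (fun _ _ => zero_le) (Finset.mem_univ p.1)) 2).trans
        (ENNReal.le_tsum p.2)).trans (hA n t ht)
      rcases le_total ‖X n t p.1 p.2‖ₑ 1 with h | h
      · exact h.trans le_self_add
      · exact ((le_self_pow₀ h two_ne_zero).trans h2).trans le_add_self)
    (by
      have hle : ∀ n, ∀ s ∈ Icc 0 T, ∀ t ∈ Icc 0 T, s ≤ t → ∀ p : Fin 3 × (Fin 3 → ℤ),
          ‖X n t p.1 p.2 - X n s p.1 p.2‖ ≤ (L p.1 p.2).toReal * |t - s| := by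
        intro n s hs t ht hst p
        by_cases hk : p.2 ∈ B n
        · rw [← (hX n).sub_eq_integral hs.1 hst ht.2 p.1 hk]
          refine intervalIntegral.norm_integral_le_of_norm_le_const fun r hr => ?_
          rw [uIoc_of_le hst] at hr
          exact hrhs n r ⟨hs.1.trans hr.1.le, hr.2.trans ht.2⟩ p.1 p.2
        · rw [(hX n).supp t p.1 p.2 hk, (hX n).supp s p.1 p.2 hk, sub_zero, norm_zero]
          positivity
      intro n s hs t ht p
      rcases le_total s t with h | h
      · exact hle n s hs t ht h p
      · rw [norm_sub_rev, abs_sub_comm]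
        exact hle n t ht s hs h p)
  set U : ℝ → Fin 3 → (Fin 3 → ℤ) → ℂ := fun t i k => g t (i, k) with hU
  have hlim : ∀ t ∈ Icc 0 T, ∀ i k, Tendsto (fun n => X (φ n) t i k) atTop (𝓝 (U t i k)) :=
    fun t ht i k => hg t ht (i, k)
  have hEU : ∀ t ∈ Icc 0 T, energy wt (U t) ≤ ENNReal.ofReal M := fun t ht =>
    energy_le_of_tendsto (hlim t ht) fun n => hE (φ n) t ht
  have hWU : ∀ t ∈ Icc 0 T, ∑' k, ENNReal.ofReal (wt k) * amp (U t) k ^ 2 ≤ C := fun t ht =>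
    (tsum_mul_amp_sq_le hwt0 _).trans (mul_le_mul_right (hEU t ht) _)
  have hAU : ∀ t ∈ Icc 0 T, ∑' k, amp (U t) k ^ 2 ≤ C := fun t ht =>
    (tsum_amp_sq_le_weighted _).trans (hWU t ht)
  have hrl : ∀ t ∈ Icc 0 T, ∀ i k, Tendsto (fun n => rhs κ (aniso δ) (X (φ n) t) i k) atTop
      (𝓝 (rhs κ (aniso δ) (U t) i k)) := fun t ht => tendsto_rhs (hlim t ht)
    (tendsto_nl hCtop (fun n => hA (φ n) t ht) (hAU t ht)
      (tendsto_tsum_amp_sub (hlim t ht) hCtop (fun n => hW (φ n) t ht) (hWU t ht)))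
  have hfield : ∀ t ∈ Icc 0 T, FieldCoef (U t) := fun t ht => FieldCoef.of_tendsto (hlim t ht)
    fun n => ⟨(hX _).div t, (hX _).real t, (hX _).parity t⟩
  have hUb : ∀ t ∈ Icc 0 T, ∀ i k, ‖rhs κ (aniso δ) (U t) i k‖ ≤ (L i k).toReal := fun t ht i k => by
    rw [← toReal_enorm]
    exact ENNReal.toReal_mono (hLtop i k) (enorm_rhs_le hκ.pos (hAU t ht) i k)
  have hint : ∀ i k, IntervalIntegrable (fun s => rhs κ (aniso δ) (U s) i k) volume 0 T := by
    intro i k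
    rw [intervalIntegrable_iff_integrableOn_Icc_of_le hT.le]
    refine Integrable.of_bound ?_ (L i k).toReal ?_
    · exact aestronglyMeasurable_of_tendsto_ae atTop (fun n =>
        (continuous_rhs (hX (φ n)).supp (hX (φ n)).cont i k).aestronglyMeasurable)
        ((ae_restrict_iff' measurableSet_Icc).mpr (Eventually.of_forall fun t ht => hrl t ht i k))
    · exact (ae_restrict_iff' measurableSet_Icc).mpr (Eventually.of_forall fun t ht => hUb t ht i k)
  have heq : ∀ t ∈ Icc 0 T, ∀ i k, U t i k = U 0 i k + ∫ s in (0 : ℝ)..t, rhs κ (aniso δ) (U s) i k := by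
    intro t ht i k
    have hd : Tendsto (fun n => ∫ s in (0 : ℝ)..t, rhs κ (aniso δ) (X (φ n) s) i k) atTop
        (𝓝 (∫ s in (0 : ℝ)..t, rhs κ (aniso δ) (U s) i k)) := by
      refine intervalIntegral.tendsto_integral_filter_of_dominated_convergence
        (fun _ => (L i k).toReal) (Eventually.of_forall fun n =>
          (continuous_rhs (hX (φ n)).supp (hX (φ n)).cont i k).aestronglyMeasurable)
        (Eventually.of_forall fun n => Eventually.of_forall fun s hs => ?_)
        intervalIntegrable_const (Eventually.of_forall fun s hs => ?_) <;>
      rw [uIoc_of_le ht.1] at hs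
      · exact hrhs (φ n) s ⟨hs.1.le, hs.2.trans ht.2⟩ i k
      · exact hrl s ⟨hs.1.le, hs.2.trans ht.2⟩ i k
    refine tendsto_nhds_unique (hlim t ht i k) (((hlim 0 ⟨le_rfl, hT.le⟩ i k).add hd).congr' ?_)
    have hk : ∀ᶠ n in atTop, k ∈ B (φ n) := by
      filter_upwards [(hB.comp hφ.tendsto_atTop).eventually (eventually_ge_atTop {k})] with n hn
      exact hn (Finset.mem_singleton_self k)
    filter_upwards [hk] with n hn
    rw [(hX (φ n)).sub_eq_integral le_rfl ht.1 ht.2 i hn]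
    ring
  refine ⟨φ, hφ, U, hlim, ⟨fun t ht => (hfield t ht).div, ⟨C, hCtop, hAU⟩, ?_, fun i k => ?_,
    fun i k => ?_, fun t ht i k => ?_⟩, hfield, hEU, hrl⟩
  · have hsq : ∀ k : Fin 3 → ℤ, 0 ≤ wt k ^ 2 := fun k => sq_nonneg _
    calc _ ≤ ∫⁻ t in Ioo 0 T, 3 * energy (fun k => wt k ^ 2) (U t) ^ 1 :=
          lintegral_mono fun t => by simpa using tsum_mul_amp_sq_le hsq (U t)
      _ = 3 * ∫⁻ t in Ioo 0 T, energy (fun k => wt k ^ 2) (U t) ^ 1 :=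
          lintegral_const_mul' _ _ (by norm_num)
      _ ≤ 3 * ENNReal.ofReal M₂ := by
          refine mul_le_mul_right (lintegral_energy_pow_le (Z := fun n => X (φ n))
            (fun n => (hX (φ n)).cont) hlim 1 fun n => ?_) _
          have hc : Continuous fun t => wsum (B (φ n)) (fun k => wt k ^ 2) (X (φ n) t) :=
            continuous_wsum (hX (φ n)).cont
          simp only [pow_one, energy_eq hsq ((hX (φ n)).supp _)]
          rw [lintegral_ofReal_of_continuous hT.le hc fun t => wsum_nonneg hsq _]
          exact ENNReal.ofReal_le_ofReal (h2 _)
      _ < ∞ := ENNReal.mul_lt_top (by norm_num) ENNReal.ofReal_lt_top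
  · have e : (fun s => visc (aniso δ) k * U s i k + leray κ (nl (U s) (U s)) i k)
        = -fun s => rhs κ (aniso δ) (U s) i k := by
      funext s
      simp only [rhs, Pi.neg_apply, neg_neg]
    rw [e]
    exact (hint i k).neg
  · have h3 := intervalIntegral.continuousOn_primitive_interval
      ((intervalIntegrable_iff_integrableOn_Icc_of_le hT.le).mp (hint i k) |>.mono_set
        (uIcc_of_le hT.le).le)
    rw [uIcc_of_le hT.le] at h3
    exact (continuousOn_const.add h3).congr fun t ht => heq t ht i k
  · rw [heq t ht i k]
    simp only [rhs, intervalIntegral.integral_neg]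
    ring

/-! ### Solutions on the level of Fourier coefficients -/

theorem bt_bt (U : Fin 3 → (Fin 3 → ℤ) → ℂ) : bt (bt U) = bt U := by
  funext i k
  by_cases hk : k 2 = 0 <;> simp [bt, hk]

theorem wsum_split (B : Finset (Fin 3 → ℤ)) (w : (Fin 3 → ℤ) → ℝ) (U : Fin 3 → (Fin 3 → ℤ) → ℂ) :
    wsum B w U = wsum B w (bt U) + wsum B w (bc U) := by
  rw [wsum, wsum, wsum, ← Finset.sum_add_distrib]
  refine Finset.sum_congr rfl fun k _ => ?_
  by_cases hk : k 2 = 0 <;> simp [nsq_bt, nsq_bc, hk]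

theorem FieldCoef.bt {U : Fin 3 → (Fin 3 → ℤ) → ℂ} (hU : FieldCoef U) : FieldCoef (bt U) := by
  refine ⟨hU.div.bt, fun i k => ?_, fun i k => ?_⟩
  · by_cases hk : k 2 = 0 <;> simp [AnisoNS.bt, hk, hU.real i k]
  · by_cases hk : k 2 = 0 <;> simp [AnisoNS.bt, hk, reflFreq, ← hU.parity i k]

theorem wsum_le_energy {w : (Fin 3 → ℤ) → ℝ} (hw : ∀ k, 0 ≤ w k) (B : Finset (Fin 3 → ℤ))
    {U : Fin 3 → (Fin 3 → ℤ) → ℂ} (hU : energy w U ≠ ∞) : wsum B w U ≤ (energy w U).toReal := by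
  rw [← ENNReal.ofReal_le_iff_le_toReal hU, wsum,
    ENNReal.ofReal_sum_of_nonneg fun k _ => mul_nonneg (hw k) (nsq_nonneg U k)]
  exact ENNReal.sum_le_tsum _

/-- The weight satisfies `bcw ≤ rt³/√δ`. Data in `H^{3/2}` therefore have small baroclinic energy
for large `δ`, without being small themselves. -/
theorem bcE_le_div_sqrt {δ : ℝ} (hδ : 0 < δ) (B : Finset (Fin 3 → ℤ)) {U : Fin 3 → (Fin 3 → ℤ) → ℂ}
    (hU : energy (fun k => rt k ^ 3) (bc U) ≠ ∞) :
    bcE δ B U ≤ (energy (fun k => rt k ^ 3) (bc U)).toReal / Real.sqrt δ := by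
  have hs : 0 < Real.sqrt δ := Real.sqrt_pos.mpr hδ
  rw [le_div_iff₀ hs]
  refine le_trans ?_ (wsum_le_energy (fun k => pow_nonneg (rt_pos k).le 3) B hU)
  rw [bcE, wsum, wsum, Finset.sum_mul]
  refine Finset.sum_le_sum fun k _ => ?_
  have h1 : bcw δ k * Real.sqrt δ ≤ rt k ^ 3 := by
    rw [bcw, div_mul_eq_mul_div, div_le_iff₀ (rt_add_sqrt_pos δ k)]
    exact mul_le_mul_of_nonneg_left (by linarith [rt_pos k]) (pow_nonneg (rt_pos k).le 3)
  nlinarith [mul_le_mul_of_nonneg_right h1 (nsq_nonneg (bc U) k)]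

theorem bcE_congr {δ : ℝ} {B : Finset (Fin 3 → ℤ)} {U V : Fin 3 → (Fin 3 → ℤ) → ℂ}
    (h : ∀ i, ∀ k ∈ B, U i k = V i k) : bcE δ B U = bcE δ B V :=
  Finset.sum_congr rfl fun k hk => by simp only [nsq, bc, h _ k hk]

theorem bt_eq_of_bcE_le_zero {δ : ℝ} {B : Finset (Fin 3 → ℤ)} {U : Fin 3 → (Fin 3 → ℤ) → ℂ}
    (hU : SuppIn B U) (h : bcE δ B U ≤ 0) : bt U = U := by
  have h0 := (Finset.sum_eq_zero_iff_of_nonneg fun k _ =>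
    mul_nonneg (bcw_pos δ k).le (nsq_nonneg (bc U) k)).mp (h.antisymm (bcE_nonneg δ B U))
  funext i k
  by_cases hk : k 2 = 0
  · simp [bt, hk]
  · rw [bt, if_neg hk]
    by_cases hkB : k ∈ B
    · have h1 := (mul_eq_zero.mp (h0 k hkB)).resolve_left (bcw_pos δ k).ne'
      have h2 := (Finset.sum_eq_zero_iff_of_nonneg fun _ _ => sq_nonneg _).mp h1 i (Finset.mem_univ i)
      have h3 : bc U i k = 0 := by simpa using h2
      rwa [bc, if_neg hk, eq_comm] at h3
    · exact (hU i k hkB).symm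

theorem wsum_wt_sq_eq (B : Finset (Fin 3 → ℤ)) (U : Fin 3 → (Fin 3 → ℤ) → ℂ) :
    wsum B (fun k => wt k ^ 2) U = wsum B wt U + wsum B (fun k => wt k * (wt k - 1)) U := by
  simp only [wsum, ← Finset.sum_add_distrib]
  exact Finset.sum_congr rfl fun k _ => by ring

/-- A bound in `H¹`, uniform in the truncation but not in `δ`. It feeds the compactness argument and
the regularity of the limit, not the rates. -/
theorem GalBound.wsum_wt_le {T eS δ : ℝ} {B : Finset (Fin 3 → ℤ)}
    {X : ℝ → Fin 3 → (Fin 3 → ℤ) → ℂ} (h : GalBound T eS δ B X) {y : ℝ}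
    (hy : growth T eS * bcE δ B (X 0) ≤ y) {t : ℝ} (ht : t ∈ Icc 0 T) :
    wsum B wt (X t) ≤ eS + y * (1 + Real.sqrt δ) := by
  rw [wsum_split]
  refine add_le_add (h.e t ht) ?_
  have hs := Real.sqrt_nonneg δ
  refine le_trans ?_ (mul_le_mul_of_nonneg_right ((h.y t ht).trans hy) (by linarith))
  rw [bcE, wsum, wsum, Finset.sum_mul]
  refine Finset.sum_le_sum fun k _ => ?_
  have h1 := rt_sq_le_bcw (δ := δ) k
  rw [rt_sq] at h1
  nlinarith [mul_le_mul_of_nonneg_right h1 (nsq_nonneg (bc (X t)) k)]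

theorem GalBound.integral_wsum_wt_sq_le {T eS δ : ℝ} (hT : 0 ≤ T) (hδ : 1 ≤ δ)
    {B : Finset (Fin 3 → ℤ)} {X : ℝ → Fin 3 → (Fin 3 → ℤ) → ℂ} (h : GalBound T eS δ B X)
    (hX : ∀ i k, Continuous fun t => X t i k) {y : ℝ} (hy : growth T eS * bcE δ B (X 0) ≤ y) :
    ∫ s in (0 : ℝ)..T, wsum B (fun k => wt k ^ 2) (X s) ≤ eS * T + 2 * eS + 8 * y := by
  have c1 : Continuous fun t => btE B (X t) := continuous_wsum (continuous_bt hX)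
  have c2 : Continuous fun t => btD B (X t) := continuous_wsum (continuous_bt hX)
  have c3 : Continuous fun t => bcD δ B (X t) := continuous_wsum (continuous_bc hX)
  have hle : ∀ t, wsum B (fun k => wt k ^ 2) (X t) ≤ (btE B (X t) + btD B (X t)) + 4 * bcD δ B (X t) := by
    intro t
    rw [wsum_split, wsum_wt_sq_eq]
    refine add_le_add le_rfl ?_
    rw [bcD, wsum, wsum, Finset.mul_sum]
    refine Finset.sum_le_sum fun k _ => ?_
    rw [nsq_bc]
    split_ifs with hk
    · simp
    · have h1 := bcw_mul_visc_ge hδ hk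
      have h2 : wt k ^ 2 ≤ rt k ^ 3 * (rt k + Real.sqrt δ) := by
        rw [← rt_sq]
        have := mul_nonneg (pow_nonneg (rt_pos k).le 3) (Real.sqrt_nonneg δ)
        nlinarith
      nlinarith [mul_le_mul_of_nonneg_right (h2.trans h1) (nsq_nonneg (X t) k)]
  have hE : ∫ s in (0 : ℝ)..T, btE B (X s) ≤ eS * T := by
    have := intervalIntegral.integral_mono_on hT (c1.intervalIntegrable _ _)
      (continuous_const.intervalIntegrable (μ := volume) 0 T) fun s hs => h.e s hs
    simpa [mul_comm] using this
  refine (intervalIntegral.integral_mono_on hT ((continuous_wsum hX).intervalIntegrable _ _)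
    (Continuous.intervalIntegrable (by fun_prop) _ _) fun s _ => hle s).trans ?_
  simp (disch := fun_prop) only [intervalIntegral_add_of_continuous,
    intervalIntegral.integral_const_mul]
  linarith [h.f, h.z]

/-- The limit equations together with the convergence rates. -/
theorem exists_coefSol {T : ℝ} (hT : 0 < T) {U₀ : Fin 3 → (Fin 3 → ℤ) → ℂ} (hU₀ : FieldCoef U₀)
    (h1 : energy wt (bt U₀) ≠ ∞) (h2 : energy (fun k => rt k ^ 3) (bc U₀) ≠ ∞) :
    ∃ V : ℝ → Fin 3 → (Fin 3 → ℤ) → ℂ, CoefSol (fun _ => 1) (aniso 1) T V ∧ V 0 = bt U₀ ∧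
      (∀ t ∈ Icc 0 T, FieldCoef (V t) ∧ bt (V t) = V t) ∧
      (∃ M : ℝ, ∀ t ∈ Icc 0 T, energy wt (V t) ≤ ENNReal.ofReal M) ∧
      ∃ C : ℝ, 0 ≤ C ∧ ∃ δ₀ : ℝ, 1 ≤ δ₀ ∧ ∀ δ, δ₀ ≤ δ → ∀ κ, Admissible κ →
        ∃ U : ℝ → Fin 3 → (Fin 3 → ℤ) → ℂ, CoefSol κ (aniso δ) T U ∧ U 0 = U₀ ∧
          (∀ t ∈ Icc 0 T, FieldCoef (U t)) ∧
          (∃ M : ℝ, ∀ t ∈ Icc 0 T, energy wt (U t) ≤ ENNReal.ofReal M) ∧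
          ∫⁻ t in Ioo 0 T, energy (fun k => wt k ^ 2) (bt (U t) - V t) ≤ ENNReal.ofReal (C / δ) ∧
          ∫⁻ t in Ioo 0 T, energy (fun _ => 1) (bt (rhs κ (aniso δ) (U t))
            - rhs (fun _ => 1) (aniso 1) (V t)) ≤ ENNReal.ofReal (C / δ) ∧
          ∫⁻ t in Ioo 0 T, energy (fun k => rt k ^ 3) (bc (U t)) ^ 2 ≤ ENNReal.ofReal (C / δ) := by
  set eS : ℝ := (energy wt (bt U₀)).toReal + 1 with heS
  set K : ℝ := (energy (fun k => rt k ^ 3) (bc U₀)).toReal with hK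
  have hK0 : 0 ≤ K := ENNReal.toReal_nonneg
  have he1 : 1 ≤ eS := by rw [heS]; linarith [(ENNReal.toReal_nonneg : 0 ≤ (energy wt (bt U₀)).toReal)]
  obtain ⟨yS, hs⟩ := exists_smallData hT.le he1
  have hy1 := hs.y_pos
  have hg := growth_pos T eS
  have hbtE : ∀ B, btE B U₀ + 1 ≤ eS := fun B =>
    add_le_add (wsum_le_energy (fun k => (wt_pos k).le) B h1) le_rfl
  have hbox : ∀ n, ∀ k : Fin 3 → ℤ, -k ∈ box 3 n ↔ k ∈ box 3 n := fun n k => neg_mem_box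
  have hbox' : ∀ n, ∀ k : Fin 3 → ℤ, reflFreq k ∈ box 3 n ↔ k ∈ box 3 n := fun n k => reflFreq_mem_box
  have hbc0 : ∀ (δ : ℝ) B, bcE δ B (bt U₀) = 0 := fun δ B => Finset.sum_eq_zero fun k _ => by
    by_cases hk : k 2 = 0 <;> simp [nsq, bc, bt, hk]
  -- The 2D flow: with zero baroclinic data the smallness condition holds trivially, and the bound
  -- by the initial baroclinic energy keeps the approximations `z`-independent.
  have hV := fun n => exists_galerkin Admissible.ones le_rfl (hbox n) (hbox' n) hT.le hs hU₀.bt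
    (by simpa only [btE, bt_bt] using hbtE (box 3 n)) (by rw [hbc0, mul_zero]; exact hy1.le)
  choose Vn hVsol hV0 hVb using hV
  have hbcV0 : ∀ n, bcE 1 (box 3 n) (Vn n 0) = 0 := fun n => by
    refine (bcE_congr fun i k hk => ?_).trans (hbc0 1 (box 3 n))
    rw [hV0, if_pos hk]
  have hVt : ∀ n, ∀ t ∈ Icc 0 T, bt (Vn n t) = Vn n t := fun n t ht => by
    refine bt_eq_of_bcE_le_zero ((hVsol n).supp t) (((hVb n).y t ht).trans ?_)
    rw [hbcV0, mul_zero]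
  have hgV : ∀ n, growth T eS * bcE 1 (box 3 n) (Vn n 0) ≤ 0 := fun n => by rw [hbcV0, mul_zero]
  obtain ⟨φ, hφ, V, hVlim, hVc, hVf, hVe, hVr⟩ := galerkin_limit Admissible.ones hT (tendsto_box 3)
    hVsol (fun n t ht => (hVb n).wsum_wt_le (hgV n) ht)
    fun n => (hVb n).integral_wsum_wt_sq_le hT.le le_rfl (hVsol n).cont (hgV n)
  have h0T : (0 : ℝ) ∈ Icc 0 T := ⟨le_rfl, hT.le⟩
  have hev : ∀ {φ : ℕ → ℕ}, Tendsto φ atTop atTop → ∀ k, ∀ᶠ n in atTop, k ∈ box 3 (φ n) := by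
    intro φ hφ k
    filter_upwards [((tendsto_box 3).comp hφ).eventually (eventually_ge_atTop {k})] with n hn
    exact hn (Finset.mem_singleton_self k)
  have hinit : ∀ {X : ℕ → Fin 3 → (Fin 3 → ℤ) → ℂ} {Y W : Fin 3 → (Fin 3 → ℤ) → ℂ} {φ : ℕ → ℕ},
      Tendsto φ atTop atTop → (∀ i k, Tendsto (fun n => X n i k) atTop (𝓝 (Y i k))) →
      (∀ n i k, X n i k = if k ∈ box 3 (φ n) then W i k else 0) → Y = W := by
    intro X Y W φ hφ hl hX
    funext i k
    refine tendsto_nhds_unique (hl i k) (tendsto_const_nhds.congr' ?_)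
    filter_upwards [hev hφ k] with n hn
    rw [hX, if_pos hn]
  have hVbt : ∀ t ∈ Icc 0 T, bt (V t) = V t := fun t ht => by
    funext i k
    by_cases hk : k 2 = 0
    · simp [bt, hk]
    · rw [bt, if_neg hk]
      refine tendsto_nhds_unique tendsto_const_nhds ((hVlim t ht i k).congr fun n => ?_)
      rw [← hVt _ t ht, bt, if_neg hk]
  refine ⟨V, hVc, hinit hφ.tendsto_atTop (hVlim 0 h0T) (fun n i k => hV0 _ i k),
    fun t ht => ⟨hVf t ht, hVbt t ht⟩, ⟨_, hVe⟩, ?_⟩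
  set C₁ : ℝ := cmpConst T eS * (T + 2) with hC₁
  set C₂ : ℝ := 4 * cmpConst T eS + derivConst * (cmpConst T eS * (T + 2
        + eS * (eS * T + 2 * eS)) + 8 * growth T eS ^ 2) with hC₂
  set C₃ : ℝ := 8 * growth T eS ^ 2 with hC₃
  have hcmp := cmpConst_nonneg T eS
  have hder := derivConst_nonneg
  have p1 : 0 ≤ C₁ := by positivity
  have p2 : 0 ≤ C₂ := by positivity
  have p3 : 0 ≤ C₃ := by positivity
  -- The threshold makes `growth * K / √δ ≤ yS`, the smallness required at the start of the
  -- bootstrap. The constants `C₁`, `C₂`, `C₃` belong to the difference, to its time derivative and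
  -- to the baroclinic part; none involves `κ` or `δ`.
  refine ⟨(C₁ + C₂ + C₃) * K ^ 2, by positivity, max 1 ((growth T eS * K / yS) ^ 2), le_max_left _ _,
    fun δ hδ κ hκ => ?_⟩
  have hδ1 : 1 ≤ δ := (le_max_left _ _).trans hδ
  have hδ0 : 0 < δ := zero_lt_one.trans_le hδ1
  have hsq : 0 < Real.sqrt δ := Real.sqrt_pos.mpr hδ0
  have hgy : growth T eS * (K / Real.sqrt δ) ≤ yS := by
    have h3 : growth T eS * K / yS ≤ Real.sqrt δ :=
      Real.le_sqrt_of_sq_le ((le_max_right _ _).trans hδ)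
    rw [div_le_iff₀ hy1] at h3
    rw [← mul_div_assoc, div_le_iff₀ hsq]
    linarith
  -- The boxes follow the subsequence along which the 2D approximations converge, so that both flows
  -- are compared on the same truncation and `V` does not depend on `δ` or `κ`.
  have hX := fun n => exists_galerkin hκ hδ1 (hbox (φ n)) (hbox' (φ n)) hT.le hs hU₀ (hbtE _)
    ((mul_le_mul_of_nonneg_left (bcE_le_div_sqrt hδ0 _ h2) hg.le).trans hgy)
  choose X hXsol hX0 hXb using hX
  have hy0 : ∀ n, bcE δ (box 3 (φ n)) (X n 0) ≤ K / Real.sqrt δ := fun n => by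
    rw [bcE_congr (V := U₀) fun i k hk => by rw [hX0, if_pos hk]]
    exact bcE_le_div_sqrt hδ0 _ h2
  have hy0g : ∀ n, growth T eS * bcE δ (box 3 (φ n)) (X n 0) ≤ yS := fun n =>
    (mul_le_mul_of_nonneg_left (hy0 n) hg.le).trans hgy
  obtain ⟨ψ, hψ, U, hUlim, hUc, hUf, hUe, hUr⟩ := galerkin_limit hκ hT
    ((tendsto_box 3).comp hφ.tendsto_atTop) hXsol (fun n t ht => (hXb n).wsum_wt_le (hy0g n) ht)
    fun n => (hXb n).integral_wsum_wt_sq_le hT.le hδ1 (hXsol n).cont (hy0g n)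
  have hsqy : ∀ n, bcE δ (box 3 (φ n)) (X n 0) ^ 2 ≤ K ^ 2 / δ := fun n => by
    refine (pow_le_pow_left₀ (bcE_nonneg δ _ _) (hy0 n) 2).trans (le_of_eq ?_)
    rw [div_pow, Real.sq_sqrt hδ0.le]
  have hVsol' : ∀ n, GalSol κ δ (box 3 n) T (Vn n) := fun n =>
    { hVsol n with
      deriv := fun t ht i k hk => by
        rw [rhs_eq_of_bt_eq hκ Admissible.ones δ 1 (hVt n t (Ioo_subset_Icc_self ht))]
        exact (hVsol n).deriv t ht i k hk }
  have hcomp := fun n => galerkin_comparison hκ hδ1 hT.le (hXsol n) (hVsol' (φ n))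
    (zero_le_one.trans he1) (hXb n) (hVb (φ n)).e (hVb (φ n)).f (hVt (φ n)) (fun i k hk => by
      rw [hV0, if_pos hk, bt, bt, hX0, if_pos hk])
  have hVlim' : ∀ t ∈ Icc 0 T, ∀ i k, Tendsto (fun n => Vn (φ (ψ n)) t i k) atTop (𝓝 (V t i k)) :=
    fun t ht i k => (hVlim t ht i k).comp hψ.tendsto_atTop
  have hbt : ∀ {Z : ℕ → Fin 3 → (Fin 3 → ℤ) → ℂ} {Y : Fin 3 → (Fin 3 → ℤ) → ℂ},
      (∀ i k, Tendsto (fun n => Z n i k) atTop (𝓝 (Y i k))) →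
      ∀ i k, Tendsto (fun n => bt (Z n) i k) atTop (𝓝 (bt Y i k)) := by
    intro Z Y h i k
    by_cases hk : k 2 = 0
    · simpa [bt, hk] using h i k
    · simp [bt, hk]
  have hfin : ∀ c, 0 ≤ c → c ≤ C₁ + C₂ + C₃ → ∀ n, ∀ r, r ≤ c * bcE δ (box 3 (φ n)) (X n 0) ^ 2 →
      ENNReal.ofReal r ≤ ENNReal.ofReal ((C₁ + C₂ + C₃) * K ^ 2 / δ) := by
    intro c hc hcC n r hr
    refine ENNReal.ofReal_le_ofReal (hr.trans ?_)
    rw [mul_div_assoc]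
    exact mul_le_mul hcC (hsqy n) (sq_nonneg _) (hc.trans hcC)
  refine ⟨U, hUc, hinit (hφ.comp hψ).tendsto_atTop (hUlim 0 h0T) (fun n i k => hX0 _ i k), hUf,
    ⟨_, hUe⟩, ?_, ?_, ?_⟩
  · have hw : ∀ k : Fin 3 → ℤ, 0 ≤ wt k ^ 2 := fun k => sq_nonneg _
    have hc : ∀ n i k, Continuous fun t => (bt (X (ψ n) t) - Vn (φ (ψ n)) t) i k := fun n i k =>
      (continuous_bt (hXsol _).cont i k).sub ((hVsol _).cont i k)
    have := lintegral_energy_pow_le (w := fun k => wt k ^ 2) (T := T)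
      (Y := fun t => bt (U t) - V t)
      (Z := fun n t => bt (X (ψ n) t) - Vn (φ (ψ n)) t) hc
      (fun t ht i k => (hbt (hUlim t ht) i k).sub (hVlim' t ht i k)) 1
      (C := ENNReal.ofReal ((C₁ + C₂ + C₃) * K ^ 2 / δ)) (fun n => by
        simp only [pow_one, energy_eq hw (((hXsol (ψ n)).supp _).bt.sub ((hVsol (φ (ψ n))).supp _))]
        rw [lintegral_ofReal_of_continuous hT.le (continuous_wsum (hc n)) fun t => wsum_nonneg hw _]
        refine hfin C₁ p1 (by linarith) (ψ n) _ ?_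
        simp only [wsum_wt_sq_eq]
        rw [intervalIntegral_add_of_continuous (continuous_wsum (hc n)) (continuous_wsum (hc n))]
        have a1 := intervalIntegral.integral_mono_on hT.le
          ((continuous_wsum (B := box 3 (φ (ψ n))) (w := wt) (hc n)).intervalIntegrable _ _)
          (continuous_const.intervalIntegrable (μ := volume) 0 T) (hcomp (ψ n)).1
        rw [intervalIntegral.integral_const, smul_eq_mul, sub_zero] at a1
        refine (add_le_add a1 (hcomp (ψ n)).2.1).trans (le_of_eq ?_)
        rw [hC₁]; ring)
    simpa only [pow_one] using this
  · have hw : ∀ k : Fin 3 → ℤ, (0 : ℝ) ≤ 1 := fun k => zero_le_one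
    -- The right-hand sides contain frequencies outside the box, where the Galerkin equations and
    -- the comparison say nothing; they are cut off. Any fixed frequency eventually lies in the box,
    -- so the limit is unaffected.
    set Z : ℕ → ℝ → Fin 3 → (Fin 3 → ℤ) → ℂ := fun n t i k => if k ∈ box 3 (φ (ψ n)) then
      (bt (rhs κ (aniso δ) (X (ψ n) t)) - rhs (fun _ => 1) (aniso 1) (Vn (φ (ψ n)) t)) i k else 0 with hZ
    have hc : ∀ n i k, Continuous fun t => Z n t i k := fun n i k => by
      simp only [hZ]
      split_ifs
      · exact (continuous_bt (continuous_rhs (hXsol _).supp (hXsol _).cont) i k).sub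
          (continuous_rhs (hVsol _).supp (hVsol _).cont i k)
      · exact continuous_const
    have := lintegral_energy_pow_le (w := fun _ => 1) (T := T)
      (Y := fun t => bt (rhs κ (aniso δ) (U t)) - rhs (fun _ => 1) (aniso 1) (V t)) hc
      (fun t ht i k => ((hbt (hUr t ht) i k).sub ((hVr t ht i k).comp hψ.tendsto_atTop)).congr' (by
        filter_upwards [hev (hφ.comp hψ).tendsto_atTop k] with n hn
        exact (if_pos hn).symm)) 1
      (C := ENNReal.ofReal ((C₁ + C₂ + C₃) * K ^ 2 / δ)) (fun n => by
        obtain ⟨G, hGc, hG, hGi⟩ := (hcomp (ψ n)).2.2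
        have hle : ∀ t ∈ Ioo 0 T, energy (fun _ => 1) (Z n t) ≤ ENNReal.ofReal |G t| := by
          intro t ht
          rw [energy_eq hw fun i k hk => if_neg hk]
          refine ENNReal.ofReal_le_ofReal (le_trans (le_of_eq ?_)
            ((hG t (Ioo_subset_Icc_self ht)).trans (le_abs_self _)))
          refine Finset.sum_congr rfl fun k hk => ?_
          rw [one_mul, rhs_eq_of_bt_eq hκ Admissible.ones δ 1 (hVt _ t (Ioo_subset_Icc_self ht))]
          simp only [nsq, if_pos hk]
        simp only [pow_one]
        refine (setLIntegral_mono' measurableSet_Ioo hle).trans ?_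
        rw [lintegral_ofReal_of_continuous hT.le hGc.abs fun t => abs_nonneg _]
        refine hfin C₂ p2 (by linarith) (ψ n) _ (le_trans (le_of_eq ?_) hGi)
        refine intervalIntegral.integral_congr fun t ht => abs_of_nonneg ?_
        rw [uIcc_of_le hT.le] at ht
        exact (Finset.sum_nonneg fun k _ => nsq_nonneg _ k).trans (hG t ht))
    simpa only [pow_one] using this
  · have hw : ∀ k : Fin 3 → ℤ, 0 ≤ rt k ^ 3 := fun k => pow_nonneg (rt_pos k).le 3
    have hc := fun n => continuous_bc (hXsol (ψ n)).cont
    refine lintegral_energy_pow_le (Z := fun n t => bc (X (ψ n) t)) hc (fun t ht i k => ?_) 2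
      fun n => ?_
    · by_cases hk : k 2 = 0
      · simp [bc, hk]
      · simpa [bc, hk] using hUlim t ht i k
    · simp only [energy_eq hw ((hXsol (ψ n)).supp _).bc, ← ENNReal.ofReal_pow (wsum_nonneg hw _)]
      have hcc : Continuous fun t => wsum (box 3 (φ (ψ n))) (fun k => rt k ^ 3) (bc (X (ψ n) t)) ^ 2 :=
        (continuous_wsum (hc n)).pow 2
      rw [lintegral_ofReal_of_continuous hT.le hcc fun t => sq_nonneg _]
      exact hfin C₃ p3 (by linarith) (ψ n) _
        ((hXb (ψ n)).integral_crit_bc_sq_le hT.le hδ1 (hXsol (ψ n)).cont)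

/-! ### Strong solutions and their Fourier coefficients -/

/-- The coefficients of the pressure gradient in the rescaled equations. -/
def pressScale (ε : ℝ) : Fin 3 → ℝ := ![1, 1, 1 / ε ^ 2]

theorem admissible_pressScale {ε : ℝ} (hε : ε ∈ Ioc (0 : ℝ) 1) : Admissible (pressScale ε) := by
  refine ⟨rfl, rfl, ?_⟩
  have h : (1 : ℝ) ≤ 1 / ε ^ 2 := by
    rw [le_div_iff₀ (pow_pos hε.1 2), one_mul]
    exact pow_le_one₀ hε.1.le hε.2
  exact h

theorem one_le_aniso {δ : ℝ} (hδ : 1 ≤ δ) (i : Fin 3) : 1 ≤ aniso δ i := by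
  fin_cases i <;> simp [aniso, hδ]

theorem lapAniso_eq (δ : ℝ) (f : L2 3) : lapAniso δ f = ∑ j, aniso δ j • pderiv j (pderiv j f) := by
  simp [lapAniso, Fin.sum_univ_three, aniso]

theorem lapH_eq (f : L2 2) : lapH f = ∑ j, (1 : ℝ) • pderiv j (pderiv j f) := by
  simp [lapH]

theorem momentum3_iff (ε δ : ℝ) (u : ℝ → Fin 3 → L2 3) (p : ℝ → L2 3) (t : ℝ) (x : Fin 3 → ℝ) :
    (momentum3 δ u 0 t x + pderiv 0 (p t) x = 0 ∧ momentum3 δ u 1 t x + pderiv 1 (p t) x = 0 ∧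
      momentum3 δ u 2 t x + (1 / ε ^ 2) * pderiv 2 (p t) x = 0) ↔
    ∀ i, deriv (fun s => u s i) t x + ∑ j, u t j x * pderiv j (u t i) x
        - (∑ j, aniso δ j • pderiv j (pderiv j (u t i)) : L2 3) x
        + pressScale ε i * pderiv i (p t) x = 0 := by
  simp only [momentum3, ← lapAniso_eq]
  rw [Fin.forall_fin_succ, Fin.forall_fin_succ, Fin.forall_fin_one]
  simp [pressScale]

theorem IsStrongSolution3.coefSol {ε δ T : ℝ} (hε : ε ∈ Ioc (0 : ℝ) 1) (hT : 0 < T)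
    {u₀ : Fin 3 → L2 3} {u : ℝ → Fin 3 → L2 3} (h : IsStrongSolution3 ε δ T u₀ u) :
    CoefSol (pressScale ε) (aniso δ) T fun t i => fourierCoef (u t i) := by
  obtain ⟨p, hp, -, hm⟩ := h.momentum
  refine coefSol_of_strong le_rfl (admissible_pressScale hε).pos hT h.memE1
    (fun t ht => divFreeCoef_of_mem_solenoidal3 (h.solenoidal t ht)) hp ?_
  filter_upwards [hm] with t ht
  filter_upwards [ht] with x hx
  exact (momentum3_iff ε δ u p t x).mp hx

/-- Uniqueness within the whole class of strong solutions, since each of them gives a coefficient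
solution; `δ ≥ 1` enters as a lower bound on the viscosities. -/
theorem IsStrongSolution3.eqOn {ε δ T : ℝ} (hε : ε ∈ Ioc (0 : ℝ) 1) (hδ : 1 ≤ δ) (hT : 0 < T)
    {u₀ : Fin 3 → L2 3} {u u' : ℝ → Fin 3 → L2 3} (h : IsStrongSolution3 ε δ T u₀ u)
    (h' : IsStrongSolution3 ε δ T u₀ u') : EqOn u' u (Icc 0 T) := fun t ht => by
  have he := (h'.coefSol hε hT).unique le_rfl (admissible_pressScale hε).pos (one_le_aniso hδ)
    (h.coefSol hε hT) (by simp only [h.initial, h'.initial]) t ht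
  exact funext fun i => ext_fourierCoef fun k => congrFun (congrFun he i) k

theorem divFree_of_divFreeCoef {d : ℕ} {u : Fin d → L2 d} (hu : ∀ i, MemH 2 (u i))
    (hd : DivFreeCoef fun i => fourierCoef (u i)) : ∑ j, pderiv j (u j) = 0 := by
  refine ext_fourierCoef fun k => ?_
  simp only [fourierCoef_sum, fourierCoef_pderiv (memH_two_summable_wt (hu _)), fourierCoef_zero,
    mul_assoc, ← Finset.mul_sum, hd k, mul_zero]

theorem divFreeCoef_of_divFree {d : ℕ} {u : Fin d → L2 d} (hu : ∀ i, MemH 2 (u i))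
    (hd : ∑ j, pderiv j (u j) = 0) : DivFreeCoef fun i => fourierCoef (u i) := by
  intro k
  have h := congrArg (fourierCoef · k) hd
  simp only [fourierCoef_sum, fourierCoef_pderiv (memH_two_summable_wt (hu _)), fourierCoef_zero,
    mul_assoc, ← Finset.mul_sum] at h
  exact (mul_eq_zero.mp ((mul_eq_zero.mp h).resolve_left (by simp [Real.pi_ne_zero]))).resolve_left
    Complex.I_ne_zero

theorem integral_eq_zero_of_fourierCoef {d : ℕ} {p : L2 d} (h : fourierCoef p 0 = 0) :
    ∫ x in cell d, p x = 0 := by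
  simp only [fourierCoef, Pi.zero_apply, Int.cast_zero, zero_mul, Finset.sum_const_zero, mul_zero,
    neg_zero, Complex.exp_zero, mul_one] at h
  have h1 := (mul_eq_zero.mp h).resolve_left (by simp)
  rw [integral_complex_ofReal] at h1
  exact_mod_cast h1

theorem IsStrongSolution2.coefSol {T : ℝ} (hT : 0 < T) {v₀ : Fin 2 → L2 2} {v : ℝ → Fin 2 → L2 2}
    (h : IsStrongSolution2 T v₀ v) :
    CoefSol (fun _ => 1) (fun _ => 1) T fun t i => fourierCoef (v t i) := by
  obtain ⟨p, hp, -, hm⟩ := h.momentum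
  refine coefSol_of_strong (by norm_num) (fun _ => one_pos) hT h.memE1 (fun t ht k => ?_) hp ?_
  -- Solenoidality is assumed for almost every time only; continuity of the coefficients extends it
  -- to all times.
  · refine Measure.eqOn_Icc_of_ae_eq (μ := volume) hT.ne
      (f := fun t => ∑ j, (k j : ℂ) * fourierCoef (v t j) k) (g := fun _ => 0) ?_ ?_
      continuousOn_const ht
    · rw [Filter.EventuallyEq, ← restrict_Ioo_eq_restrict_Icc]
      filter_upwards [h.divFree, ae_all_iff.mpr fun i => (h.memE1 i).1.ae_memH] with t h1 h2
      exact divFreeCoef_of_divFree h2 h1 k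
    · exact continuousOn_finsetSum _ fun j _ => continuousOn_const.mul
        ((fourierCoefL k).continuous.comp_continuousOn ((h.memE1 j).2.continuousOn hT))
  · filter_upwards [hm] with t ht
    filter_upwards [ht] with x hx i
    rw [← lapH_eq, one_mul]
    exact hx i

theorem IsStrongSolution2.eqOn {T : ℝ} (hT : 0 < T) {v₀ : Fin 2 → L2 2} {v v' : ℝ → Fin 2 → L2 2}
    (h : IsStrongSolution2 T v₀ v) (h' : IsStrongSolution2 T v₀ v') : EqOn v' v (Icc 0 T) :=
  fun t ht => by
    have he := (h'.coefSol hT).unique (by norm_num) (fun _ => one_pos) (fun _ => le_rfl)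
      (h.coefSol hT) (by simp only [h.initial, h'.initial]) t ht
    exact funext fun i => ext_fourierCoef fun k => congrFun (congrFun he i) k

theorem weighted_amp_bound {U : ℝ → Fin 3 → (Fin 3 → ℤ) → ℂ} {T M : ℝ}
    (hM : ∀ t ∈ Icc 0 T, energy wt (U t) ≤ ENNReal.ofReal M) :
    ∃ M : ℝ≥0∞, M ≠ ∞ ∧ ∀ t ∈ Icc 0 T, ∑' k, ENNReal.ofReal (wt k) * amp (U t) k ^ 2 ≤ M :=
  ⟨3 * ENNReal.ofReal M, ENNReal.mul_ne_top (by norm_num) ENNReal.ofReal_ne_top, fun t ht =>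
    (tsum_mul_amp_sq_le (fun k => (wt_pos k).le) _).trans (mul_le_mul_right (hM t ht) _)⟩

theorem exists_strongSolution3 {ε δ T : ℝ} (hε : ε ∈ Ioc (0 : ℝ) 1) (hT : 0 < T)
    {U : ℝ → Fin 3 → (Fin 3 → ℤ) → ℂ} (hU : CoefSol (pressScale ε) (aniso δ) T U)
    (hf : ∀ t ∈ Icc 0 T, FieldCoef (U t)) {M : ℝ}
    (hM : ∀ t ∈ Icc 0 T, energy wt (U t) ≤ ENNReal.ofReal M) {u₀ : Fin 3 → L2 3}
    (h0 : ∀ i k, fourierCoef (u₀ i) k = U 0 i k) :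
    ∃ u, IsStrongSolution3 ε δ T u₀ u ∧ (∀ t ∈ Icc 0 T, ∀ i k, fourierCoef (u t i) k = U t i k) ∧
      ∀ i, ∀ᵐ t ∂volume.restrict (Ioo 0 T), HasDerivAt (fun s => u s i) (deriv (fun s => u s i) t) t
        ∧ ∀ k, fourierCoef (deriv (fun s => u s i) t) k = rhs (pressScale ε) (aniso δ) (U t) i k := by
  obtain ⟨u, p, hc, hE, hd, h2, hp, hpc, hm⟩ := hU.exists_strong le_rfl
    (admissible_pressScale hε).pos hT (fun t ht => (hf t ht).real) (weighted_amp_bound hM)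
  have hc' : ∀ t ∈ Icc 0 T, (fun i => fourierCoef (u t i)) = U t := fun t ht =>
    funext fun i => funext fun k => hc t ht i k
  refine ⟨u, ⟨hE, fun t ht => mem_solenoidal3 ?_ ?_, ?_, ?_, p, hp, ?_, ?_⟩, hc, hd⟩
  · rw [hc' t ht]; exact (hf t ht).div
  · rw [hc' t ht]; exact (hf t ht).parity
  · exact funext fun i => ext_fourierCoef fun k => by rw [hc 0 ⟨le_rfl, hT.le⟩, h0]
  · filter_upwards [h2, ae_restrict_mem measurableSet_Ioo] with t ht htT
    refine divFree_of_divFreeCoef ht ?_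
    rw [hc' t (Ioo_subset_Icc_self htT)]
    exact (hf t (Ioo_subset_Icc_self htT)).div
  · filter_upwards [hpc, ae_restrict_mem measurableSet_Ioo] with t ht htT
    refine ⟨integral_eq_zero_of_fourierCoef (by rw [ht]; simp [pres]), isEvenZ_of_fourierCoef fun k => ?_⟩
    have hp := (hf t (Ioo_subset_Icc_self htT)).parity.nl
    rw [ht, ht, pres, pres]
    have e : ∑ j, ((reflFreq k j : ℤ) : ℂ) * nl (U t) (U t) j (reflFreq k)
        = ∑ j, (k j : ℂ) * nl (U t) (U t) j k := Finset.sum_congr rfl fun j _ => by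
      rw [reflFreq_apply, hp j k]
      linear_combination (k j * nl (U t) (U t) j k) * paritySign_mul_self j
    rw [e]
    simp only [reflFreq_apply_sq]
  · filter_upwards [hm] with t ht
    filter_upwards [ht] with x hx
    exact (momentum3_iff ε δ u p t x).mpr hx

/-! ### Two-dimensional solutions as `z`-independent coefficient families. -/

/-- The horizontal components at the frequencies `(h₀, h₁, 0)`. -/
def planar (V : Fin 3 → (Fin 3 → ℤ) → ℂ) (i : Fin 2) (h : Fin 2 → ℤ) : ℂ := V i.castSucc (embFreq h)

theorem embFreq_castSucc (h : Fin 2 → ℤ) (i : Fin 2) : embFreq h i.castSucc = h i := by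
  fin_cases i <;> simp [embFreq]

theorem embFreq_last (h : Fin 2 → ℤ) : embFreq h (Fin.last 2) = 0 := by simp [embFreq, Fin.last]

theorem embFreq_two (h : Fin 2 → ℤ) : embFreq h 2 = 0 := embFreq_last h

theorem wt_embFreq (h : Fin 2 → ℤ) : wt (embFreq h) = wt h := by
  simp only [wt, Fin.sum_univ_castSucc (n := 2), embFreq_castSucc, embFreq_last]
  simp

theorem embFreq_sub (h l : Fin 2 → ℤ) : embFreq (h - l) = embFreq h - embFreq l := by
  funext i
  fin_cases i <;> simp [embFreq]

/-- The 3D convolution of barotropic coefficients is supported on the embedded plane, and the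
vertical derivative vanishes there. -/
theorem planar_nl {V : Fin 3 → (Fin 3 → ℤ) → ℂ} (hV : bt V = V) (i : Fin 2) (h : Fin 2 → ℤ) :
    nl (planar V) (planar V) i h = nl V V i.castSucc (embFreq h) := by
  have hc : ∀ j, conv (planar V j) (planar V i) h = conv (V j.castSucc) (V i.castSucc) (embFreq h) := by
    intro j
    rw [conv, conv, ← embFreq_injective.tsum_eq]
    · exact tsum_congr fun l => by rw [planar, planar, embFreq_sub]
    · intro l hl
      by_contra hr
      have hl2 : l 2 ≠ 0 := fun h0 => hr ⟨horFreq l, embFreq_horFreq h0⟩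
      refine hl ?_
      have : V j.castSucc l = 0 := by rw [← hV, bt, if_neg hl2]
      simp only [this, zero_mul]
  simp only [nl, hc, Fin.sum_univ_castSucc (n := 2), embFreq_castSucc, embFreq_last]
  simp

theorem planar_rhs {V : Fin 3 → (Fin 3 → ℤ) → ℂ} (hV : bt V = V) (i : Fin 2) (h : Fin 2 → ℤ) :
    rhs (fun _ => 1) (fun _ => 1) (planar V) i h
      = rhs (fun _ => 1) (aniso 1) V i.castSucc (embFreq h) := by
  have hv : visc (fun _ => 1) h = visc (aniso 1) (embFreq h) := by
    simp [visc, Fin.sum_univ_three, Fin.sum_univ_two, aniso, embFreq]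
  have hl : leray (fun _ => 1) (nl (planar V) (planar V)) i h
      = leray (fun _ => 1) (nl V V) i.castSucc (embFreq h) := by
    simp only [leray, planar_nl hV, Fin.sum_univ_castSucc (n := 2), embFreq_castSucc, embFreq_last]
    simp
  rw [rhs, rhs, hv, hl, planar]

theorem tsum_planar_le (V : Fin 3 → (Fin 3 → ℤ) → ℂ) (w : ℝ → ℝ≥0∞) :
    ∑' h, w (wt h) * amp (planar V) h ^ 2 ≤ ∑' k, w (wt k) * amp V k ^ 2 := by
  refine le_trans (ENNReal.tsum_le_tsum fun h => ?_)
    (ENNReal.tsum_comp_le_tsum_of_injective embFreq_injective fun k => w (wt k) * amp V k ^ 2)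
  simp only [wt_embFreq]
  gcongr
  rw [amp, amp, Fin.sum_univ_castSucc (n := 2)]
  exact le_self_add

theorem CoefSol.planar {T : ℝ} {V : ℝ → Fin 3 → (Fin 3 → ℤ) → ℂ}
    (h : CoefSol (fun _ => 1) (aniso 1) T V) (hV : ∀ t ∈ Icc 0 T, bt (V t) = V t) (hT : 0 ≤ T) :
    CoefSol (fun _ => 1) (fun _ => 1) T fun t => planar (V t) := by
  have e : ∀ i k, ∀ t ∈ Icc 0 T, ((visc (fun _ : Fin 2 => 1) k : ℝ) : ℂ) * AnisoNS.planar (V t) i k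
      + leray (fun _ => 1) (nl (AnisoNS.planar (V t)) (AnisoNS.planar (V t))) i k
      = visc (aniso 1) (embFreq k) * V t i.castSucc (embFreq k)
      + leray (fun _ => 1) (nl (V t) (V t)) i.castSucc (embFreq k) := fun i k t ht =>
    neg_injective (planar_rhs (hV t ht) i k)
  refine ⟨fun t ht k => ?_, ?_, ?_, fun i k => ?_, fun i k => h.cont _ _, fun t ht i k => ?_⟩
  · have := h.div t ht (embFreq k)
    simp only [Fin.sum_univ_castSucc (n := 2), embFreq_castSucc, embFreq_last, Int.cast_zero,
      zero_mul, add_zero] at this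
    exact this
  · obtain ⟨M, hM, hb⟩ := h.bdd
    refine ⟨M, hM, fun t ht => le_trans ?_ (hb t ht)⟩
    simpa using tsum_planar_le (V t) fun _ => 1
  · exact (lintegral_mono fun t => tsum_planar_le (V t) fun r => ENNReal.ofReal (r ^ 2)).trans_lt h.h2
  · refine (intervalIntegrable_congr fun t ht => ?_).mpr (h.int i.castSucc (embFreq k))
    rw [uIoc_of_le hT] at ht
    exact e i k t ⟨ht.1.le, ht.2⟩
  · refine (h.eq t ht i.castSucc (embFreq k)).trans (congrArg₂ _ rfl ?_)
    refine intervalIntegral.integral_congr fun s hs => (e i k s ?_).symm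
    rw [uIcc_of_le ht.1] at hs
    exact ⟨hs.1, hs.2.trans ht.2⟩

theorem exists_strongSolution2 {T : ℝ} (hT : 0 < T) {V : ℝ → Fin 3 → (Fin 3 → ℤ) → ℂ}
    (hVs : CoefSol (fun _ => 1) (aniso 1) T V) (hV : ∀ t ∈ Icc 0 T, FieldCoef (V t) ∧ bt (V t) = V t)
    {M : ℝ} (hM : ∀ t ∈ Icc 0 T, energy wt (V t) ≤ ENNReal.ofReal M) {v₀ : Fin 2 → L2 2}
    (h0 : ∀ i h, fourierCoef (v₀ i) h = planar (V 0) i h) :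
    ∃ v, IsStrongSolution2 T v₀ v ∧
      (∀ t ∈ Icc 0 T, ∀ i h, fourierCoef (v t i) h = planar (V t) i h) ∧
      ∀ i, ∀ᵐ t ∂volume.restrict (Ioo 0 T), HasDerivAt (fun s => v s i) (deriv (fun s => v s i) t) t
        ∧ ∀ h, fourierCoef (deriv (fun s => v s i) t) h
          = planar (rhs (fun _ => 1) (aniso 1) (V t)) i h := by
  have hW := hVs.planar (fun t ht => (hV t ht).2) hT.le
  obtain ⟨B, hB, hBb⟩ := weighted_amp_bound hM
  obtain ⟨v, p, hc, hE, hd, h2, hp, hpc, hm⟩ := hW.exists_strong (by norm_num) (fun _ => one_pos) hT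
    (fun t ht i k => by
      have := (hV t ht).1.real i.castSucc (embFreq k)
      rwa [show -embFreq k = embFreq (-k) by funext i; fin_cases i <;> simp [embFreq]] at this)
    ⟨B, hB, fun t ht => (tsum_planar_le (V t) ENNReal.ofReal).trans (hBb t ht)⟩
  refine ⟨v, ⟨hE, ?_, ?_, p, hp, ?_, ?_⟩, hc, fun i => ?_⟩
  · exact funext fun i => ext_fourierCoef fun k => by rw [hc 0 ⟨le_rfl, hT.le⟩, h0]
  · filter_upwards [h2, ae_restrict_mem measurableSet_Ioo] with t ht htT
    refine divFree_of_divFreeCoef ht fun k => ?_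
    simp only [hc t (Ioo_subset_Icc_self htT)]
    exact hW.div t (Ioo_subset_Icc_self htT) k
  · filter_upwards [hpc] with t ht
    exact integral_eq_zero_of_fourierCoef (by rw [ht]; simp [pres])
  · filter_upwards [hm] with t ht
    filter_upwards [ht] with x hx i
    have := hx i
    rwa [← lapH_eq, one_mul] at this
  · filter_upwards [hd i, ae_restrict_mem measurableSet_Ioo] with t ht htT
    exact ⟨ht.1, fun k => by
      rw [ht.2, planar_rhs (hV t (Ioo_subset_Icc_self htT)).2]; rfl⟩

/-! ### Initial data, modes and norms in terms of coefficients. -/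

theorem energy_eq_sum {w : (Fin 3 → ℤ) → ℝ} (hw : ∀ k, 0 ≤ w k) (Y : Fin 3 → (Fin 3 → ℤ) → ℂ) :
    energy w Y = ∑ i, ∑' k, ENNReal.ofReal (w k) * ‖Y i k‖ₑ ^ 2 := by
  rw [energy, ← Summable.tsum_finsetSum fun _ _ => ENNReal.summable]
  refine tsum_congr fun k => ?_
  rw [nsq, ENNReal.ofReal_mul (hw k), ENNReal.ofReal_sum_of_nonneg fun i _ => by positivity,
    Finset.mul_sum]
  refine Finset.sum_congr rfl fun i _ => ?_
  rw [ENNReal.ofReal_pow (norm_nonneg _), ofReal_norm]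

theorem tsum_le_energy {w : (Fin 3 → ℤ) → ℝ} (hw : ∀ k, 0 ≤ w k) (Y : Fin 3 → (Fin 3 → ℤ) → ℂ)
    (i : Fin 3) : ∑' k, ENNReal.ofReal (w k) * ‖Y i k‖ₑ ^ 2 ≤ energy w Y := by
  rw [energy_eq_sum hw]
  exact Finset.single_le_sum (f := fun i => ∑' k, ENNReal.ofReal (w k) * ‖Y i k‖ₑ ^ 2)
    (fun _ _ => zero_le) (Finset.mem_univ i)

theorem tsum_embFreq_le_energy {w : (Fin 3 → ℤ) → ℝ} (hw : ∀ k, 0 ≤ w k)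
    (Y : Fin 3 → (Fin 3 → ℤ) → ℂ) (i : Fin 3) :
    ∑' h, ENNReal.ofReal (w (embFreq h)) * ‖Y i (embFreq h)‖ₑ ^ 2 ≤ energy w Y :=
  (ENNReal.tsum_comp_le_tsum_of_injective embFreq_injective
    fun k => ENNReal.ofReal (w k) * ‖Y i k‖ₑ ^ 2).trans (tsum_le_energy hw Y i)

theorem MemH.tsum_ne_top {d : ℕ} {s : ℝ} {f : L2 d} (h : MemH s f) :
    ∑' k, ENNReal.ofReal (wt k ^ s) * ‖fourierCoef f k‖ₑ ^ 2 ≠ ∞ := fun e => by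
  have h1 := ENNReal.rpow_lt_top_of_nonneg zero_le_two h.ne
  rw [hNorm_sq_eq, e, ENNReal.mul_top (by positivity)] at h1
  exact h1.ne rfl

theorem wt_rpow_three_half {d : ℕ} (k : Fin d → ℤ) : wt k ^ (3 / 2 : ℝ) = rt k ^ 3 := by
  rw [rt, Real.sqrt_eq_rpow, ← Real.rpow_mul_natCast (wt_pos k).le]
  norm_num

theorem ParityCoef.vertical_eq_zero {Y : Fin 3 → (Fin 3 → ℤ) → ℂ} (hY : ParityCoef Y)
    {k : Fin 3 → ℤ} (hk : k 2 = 0) : Y 2 k = 0 := by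
  have h := hY 2 k
  rw [show reflFreq k = k by funext i; fin_cases i <;> simp [reflFreq, hk]] at h
  simp only [paritySign] at h
  simpa [self_eq_neg] using h

theorem fourierCoef_barotropic_castSucc (v : Fin 2 → L2 2) (i : Fin 2) (k : Fin 3 → ℤ) :
    fourierCoef (barotropic v i.castSucc) k
      = if k 2 = 0 then fourierCoef (v i) (horFreq k) else 0 := by
  fin_cases i <;> exact fourierCoef_lift _ k

theorem fourierCoef_barotropic_last (v : Fin 2 → L2 2) (k : Fin 3 → ℤ) :
    fourierCoef (barotropic v (Fin.last 2)) k = 0 := fourierCoef_zero k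

theorem fourierCoef_averagePart (u : Fin 3 → L2 3) (i : Fin 2) (h : Fin 2 → ℤ) :
    fourierCoef (averagePart u i) h = fourierCoef (u i.castSucc) (embFreq h) := by
  fin_cases i <;> exact fourierCoef_verticalAverage _ h

theorem fourierCoef_baroclinicPart {u : Fin 3 → L2 3} (hp : ParityCoef fun i => fourierCoef (u i))
    (i : Fin 3) (k : Fin 3 → ℤ) :
    fourierCoef (baroclinicPart u i) k = bc (fun i => fourierCoef (u i)) i k := by
  rw [baroclinicPart, Pi.sub_apply, fourierCoef_sub, bc]
  refine Fin.lastCases ?_ (fun i => ?_) i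
  · rw [fourierCoef_barotropic_last, sub_zero]
    split_ifs with hk
    · exact hp.vertical_eq_zero hk
    · rfl
  · rw [fourierCoef_barotropic_castSucc]
    split_ifs with hk
    · rw [fourierCoef_averagePart, embFreq_horFreq hk, sub_self]
    · rw [sub_zero]

theorem divFreeCoef_barotropic {v : Fin 2 → L2 2} (hv : DivFreeCoef fun i => fourierCoef (v i)) :
    DivFreeCoef fun i => fourierCoef (barotropic v i) := fun k => by
  simp only [Fin.sum_univ_castSucc (n := 2), fourierCoef_barotropic_castSucc,
    fourierCoef_barotropic_last, mul_zero, add_zero]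
  by_cases hk : k 2 = 0
  · simp only [hk, if_true]
    simpa [Fin.sum_univ_two, horFreq] using hv (horFreq k)
  · simp [hk]

theorem parityCoef_barotropic (v : Fin 2 → L2 2) : ParityCoef fun i => fourierCoef (barotropic v i) := by
  intro i k
  refine Fin.lastCases ?_ (fun i => ?_) i
  · simp only [fourierCoef_barotropic_last, mul_zero]
  · have h2 : horFreq (reflFreq k) = horFreq k := by
      funext j; fin_cases j <;> simp [horFreq, reflFreq]
    simp only [fourierCoef_barotropic_castSucc, h2]
    fin_cases i <;> simp [reflFreq, paritySign]

theorem fieldCoef_barotropic_add {v : Fin 2 → L2 2} (hv : v ∈ solenoidal2) {w : Fin 3 → L2 3}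
    (hw : w ∈ solenoidal3) : FieldCoef fun i => fourierCoef ((barotropic v + w) i) where
  div k := by
    have h1 := divFreeCoef_barotropic (divFreeCoef_of_mem_solenoidal2 hv) k
    have h2 := divFreeCoef_of_mem_solenoidal3 hw k
    simp only [Pi.add_apply, fourierCoef_add, mul_add, Finset.sum_add_distrib, h1, h2, add_zero]
  real i k := fourierCoef_neg _ k
  parity i k := by
    simp only [Pi.add_apply, fourierCoef_add, mul_add]
    exact congrArg₂ _ (parityCoef_barotropic v i k) (parityCoef_of_mem_solenoidal3 hw i k)

theorem fourierCoef_eq_zero_of_verticalAverage {f : L2 3} (hf : verticalAverage f = 0)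
    {k : Fin 3 → ℤ} (hk : k 2 = 0) : fourierCoef f k = 0 := by
  rw [← embFreq_horFreq hk, ← fourierCoef_verticalAverage, hf, fourierCoef_zero]

theorem bt_fourierCoef_add (v : Fin 2 → L2 2) {w : Fin 3 → L2 3}
    (hw : ∀ i, verticalAverage (w i) = 0) :
    bt (fun i => fourierCoef ((barotropic v + w) i)) = fun i => fourierCoef (barotropic v i) := by
  funext i k
  simp only [bt, Pi.add_apply, fourierCoef_add]
  split_ifs with hk
  · rw [fourierCoef_eq_zero_of_verticalAverage (hw i) hk, add_zero]
  · refine Fin.lastCases ?_ (fun i => ?_) i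
    · rw [fourierCoef_barotropic_last]
    · rw [fourierCoef_barotropic_castSucc, if_neg hk]

theorem bc_fourierCoef_add (v : Fin 2 → L2 2) {w : Fin 3 → L2 3}
    (hw : ∀ i, verticalAverage (w i) = 0) :
    bc (fun i => fourierCoef ((barotropic v + w) i)) = fun i => fourierCoef (w i) := by
  funext i k
  simp only [bc, Pi.add_apply, fourierCoef_add]
  split_ifs with hk
  · rw [fourierCoef_eq_zero_of_verticalAverage (hw i) hk]
  · refine Fin.lastCases ?_ (fun i => ?_) i
    · rw [fourierCoef_barotropic_last, zero_add]
    · rw [fourierCoef_barotropic_castSucc, if_neg hk, zero_add]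

theorem energy_barotropic_ne_top {v : Fin 2 → L2 2} (hv : ∀ i, MemH 1 (v i)) :
    energy wt (fun i => fourierCoef (barotropic v i)) ≠ ∞ := by
  rw [energy_eq_sum fun k => (wt_pos k).le, Fin.sum_univ_castSucc]
  simp only [fourierCoef_barotropic_last, fourierCoef_barotropic_castSucc]
  refine ENNReal.add_ne_top.mpr ⟨ENNReal.sum_ne_top.mpr fun i _ => ?_, by simp⟩
  rw [← embFreq_injective.tsum_eq fun k hk => ?_]
  · have := (hv i).tsum_ne_top
    simp only [Real.rpow_one] at this
    simpa only [wt_embFreq, horFreq_embFreq, show ∀ h, embFreq h 2 = 0 from fun h => embFreq_last h,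
      if_true] using this
  · by_cases h : k 2 = 0
    · exact ⟨horFreq k, embFreq_horFreq h⟩
    · exact absurd (by simp [h]) hk

theorem energy_rt_ne_top {w : Fin 3 → L2 3} (hw : ∀ i, MemH (3 / 2) (w i)) :
    energy (fun k => rt k ^ 3) (fun i => fourierCoef (w i)) ≠ ∞ := by
  have h0 : ∀ k : Fin 3 → ℤ, 0 ≤ rt k ^ 3 := fun k => pow_nonneg (Real.sqrt_nonneg _) 3
  rw [energy_eq_sum h0]
  refine ENNReal.sum_ne_top.mpr fun i _ => ?_
  simpa only [wt_rpow_three_half] using (hw i).tsum_ne_top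

/-- Brings the two rates to a common form: `p = 1/2` for the barotropic difference, where a better
power is given away, and `p = 1/4` for the baroclinic part. -/
theorem rpow_le_div_rpow {K δ p : ℝ} (hK : 1 ≤ K) (hδ : 1 ≤ δ) (hp : 1 / 4 ≤ p) (hp1 : p ≤ 1)
    {a : ℝ≥0∞} (ha : a ≤ ENNReal.ofReal (K / δ)) :
    a ^ p ≤ ENNReal.ofReal (K / δ ^ (1 / 4 : ℝ)) := by
  have hp0 : 0 ≤ p := by linarith
  refine (ENNReal.rpow_le_rpow ha hp0).trans ?_
  rw [ENNReal.ofReal_rpow_of_nonneg (by positivity) hp0, Real.div_rpow (by positivity) (by positivity)]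
  refine ENNReal.ofReal_le_ofReal (div_le_div₀ (by positivity) ?_ (by positivity) ?_)
  · simpa using Real.rpow_le_rpow_of_exponent_le hK hp1
  · exact Real.rpow_le_rpow_of_exponent_le hδ hp

theorem lintegral_le_of_le_mul {T : ℝ} {f E : ℝ → ℝ≥0∞} {a : ℝ} (ha : 0 ≤ a) {b : ℝ}
    (h : ∀ᵐ t ∂volume.restrict (Ioo 0 T), f t ≤ ENNReal.ofReal a * E t)
    (hE : ∫⁻ t in Ioo 0 T, E t ≤ ENNReal.ofReal b) :
    ∫⁻ t in Ioo 0 T, f t ≤ ENNReal.ofReal (a * b) := by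
  refine (lintegral_mono_ae h).trans ?_
  rw [lintegral_const_mul' _ _ ENNReal.ofReal_ne_top, ENNReal.ofReal_mul ha]
  exact mul_le_mul_right hE _

/-- The factor 4 is the area of `G` in Parseval's identity. Only moduli of coefficients matter, so
the sign of the difference is free. -/
theorem e1Norm_le {T K δ : ℝ} (hK : 1 ≤ K) (hδ : 1 ≤ δ) {f : ℝ → L2 2} (i : Fin 3)
    {Y Z : ℝ → Fin 3 → (Fin 3 → ℤ) → ℂ} {b : ℝ} (hb : 4 * b ≤ K / δ)
    (hf : ∀ t ∈ Ioo 0 T, ∀ h, ‖fourierCoef (f t) h‖ₑ = ‖Y t i (embFreq h)‖ₑ)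
    (hf' : ∀ᵐ t ∂volume.restrict (Ioo 0 T), ∀ h, ‖fourierCoef (deriv f t) h‖ₑ = ‖Z t i (embFreq h)‖ₑ)
    (hY : ∫⁻ t in Ioo 0 T, energy (fun k => wt k ^ 2) (Y t) ≤ ENNReal.ofReal b)
    (hZ : ∫⁻ t in Ioo 0 T, energy (fun _ => 1) (Z t) ≤ ENNReal.ofReal b) :
    e1Norm T f ≤ 3 * ENNReal.ofReal (K / δ ^ (1 / 4 : ℝ)) := by
  have e4 : ENNReal.ofReal 4 = 2 ^ 2 := by norm_num
  have hw : ∀ k : Fin 3 → ℤ, 0 ≤ wt k ^ 2 := fun k => sq_nonneg _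
  have h1 : ∀ᵐ t ∂volume.restrict (Ioo 0 T), hNorm 2 (f t) ^ (2 : ℝ)
      ≤ ENNReal.ofReal 4 * energy (fun k => wt k ^ 2) (Y t) := by
    filter_upwards [ae_restrict_mem measurableSet_Ioo] with t ht
    rw [hNorm_sq_eq, e4]
    refine mul_le_mul_right (le_trans (le_of_eq ?_) (tsum_embFreq_le_energy hw (Y t) i)) _
    simp only [hf t ht, wt_embFreq, Real.rpow_two]
  have h2 : ∀ᵐ t ∂volume.restrict (Ioo 0 T), ‖f t‖ₑ ^ (2 : ℝ)
      ≤ ENNReal.ofReal 4 * energy (fun k => wt k ^ 2) (Y t) := by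
    filter_upwards [ae_restrict_mem measurableSet_Ioo] with t ht
    rw [ENNReal.rpow_two, enorm_sq_eq_tsum, ENNReal.tsum_mul_left, e4]
    refine mul_le_mul_right (le_trans (ENNReal.tsum_le_tsum fun h => ?_)
      (tsum_embFreq_le_energy hw (Y t) i)) _
    rw [hf t ht]
    exact le_mul_of_one_le_left zero_le
      (ENNReal.one_le_ofReal.mpr (one_le_pow₀ (one_le_wt _)))
  have h3 : ∀ᵐ t ∂volume.restrict (Ioo 0 T), ‖deriv f t‖ₑ ^ (2 : ℝ)
      ≤ ENNReal.ofReal 4 * energy (fun _ => 1) (Z t) := by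
    filter_upwards [hf'] with t ht
    rw [ENNReal.rpow_two, enorm_sq_eq_tsum, ENNReal.tsum_mul_left, e4]
    refine mul_le_mul_right (le_trans (le_of_eq ?_)
      (tsum_embFreq_le_energy (fun _ => zero_le_one) (Z t) i)) _
    simp only [ht, ENNReal.ofReal_one, one_mul]
  have key : ∀ {g E : ℝ → ℝ≥0∞}, (∀ᵐ t ∂volume.restrict (Ioo 0 T), g t ≤ ENNReal.ofReal 4 * E t) →
      ∫⁻ t in Ioo 0 T, E t ≤ ENNReal.ofReal b →
      (∫⁻ t in Ioo 0 T, g t) ^ (1 / 2 : ℝ) ≤ ENNReal.ofReal (K / δ ^ (1 / 4 : ℝ)) := fun hg hE =>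
    rpow_le_div_rpow hK hδ (by norm_num) (by norm_num)
      ((lintegral_le_of_le_mul (by norm_num) hg hE).trans (ENNReal.ofReal_le_ofReal hb))
  rw [e1Norm, lqhNorm, eLpNorm_eq_lintegral_rpow_enorm_toReal (by norm_num) (by norm_num),
    eLpNorm_eq_lintegral_rpow_enorm_toReal (by norm_num) (by norm_num), ENNReal.toReal_ofNat]
  refine (add_le_add (add_le_add (key h1 hY) (key h2 hY)) (key h3 hZ)).trans (le_of_eq ?_)
  ring

theorem lqhNorm_four_le {T K δ : ℝ} (hK : 1 ≤ K) (hδ : 1 ≤ δ) {f : ℝ → L2 3} (i : Fin 3)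
    {Y : ℝ → Fin 3 → (Fin 3 → ℤ) → ℂ} {b : ℝ} (hb : 64 * b ≤ K / δ)
    (hf : ∀ t ∈ Ioo 0 T, ∀ k, fourierCoef (f t) k = Y t i k)
    (hY : ∫⁻ t in Ioo 0 T, energy (fun k => rt k ^ 3) (Y t) ^ 2 ≤ ENNReal.ofReal b) :
    lqhNorm T 4 (3 / 2) f ≤ ENNReal.ofReal (K / δ ^ (1 / 4 : ℝ)) := by
  have h1 : ∀ᵐ t ∂volume.restrict (Ioo 0 T), hNorm (3 / 2) (f t) ^ (4 : ℝ)
      ≤ ENNReal.ofReal 64 * energy (fun k => rt k ^ 3) (Y t) ^ 2 := by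
    filter_upwards [ae_restrict_mem measurableSet_Ioo] with t ht
    have e : hNorm (3 / 2) (f t) ^ (4 : ℝ) = (hNorm (3 / 2) (f t) ^ (2 : ℝ)) ^ 2 := by
      rw [← ENNReal.rpow_natCast, ← ENNReal.rpow_mul]; norm_num
    have e64 : ENNReal.ofReal 64 = (2 ^ 3) ^ 2 := by norm_num
    rw [e, hNorm_sq_eq, e64, ← mul_pow]
    refine pow_le_pow_left' (mul_le_mul_right (le_trans (le_of_eq ?_)
      (tsum_le_energy (fun k => pow_nonneg (Real.sqrt_nonneg _) 3) (Y t) i)) _) 2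
    simp only [hf t ht, wt_rpow_three_half]
    rfl
  exact rpow_le_div_rpow hK hδ le_rfl (by norm_num)
    ((lintegral_le_of_le_mul (by norm_num) h1 hY).trans (ENNReal.ofReal_le_ofReal hb))

theorem hasDerivAt_averagePart {u : ℝ → Fin 3 → L2 3} {i : Fin 2} {t : ℝ} {g : L2 3}
    (h : HasDerivAt (fun s => u s i.castSucc) g t) :
    HasDerivAt (fun s => averagePart (u s) i) (verticalAverage g) t := by
  have := verticalAverageL.hasFDerivAt.comp_hasDerivAt t h
  rw [verticalAverageL_apply] at this
  refine this.congr_of_eventuallyEq (Filter.Eventually.of_forall fun s => ?_)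
  fin_cases i <;> exact (verticalAverageL_apply _).symm

end AnisoNS

end

/-! ### Assembly of the theorem. -/

theorem theorem4p7 (T : ℝ) (hT : 0 < T)
    (v₀ : Fin 2 → L2 2) (hv₀ : ∀ i, MemH 1 (v₀ i)) (hv₀_sol : v₀ ∈ solenoidal2)
    (ut₀ : Fin 3 → L2 3) (hut₀ : ∀ i, MemH (3 / 2) (ut₀ i)) (hut₀_sol : ut₀ ∈ solenoidal3)
    (hut₀_avg : ∀ i, verticalAverage (ut₀ i) = 0) :
    -- the unique strong solution of the 2D Navier-Stokes equations
    ∃ vlim : ℝ → Fin 2 → L2 2, IsStrongSolution2 T v₀ vlim ∧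
      (∀ v', IsStrongSolution2 T v₀ v' → EqOn v' vlim (Icc 0 T)) ∧
      -- the existence time equals `T` for small `ε` and `1/δ`
      (∃ c > 0, ∀ ε > 0, ∀ δ > 0, ε < c → 1 / δ < c →
        IsMaximalExistenceTime ε δ T (barotropic v₀ + ut₀) T) ∧
      -- the estimate, uniformly in `ε ∈ (0,1]`, for the unique strong solution on `(0,T)`
      (∃ C > 0, ∃ c > 0, ∀ δ > 0, 1 / δ < c → ∀ ε ∈ Ioc (0 : ℝ) 1,
        ∃ u : ℝ → Fin 3 → L2 3, IsStrongSolution3 ε δ T (barotropic v₀ + ut₀) u ∧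
          (∀ u', IsStrongSolution3 ε δ T (barotropic v₀ + ut₀) u' → EqOn u' u (Icc 0 T)) ∧
          ∑ i, e1Norm T (fun t => vlim t i - averagePart (u t) i)
            + ∑ i, lqhNorm T 4 (3 / 2) (fun t => baroclinicPart (u t) i)
            ≤ ENNReal.ofReal (C / δ ^ (1 / 4 : ℝ))) := by
  have hf := fieldCoef_barotropic_add hv₀_sol hut₀_sol
  have hbt := bt_fourierCoef_add v₀ hut₀_avg
  obtain ⟨V, hV, hV0, hVf, ⟨M, hM⟩, C, hC, δ₀, hδ₀, hδ⟩ := exists_coefSol hT hf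
    (hbt ▸ energy_barotropic_ne_top hv₀)
    (bc_fourierCoef_add v₀ hut₀_avg ▸ energy_rt_ne_top hut₀)
  obtain ⟨vlim, hv, hvc, hvd⟩ := exists_strongSolution2 hT hV hVf hM (v₀ := v₀) fun i h => by
    rw [hV0, hbt, planar, fourierCoef_barotropic_castSucc, horFreq_embFreq]
    exact (if_pos (embFreq_last h)).symm
  have main : ∃ C > 0, ∃ c > 0, ∀ δ > 0, 1 / δ < c → ∀ ε ∈ Ioc (0 : ℝ) 1,
      ∃ u : ℝ → Fin 3 → L2 3, IsStrongSolution3 ε δ T (barotropic v₀ + ut₀) u ∧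
        (∀ u', IsStrongSolution3 ε δ T (barotropic v₀ + ut₀) u' → EqOn u' u (Icc 0 T)) ∧
        ∑ i, e1Norm T (fun t => vlim t i - averagePart (u t) i)
          + ∑ i, lqhNorm T 4 (3 / 2) (fun t => baroclinicPart (u t) i)
          ≤ ENNReal.ofReal (C / δ ^ (1 / 4 : ℝ)) := by
    have hK : 1 ≤ 64 * C + 1 := by linarith
    -- The number 64 is the squared volume of `Ω`, from the fourth power of the norm, and adding 1
    -- makes the base at least 1 for taking roots. Two barotropic components with three norms each
    -- and three baroclinic components give the factor 9.
    refine ⟨9 * (64 * C + 1), by linarith, 1 / δ₀, by positivity, fun δ hδp hδc ε hε => ?_⟩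
    have hδ₁ : δ₀ ≤ δ := ((one_div_lt_one_div hδp (by linarith)).mp hδc).le
    have hδ1 : 1 ≤ δ := hδ₀.trans hδ₁
    obtain ⟨U, hU, hU0, hUf, ⟨M', hM'⟩, h2, h0, h4⟩ := hδ δ hδ₁ _ (admissible_pressScale hε)
    obtain ⟨u, hu, huc, hud⟩ := exists_strongSolution3 hε hT hU hUf hM'
      (u₀ := barotropic v₀ + ut₀) fun i k => by rw [hU0]
    refine ⟨u, hu, fun u' hu' => hu.eqOn hε hδ1 hT hu', ?_⟩
    have hb : ∀ a : ℝ, a ≤ 64 → a * (C / δ) ≤ (64 * C + 1) / δ := fun a ha => by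
      rw [← mul_div_assoc]
      gcongr
      nlinarith
    have he : ∀ i, e1Norm T (fun t => vlim t i - averagePart (u t) i)
        ≤ 3 * ENNReal.ofReal ((64 * C + 1) / δ ^ (1 / 4 : ℝ)) := fun i => by
      refine e1Norm_le hK hδ1 i.castSucc (hb 4 (by norm_num)) (fun t ht h => ?_) ?_ h2 h0
      · have ht' := Ioo_subset_Icc_self ht
        rw [fourierCoef_sub, hvc t ht', fourierCoef_averagePart, huc t ht', planar, ← enorm_neg,
          neg_sub]
        simp only [Pi.sub_apply, bt, embFreq_two, if_true]
      · filter_upwards [hvd i, hud i.castSucc] with t hvt hut h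
        rw [(hvt.1.fun_sub (hasDerivAt_averagePart hut.1)).deriv, fourierCoef_sub, hvt.2,
          fourierCoef_verticalAverage, hut.2, planar, ← enorm_neg, neg_sub]
        simp only [Pi.sub_apply, bt, embFreq_two, if_true]
    have hl : ∀ i, lqhNorm T 4 (3 / 2) (fun t => baroclinicPart (u t) i)
        ≤ ENNReal.ofReal ((64 * C + 1) / δ ^ (1 / 4 : ℝ)) := fun i => by
      refine lqhNorm_four_le hK hδ1 i (hb 64 le_rfl) (fun t ht k => ?_) h4
      have ht' := Ioo_subset_Icc_self ht
      have e : (fun i => fourierCoef (u t i)) = U t := funext fun i => funext fun k => huc t ht' i k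
      rw [fourierCoef_baroclinicPart (e ▸ (hUf t ht').parity), e]
    refine (add_le_add (Finset.sum_le_sum fun i _ => he i) (Finset.sum_le_sum fun i _ => hl i)).trans
      (le_of_eq ?_)
    rw [Fin.sum_const, Fin.sum_const, mul_div_assoc, ENNReal.ofReal_mul (by norm_num),
      ENNReal.ofReal_ofNat, nsmul_eq_mul, nsmul_eq_mul]
    push_cast
    ring
  refine ⟨vlim, hv, fun v' hv' => hv.eqOn hT hv', ?_, main⟩
  obtain ⟨_, _, c, hc, h⟩ := main
  -- Existence on all of `(0,T)` is part of the uniform statement; the minimum with 1 places `ε` in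
  -- its range.
  refine ⟨min c 1, lt_min hc one_pos, fun ε hε δ hδ hεc hδc => ⟨⟨⟨hT, le_rfl⟩, ?_⟩, fun τ hτ => hτ.1.2⟩⟩
  obtain ⟨u, hu, -⟩ := h δ hδ (hδc.trans_le (min_le_left _ _)) ε
    ⟨hε, (hεc.trans_le (min_le_right _ _)).le⟩
  exact ⟨u, hu⟩
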